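/- **Setting.** Let $r>3$ be an integer. Let $V_1,V_2\in C^{r+1}(\mathbb R)$, each with finitely many critical points, all nondegenerate, and $V_i(q)\to+\infty$ as $|q|\to\infty$ (the S3B class). Put $H_i=\tfrac12p_i^2+V_i(q_i)$. Let $V_r(q_1,q_2)$ and $Q(q_2;\epsilon_w)$ be $C^{r+1}$ with $Q(0;0)=0$. For $\epsilon=(\epsilon_r,\epsilon_w)\in\mathbb R^2$, $\varepsilon=\|\epsilon\|$ (Euclidean norm), consider the Hamiltonian motion of $H_1+H_2+\epsilon_rV_r$ in the region $q_1\ge\epsilon_wQ(q_2;\epsilon_w)$, with elastic reflection at the wall $q_1=\epsilon_wQ(q_2;\epsilon_w)$, a potential barrier of height $b$ (reflection takes place when the normal kinetic energy is less than $b$). A saddle of $V_i$ is a critical point with $V_i''<0$. The wall position is regular: $V_1'(0)\neq0$ and $V_1(0)\ne V_1(q)$ for every saddle $q$ of $V_1$. For $\{i,\bar i\}=\{1,2\}$ let $\mathbb H_i^{R,\delta}(H)$ be the set of $h\in[\min V_i,\,H-\min V_{\bar i}]$ with $|h-V_i(q)|\ge\delta$ for all saddles $q$ of $V_i$ and $|h-(H-V_{\bar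 i}(q))|\ge\delta$ for all saddles $q$ of $V_{\bar i}$. A regular leaf of $H_i$ is a closed orbit of $H_i$ in the $(q_i,p_i)$ plane without fixed points, and a branch is a maximal connected one-parameter family of regular leaves. On a branch of $H_2$ use the action-angle coordinates $(I,\theta)$ with $\theta=0$ at the right turning point; $T_2(I)$ is the period. For given $H$ and $I$ consider in the $(q_1,p_1)$ plane the leaf of energy $H-H_2(I)$ that reaches into $q_1>0$ and either meets $\{q_1=0\}$ or belongs to the branch of the leaf tangent to $\{q_1=0\}$ from the right. Let $J$ be its action, $T_1$ its period, and $\tilde T_1$ equal to $T_1$ minus the time which this orbit spends in $q_1<0$. Put $\Theta(I)=2\pi\tilde T_1/T_2$. On each branch of $H_2$ let $I_{tan}$ be the action of the leaf of energy $H-V_1(0)$, if there is one. The return map $\mathcal F_\epsilon:(I,\theta)\mapsto(I',\theta')$ is the first return map of the impact system, at total energy $H$, to the section $\{p_1=0,\ \dot p_1<0\}$, near the right turning points of the leaves above. **Theorem.** Let $\delta,\rho,\eta>0$. Let $H$ be $\delta$-regular, i.e. $V_1(0)\in\mathbb H_1^{R,\delta}(H)$, and let the wall be impassable at energy $H$: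 $H-V_1(0)-\min V_2<b$. For each branch of $H_2$ let $A$ be the set of actions $I$ on it for which the torus above exists, $H_2(I)\in\mathbb H_2^{R,\delta}(H)$, $|I-I_{tan}|\ge\rho$ (if $I_{tan}$ exists on this branch), and $I\ge\eta$, $J\ge\eta$. Then there are $\varepsilon_0>0$ and $C$, the same for all branches, and for each branch an open $U\supseteq A$ such that for all $\epsilon$ with $\varepsilon<\varepsilon_0$ the map $\mathcal F_\epsilon$ is well defined on $U\times\mathbb R$, symplectic and $C^r$, and $$I'=I+\varepsilon f(I,\theta;\epsilon),\qquad \theta'=\theta+\Theta(I)+\varepsilon g(I,\theta;\epsilon),$$ where $f(\cdot;\epsilon)$ and $g(\cdot;\epsilon)$ are $C^r$ on $U\times\mathbb R$ and $2\pi$-periodic in $\theta$. Moreover $\mathcal F_\epsilon$ is close to $\mathcal F_0:(I,\theta)\mapsto(I,\theta+\Theta(I))$ in the following sense: 1. all derivatives of $f$ and $g$ in $(I,\theta)$ of order at most $r-1$ are bounded by $C$ on $U\times\mathbb R$, uniformly in $\epsilon$; 2. all derivatives of $\varepsilon f$ and $\varepsilon g$ of order at most $r$ tend to $0$ as $\varepsilon\to0$,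 uniformly on $U\times\mathbb R$; 3. if moreover $V_1,V_2,V_r,Q$ are $C^{r+2}$, then all derivatives of $f$ and $g$ of order at most $r$ are bounded on $U\times\mathbb R$, uniformly in $\epsilon$ (so $\mathcal F_\epsilon$ is $O(\varepsilon)$-close to $\mathcal F_0$ in $C^r$). -/

import Mathlib

open Set Filter Topology

noncomputable section

namespace ImpactHam

/-! ### One degree of freedom: `p ^ 2 / 2 + V q` -/

/-- `V` is a separable summand of an S3B Hamiltonian: `C^(r+1)` smooth, with finitely many critical
points, all of them simple (nondegenerate), and tending to `+∞` as `|q| → ∞`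
(hence bounded from below, with bounded level sets). -/
structure IsS3BPotential (r : ℕ) (V : ℝ → ℝ) : Prop where
  smooth : ContDiff ℝ (r + 1) V
  finite_critical : {q | deriv V q = 0}.Finite
  simple : ∀ q, deriv V q = 0 → deriv (deriv V) q ≠ 0
  bounded : Tendsto V (cocompact ℝ) atTop

/-- `(q, 0)` is a saddle fixed point of `p ^ 2 / 2 + V q`. -/
def IsSaddle (V : ℝ → ℝ) (q : ℝ) : Prop :=
  deriv V q = 0 ∧ deriv (deriv V) q < 0

/-- A regular leaf of `p ^ 2 / 2 + V q`: the closed orbit of energy `energy` whose projection to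
the configuration line is `[left, right]`, with no fixed point on it. -/
structure Leaf (V : ℝ → ℝ) where
  energy : ℝ
  left : ℝ
  right : ℝ
  left_lt_right : left < right
  left_eq : V left = energy
  right_eq : V right = energy
  below : ∀ q ∈ Ioo left right, V q < energy
  deriv_left : deriv V left < 0
  deriv_right : 0 < deriv V right

namespace Leaf

variable {V : ℝ → ℝ}

/-- The two leaves belong to the same branch (connected one-parameter family of regular leaves):
while one is deformed into the other, the turning points sweep no critical point of `V`. -/
def SameBranch (L L' : Leaf V) : Prop :=
  (∀ q ∈ uIcc L.left L'.left, deriv V q ≠ 0) ∧ ∀ q ∈ uIcc L.right L'.right, deriv V q ≠ 0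

/-- The action `(2π)⁻¹ ∮ p dq`. -/
def action (L : Leaf V) : ℝ :=
  Real.pi⁻¹ * ∫ q in L.left..L.right, Real.sqrt (2 * (L.energy - V q))

/-- The period of the closed orbit. -/
def period (L : Leaf V) : ℝ :=
  2 * ∫ q in L.left..L.right, (Real.sqrt (2 * (L.energy - V q)))⁻¹

/-- The time which the orbit spends to the left of the vertical wall `q = 0`. -/
def travelTime (L : Leaf V) : ℝ :=
  if L.left < 0 then 2 * ∫ q in L.left..0, (Real.sqrt (2 * (L.energy - V q)))⁻¹ else 0

/-- The period of the orbit of the system with elastic reflection at the wall `q = 0`. -/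
def impactPeriod (L : Leaf V) : ℝ := L.period - L.travelTime

/-- `(q, p)` is the point with angle `θ` on the leaf. The angle is `2π / period` times the
time needed to reach the point from the right turning point, which has angle `0`. -/
def HasAngle (L : Leaf V) (θ q p : ℝ) : Prop :=
  ∃ x y : ℝ → ℝ, (∀ t, HasDerivAt x (y t) t) ∧ (∀ t, HasDerivAt y (-deriv V (x t)) t) ∧
    x 0 = L.right ∧ y 0 = 0 ∧
    x (θ * L.period / (2 * Real.pi)) = q ∧ y (θ * L.period / (2 * Real.pi)) = p

/-- A leaf of the `(q₁, p₁)` plane which enters the billiard `q₁ > 0` and lies on an intersecting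
branch or on the tangent branch of the wall `q₁ = 0`: it meets the wall, or it belongs
to the branch of the leaf that touches the wall from inside the billiard. -/
def OnWallBranch (L : Leaf V) : Prop :=
  0 < L.right ∧
    (L.left ≤ 0 ∨ ∃ Lt : Leaf V, Lt.energy = V 0 ∧ Lt.left = 0 ∧ Lt.SameBranch L)

end Leaf

/-- `(q, p)` has action-angle coordinates `(I, θ)` on the branch of the leaf `B`. -/
def HasCoords {V : ℝ → ℝ} (B : Leaf V) (I θ q p : ℝ) : Prop :=
  ∃ L : Leaf V, B.SameBranch L ∧ L.action = I ∧ L.HasAngle θ q p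

/-- The regular values of the energy `p ^ 2 / 2 + V q` of one degree of freedom at total energy
`H`, where `W` is the potential of the other one: values allowed at total energy `H`, at distance
at least `δ` from the saddle energies of `V` and from `H` minus the saddle energies of `W`. -/
def regularEnergies (V W : ℝ → ℝ) (δ H : ℝ) : Set ℝ :=
  {h | h ∈ Icc (⨅ q, V q) (H - ⨅ q, W q) ∧ (∀ q, IsSaddle V q → δ ≤ |h - V q|) ∧
    ∀ q, IsSaddle W q → δ ≤ |h - (H - W q)|}

/-! ### The impact system -/

/-- A point of the four-dimensional phase space. -/
@[ext]
structure Phase where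
  q₁ : ℝ
  p₁ : ℝ
  q₂ : ℝ
  p₂ : ℝ

/-- Perturbation parameters: `ε 0` is `ε_r` (potential) and `ε 1` is `ε_w` (wall). -/
abbrev Params : Type := EuclideanSpace ℝ (Fin 2)

/-- The data of the impact system: separable potential `V₁ q₁ + V₂ q₂`, coupling potential
`Vr q₁ q₂`, wall profile `Q q₂ ε_w` and height `b` of the barrier at the wall. -/
structure ImpactSystem where
  V₁ : ℝ → ℝ
  V₂ : ℝ → ℝ
  Vr : ℝ → ℝ → ℝ
  Q : ℝ → ℝ → ℝ
  b : ℝ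

namespace ImpactSystem

variable (S : ImpactSystem)

/-- The smooth potential. -/
def potential (ε : Params) (q₁ q₂ : ℝ) : ℝ := S.V₁ q₁ + S.V₂ q₂ + ε 0 * S.Vr q₁ q₂

/-- Total energy inside the billiard. -/
def energy (ε : Params) (x : Phase) : ℝ :=
  x.p₁ ^ 2 / 2 + x.p₂ ^ 2 / 2 + S.potential ε x.q₁ x.q₂

/-- The force `-∂V/∂q₁`. -/
def force₁ (ε : Params) (x : Phase) : ℝ := -deriv (fun q => S.potential ε q x.q₂) x.q₁

/-- The force `-∂V/∂q₂`. -/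
def force₂ (ε : Params) (x : Phase) : ℝ := -deriv (fun q => S.potential ε x.q₁ q) x.q₂

/-- The wall is the graph `q₁ = wall ε q₂`; the billiard is to the right of it. -/
def wall (ε : Params) (q₂ : ℝ) : ℝ := ε 1 * S.Q q₂ (ε 1)

/-- Momentum component along `(1, -wall')`, a normal of the wall pointing into the billiard. -/
def normalMomentum (ε : Params) (x : Phase) : ℝ := x.p₁ - deriv (S.wall ε) x.q₂ * x.p₂

/-- `x` hits the wall transversally from inside the billiard, and its kinetic energy in the normal
direction is below the height of the barrier. -/
def IsImpact (ε : Params) (x : Phase) : Prop :=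
  x.q₁ = S.wall ε x.q₂ ∧ S.normalMomentum ε x < 0 ∧
    S.normalMomentum ε x ^ 2 / (1 + deriv (S.wall ε) x.q₂ ^ 2) / 2 < S.b

/-- Elastic reflection: the momentum component normal to the wall changes its sign. -/
def reflect (ε : Params) (x : Phase) : Phase where
  q₁ := x.q₁
  p₁ := x.p₁ - 2 * S.normalMomentum ε x / (1 + deriv (S.wall ε) x.q₂ ^ 2)
  q₂ := x.q₂
  p₂ := x.p₂ + 2 * S.normalMomentum ε x / (1 + deriv (S.wall ε) x.q₂ ^ 2)
    * deriv (S.wall ε) x.q₂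

end ImpactSystem

/-- Coordinatewise convergence in phase space. -/
def TendsToPhase (γ : ℝ → Phase) (l : Filter ℝ) (x : Phase) : Prop :=
  Tendsto (fun t => (γ t).q₁) l (𝓝 x.q₁) ∧ Tendsto (fun t => (γ t).p₁) l (𝓝 x.p₁) ∧
    Tendsto (fun t => (γ t).q₂) l (𝓝 x.q₂) ∧ Tendsto (fun t => (γ t).p₂) l (𝓝 x.p₂)

namespace ImpactSystem

variable (S : ImpactSystem)

/-- `γ` is a trajectory of the impact system on `[0, T]`, with impacts exactly at the times in
`τ`: Hamilton's equations hold between impacts, elastic reflection takes place at impacts, and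
the trajectory stays in the billiard. -/
structure IsTrajectory (ε : Params) (T : ℝ) (γ : ℝ → Phase) (τ : Finset ℝ) : Prop where
  times : ∀ s ∈ τ, 0 < s ∧ s < T
  inside : ∀ t ∈ Icc 0 T, S.wall ε (γ t).q₂ ≤ (γ t).q₁
  motion : ∀ t ∈ Icc 0 T, t ∉ τ →
    HasDerivWithinAt (fun s => (γ s).q₁) (γ t).p₁ (Icc 0 T) t ∧
    HasDerivWithinAt (fun s => (γ s).p₁) (S.force₁ ε (γ t)) (Icc 0 T) t ∧
    HasDerivWithinAt (fun s => (γ s).q₂) (γ t).p₂ (Icc 0 T) t ∧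
    HasDerivWithinAt (fun s => (γ s).p₂) (S.force₂ ε (γ t)) (Icc 0 T) t
  impact : ∀ s ∈ τ, ∃ x : Phase, TendsToPhase γ (𝓝[<] s) x ∧ S.IsImpact ε x ∧
    γ s = S.reflect ε x ∧ TendsToPhase γ (𝓝[>] s) (γ s)

/-- The cross-section `p₁ = 0`, `dp₁/dt < 0`. -/
def crossSection (ε : Params) : Set Phase := {x | x.p₁ = 0 ∧ S.force₁ ε x < 0}

/-- The trajectory of `x` returns to the cross-section for the first time at `y`. -/
def IsFirstReturn (ε : Params) (x y : Phase) : Prop :=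
  ∃ T > 0, ∃ γ τ, S.IsTrajectory ε T γ τ ∧ γ 0 = x ∧ γ T = y ∧
    x ∈ S.crossSection ε ∧ y ∈ S.crossSection ε ∧ ∀ t ∈ Ioo 0 T, γ t ∉ S.crossSection ε

/-- The unperturbed Hamiltonian is of the S3B class. -/
def IsS3B (r : ℕ) : Prop := IsS3BPotential r S.V₁ ∧ IsS3BPotential r S.V₂

/-- The unperturbed wall `q₁ = 0` is in regular position. -/
def RegularWall : Prop := deriv S.V₁ 0 ≠ 0 ∧ ∀ q, IsSaddle S.V₁ q → S.V₁ 0 ≠ S.V₁ q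

/-- The energy level `H` is `δ`-regular with respect to the wall position. -/
def DeltaRegular (δ H : ℝ) : Prop := S.V₁ 0 ∈ regularEnergies S.V₁ S.V₂ δ H

/-- The coupling potential and the wall profile are `C^n`. -/
def PerturbationSmooth (n : ℕ) : Prop :=
  ContDiff ℝ n (fun x : ℝ × ℝ => S.Vr x.1 x.2) ∧ ContDiff ℝ n (fun x : ℝ × ℝ => S.Q x.1 x.2)

/-- `L₁` and `L₂` are the leaves of the unperturbed torus of total energy `H` with action `I` on
the branch of `B`, where `L₁` is on an intersecting branch or on the tangent branch. -/
def IsTorus (B : Leaf S.V₂) (H I : ℝ) (L₁ : Leaf S.V₁) (L₂ : Leaf S.V₂) : Prop :=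
  L₁.OnWallBranch ∧ B.SameBranch L₂ ∧ L₂.action = I ∧ L₁.energy + L₂.energy = H

/-- The actions `I` on the branch of `B` whose energy is in the regular set, which are outside
the open `ρ`-interval around the action `I_tan` of the tangent torus on this branch (if there
is one), and whose torus is not `η`-close to a lower-dimensional torus `I = 0` or `J = 0`. -/
def regularActions (B : Leaf S.V₂) (H δ ρ η : ℝ) : Set ℝ :=
  {I | ∃ L₁ L₂, S.IsTorus B H I L₁ L₂ ∧ L₂.energy ∈ regularEnergies S.V₂ S.V₁ δ H ∧
    (∀ Lt : Leaf S.V₂, B.SameBranch Lt → Lt.energy = H - S.V₁ 0 → ρ ≤ |I - Lt.action|) ∧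
    η ≤ I ∧ η ≤ L₁.action}

open Classical in
/-- The rotation `Θ(I) = 2π T̃₁ / T₂` of the unperturbed impact return map
(the leaves are unique; the value is irrelevant where there are none). -/
def rotation (B : Leaf S.V₂) (H I : ℝ) : ℝ :=
  if h : ∃ L : Leaf S.V₁ × Leaf S.V₂, S.IsTorus B H I L.1 L.2 then
    2 * Real.pi * (h.choose.1.impactPeriod / h.choose.2.period)
  else 0

/-- `x` is the point with coordinates `(I, θ)` of the perturbed cross-section at energy `H`: its
`q₁` is `κ`-close to the right turning point of the unperturbed leaf in the `(q₁, p₁)` plane. -/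
def IsSectionPoint (B : Leaf S.V₂) (H κ : ℝ) (ε : Params) (I θ : ℝ) (x : Phase) : Prop :=
  x ∈ S.crossSection ε ∧ S.energy ε x = H ∧ HasCoords B I θ x.q₂ x.p₂ ∧
    ∃ L₁ L₂, S.IsTorus B H I L₁ L₂ ∧ |x.q₁ - L₁.right| < κ

/-- On `U × ℝ`, the coordinates `(I, θ)` determine a point of the perturbed cross-section, and `F`
is the (lifted) return map of the perturbed impact system in these coordinates. -/
def IsReturnMapOn (B : Leaf S.V₂) (H κ : ℝ) (ε : Params) (U : Set ℝ)
    (F : ℝ × ℝ → ℝ × ℝ) : Prop :=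
  ∀ I ∈ U, ∀ θ : ℝ, (∃! x, S.IsSectionPoint B H κ ε I θ x) ∧
    ∀ x, S.IsSectionPoint B H κ ε I θ x →
      ∃ y, S.IsFirstReturn ε x y ∧ S.IsSectionPoint B H κ ε (F (I, θ)).1 (F (I, θ)).2 y

/-- The map `I' = I + ‖ε‖ f`, `θ' = θ + Θ(I) + ‖ε‖ g`. -/
def nearIntegrableMap (B : Leaf S.V₂) (H : ℝ) (ε : Params) (f g : ℝ × ℝ → ℝ) (x : ℝ × ℝ) :
    ℝ × ℝ :=
  (x.1 + ‖ε‖ * f x, x.2 + S.rotation B H x.1 + ‖ε‖ * g x)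

end ImpactSystem

/-- `F` preserves the symplectic form `dI ∧ dθ` on `s`. -/
def IsSymplecticOn (F : ℝ × ℝ → ℝ × ℝ) (s : Set (ℝ × ℝ)) : Prop :=
  ∀ x ∈ s, DifferentiableAt ℝ F x ∧ ∀ u v : ℝ × ℝ,
    (fderiv ℝ F x u).1 * (fderiv ℝ F x v).2 - (fderiv ℝ F x u).2 * (fderiv ℝ F x v).1 =
      u.1 * v.2 - u.2 * v.1

/-- All derivatives of `f` of order at most `k` are bounded by `C` on `s`. -/
def CNormLE (k : ℕ) (f : ℝ × ℝ → ℝ) (s : Set (ℝ × ℝ)) (C : ℝ) : Prop :=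
  ∀ j ≤ k, ∀ x ∈ s, ‖iteratedFDeriv ℝ j f x‖ ≤ C

end ImpactHam

end

noncomputable section

namespace ImpactHam

/-! ### Flows of Lipschitz vector fields -/

section Flow

variable {E : Type} [NormedAddCommGroup E] [NormedSpace ℝ E]

/-! For `ε = 0` the return is explicit. The motion is a product; the first degree of freedom runs
from its right turning point to the wall (or, on a torus that misses the wall, to its left turning
point) and then retraces its path with reversed momentum, while the second runs on. So the action is
kept and the angle advances by `2π T̃₁ / T₂`.

The perturbed return is a solution of finitely many equations (`returnEquation`). The unknowns are
the initial `q₁`, the durations of the two legs, the new action and the increment of the angle. The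
equations say that the energy is `H`, that the first leg ends at the wall (or at `p₁ = 0`), that the
second ends at `p₁ = 0`, and that the new coordinates describe its end. The explicit solution for `ε
= 0` (`returnEquation_base`) is nondegenerate (`injective_returnEquation`): the linearization is
triangular, and its diagonal blocks are the force at the right turning point, the momentum at the
wall or the force at the left turning point, again the force on the section, and the derivative of
the action-angle coordinates. Away from tangency with the wall none of these degenerates, and the
implicit function theorem gives a solution that is smooth jointly in `(I, θ, ε)`
(`exists_solution_map`, `exists_branch_solution`). It is the true first return because the signs of
`p₁` and of the distance to the wall along the two legs survive small perturbations
(`eventually_isReturnData`, `isFirstReturn`).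

Uniformity is compactness. Distance from saddle energies, from the tangent torus and from zero
actions keeps all limits of the tori regular and transverse, so the relevant actions lie in the
interior of a compact set of such tori (`exists_compact_actions`). Angles are periodic, and branches
are finite in number because critical points are.

For the estimates, let the solution be `C^N` in all variables. Its derivatives in `(I, θ)` of order
below `N` are `C^1` in the parameter, so they differ from the unperturbed ones by `O(‖ε‖)`; those of
order `N` are only continuous, so their difference is `o(1)`. Data of class `C^(r+1)` give `N = r`,
one more derivative gives `N = r + 1`.

Symplecticity follows from three facts. Moving points along a Hamiltonian flow for a variable time
`T` changes the pulled back form by `dT ∧ dh`, which vanishes on an energy level (`pullback_flow`).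
Reflection preserves the form on vectors tangent to the wall (`form3_reflectMap`). Action-angle
coordinates are canonical up to a sign which is the same at both ends (`area_fderiv_angleMap`).

Two devices make the flow smooth and complete: the potential is cut off outside the region to which
the energy confines the motion, and the parameter of the potential becomes a phase variable with a
conjugate momentum. Smooth dependence on initial data (`contDiff_flow`) is the implicit function
theorem in a space of curves. -/

theorem exists_solution_of_lipschitz [CompleteSpace E] {f : E → E} {K : NNReal}
    (hL : LipschitzWith K f) (hf : ContDiff ℝ 1 f) (x : E) :
    ∃ γ : ℝ → E, γ 0 = x ∧ ∀ t, HasDerivAt γ (f (γ t)) t := by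
  have key : ∀ x : E, ∃ γ : ℝ → E, γ 0 = x ∧
      IsMIntegralCurveOn (I := modelWithCornersSelf ℝ E) γ f (Ioo (-(1 / (1 + K : ℝ))) (1 / (1 + K : ℝ))) := by
    intro x
    set δ : ℝ := 1 / (1 + K : ℝ) with hδ
    have hδ0 : 0 < δ := by positivity
    let t₀ : Icc (-δ) δ := ⟨0, by constructor <;> linarith⟩
    -- On the ball of radius `a = ‖f x‖ + 1` the field is bounded by `‖f x‖ + K a`, and `(‖f x‖ + K
    -- a) / (1 + K) ≤ a`. The existence time `1 / (1 + K)` is thus independent of `x`, which is what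
    -- continuation to all times needs.
    let a : NNReal := ‖f x‖₊ + 1
    have hpl : IsPicardLindelof (fun _ => f) t₀ x a 0 (‖f x‖₊ + K * a) K := by
      apply IsPicardLindelof.of_time_independent
      · intro y hy
        have h1 := hL.dist_le_mul y x
        have h2 : dist y x ≤ a := by simpa using hy
        have h3 : ‖f y‖ ≤ ‖f x‖ + dist (f y) (f x) := by
          rw [dist_eq_norm]; have := norm_add_le (f x) (f y - f x); simpa using this
        have h4 : (K : ℝ) * dist y x ≤ K * a := by gcongr
        push_cast at *
        linarith
      · exact hL.lipschitzOnWith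
      · have : max (δ - (t₀ : ℝ)) ((t₀ : ℝ) - -δ) = δ := by simp [t₀]
        rw [this]
        have h1 : (0 : ℝ) ≤ K := K.2
        have h2 : ((a : NNReal) : ℝ) = ‖f x‖ + 1 := by simp [a]
        have h3 := norm_nonneg (f x)
        have h4 : (1 + (K : ℝ)) * δ = 1 := by rw [hδ]; field_simp
        push_cast
        rw [h2]
        nlinarith [mul_nonneg h1 h3, mul_nonneg hδ0.le h3]
    obtain ⟨γ, h0, hγ⟩ := hpl.exists_eq_forall_mem_Icc_hasDerivWithinAt₀
    refine ⟨γ, h0, fun t ht => ?_⟩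
    have := (hγ t (Ioo_subset_Icc_self ht)).mono Ioo_subset_Icc_self
    exact this.hasFDerivWithinAt.hasMFDerivWithinAt
  have hv : ContMDiff (modelWithCornersSelf ℝ E) (modelWithCornersSelf ℝ E).tangent 1
      (fun x => (⟨x, f x⟩ : TangentBundle (modelWithCornersSelf ℝ E) E)) :=
    contMDiff_vectorSpace_iff_contDiff.2 hf
  obtain ⟨γ, h0, hγ⟩ := exists_isMIntegralCurve_of_isMIntegralCurveOn (I := modelWithCornersSelf ℝ E)
    (M := E) (v := f) hv (ε := 1 / (1 + K : ℝ)) (by positivity) key x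
  refine ⟨γ, h0, fun t => ?_⟩
  have h : HasFDerivAt γ ((1 : ℝ →L[ℝ] ℝ).smulRight (f (γ t))) t := (hγ t).hasFDerivAt
  exact h.hasDerivAt.congr_deriv (by simp)

theorem solution_unique_of_lipschitz {f : E → E} {K : NNReal} (hL : LipschitzWith K f)
    {γ γ' : ℝ → E} (hγ : ∀ t, HasDerivAt γ (f (γ t)) t) (hγ' : ∀ t, HasDerivAt γ' (f (γ' t)) t)
    (h0 : γ 0 = γ' 0) : γ = γ' :=
  ODE_solution_unique_univ (v := fun _ => f) (s := fun _ => univ) (t₀ := 0)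
    (fun _ => hL.lipschitzOnWith) (fun t => ⟨hγ t, trivial⟩) (fun t => ⟨hγ' t, trivial⟩) h0

open Classical in
/-- The flow of a vector field all of whose integral curves are complete. -/
def flow (f : E → E) (x : E) : ℝ → E :=
  if h : ∃ γ : ℝ → E, γ 0 = x ∧ ∀ t, HasDerivAt γ (f (γ t)) t then h.choose else fun _ => x

theorem flow_zero (f : E → E) (x : E) : flow f x 0 = x := by
  unfold flow
  split_ifs with h
  · exact h.choose_spec.1
  · rfl

/-- A Lipschitz field of class `C^1`. -/
structure IsLipschitzField (f : E → E) : Prop where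
  contDiff : ContDiff ℝ 1 f
  lipschitz : ∃ K : NNReal, LipschitzWith K f

namespace IsLipschitzField

variable [CompleteSpace E] {f : E → E}

theorem hasDerivAt_flow (hf : IsLipschitzField f) (x : E) (t : ℝ) : HasDerivAt (flow f x) (f (flow f x t)) t := by
  obtain ⟨K, hK⟩ := hf.lipschitz
  have h := exists_solution_of_lipschitz hK hf.contDiff x
  unfold flow
  rw [dif_pos h]
  exact h.choose_spec.2 t

theorem eq_flow (hf : IsLipschitzField f) {γ : ℝ → E} (hγ : ∀ t, HasDerivAt γ (f (γ t)) t) : γ = flow f (γ 0) := by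
  obtain ⟨K, hK⟩ := hf.lipschitz
  exact solution_unique_of_lipschitz hK hγ (hf.hasDerivAt_flow _) (flow_zero _ _).symm

theorem flow_add (hf : IsLipschitzField f) (x : E) (s t : ℝ) : flow f x (s + t) = flow f (flow f x s) t := by
  have := hf.eq_flow (γ := fun t => flow f x (s + t)) fun t => by
    simpa using (hf.hasDerivAt_flow x (s + t)).comp_const_add s t
  simpa using congrFun this t

end IsLipschitzField
end Flow

/-! ### Smooth dependence of flows on the initial point and the time -/

section FlowSmooth

variable {E F : Type} [NormedAddCommGroup E] [NormedSpace ℝ E] [NormedAddCommGroup F]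
  [NormedSpace ℝ F]

/-- Composition with a continuous map, as a map between spaces of continuous curves. -/
def superposition (f : E → F) (hf : Continuous f) (α : C(Icc (0 : ℝ) 1, E)) :
    C(Icc (0 : ℝ) 1, F) :=
  (⟨f, hf⟩ : C(E, F)).comp α

/-- Pointwise application of a curve of operators to a curve of vectors. -/
def pointwiseApply : C(Icc (0 : ℝ) 1, E →L[ℝ] F) →L[ℝ] C(Icc (0 : ℝ) 1, E) →L[ℝ]
    C(Icc (0 : ℝ) 1, F) :=
  LinearMap.mkContinuous₂
    (LinearMap.mk₂ ℝ (fun (A : C(Icc (0 : ℝ) 1, E →L[ℝ] F)) (v : C(Icc (0 : ℝ) 1, E)) =>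
        (⟨fun s => A s (v s), by fun_prop⟩ : C(Icc (0 : ℝ) 1, F)))
      (fun _ _ _ => by ext; simp) (fun _ _ _ => by ext; simp)
      (fun _ _ _ => by ext; simp) (fun _ _ _ => by ext; simp)) 1
    (fun A v => by
      rw [ContinuousMap.norm_le _ (by positivity)]
      intro s
      simp only [LinearMap.mk₂_apply, ContinuousMap.coe_mk, one_mul]
      exact (ContinuousLinearMap.le_opNorm _ _).trans
        (mul_le_mul (A.norm_coe_le_norm s) (v.norm_coe_le_norm s) (norm_nonneg _) (norm_nonneg A)))

@[simp] theorem pointwiseApply_apply (A : C(Icc (0 : ℝ) 1, E →L[ℝ] F)) (v : C(Icc (0 : ℝ) 1, E))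
    (s : Icc (0 : ℝ) 1) : pointwiseApply A v s = A s (v s) := rfl

theorem contDiff_pointwiseApply (n : ℕ) : ContDiff ℝ n
    (fun A : C(Icc (0 : ℝ) 1, E →L[ℝ] F) => (pointwiseApply A : C(Icc (0 : ℝ) 1, E) →L[ℝ] _)) :=
  ContinuousLinearMap.contDiff (𝕜 := ℝ) (E := C(Icc (0 : ℝ) 1, E →L[ℝ] F))
    (F := C(Icc (0 : ℝ) 1, E) →L[ℝ] C(Icc (0 : ℝ) 1, F)) pointwiseApply

/-- Mean value inequality on the segments from `α s` to `α s + v s`. It is uniform in `s` because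
composition with `f'` is continuous on curves in the supremum norm. -/
theorem hasFDerivAt_superposition {f : E → F} (hf : ContDiff ℝ 1 f) (α : C(Icc (0 : ℝ) 1, E)) :
    HasFDerivAt (superposition f hf.continuous)
      (pointwiseApply (superposition (fderiv ℝ f) (hf.continuous_fderiv one_ne_zero) α)) α := by
  have hc : Continuous (superposition (fderiv ℝ f) (hf.continuous_fderiv one_ne_zero)) :=
    ContinuousMap.continuous_postcomp _
  rw [hasFDerivAt_iff_isLittleO_nhds_zero, Asymptotics.isLittleO_iff]
  intro c hc0
  obtain ⟨δ, hδ, h⟩ := Metric.continuousAt_iff.1 hc.continuousAt c hc0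
  filter_upwards [Metric.ball_mem_nhds (0 : C(Icc (0 : ℝ) 1, E)) hδ] with v hv
  rw [ContinuousMap.norm_le _ (by positivity)]
  intro s
  have hs : ∀ y ∈ segment ℝ (α s) (α s + v s), ‖fderiv ℝ f y - fderiv ℝ f (α s)‖ ≤ c := by
    intro y hy
    rw [segment_eq_image'] at hy
    obtain ⟨σ, hσ, rfl⟩ := hy
    have h1 : dist (α + σ • v) α < δ := by
      rw [dist_eq_norm, add_sub_cancel_left, norm_smul, Real.norm_of_nonneg hσ.1]
      have : ‖v‖ < δ := by simpa using hv
      nlinarith [hσ.2, norm_nonneg v]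
    have h2 := (ContinuousMap.dist_apply_le_dist (f := superposition (fderiv ℝ f) (hf.continuous_fderiv one_ne_zero) (α + σ • v))
      (g := superposition (fderiv ℝ f) (hf.continuous_fderiv one_ne_zero) α) s).trans (h h1).le
    rw [dist_eq_norm] at h2
    simpa [superposition] using h2
  have := (convex_segment (α s) (α s + v s)).norm_image_sub_le_of_norm_fderiv_le' (𝕜 := ℝ)
    (fun y _ => (hf.differentiable one_ne_zero).differentiableAt) hs (left_mem_segment ℝ _ _)
    (right_mem_segment ℝ _ _)
  simp only [add_sub_cancel_left] at this
  have h3 : c * ‖v s‖ ≤ c * ‖v‖ := by gcongr; exact v.norm_coe_le_norm s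
  exact this.trans h3

/-- The derivative of the superposition is again a superposition, with `f'`, followed by a bounded
linear map; hence induction on `n`. The target varies in the induction because `f'` has operator
values. -/
theorem contDiff_superposition (n : ℕ) : ∀ {F : Type} [NormedAddCommGroup F]
    [NormedSpace ℝ F] {f : E → F} (hf : ContDiff ℝ n f),
    ContDiff ℝ n (superposition f hf.continuous) := by
  induction n with
  | zero =>
    intro F _ _ f hf
    exact contDiff_zero.2 (ContinuousMap.continuous_postcomp _)
  | succ n ih =>
    intro F _ _ f hf
    have h1 : ContDiff ℝ 1 f := hf.of_le (by norm_cast; omega)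
    have h2 : ContDiff ℝ n (fderiv ℝ f) := hf.fderiv_right (by norm_cast)
    push_cast
    rw [contDiff_succ_iff_hasFDerivAt]
    exact ⟨fun α => pointwiseApply (superposition (fderiv ℝ f) h2.continuous α),
      (contDiff_pointwiseApply n).comp (ih h2),
      fun α => hasFDerivAt_superposition h1 α⟩

/-- The primitive vanishing at `0`. -/
def primitive [CompleteSpace E] : C(Icc (0 : ℝ) 1, E) →L[ℝ] C(Icc (0 : ℝ) 1, E) :=
  have hcont : ∀ α : C(Icc (0 : ℝ) 1, E), Continuous fun σ : ℝ => α (projIcc 0 1 zero_le_one σ) :=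
    fun α => α.continuous.comp continuous_projIcc
  LinearMap.mkContinuous
    { toFun := fun α => ⟨fun s => ∫ σ in (0 : ℝ)..s, α (projIcc 0 1 zero_le_one σ), by
        have := intervalIntegral.continuous_primitive (μ := MeasureTheory.volume)
          (fun a b => (hcont α).intervalIntegrable a b) 0
        exact this.comp continuous_subtype_val⟩
      map_add' := fun α β => by
        ext s
        exact intervalIntegral.integral_add ((hcont α).intervalIntegrable _ _)
          ((hcont β).intervalIntegrable _ _)
      map_smul' := fun c α => by
        ext s
        exact intervalIntegral.integral_smul _ _ } 1
    (fun α => by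
      rw [ContinuousMap.norm_le _ (by positivity)]
      intro s
      have := intervalIntegral.norm_integral_le_of_norm_le_const (a := 0) (b := (s : ℝ)) (C := ‖α‖)
        (f := fun σ => α (projIcc 0 1 zero_le_one σ)) (fun σ _ => α.norm_coe_le_norm _)
      refine this.trans ?_
      rw [sub_zero, abs_of_nonneg s.2.1, one_mul]
      exact mul_le_of_le_one_right (norm_nonneg _) s.2.2)

theorem norm_primitive_le [CompleteSpace E] (α : C(Icc (0 : ℝ) 1, E)) : ‖primitive α‖ ≤ ‖α‖ := by
  have h : ‖primitive (E := E)‖ ≤ 1 := by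
    unfold primitive
    exact LinearMap.mkContinuous_norm_le _ zero_le_one _
  simpa using (primitive (E := E)).le_of_opNorm_le h α

theorem primitive_apply [CompleteSpace E] (α : C(Icc (0 : ℝ) 1, E)) (s : Icc (0 : ℝ) 1) :
    primitive α s = ∫ σ in (0 : ℝ)..s, α (projIcc 0 1 zero_le_one σ) := rfl

namespace IsLipschitzField

variable [CompleteSpace E] {f : E → E}

theorem continuous_flow (hf : IsLipschitzField f) (x : E) : Continuous (flow f x) :=
  continuous_iff_continuousAt.2 fun t => (hf.hasDerivAt_flow x t).continuousAt

/-- The orbit segment of `x` over the time interval from `0` to `T`, reparametrized. -/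
def arc (hf : IsLipschitzField f) (p : E × ℝ) : C(Icc (0 : ℝ) 1, E) :=
  ⟨fun s => flow f p.1 (p.2 * s), (hf.continuous_flow _).comp (by fun_prop)⟩

/-- The integral equation of orbit segments. -/
def arcEquation (hf : IsLipschitzField f) (q : (E × ℝ) × C(Icc (0 : ℝ) 1, E)) :
    C(Icc (0 : ℝ) 1, E) :=
  q.2 - ContinuousMap.const _ q.1.1 - q.1.2 • primitive (superposition f hf.contDiff.continuous q.2)

theorem arcEquation_arc (hf : IsLipschitzField f) (p : E × ℝ) :
    hf.arcEquation (p, hf.arc p) = 0 := by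
  ext s
  have h1 : ∀ σ : ℝ, HasDerivAt (fun σ => flow f p.1 (p.2 * σ)) (p.2 • f (flow f p.1 (p.2 * σ))) σ := by
    intro σ
    have := (hf.hasDerivAt_flow p.1 (p.2 * σ)).scomp σ ((hasDerivAt_id σ).const_mul p.2)
    simpa [Function.comp_def] using this
  have hc : Continuous fun σ : ℝ => p.2 • f (flow f p.1 (p.2 * σ)) :=
    continuous_const.smul (hf.contDiff.continuous.comp ((hf.continuous_flow _).comp (by fun_prop)))
  have h2 := intervalIntegral.integral_eq_sub_of_hasDerivAt (a := 0) (b := (s : ℝ))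
    (fun σ _ => h1 σ) (hc.intervalIntegrable _ _)
  have h3 : ∫ σ in (0 : ℝ)..s, (superposition f hf.contDiff.continuous (hf.arc p))
      (projIcc 0 1 zero_le_one σ) = ∫ σ in (0 : ℝ)..s, f (flow f p.1 (p.2 * σ)) := by
    apply intervalIntegral.integral_congr
    intro σ hσ
    rw [uIcc_of_le s.2.1] at hσ
    simp [superposition, arc, projIcc_of_mem zero_le_one (⟨hσ.1, hσ.2.trans s.2.2⟩ : σ ∈ Icc (0:ℝ) 1)]
  simp only [arcEquation, ContinuousMap.sub_apply, ContinuousMap.const_apply,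
    ContinuousMap.smul_apply, primitive_apply, h3, ContinuousMap.zero_apply]
  rw [← intervalIntegral.integral_smul, h2]
  simp [arc, flow_zero]

theorem contDiff_arcEquation (hf : IsLipschitzField f) {n : ℕ} (hn : ContDiff ℝ n f) :
    ContDiff ℝ n hf.arcEquation := by
  have h1 : ContDiff ℝ n fun x : E => ContinuousMap.const (Icc (0 : ℝ) 1) x := by
    exact (ContinuousLinearMap.const ℝ (Icc (0 : ℝ) 1) : E →L[ℝ] _).contDiff
  have h2 := contDiff_superposition n hn
  exact (contDiff_snd.sub (h1.comp (contDiff_fst.comp contDiff_fst))).sub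
    ((contDiff_snd.comp contDiff_fst).smul
      ((primitive (E := E)).contDiff.comp (h2.comp contDiff_snd)))

omit [CompleteSpace E] in
theorem norm_superposition_sub_le {K : NNReal} (hf : IsLipschitzField f) (hK : LipschitzWith K f)
    (α β : C(Icc (0 : ℝ) 1, E)) :
    ‖superposition f hf.contDiff.continuous α - superposition f hf.contDiff.continuous β‖ ≤
      K * ‖α - β‖ := by
  rw [ContinuousMap.norm_le _ (by positivity)]
  intro s
  have h1 := hK.dist_le_mul (α s) (β s)
  rw [dist_eq_norm, dist_eq_norm] at h1
  exact h1.trans (by gcongr; exact (α - β).norm_coe_le_norm s)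

/-- By the integral equation two arcs differ by the difference of the data plus at most `|T| K`
times their own difference, which `|T| K < 1` absorbs. Continuity serves to recognize the arcs as
the solutions that the implicit function selects. -/
theorem continuousAt_arc {K : NNReal} (hf : IsLipschitzField f) (hK : LipschitzWith K f)
    {p : E × ℝ} (hp : |p.2| * K < 1) : ContinuousAt hf.arc p := by
  set N := superposition f hf.contDiff.continuous
  have heq : ∀ q, hf.arc q = ContinuousMap.const _ q.1 + q.2 • primitive (N (hf.arc q)) := by
    intro q
    have := hf.arcEquation_arc q
    simp only [arcEquation] at this
    rw [sub_sub, sub_eq_zero] at this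
    exact this
  set B := ‖primitive (N (hf.arc p))‖
  have hest : ∀ᶠ q in 𝓝 p, ‖hf.arc q - hf.arc p‖ ≤
      (1 - |q.2| * K)⁻¹ * (‖q.1 - p.1‖ + |q.2 - p.2| * B) := by
    have : ∀ᶠ q : E × ℝ in 𝓝 p, |q.2| * K < 1 :=
      (continuous_snd.abs.mul continuous_const).continuousAt.eventually (gt_mem_nhds hp)
    filter_upwards [this] with q hq
    rw [inv_mul_eq_div, le_div_iff₀ (by linarith)]
    have h1 : hf.arc q - hf.arc p = ContinuousMap.const _ (q.1 - p.1) +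
        q.2 • primitive (N (hf.arc q) - N (hf.arc p)) +
        (q.2 - p.2) • primitive (N (hf.arc p)) := by
      rw [map_sub]
      conv_lhs => rw [heq q, heq p]
      ext s
      simp [sub_smul, smul_sub]
      abel
    have h2 : ‖ContinuousMap.const (Icc (0 : ℝ) 1) (q.1 - p.1)‖ ≤ ‖q.1 - p.1‖ := by
      rw [ContinuousMap.norm_le _ (norm_nonneg _)]
      intro s; simp
    have h3 : ‖q.2 • primitive (N (hf.arc q) - N (hf.arc p))‖ ≤
        |q.2| * (K * ‖hf.arc q - hf.arc p‖) := by
      rw [norm_smul, Real.norm_eq_abs]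
      gcongr
      exact (norm_primitive_le _).trans (hf.norm_superposition_sub_le hK _ _)
    have h4 : ‖(q.2 - p.2) • primitive (N (hf.arc p))‖ ≤ |q.2 - p.2| * B := by
      rw [norm_smul, Real.norm_eq_abs]
    have h5 := norm_add₃_le (a := ContinuousMap.const (Icc (0 : ℝ) 1) (q.1 - p.1))
      (b := q.2 • primitive (N (hf.arc q) - N (hf.arc p)))
      (c := (q.2 - p.2) • primitive (N (hf.arc p)))
    rw [← h1] at h5
    nlinarith
  rw [ContinuousAt, tendsto_iff_norm_sub_tendsto_zero]
  refine squeeze_zero' (Eventually.of_forall fun _ => norm_nonneg _) hest ?_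
  have hc : ContinuousAt (fun q : E × ℝ => (1 - |q.2| * K)⁻¹ * (‖q.1 - p.1‖ + |q.2 - p.2| * B)) p := by
    refine ContinuousAt.mul (ContinuousAt.inv₀ (by fun_prop) (by linarith)) (by fun_prop)
  have := hc.tendsto
  simpa using this

/-- The derivative of the arc equation with respect to the arc is `1 - A` with `‖A‖ ≤ |T| K < 1`,
invertible by the Neumann series. The implicit function theorem makes the arc a smooth function of
the data, and evaluation at its end is linear. -/
theorem contDiffAt_flow_of_small {K : NNReal} (hf : IsLipschitzField f) (hK : LipschitzWith K f)
    {n : ℕ} (hn0 : n ≠ 0) (hn : ContDiff ℝ n f) {p : E × ℝ} (hp : |p.2| * K < 1) :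
    ContDiffAt ℝ n (fun q : E × ℝ => flow f q.1 q.2) p := by
  have hcd : ContDiffAt ℝ n hf.arcEquation (p, hf.arc p) := (hf.contDiff_arcEquation hn).contDiffAt
  have hn0' : (n : WithTop ℕ∞) ≠ 0 := by exact_mod_cast hn0
  set A : C(Icc (0 : ℝ) 1, E) →L[ℝ] C(Icc (0 : ℝ) 1, E) := p.2 • primitive ∘L
    pointwiseApply (superposition (fderiv ℝ f) (hf.contDiff.continuous_fderiv one_ne_zero) (hf.arc p))
    with hA
  have hder : fderiv ℝ hf.arcEquation (p, hf.arc p) ∘L .inr ℝ _ _ = 1 - A := by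
    have h1 : HasFDerivAt (fun α => hf.arcEquation (p, α))
        (fderiv ℝ hf.arcEquation (p, hf.arc p) ∘L .inr ℝ _ _) (hf.arc p) :=
      (hcd.differentiableAt hn0').hasFDerivAt.comp _ (hasFDerivAt_prodMk_right p (hf.arc p))
    have h2 : HasFDerivAt (fun α => hf.arcEquation (p, α)) (1 - A) (hf.arc p) := by
      have h3 := ((primitive (E := E)).hasFDerivAt.comp _
        (hasFDerivAt_superposition hf.contDiff (hf.arc p))).const_smul p.2
      have h4 := ((hasFDerivAt_id (hf.arc p)).sub_const (ContinuousMap.const _ p.1)).sub h3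
      exact h4
    exact h1.unique h2
  have hnorm : ‖A‖ < 1 := by
    refine lt_of_le_of_lt (ContinuousLinearMap.opNorm_le_bound _ (by positivity) fun v => ?_) hp
    simp only [hA, _root_.smul_apply, ContinuousLinearMap.comp_apply, norm_smul,
      Real.norm_eq_abs, mul_assoc]
    gcongr
    refine (norm_primitive_le _).trans ?_
    rw [ContinuousMap.norm_le _ (by positivity)]
    intro s
    refine ((fderiv ℝ f _).le_opNorm _).trans ?_
    gcongr
    · exact norm_fderiv_le_of_lipschitz ℝ hK
    · exact v.norm_coe_le_norm s
  have hinv : (fderiv ℝ hf.arcEquation (p, hf.arc p) ∘L .inr ℝ _ _).IsInvertible := by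
    rw [hder]
    exact ⟨ContinuousLinearEquiv.unitsEquiv ℝ _ (Units.oneSub A hnorm), rfl⟩
  have himp := hcd.contDiffAt_implicitFunction hn0' hinv
  have hev : hcd.implicitFunction hn0' hinv =ᶠ[𝓝 p] hf.arc := by
    have h1 := hcd.eventually_apply_eq_iff_implicitFunction hn0' hinv
    have h2 : Tendsto (fun q => (q, hf.arc q)) (𝓝 p) (𝓝 (p, hf.arc p)) :=
      (continuousAt_id.prodMk (hf.continuousAt_arc hK hp))
    filter_upwards [h2.eventually h1] with q hq
    exact hq.1 (by rw [hf.arcEquation_arc, hf.arcEquation_arc])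
  have harc : ContDiffAt ℝ n hf.arc p := himp.congr_of_eventuallyEq hev.symm
  have heval : ContDiff ℝ n (fun α : C(Icc (0 : ℝ) 1, E) => α 1) :=
    ContinuousLinearMap.contDiff (𝕜 := ℝ) (E := C(Icc (0 : ℝ) 1, E)) (F := E)
      (ContinuousMap.evalCLM ℝ (1 : Icc (0 : ℝ) 1))
  have := heval.contDiffAt.comp p harc
  refine this.congr_of_eventuallyEq (Eventually.of_forall fun q => ?_)
  simp [arc]

/-- The flow of a `C^n` Lipschitz field is `C^n`, jointly in the point and the time. -/
theorem contDiff_flow (hf : IsLipschitzField f) {n : ℕ} (hn0 : n ≠ 0) (hn : ContDiff ℝ n f) :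
    ContDiff ℝ n (fun q : E × ℝ => flow f q.1 q.2) := by
  obtain ⟨K, hK⟩ := hf.lipschitz
  -- Long times are reached by doubling: the flow for time `T` is the flow for time `T / 2` applied
  -- twice.
  have key : ∀ k : ℕ, ∀ p : E × ℝ, |p.2| * K < 2 ^ k →
      ContDiffAt ℝ n (fun q : E × ℝ => flow f q.1 q.2) p := by
    intro k
    induction k with
    | zero => exact fun p hp => hf.contDiffAt_flow_of_small hK hn0 hn (by simpa using hp)
    | succ k ih =>
      intro p hp
      have h2 : |p.2 / 2| * K < 2 ^ k := by
        rw [abs_div, abs_two]; rw [pow_succ] at hp; linarith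
      have h3 : ContDiffAt ℝ n (fun q : E × ℝ => flow f q.1 (q.2 / 2)) p :=
        (ih (p.1, p.2 / 2) h2).comp (f := fun q : E × ℝ => (q.1, q.2 / 2)) p
          (contDiffAt_fst.prodMk (contDiffAt_snd.div_const 2))
      have h4 : ContDiffAt ℝ n (fun q : E × ℝ => flow f (flow f q.1 (q.2 / 2)) (q.2 / 2)) p :=
        (ih (flow f p.1 (p.2 / 2), p.2 / 2) h2).comp
          (f := fun q : E × ℝ => (flow f q.1 (q.2 / 2), q.2 / 2)) p
          (h3.prodMk (contDiffAt_snd.div_const 2))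
      refine h4.congr_of_eventuallyEq (Eventually.of_forall fun q => ?_)
      simp only [← hf.flow_add, add_halves]
  rw [contDiff_iff_contDiffAt]
  intro p
  obtain ⟨k, hk⟩ := pow_unbounded_of_one_lt (|p.2| * K) one_lt_two
  exact key k p hk

end IsLipschitzField
end FlowSmooth

/-! ### Hamiltonian flows: conservation of the energy and of the symplectic form -/

section Hamiltonian

variable {E : Type} [NormedAddCommGroup E] [NormedSpace ℝ E]

/-- `f` is the Hamiltonian vector field of `h` with respect to the constant
alternating form `ω`. -/
structure IsHamiltonianField (ω : E →L[ℝ] E →L[ℝ] ℝ) (h : E → ℝ) (f : E → E) : Prop where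
  field : IsLipschitzField f
  contDiff_field : ContDiff ℝ 2 f
  contDiff_energy : ContDiff ℝ 2 h
  alternating : ∀ u v, ω u v = -ω v u
  apply_field : ∀ x v, ω (f x) v = fderiv ℝ h x v

namespace IsHamiltonianField

variable {ω : E →L[ℝ] E →L[ℝ] ℝ} {h : E → ℝ} {f : E → E}

/-- `ω (f' u) v` is the second derivative of `h` at `(u, v)`; it is symmetric, whereas `ω` is
alternating. -/
theorem linearized (H : IsHamiltonianField ω h f) (x u v : E) :
    ω (fderiv ℝ f x u) v + ω u (fderiv ℝ f x v) = 0 := by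
  have h1 : ∀ u v, ω (fderiv ℝ f x u) v = fderiv ℝ (fderiv ℝ h) x u v := by
    intro u v
    have e1 : HasFDerivAt (fun y => ω (f y) v) ((ω.flip v) ∘L fderiv ℝ f x) x :=
      (ω.flip v).hasFDerivAt.comp x
        ((H.contDiff_field.differentiable two_ne_zero).differentiableAt.hasFDerivAt)
    have hd : DifferentiableAt ℝ (fderiv ℝ h) x :=
      ((H.contDiff_energy.fderiv_right (m := 1) (by norm_num)).differentiable
        one_ne_zero).differentiableAt
    have e2 : HasFDerivAt (fun y => fderiv ℝ h y v)
        ((ContinuousLinearMap.apply ℝ ℝ v) ∘L fderiv ℝ (fderiv ℝ h) x) x :=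
      (ContinuousLinearMap.apply ℝ ℝ v).hasFDerivAt.comp x hd.hasFDerivAt
    have e3 : (fun y => ω (f y) v) = fun y => fderiv ℝ h y v := funext fun y => H.apply_field y v
    rw [e3] at e1
    have := congrArg (fun L : E →L[ℝ] ℝ => L u) (e1.unique e2)
    simpa using this
  have h2 : fderiv ℝ (fderiv ℝ h) x u v = fderiv ℝ (fderiv ℝ h) x v u :=
    (H.contDiff_energy.contDiffAt.isSymmSndFDerivAt (by simp)) u v
  rw [H.alternating u, h1, h1, h2]
  ring

variable [CompleteSpace E]

theorem energy_flow (H : IsHamiltonianField ω h f) (x : E) (t : ℝ) : h (flow f x t) = h x := by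
  have h1 : ∀ t, HasDerivAt (fun t => h (flow f x t)) 0 t := by
    intro t
    have := ((H.contDiff_energy.differentiable two_ne_zero).differentiableAt (x := flow f x t)).hasFDerivAt.comp_hasDerivAt t (H.field.hasDerivAt_flow x t)
    refine this.congr_deriv ?_
    rw [← H.apply_field]
    have := H.alternating (f (flow f x t)) (f (flow f x t))
    linarith
  have := is_const_of_deriv_eq_zero (fun t => (h1 t).differentiableAt) (fun t => (h1 t).deriv) t 0
  simpa [flow_zero] using this

/-- The derivative of the flow with respect to the initial point. -/
def flowDeriv (f : E → E) (x : E) (t : ℝ) : E →L[ℝ] E :=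
  fderiv ℝ (fun q : E × ℝ => flow f q.1 q.2) (x, t) ∘L .inl ℝ E ℝ

theorem hasFDerivAt_flow (H : IsHamiltonianField ω h f) (x : E) (t : ℝ) :
    HasFDerivAt (fun q : E × ℝ => flow f q.1 q.2)
      (flowDeriv f x t ∘L .fst ℝ E ℝ + (ContinuousLinearMap.snd ℝ E ℝ).smulRight (f (flow f x t)))
      (x, t) := by
  have h1 := ((H.field.contDiff_flow two_ne_zero H.contDiff_field).differentiable two_ne_zero
    (x, t)).hasFDerivAt
  refine h1.congr_fderiv ?_
  have h2 : fderiv ℝ (fun q : E × ℝ => flow f q.1 q.2) (x, t) (0, 1) = f (flow f x t) := by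
    have h3 : HasDerivAt (fun s : ℝ => ((x, s) : E × ℝ)) (0, 1) t :=
      (hasDerivAt_const t x).prodMk (hasDerivAt_id t)
    exact (h1.comp_hasDerivAt t h3).unique (H.field.hasDerivAt_flow x t)
  ext v
  · simp [flowDeriv]
  · simp only [ContinuousLinearMap.comp_apply, ContinuousLinearMap.inr_apply, _root_.add_apply,
      ContinuousLinearMap.coe_fst', ContinuousLinearMap.smulRight_apply,
      ContinuousLinearMap.coe_snd', h2, map_zero, zero_add, one_smul]

/-- The variational equation. Symmetry of the second derivative of the flow exchanges the
derivatives in time and in the initial point; this is why the field has to be `C^2`. -/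
theorem hasDerivAt_flowDeriv (H : IsHamiltonianField ω h f) (x : E) (t : ℝ) (v : E) :
    HasDerivAt (fun t => flowDeriv f x t v) (fderiv ℝ f (flow f x t) (flowDeriv f x t v)) t := by
  set Φ := fun q : E × ℝ => flow f q.1 q.2 with hΦ
  have hC : ContDiff ℝ 2 Φ := H.field.contDiff_flow two_ne_zero H.contDiff_field
  have hd : DifferentiableAt ℝ (fderiv ℝ Φ) (x, t) :=
    ((hC.fderiv_right (m := 1) (by norm_num)).differentiable one_ne_zero).differentiableAt
  have h3 : HasDerivAt (fun s : ℝ => ((x, s) : E × ℝ)) (0, 1) t :=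
    (hasDerivAt_const t x).prodMk (hasDerivAt_id t)
  have h4 : HasDerivAt (fun t => flowDeriv f x t v) (fderiv ℝ (fderiv ℝ Φ) (x, t) (0, 1) (v, 0)) t := by
    have := (ContinuousLinearMap.apply ℝ E ((v, 0) : E × ℝ)).hasFDerivAt.comp_hasDerivAt t
      (hd.hasFDerivAt.comp_hasDerivAt t h3)
    exact this
  refine h4.congr_deriv ?_
  rw [(hC.contDiffAt.isSymmSndFDerivAt (by simp)) (0, 1) (v, 0)]
  have h5 : HasFDerivAt (fun q => fderiv ℝ Φ q (0, 1))
      ((ContinuousLinearMap.apply ℝ E ((0, 1) : E × ℝ)) ∘L fderiv ℝ (fderiv ℝ Φ) (x, t)) (x, t) :=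
    (ContinuousLinearMap.apply ℝ E ((0, 1) : E × ℝ)).hasFDerivAt.comp _ hd.hasFDerivAt
  have h6 : (fun q => fderiv ℝ Φ q (0, 1)) = fun q => f (Φ q) := by
    funext q
    rw [(H.hasFDerivAt_flow q.1 q.2).fderiv]
    simp [hΦ]
  have h7 : HasFDerivAt (fun q => f (Φ q)) (fderiv ℝ f (flow f x t) ∘L fderiv ℝ Φ (x, t)) (x, t) :=
    ((H.contDiff_field.differentiable two_ne_zero).differentiableAt (x := Φ (x, t))).hasFDerivAt.comp (x, t)
      ((hC.differentiable two_ne_zero).differentiableAt.hasFDerivAt)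
  rw [h6] at h5
  have := congrArg (fun L : E × ℝ →L[ℝ] E => L (v, 0)) (h5.unique h7)
  simpa [flowDeriv, hΦ] using this

theorem flowDeriv_symplectic (H : IsHamiltonianField ω h f) (x : E) (t : ℝ) (u v : E) :
    ω (flowDeriv f x t u) (flowDeriv f x t v) = ω u v := by
  have h1 : ∀ t, HasDerivAt (fun t => ω (flowDeriv f x t u) (flowDeriv f x t v)) 0 t := by
    intro t
    have hu := H.hasDerivAt_flowDeriv x t u
    have hv := H.hasDerivAt_flowDeriv x t v
    have := (ω.hasFDerivAt.comp_hasDerivAt t hu).clm_apply hv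
    refine this.congr_deriv ?_
    exact H.linearized _ _ _
  have h0 : ∀ w, flowDeriv f x 0 w = w := by
    intro w
    have e1 : HasFDerivAt (fun y : E => flow f y 0) (flowDeriv f x 0) x := by
      have := HasFDerivAt.comp (f := fun e : E => (e, (0 : ℝ))) x
        (H.hasFDerivAt_flow x 0) (hasFDerivAt_prodMk_left x (0 : ℝ))
      refine this.congr_fderiv ?_
      ext; simp
    simp only [flow_zero] at e1
    simpa using congrArg (fun L : E →L[ℝ] E => L w) (e1.unique (hasFDerivAt_id x))
  have := is_const_of_deriv_eq_zero (fun t => (h1 t).differentiableAt) (fun t => (h1 t).deriv) t 0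
  simpa [h0] using this

/-- How the pullback of `ω` changes when points move along the flow for a time that depends
on the point. -/
theorem pullback_flow (H : IsHamiltonianField ω h f) {D : Type} [NormedAddCommGroup D]
    [NormedSpace ℝ D] {z : D → E} {z' : D →L[ℝ] E} {T : D → ℝ} {T' : D →L[ℝ] ℝ} {d : D}
    (hz : HasFDerivAt z z' d) (hT : HasFDerivAt T T' d) :
    ∃ L : D →L[ℝ] E, HasFDerivAt (fun d => flow f (z d) (T d)) L d ∧
      ∀ a b, ω (L a) (L b) = ω (z' a) (z' b) +
        (T' a * fderiv ℝ h (z d) (z' b) - T' b * fderiv ℝ h (z d) (z' a)) := by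
  have h1 := (H.hasFDerivAt_flow (z d) (T d)).comp d (hz.prodMk hT)
  refine ⟨_, h1, fun a b => ?_⟩
  -- Differentiate the conservation law `h (flow f y t) = h y` with respect to `y`.
  have h2 : ∀ w, ω (f (flow f (z d) (T d))) (flowDeriv f (z d) (T d) w) = fderiv ℝ h (z d) w := by
    intro w
    rw [H.apply_field]
    have e1 : HasFDerivAt (fun y : E => flow f y (T d)) (flowDeriv f (z d) (T d)) (z d) := by
      have := HasFDerivAt.comp (f := fun e : E => (e, T d)) (z d)
        (H.hasFDerivAt_flow (z d) (T d)) (hasFDerivAt_prodMk_left (z d) (T d))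
      refine this.congr_fderiv ?_
      ext; simp
    have hdh := H.contDiff_energy.differentiable two_ne_zero
    have e2 := (hdh (flow f (z d) (T d))).hasFDerivAt.comp (z d) e1
    have e3 : (h ∘ fun y : E => flow f y (T d)) = h := funext fun y => H.energy_flow y (T d)
    rw [e3] at e2
    rw [e2.fderiv]; rfl
  have h3 : ω (f (flow f (z d) (T d))) (f (flow f (z d) (T d))) = 0 := by
    have := H.alternating (f (flow f (z d) (T d))) (f (flow f (z d) (T d)))
    linarith
  simp only [ContinuousLinearMap.comp_apply, _root_.add_apply,
    ContinuousLinearMap.smulRight_apply, ContinuousLinearMap.coe_fst',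
    ContinuousLinearMap.coe_snd', ContinuousLinearMap.prod_apply, map_add, map_smul,
    _root_.smul_apply, smul_eq_mul, h3, H.flowDeriv_symplectic, h2]
  rw [H.alternating (flowDeriv f (z d) (T d) (z' a)) (f (flow f (z d) (T d))), h2]
  ring

end IsHamiltonianField
end Hamiltonian

/-! ### One-dimensional Hamiltonian motion -/

section OneDegree

/-- Signs near a simple zero `b p` of `g p`, uniformly in the parameter. -/
theorem sign_near_simple_zero {X : Type*} [TopologicalSpace X] {p₀ : X} {g g' : X → ℝ → ℝ}
    {b : X → ℝ} (hg : ∀ᶠ p in 𝓝 p₀, ∀ t, HasDerivAt (g p) (g' p t) t)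
    (hc : ContinuousAt (fun x : X × ℝ => g' x.1 x.2) (p₀, b p₀)) (hb : ContinuousAt b p₀)
    (h0 : ∀ᶠ p in 𝓝 p₀, g p (b p) = 0) (hneg : g' p₀ (b p₀) < 0) :
    ∃ a > 0, ∀ᶠ p in 𝓝 p₀, ∀ t ∈ Ioc 0 a, g p (b p + t) < 0 ∧ 0 < g p (b p - t) := by
  have h1 : ∀ᶠ x : X × ℝ in 𝓝 (p₀, b p₀), g' x.1 x.2 < 0 := hc.eventually (gt_mem_nhds hneg)
  rw [nhds_prod_eq] at h1
  obtain ⟨P, hP, Q, hQ, hPQ⟩ := eventually_prod_iff.1 h1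
  obtain ⟨c, hc0, hcQ⟩ := Metric.eventually_nhds_iff.1 hQ
  refine ⟨c / 2, by linarith, ?_⟩
  have h2 : ∀ᶠ p in 𝓝 p₀, dist (b p) (b p₀) < c / 2 := hb (Metric.ball_mem_nhds _ (by linarith))
  filter_upwards [hg, h0, hP, h2] with p hgp h0p hPp hbp t ht
  rw [Real.dist_eq, abs_lt] at hbp
  have hanti : StrictAntiOn (g p) (Icc (b p - c / 2) (b p + c / 2)) := by
    apply strictAntiOn_of_deriv_neg (convex_Icc _ _)
      (fun t _ => (hgp t).continuousAt.continuousWithinAt)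
    intro s hs
    rw [interior_Icc] at hs
    rw [(hgp s).deriv]
    refine hPQ hPp (hcQ ?_)
    rw [Real.dist_eq, abs_lt]
    constructor <;> linarith [hs.1, hs.2]
  have hm : b p ∈ Icc (b p - c / 2) (b p + c / 2) := ⟨by linarith, by linarith⟩
  constructor
  · rw [← h0p]
    exact hanti hm ⟨by linarith [ht.1], by linarith [ht.2]⟩ (by linarith [ht.1])
  · rw [← h0p]
    exact hanti ⟨by linarith [ht.2], by linarith [ht.1]⟩ hm (by linarith [ht.1])

/-- The vector field of `p ^ 2 / 2 + W q`. -/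
def field1 (W : ℝ → ℝ) (x : ℝ × ℝ) : ℝ × ℝ := (x.2, -deriv W x.1)

/-- The energy `p ^ 2 / 2 + W q`. -/
def energy1 (W : ℝ → ℝ) (x : ℝ × ℝ) : ℝ := x.2 ^ 2 / 2 + W x.1

/-- The area form of the plane. -/
def area : ℝ × ℝ →L[ℝ] ℝ × ℝ →L[ℝ] ℝ :=
  (ContinuousLinearMap.fst ℝ ℝ ℝ).smulRight (ContinuousLinearMap.snd ℝ ℝ ℝ) -
    (ContinuousLinearMap.snd ℝ ℝ ℝ).smulRight (ContinuousLinearMap.fst ℝ ℝ ℝ)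

theorem area_apply (u v : ℝ × ℝ) : area u v = u.1 * v.2 - u.2 * v.1 := by
  simp [area]

/-- A potential for which the motion is complete. -/
structure IsGlobalPotential (W : ℝ → ℝ) : Prop where
  contDiff : ContDiff ℝ 3 W
  field : IsLipschitzField (field1 W)

theorem contDiff_deriv {n : ℕ} {W : ℝ → ℝ} (h : ContDiff ℝ (n + 1 : ℕ) W) : ContDiff ℝ n (deriv W) := by
  have : ContDiff ℝ ((n : WithTop ℕ∞) + 1) W := by exact_mod_cast h
  exact (contDiff_succ_iff_deriv.1 this).2.2

theorem contDiff_field1 {n : ℕ} {W : ℝ → ℝ} (h : ContDiff ℝ (n + 1 : ℕ) W) :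
    ContDiff ℝ n (field1 W) :=
  contDiff_snd.prodMk ((contDiff_deriv h).comp contDiff_fst).neg

namespace IsGlobalPotential

variable {W : ℝ → ℝ} (hW : IsGlobalPotential W)

theorem hasDerivAt (hW : IsGlobalPotential W) (q : ℝ) : HasDerivAt W (deriv W q) q :=
  ((hW.contDiff.differentiable (by norm_num)) q).hasDerivAt

theorem continuous_deriv (hW : IsGlobalPotential W) : Continuous (deriv W) :=
  (contDiff_deriv (n := 2) hW.contDiff).continuous

theorem hamiltonian (hW : IsGlobalPotential W) :
    IsHamiltonianField area (energy1 W) (field1 W) where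
  field := hW.field
  contDiff_field := contDiff_field1 (n := 2) hW.contDiff
  contDiff_energy := ((contDiff_snd.pow 2).div_const 2).add
    ((hW.contDiff.of_le (by norm_num)).comp contDiff_fst)
  alternating u v := by simp only [area_apply]; ring
  apply_field x v := by
    have h : HasFDerivAt (energy1 W) (x.2 • ContinuousLinearMap.snd ℝ ℝ ℝ +
        deriv W x.1 • ContinuousLinearMap.fst ℝ ℝ ℝ) x := by
      have h1 := ((hasFDerivAt_snd (𝕜 := ℝ) (p := x)).pow 2).mul_const (1 / 2 : ℝ)
      have h2 := (hW.hasDerivAt x.1).comp_hasFDerivAt x (hasFDerivAt_fst (𝕜 := ℝ) (p := x))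
      refine ((h1.add h2).congr_of_eventuallyEq (Eventually.of_forall fun y => ?_)).congr_fderiv ?_
      · simp [energy1]; ring
      · ext <;> simp
    rw [h.fderiv, area_apply]
    simp [field1]

end IsGlobalPotential

/-- The orbit which starts at rest at the position `R`. -/
def orb (W : ℝ → ℝ) (R t : ℝ) : ℝ × ℝ := flow (field1 W) (R, 0) t

namespace IsGlobalPotential

variable {W : ℝ → ℝ}

theorem orb_zero (W : ℝ → ℝ) (R : ℝ) : orb W R 0 = (R, 0) := flow_zero _ _

theorem hasDerivAt_fst (hW : IsGlobalPotential W) (R t : ℝ) :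
    HasDerivAt (fun t => (orb W R t).1) (orb W R t).2 t :=
  (hW.field.hasDerivAt_flow (R, 0) t).fst

theorem hasDerivAt_snd (hW : IsGlobalPotential W) (R t : ℝ) :
    HasDerivAt (fun t => (orb W R t).2) (-deriv W (orb W R t).1) t :=
  (hW.field.hasDerivAt_flow (R, 0) t).snd

theorem energy_orb (hW : IsGlobalPotential W) (R t : ℝ) :
    (orb W R t).2 ^ 2 / 2 + W (orb W R t).1 = W R := by
  have := hW.hamiltonian.energy_flow (R, 0) t
  simpa [energy1, orb] using this

theorem continuous_orb (hW : IsGlobalPotential W) (R : ℝ) : Continuous (orb W R) :=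
  hW.field.continuous_flow _

theorem contDiff_orb (hW : IsGlobalPotential W) {n : ℕ} (hn0 : n ≠ 0)
    (hn : ContDiff ℝ (n + 1 : ℕ) W) : ContDiff ℝ n fun x : ℝ × ℝ => orb W x.1 x.2 :=
  (hW.field.contDiff_flow hn0 (contDiff_field1 hn)).comp
    (((contDiff_fst.prodMk contDiff_const).prodMk contDiff_snd) :
      ContDiff ℝ n fun x : ℝ × ℝ => ((x.1, (0 : ℝ)), x.2))

/-- Time reversal. -/
theorem flow_reverse (hW : IsGlobalPotential W) (q p t : ℝ) :
    flow (field1 W) (q, -p) t = ((flow (field1 W) (q, p) (-t)).1, -(flow (field1 W) (q, p) (-t)).2) := by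
  have h := hW.field.eq_flow
    (γ := fun t => ((flow (field1 W) (q, p) (-t)).1, -(flow (field1 W) (q, p) (-t)).2)) fun t => by
      have h1 : HasDerivAt (fun t : ℝ => flow (field1 W) (q, p) (-t))
          ((-1 : ℝ) • field1 W (flow (field1 W) (q, p) (-t))) t :=
        (hW.field.hasDerivAt_flow (q, p) (-t)).scomp t (hasDerivAt_neg t)
      have h2 : HasDerivAt (fun t : ℝ => (flow (field1 W) (q, p) (-t)).1) _ t := h1.fst
      have h3 : HasDerivAt (fun t : ℝ => (flow (field1 W) (q, p) (-t)).2) _ t := h1.snd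
      have h4 : HasDerivAt (fun t : ℝ => -(flow (field1 W) (q, p) (-t)).2) _ t := HasDerivAt.fun_neg h3
      convert! HasDerivAt.prodMk h2 h4 using 1
      simp [field1]
  have := congrFun h t
  simp only [neg_zero, flow_zero] at this
  exact this.symm

/-- The first half of a regular leaf, from the right to the left turning point. -/
theorem exists_half_time (hW : IsGlobalPotential W) (L : Leaf W) :
    ∃ τ > 0, (∀ t ∈ Ioo 0 τ, (orb W L.right t).2 < 0) ∧ orb W L.right τ = (L.left, 0) := by
  set x := fun t => (orb W L.right t).1 with hx
  set y := fun t => (orb W L.right t).2 with hy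
  have hx0 : x 0 = L.right := by simp [hx, orb_zero]
  have hy0 : y 0 = 0 := by simp [hy, orb_zero]
  have hyc : Continuous y := (hW.continuous_orb _).snd
  have hxc : Continuous x := (hW.continuous_orb _).fst
  have hen : ∀ t, y t ^ 2 / 2 + W (x t) = L.energy := fun t => by
    rw [← L.right_eq]; exact hW.energy_orb _ t
  have hneg : ∃ a > 0, ∀ t ∈ Ioo 0 a, y t < 0 := by
    have h1 : HasDerivAt y (-deriv W L.right) 0 := by
      have := hW.hasDerivAt_snd L.right 0
      rwa [show (orb W L.right 0).1 = L.right from hx0] at this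
    obtain ⟨a, ha, h⟩ := sign_near_simple_zero (X := Unit) (p₀ := ()) (g := fun _ t => y t)
      (g' := fun _ t => -deriv W (x t)) (b := fun _ => 0)
      (Eventually.of_forall fun _ => (fun t => hW.hasDerivAt_snd L.right t))
      ((hW.continuous_deriv.comp (hxc.comp continuous_snd)).neg.continuousAt)
      continuousAt_const (Eventually.of_forall fun _ => hy0)
      (by simp only [hx0]; linarith [L.deriv_right])
    exact ⟨a, ha, fun t ht => by simpa using (h.self_of_nhds t ⟨ht.1, ht.2.le⟩).1⟩
  obtain ⟨a, ha, hneg⟩ := hneg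
  -- as long as the momentum is negative, the position decreases and does not pass `left`
  have hanti : ∀ T > 0, (∀ t ∈ Ioo 0 T, y t < 0) → StrictAntiOn x (Icc 0 T) := by
    intro T hT h
    apply strictAntiOn_of_deriv_neg (convex_Icc 0 T) hxc.continuousOn
    intro t ht
    rw [interior_Icc] at ht
    rw [(hW.hasDerivAt_fst L.right t).deriv]
    exact h t ht
  have hleft : ∀ T > 0, (∀ t ∈ Ioo 0 T, y t < 0) → ∀ t ∈ Icc 0 T, L.left ≤ x t := by
    intro T hT h t ht
    by_contra! hlt
    have hiv : L.left ∈ Ioo (x t) (x 0) := ⟨hlt, by rw [hx0]; exact L.left_lt_right⟩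
    obtain ⟨s, hs, hxs⟩ := intermediate_value_Ioo' ht.1 hxc.continuousOn hiv
    have h1 := hen s
    have h2 := h s ⟨hs.1, hs.2.trans_le ht.2⟩
    have h3 : W (x s) = L.energy := by rw [hxs, L.left_eq]
    nlinarith [sq_pos_of_neg h2]
  -- Otherwise the position decreases forever and the orbit converges to an equilibrium `(ξ, 0)`
  -- with `ξ ∈ [left, right]` and `W ξ` at least the energy. A regular leaf has no critical point at
  -- its ends and `W` below the energy between them.
  have hzero : ∃ t > 0, y t = 0 := by
    by_contra! hne
    have hall : ∀ t > 0, y t < 0 := by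
      intro t ht
      by_contra! hge
      set s := min (a / 2) t
      have hs : 0 < s := lt_min (by linarith) ht
      have hsn : y s < 0 := hneg s ⟨hs, lt_of_le_of_lt (min_le_left _ _) (by linarith)⟩
      obtain ⟨u, hu, hyu⟩ := intermediate_value_Icc (min_le_right (a / 2) t) hyc.continuousOn
        (⟨hsn.le, hge⟩ : (0 : ℝ) ∈ Icc (y s) (y t))
      exact hne u (hs.trans_le hu.1) hyu
    -- the orbit converges to an equilibrium
    have hxanti : StrictAntiOn x (Ici 0) := by
      intro s hs t ht hst
      exact hanti (t + 1) (by linarith [mem_Ici.1 ht]) (fun u hu => hall u hu.1)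
        ⟨hs, by linarith⟩ ⟨ht, by linarith⟩ hst
    have hxl : ∀ t ≥ 0, L.left ≤ x t := fun t ht =>
      hleft (t + 1) (by linarith) (fun u hu => hall u hu.1) t ⟨ht, by linarith⟩
    obtain ⟨ξ, hξ⟩ : ∃ ξ, Tendsto x atTop (𝓝 ξ) := by
      have hb : Antitone fun t => x (max t 0) := fun s t hst =>
        hxanti.antitoneOn (mem_Ici.2 (le_max_right s 0)) (mem_Ici.2 (le_max_right t 0))
          (max_le_max_right 0 hst)
      have h1 := tendsto_atTop_ciInf hb ⟨L.left, by
        rintro _ ⟨t, rfl⟩; exact hxl _ (le_max_right _ _)⟩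
      refine ⟨_, h1.congr' ?_⟩
      filter_upwards [eventually_ge_atTop 0] with t ht
      rw [max_eq_left ht]
    have hη : Tendsto y atTop (𝓝 (-Real.sqrt (2 * (L.energy - W ξ)))) := by
      have h1 : Tendsto (fun t => -Real.sqrt (2 * (L.energy - W (x t)))) atTop
          (𝓝 (-Real.sqrt (2 * (L.energy - W ξ)))) := by
        have hc : Continuous fun q => -Real.sqrt (2 * (L.energy - W q)) := by
          have := hW.contDiff.continuous
          fun_prop
        exact (hc.tendsto ξ).comp hξ
      refine h1.congr' ?_
      filter_upwards [eventually_gt_atTop 0] with t ht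
      rw [show 2 * (L.energy - W (x t)) = y t ^ 2 by linarith [hen t], Real.sqrt_sq_eq_abs,
        abs_of_neg (hall t ht), neg_neg]
    set η := -Real.sqrt (2 * (L.energy - W ξ))
    have hlim : Tendsto (orb W L.right) atTop (𝓝 (ξ, η)) := hξ.prodMk_nhds hη
    -- A limit point of the orbit as time tends to infinity is moved by the flow to the limit of the
    -- shifted orbit, which is the same point.
    have hfix : ∀ s, flow (field1 W) (ξ, η) s = (ξ, η) := by
      intro s
      have hcs : Continuous fun z : ℝ × ℝ => flow (field1 W) z s :=
        (hW.field.contDiff_flow one_ne_zero hW.field.contDiff).continuous.comp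
          (continuous_id.prodMk continuous_const)
      have h1 := (hcs.tendsto (ξ, η)).comp hlim
      have h2 : Tendsto (fun t => orb W L.right (t + s)) atTop (𝓝 (ξ, η)) :=
        hlim.comp (tendsto_atTop_add_const_right _ s tendsto_id)
      refine tendsto_nhds_unique (h1.congr fun t => ?_) h2
      simp only [Function.comp, orb, hW.field.flow_add]
    have hd := hW.field.hasDerivAt_flow (ξ, η) 0
    rw [show flow (field1 W) (ξ, η) = fun _ => (ξ, η) from funext hfix] at hd
    have h0 := hd.unique (hasDerivAt_const _ _)
    have hη0 : η = 0 := congrArg Prod.fst h0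
    have hd0 : deriv W ξ = 0 := by
      have := congrArg Prod.snd h0; simpa [field1] using this
    have hξl : L.left ≤ ξ := ge_of_tendsto hξ (by
      filter_upwards [eventually_ge_atTop 0] with t ht using hxl t ht)
    have hξr : ξ ≤ L.right := le_of_tendsto hξ (by
      filter_upwards [eventually_ge_atTop 0] with t ht
      rw [← hx0]; exact hxanti.antitoneOn (mem_Ici.2 le_rfl) ht ht)
    have hWξ : L.energy ≤ W ξ := by
      have : Real.sqrt (2 * (L.energy - W ξ)) = 0 := by simpa [η] using hη0
      rw [Real.sqrt_eq_zero'] at this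
      linarith
    rcases hξl.eq_or_lt with h | h
    · rw [← h] at hd0; linarith [L.deriv_left]
    rcases hξr.eq_or_lt with h' | h'
    · rw [h'] at hd0; linarith [L.deriv_right]
    linarith [L.below ξ ⟨h, h'⟩]
  -- the first zero of the momentum
  set Z := {t | a / 2 ≤ t ∧ y t = 0} with hZ
  have hZne : Z.Nonempty := by
    obtain ⟨t, ht, hyt⟩ := hzero
    refine ⟨t, ?_, hyt⟩
    by_contra! h
    exact (hneg t ⟨ht, by linarith⟩).ne hyt
  have hZc : IsClosed Z := (isClosed_le continuous_const continuous_id).inter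
    (isClosed_eq hyc continuous_const)
  have hZb : BddBelow Z := ⟨a / 2, fun t ht => ht.1⟩
  have hτ : sInf Z ∈ Z := hZc.csInf_mem hZne hZb
  set τ := sInf Z
  have hτ0 : 0 < τ := by linarith [hτ.1]
  have hτn : ∀ t ∈ Ioo 0 τ, y t < 0 := by
    intro t ht
    by_contra! hge
    set s := min (a / 2) t
    have hs : 0 < s := lt_min (by linarith) ht.1
    have hsn : y s < 0 := hneg s ⟨hs, lt_of_le_of_lt (min_le_left _ _) (by linarith)⟩
    obtain ⟨u, hu, hyu⟩ := intermediate_value_Icc (min_le_right (a / 2) t) hyc.continuousOn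
      (⟨hsn.le, hge⟩ : (0 : ℝ) ∈ Icc (y s) (y t))
    have hua : a / 2 ≤ u := by
      by_contra! h
      exact (hneg u ⟨hs.trans_le hu.1, by linarith⟩).ne hyu
    linarith [csInf_le hZb (⟨hua, hyu⟩ : u ∈ Z), hu.2, ht.2]
  refine ⟨τ, hτ0, hτn, ?_⟩
  have h1 := hen τ
  have h2 := hleft τ hτ0 hτn τ ⟨hτ0.le, le_rfl⟩
  have h3 : x τ < L.right := by
    rw [← hx0]; exact hanti τ hτ0 hτn ⟨le_rfl, hτ0.le⟩ ⟨hτ0.le, le_rfl⟩ hτ0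
  have h4 : x τ = L.left := by
    by_contra hne
    have := L.below (x τ) ⟨lt_of_le_of_ne h2 (Ne.symm hne), h3⟩
    rw [hτ.2] at h1
    linarith
  exact Prod.ext h4 hτ.2

end IsGlobalPotential
end OneDegree

/-! ### Action, period and impact time read off from the orbit -/

section LeafOrbit

namespace IsGlobalPotential

variable {W : ℝ → ℝ}

/-- Change of variables from the position to the time along the first half of a leaf. -/
theorem integral_position_eq (hW : IsGlobalPotential W) {R τ a b : ℝ}
    (hneg : ∀ t ∈ Ioo 0 τ, (orb W R t).2 < 0) (ha : 0 ≤ a) (hab : a ≤ b) (hb : b ≤ τ) (g : ℝ → ℝ) :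
    ∫ q in (orb W R b).1..(orb W R a).1, g q =
      ∫ t in a..b, -(orb W R t).2 * g (orb W R t).1 := by
  set x := fun t => (orb W R t).1 with hx
  have hxc : Continuous x := (hW.continuous_orb _).fst
  have hanti : StrictAntiOn x (Icc a b) := by
    apply strictAntiOn_of_deriv_neg (convex_Icc a b) hxc.continuousOn
    intro t ht
    rw [interior_Icc] at ht
    rw [(hW.hasDerivAt_fst R t).deriv]
    exact hneg t ⟨ha.trans_lt ht.1, ht.2.trans_le hb⟩
  have himg : x '' Ioo a b = Ioo (x b) (x a) := by
    apply subset_antisymm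
    · rintro _ ⟨t, ht, rfl⟩
      exact ⟨hanti ⟨ht.1.le, ht.2.le⟩ ⟨hab, le_rfl⟩ ht.2,
        hanti ⟨le_rfl, hab⟩ ⟨ht.1.le, ht.2.le⟩ ht.1⟩
    · exact intermediate_value_Ioo' hab hxc.continuousOn
  have hle : x b ≤ x a := hanti.antitoneOn ⟨le_rfl, hab⟩ ⟨hab, le_rfl⟩ hab
  have key := MeasureTheory.integral_image_eq_integral_abs_deriv_smul (measurableSet_Ioo (a := a) (b := b))
    (f := x) (f' := fun t => (orb W R t).2) (fun t _ => (hW.hasDerivAt_fst R t).hasDerivWithinAt)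
    (hanti.injOn.mono Ioo_subset_Icc_self) g
  rw [himg] at key
  rw [intervalIntegral.integral_of_le hle, intervalIntegral.integral_of_le hab,
    MeasureTheory.integral_Ioc_eq_integral_Ioo, MeasureTheory.integral_Ioc_eq_integral_Ioo, key]
  apply MeasureTheory.setIntegral_congr_fun measurableSet_Ioo
  intro t ht
  have := hneg t ⟨ha.trans_lt ht.1, ht.2.trans_le hb⟩
  simp [abs_of_neg this, hx]

/-- The time element is `dq / |p|`, and by conservation of energy the square root is `|p|`. The
singularities of the integrand at turning points fall outside the open interval on which the
integrals are compared. -/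
theorem integral_inv_sqrt (hW : IsGlobalPotential W) {R τ a b : ℝ}
    (hneg : ∀ t ∈ Ioo 0 τ, (orb W R t).2 < 0) (ha : 0 ≤ a) (hab : a ≤ b) (hb : b ≤ τ) :
    ∫ q in (orb W R b).1..(orb W R a).1, (Real.sqrt (2 * (W R - W q)))⁻¹ = b - a := by
  rw [hW.integral_position_eq hneg ha hab hb]
  rw [intervalIntegral.integral_of_le hab, MeasureTheory.integral_Ioc_eq_integral_Ioo]
  have : ∀ t ∈ Ioo a b, -(orb W R t).2 * (Real.sqrt (2 * (W R - W (orb W R t).1)))⁻¹ = 1 := by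
    intro t ht
    have h1 := hneg t ⟨ha.trans_lt ht.1, ht.2.trans_le hb⟩
    rw [show 2 * (W R - W (orb W R t).1) = (orb W R t).2 ^ 2 by linarith [hW.energy_orb R t],
      Real.sqrt_sq_eq_abs, abs_of_neg h1]
    exact mul_inv_cancel₀ (by linarith)
  rw [MeasureTheory.setIntegral_congr_fun measurableSet_Ioo this]
  simp [hab]

theorem action_eq_of_half (hW : IsGlobalPotential W) (L : Leaf W) {τ : ℝ} (hτ : 0 < τ)
    (hneg : ∀ t ∈ Ioo 0 τ, (orb W L.right t).2 < 0) (hend : orb W L.right τ = (L.left, 0)) :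
    L.action = Real.pi⁻¹ * ∫ t in (0 : ℝ)..τ, (orb W L.right t).2 ^ 2 := by
  have h := hW.integral_position_eq hneg le_rfl hτ.le le_rfl
    (fun q => Real.sqrt (2 * (L.energy - W q)))
  rw [orb_zero, hend] at h
  rw [Leaf.action, h]
  congr 1
  apply intervalIntegral.integral_congr
  intro t ht
  rw [uIcc_of_le hτ.le] at ht
  have h1 : (orb W L.right t).2 ≤ 0 := by
    rcases ht.1.eq_or_lt with h0 | h0
    · rw [← h0, orb_zero]
    rcases ht.2.eq_or_lt with h2 | h2
    · rw [h2, hend]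
    exact (hneg t ⟨h0, h2⟩).le
  simp only
  rw [show 2 * (L.energy - W (orb W L.right t).1) = (orb W L.right t).2 ^ 2 by
    rw [← L.right_eq]; linarith [hW.energy_orb L.right t], Real.sqrt_sq_eq_abs, abs_of_nonpos h1]
  ring

theorem period_eq_of_half (hW : IsGlobalPotential W) (L : Leaf W) {τ : ℝ} (hτ : 0 < τ)
    (hneg : ∀ t ∈ Ioo 0 τ, (orb W L.right t).2 < 0) (hend : orb W L.right τ = (L.left, 0)) :
    L.period = 2 * τ := by
  have h := hW.integral_inv_sqrt hneg le_rfl hτ.le le_rfl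
  rw [orb_zero, hend, L.right_eq] at h
  rw [Leaf.period, h, sub_zero]

/-- The bridge from the integral that defines `Leaf.period` to the dynamics; later facts about the
orbit of a leaf start from it. -/
theorem half_spec (hW : IsGlobalPotential W) (L : Leaf W) :
    0 < L.period / 2 ∧ (∀ t ∈ Ioo 0 (L.period / 2), (orb W L.right t).2 < 0) ∧
      orb W L.right (L.period / 2) = (L.left, 0) := by
  obtain ⟨τ, hτ, hneg, hend⟩ := hW.exists_half_time L
  rw [hW.period_eq_of_half L hτ hneg hend, mul_div_cancel_left₀ _ two_ne_zero]
  exact ⟨hτ, hneg, hend⟩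

theorem period_pos (hW : IsGlobalPotential W) (L : Leaf W) : 0 < L.period := by
  linarith [(hW.half_spec L).1]

theorem action_eq (hW : IsGlobalPotential W) (L : Leaf W) :
    L.action = Real.pi⁻¹ * ∫ t in (0 : ℝ)..(L.period / 2), (orb W L.right t).2 ^ 2 :=
  hW.action_eq_of_half L (hW.half_spec L).1 (hW.half_spec L).2.1 (hW.half_spec L).2.2

theorem strictAntiOn_half (hW : IsGlobalPotential W) (L : Leaf W) :
    StrictAntiOn (fun t => (orb W L.right t).1) (Icc 0 (L.period / 2)) := by
  apply strictAntiOn_of_deriv_neg (convex_Icc _ _) (hW.continuous_orb _).fst.continuousOn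
  intro t ht
  rw [interior_Icc] at ht
  rw [(hW.hasDerivAt_fst _ t).deriv]
  exact (hW.half_spec L).2.1 t ht

/-- The orbit is symmetric with respect to its passage through the left turning point. -/
theorem orb_half_add (hW : IsGlobalPotential W) (L : Leaf W) (t : ℝ) :
    orb W L.right (L.period / 2 + t) =
      ((orb W L.right (L.period / 2 - t)).1, -(orb W L.right (L.period / 2 - t)).2) := by
  have h := (hW.half_spec L).2.2
  have h1 := hW.flow_reverse L.left 0 t
  rw [neg_zero] at h1
  rw [sub_eq_add_neg]
  unfold orb at h ⊢
  rw [hW.field.flow_add, hW.field.flow_add, h, h1]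

theorem orb_periodic (hW : IsGlobalPotential W) (L : Leaf W) :
    Function.Periodic (orb W L.right) L.period := by
  have h : orb W L.right L.period = (L.right, 0) := by
    have := hW.orb_half_add L (L.period / 2)
    rwa [add_halves, sub_self, orb_zero, neg_zero] at this
  intro t
  unfold orb at h ⊢
  rw [add_comm, hW.field.flow_add, h]

theorem orb_mem_Icc (hW : IsGlobalPotential W) (L : Leaf W) (t : ℝ) :
    (orb W L.right t).1 ∈ Icc L.left L.right := by
  have key : ∀ s ∈ Icc 0 (L.period / 2), (orb W L.right s).1 ∈ Icc L.left L.right := by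
    intro s hs
    have h1 := (hW.strictAntiOn_half L).antitoneOn hs ⟨hs.1.trans hs.2, le_rfl⟩ hs.2
    have h2 := (hW.strictAntiOn_half L).antitoneOn ⟨le_rfl, hs.1.trans hs.2⟩ hs hs.1
    simp only [(hW.half_spec L).2.2, orb_zero] at h1 h2
    exact ⟨h1, h2⟩
  obtain ⟨s, hs, hst⟩ := (hW.orb_periodic L).exists_mem_Ico₀ (hW.period_pos L) t
  rw [hst]
  rcases le_total s (L.period / 2) with h | h
  · exact key s ⟨hs.1, h⟩
  · have := hW.orb_half_add L (s - L.period / 2)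
    rw [add_sub_cancel] at this
    rw [this]
    exact key _ ⟨by linarith [hs.2], by linarith⟩

/-- On an orbit that crosses `q = 0`, the impact period is twice the time of the first passage. -/
theorem impactPeriod_eq_of_hit (hW : IsGlobalPotential W) (L : Leaf W) (hl : L.left < 0) {t : ℝ}
    (ht : t ∈ Icc 0 (L.period / 2)) (h0 : (orb W L.right t).1 = 0) : L.impactPeriod = 2 * t := by
  have h := hW.integral_inv_sqrt (hW.half_spec L).2.1 ht.1 ht.2 le_rfl
  rw [(hW.half_spec L).2.2, h0, L.right_eq] at h
  rw [Leaf.impactPeriod, Leaf.travelTime, if_pos hl, h]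
  ring

theorem impactPeriod_eq_period {V : ℝ → ℝ} (L : Leaf V) (hl : 0 ≤ L.left) : L.impactPeriod = L.period := by
  rw [Leaf.impactPeriod, Leaf.travelTime, if_neg hl.not_gt, sub_zero]

/-- The first passage through `q = 0` of an orbit that crosses it. -/
theorem hit_spec (hW : IsGlobalPotential W) (L : Leaf W) (hl : L.left < 0) (hr : 0 < L.right) :
    0 < L.impactPeriod / 2 ∧ L.impactPeriod / 2 < L.period / 2 ∧
      (orb W L.right (L.impactPeriod / 2)).1 = 0 := by
  obtain ⟨t, ht, h0⟩ := intermediate_value_Ioo' (hW.half_spec L).1.le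
    (f := fun t => (orb W L.right t).1) (hW.continuous_orb _).fst.continuousOn
    (show (0 : ℝ) ∈ _ by simp only [(hW.half_spec L).2.2, orb_zero]; exact ⟨hl, hr⟩)
  rw [hW.impactPeriod_eq_of_hit L hl ⟨ht.1.le, ht.2.le⟩ h0, mul_div_cancel_left₀ _ two_ne_zero]
  exact ⟨ht.1, ht.2, h0⟩

end IsGlobalPotential
end LeafOrbit

/-! ### Families of leaves parametrized by the right turning point -/

section Family

/-- A function that is negative on an open interval, and robustly so near its ends, stays negative
when the function and the interval are perturbed. -/
theorem eventually_neg_on_Ioo {X : Type*} [TopologicalSpace X] {p₀ : X} {g : X → ℝ → ℝ}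
    {τ : X → ℝ} (hτ : ContinuousAt τ p₀)
    (hg : ∀ t ∈ Ioo 0 (τ p₀), ContinuousAt (fun x : X × ℝ => g x.1 x.2) (p₀, t))
    (hneg : ∀ t ∈ Ioo 0 (τ p₀), g p₀ t < 0)
    (hstart : ∃ a > 0, ∀ᶠ p in 𝓝 p₀, ∀ t ∈ Ioc 0 a, g p t < 0)
    (hend : ∃ a > 0, ∀ᶠ p in 𝓝 p₀, ∀ t ∈ Ioc 0 a, g p (τ p - t) < 0) :
    ∀ᶠ p in 𝓝 p₀, ∀ t ∈ Ioo 0 (τ p), g p t < 0 := by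
  obtain ⟨a, ha, h1⟩ := hstart
  obtain ⟨b, hb, h2⟩ := hend
  have h3 : ∀ᶠ p in 𝓝 p₀, ∀ t ∈ Icc a (τ p₀ - b / 2), g p t < 0 := by
    apply isCompact_Icc.eventually_forall_of_forall_eventually
    intro t ht
    have ht' : t ∈ Ioo 0 (τ p₀) := ⟨by linarith [ht.1], by linarith [ht.2]⟩
    exact (hg t ht').eventually (gt_mem_nhds (hneg t ht'))
  have h4 : ∀ᶠ p in 𝓝 p₀, τ p < τ p₀ + b / 2 := hτ.eventually (gt_mem_nhds (by linarith))
  filter_upwards [h1, h2, h3, h4] with p h1 h2 h3 h4 t ht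
  by_cases hta : t ≤ a
  · exact h1 t ⟨ht.1, hta⟩
  by_cases htb : τ p - t ≤ b
  · have := h2 (τ p - t) ⟨by linarith [ht.2], htb⟩
    rwa [sub_sub_cancel] at this
  exact h3 t ⟨by linarith, by linarith⟩

theorem eventually_neg_near_base {X : Type*} [TopologicalSpace X] {p₀ : X} {g : X → ℝ → ℝ}
    {b : X → ℝ} (hb : ContinuousAt b p₀)
    (hg : ContinuousAt (fun x : X × ℝ => g x.1 x.2) (p₀, b p₀)) (hneg : g p₀ (b p₀) < 0) :
    ∃ a > 0, ∀ᶠ p in 𝓝 p₀, ∀ t ∈ Ioc 0 a, g p (b p + t) < 0 ∧ g p (b p - t) < 0 := by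
  have h1 : ∀ᶠ x : X × ℝ in 𝓝 (p₀, b p₀), g x.1 x.2 < 0 := hg.eventually (gt_mem_nhds hneg)
  rw [nhds_prod_eq] at h1
  obtain ⟨P, hP, Q, hQ, hPQ⟩ := eventually_prod_iff.1 h1
  obtain ⟨c, hc0, hcQ⟩ := Metric.eventually_nhds_iff.1 hQ
  have h2 : ∀ᶠ p in 𝓝 p₀, dist (b p) (b p₀) < c / 2 := hb (Metric.ball_mem_nhds _ (by linarith))
  refine ⟨c / 4, by linarith, ?_⟩
  filter_upwards [hP, h2] with p hPp hbp t ht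
  rw [Real.dist_eq, abs_lt] at hbp
  constructor <;>
  · refine hPQ hPp (hcQ ?_)
    rw [Real.dist_eq, abs_lt]
    constructor <;> linarith [ht.1, ht.2]

/-- For a scalar unknown the nondegeneracy asked by the implicit function theorem is that a number
does not vanish. -/
theorem isInvertible_partial {X : Type*} [NormedAddCommGroup X] [NormedSpace ℝ X] {F : X × ℝ → ℝ}
    {u : X × ℝ} {c : ℝ} (hF : DifferentiableAt ℝ F u)
    (h : HasDerivAt (fun t => F (u.1, t)) c u.2) (hc : c ≠ 0) :
    (fderiv ℝ F u ∘L .inr ℝ X ℝ).IsInvertible := by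
  have h1 : HasFDerivAt (fun t => F (u.1, t)) (fderiv ℝ F u ∘L .inr ℝ X ℝ) u.2 :=
    HasFDerivAt.comp (f := fun t : ℝ => (u.1, t)) u.2 hF.hasFDerivAt
      (hasFDerivAt_prodMk_right u.1 u.2)
  rw [h1.unique h.hasFDerivAt]
  refine ⟨ContinuousLinearEquiv.unitsEquivAut ℝ (Units.mk0 c hc), ?_⟩
  ext
  simp

namespace IsGlobalPotential

variable {W : ℝ → ℝ}

theorem hasDerivAt_orb_right (hW : IsGlobalPotential W) (R t : ℝ) :
    HasDerivAt (fun R => orb W R t)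
      (IsHamiltonianField.flowDeriv (field1 W) (R, 0) t (1, 0)) R := by
  have h1 := hW.hamiltonian.hasFDerivAt_flow (R, 0) t
  have h2 : HasDerivAt (fun R : ℝ => (((R, 0), t) : (ℝ × ℝ) × ℝ)) ((1, 0), 0) R :=
    ((hasDerivAt_id R).prodMk (hasDerivAt_const R 0)).prodMk (hasDerivAt_const R t)
  have h3 := h1.comp_hasDerivAt R h2
  refine HasDerivAt.congr_deriv h3 ?_
  simp

theorem fderiv_field1_fst (hW : IsGlobalPotential W) (x v : ℝ × ℝ) :
    (fderiv ℝ (field1 W) x v).1 = v.2 := by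
  have hd : DifferentiableAt ℝ (field1 W) x :=
    (contDiff_field1 (n := 2) hW.contDiff).differentiable two_ne_zero x
  have h1 : HasFDerivAt (fun x => (field1 W x).1) (.fst ℝ ℝ ℝ ∘L fderiv ℝ (field1 W) x) x :=
    hd.hasFDerivAt.fst
  have h2 : HasFDerivAt (fun x => (field1 W x).1) (.snd ℝ ℝ ℝ) x := hasFDerivAt_snd
  have := congrArg (fun L : ℝ × ℝ →L[ℝ] ℝ => L v) (h1.unique h2)
  simpa using this

theorem continuous_flowDeriv (hW : IsGlobalPotential W) :
    Continuous fun x : ℝ × ℝ => IsHamiltonianField.flowDeriv (field1 W) (x.1, 0) x.2 (1, 0) := by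
  have h1 : Continuous (fderiv ℝ fun q : (ℝ × ℝ) × ℝ => flow (field1 W) q.1 q.2) :=
    (hW.field.contDiff_flow one_ne_zero hW.field.contDiff).continuous_fderiv one_ne_zero
  have h2 := h1.comp (show Continuous fun x : ℝ × ℝ => (((x.1, (0 : ℝ)), x.2) : (ℝ × ℝ) × ℝ) by fun_prop)
  exact h2.clm_apply (continuous_const (y := (((1, 0), 0) : (ℝ × ℝ) × ℝ)))

theorem continuous_orb_uncurry (hW : IsGlobalPotential W) :
    Continuous fun x : ℝ × ℝ => orb W x.1 x.2 :=
  (hW.contDiff_orb (n := 2) two_ne_zero hW.contDiff).continuous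

/-- Write `δq`, `δp` for derivatives in `R`. Differentiating the energy gives `p δp + W' δq =
W'(R)`, so `2 p δp = W'(R) + p δp - W' δq`, which is the time derivative of `t W'(R) + p δq`. The
term `p δq` vanishes at both ends because `p` does. -/
theorem hasDerivAt_integral_sq (hW : IsGlobalPotential W) {R s : ℝ} (hs : 0 ≤ s)
    (h0 : (orb W R s).2 = 0) :
    HasDerivAt (fun R => ∫ t in (0 : ℝ)..s, (orb W R t).2 ^ 2) (s * deriv W R) R := by
  set Y := fun R t => IsHamiltonianField.flowDeriv (field1 W) (R, 0) t (1, 0) with hY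
  have hYc : Continuous fun x : ℝ × ℝ => Y x.1 x.2 := hW.continuous_flowDeriv
  have hoc := hW.continuous_orb_uncurry
  have hFc : Continuous fun x : ℝ × ℝ => 2 * (orb W x.1 x.2).2 * (Y x.1 x.2).2 := by fun_prop
  obtain ⟨C, hC⟩ := ((isCompact_closedBall R 1).prod (isCompact_Icc (a := (0 : ℝ)) (b := s))).exists_bound_of_continuousOn
    hFc.continuousOn
  have h1 := (intervalIntegral.hasDerivAt_integral_of_dominated_loc_of_deriv_le
    (μ := MeasureTheory.volume) (a := 0) (b := s)
    (F := fun R t => (orb W R t).2 ^ 2) (F' := fun R t => 2 * (orb W R t).2 * (Y R t).2)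
    (x₀ := R) (s := Metric.ball R 1) (bound := fun _ => C) (Metric.ball_mem_nhds R one_pos)
    (Eventually.of_forall fun R' => by
      have := hW.continuous_orb R'
      exact (Continuous.aestronglyMeasurable (by fun_prop)))
    (by
      have := hW.continuous_orb R
      exact Continuous.intervalIntegrable (by fun_prop) _ _)
    (by
      have := hFc.comp (Continuous.prodMk_right R)
      exact this.aestronglyMeasurable)
    (Eventually.of_forall fun t ht R' hR' => by
      rw [uIoc_of_le hs] at ht
      exact hC (R', t) ⟨Metric.ball_subset_closedBall hR', ht.1.le, ht.2⟩)
    (by simp)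
    (Eventually.of_forall fun t ht R' hR' => by
      have := (hW.hasDerivAt_orb_right R' t)
      have h2 : HasDerivAt (fun R => (orb W R t).2) (Y R' t).2 R' := this.snd
      simpa using h2.fun_pow 2)).2
  refine h1.congr_deriv ?_
  have henergy : ∀ t, (orb W R t).2 * (Y R t).2 + deriv W (orb W R t).1 * (Y R t).1 = deriv W R := by
    intro t
    have e1 : HasDerivAt (fun R => (orb W R t).2) (Y R t).2 R := (hW.hasDerivAt_orb_right R t).snd
    have e2 : HasDerivAt (fun R => (orb W R t).1) (Y R t).1 R := (hW.hasDerivAt_orb_right R t).fst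
    have e3 := ((e1.pow 2).div_const 2).add ((hW.hasDerivAt (orb W R t).1).comp R e2)
    have e4 : HasDerivAt W _ R := e3.congr_of_eventuallyEq (Eventually.of_forall fun R' =>
      (hW.energy_orb R' t).symm)
    have := e4.unique (hW.hasDerivAt R)
    rw [← this]; push_cast; ring
  have hprim : ∀ t, HasDerivAt (fun t => t * deriv W R + (orb W R t).2 * (Y R t).1)
      (2 * (orb W R t).2 * (Y R t).2) t := by
    intro t
    have e1 : HasDerivAt (fun t => (Y R t).1) (Y R t).2 t := by
      have := hW.hamiltonian.hasDerivAt_flowDeriv (R, 0) t (1, 0)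
      have h2 : HasDerivAt (fun t => (Y R t).1) _ t := this.fst
      refine HasDerivAt.congr_deriv h2 ?_
      simpa using hW.fderiv_field1_fst _ _
    have e2 := ((hasDerivAt_id t).mul_const (deriv W R)).add ((hW.hasDerivAt_snd R t).mul e1)
    refine HasDerivAt.congr_deriv e2 ?_
    linarith [henergy t]
  rw [intervalIntegral.integral_eq_sub_of_hasDerivAt (fun t _ => hprim t)]
  · simp [h0, orb_zero]
  · have := hFc.comp (Continuous.prodMk_right R)
    exact this.intervalIntegrable _ _

/-- The moving endpoint contributes nothing to first order, since the integrand `p ^ 2` vanishes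
there. -/
theorem hasDerivAt_action_integral (hW : IsGlobalPotential W) {R τ' : ℝ} {τ : ℝ → ℝ}
    (hτ : HasDerivAt τ τ' R) (hpos : 0 ≤ τ R) (h0 : (orb W R (τ R)).2 = 0) :
    HasDerivAt (fun R => ∫ t in (0 : ℝ)..τ R, (orb W R t).2 ^ 2) (τ R * deriv W R) R := by
  have hoc := hW.continuous_orb_uncurry
  have hint : ∀ R' a b, IntervalIntegrable (fun t => (orb W R' t).2 ^ 2) MeasureTheory.volume a b := by
    intro R' a b
    have := hW.continuous_orb R'
    exact Continuous.intervalIntegrable (by fun_prop) _ _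
  have hrest : HasDerivAt (fun R' => ∫ t in (τ R)..τ R', (orb W R' t).2 ^ 2) 0 R := by
    rw [hasDerivAt_iff_isLittleO]
    simp only [intervalIntegral.integral_same, sub_zero, smul_zero]
    have hO : (fun R' => τ R' - τ R) =O[𝓝 R] fun R' => R' - R := hτ.isBigO_sub
    refine Asymptotics.IsLittleO.trans_isBigO ?_ hO
    rw [Asymptotics.isLittleO_iff]
    intro c hc
    have h1 : ∀ᶠ x : ℝ × ℝ in 𝓝 (R, τ R), (orb W x.1 x.2).2 ^ 2 < c := by
      have : ContinuousAt (fun x : ℝ × ℝ => (orb W x.1 x.2).2 ^ 2) (R, τ R) := by fun_prop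
      refine this.eventually (gt_mem_nhds ?_)
      simpa [h0] using hc
    rw [nhds_prod_eq] at h1
    obtain ⟨P, hP, Q, hQ, hPQ⟩ := eventually_prod_iff.1 h1
    obtain ⟨d, hd0, hdQ⟩ := Metric.eventually_nhds_iff.1 hQ
    have h2 : ∀ᶠ R' in 𝓝 R, dist (τ R') (τ R) < d := hτ.continuousAt (Metric.ball_mem_nhds _ hd0)
    filter_upwards [hP, h2] with R' hPR hd
    have := intervalIntegral.norm_integral_le_of_norm_le_const (a := τ R) (b := τ R')
      (f := fun t => (orb W R' t).2 ^ 2) (C := c) fun t ht => by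
        rw [Real.norm_of_nonneg (sq_nonneg _)]
        refine (hPQ hPR (hdQ ?_)).le
        rw [Real.dist_eq] at hd ⊢
        refine lt_of_le_of_lt ?_ hd
        have := abs_sub_left_of_mem_uIcc (uIoc_subset_uIcc ht)
        exact this
    simpa [Real.norm_eq_abs] using this
  have := (hW.hasDerivAt_integral_sq hpos h0).add hrest
  rw [add_zero] at this
  refine this.congr_of_eventuallyEq (Eventually.of_forall fun R' => ?_)
  exact (intervalIntegral.integral_add_adjacent_intervals (hint _ _ _) (hint _ _ _)).symm

/-- Near a regular leaf the leaves form a smooth one-parameter family, parametrized by the right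
turning point. -/
theorem exists_half_time_family (hW : IsGlobalPotential W) (L₀ : Leaf W) :
    ∃ τ : ℝ → ℝ, τ L₀.right = L₀.period / 2 ∧
      (∀ n : ℕ, n ≠ 0 → ContDiff ℝ (n + 1 : ℕ) W → ContDiffAt ℝ n τ L₀.right) ∧
      ∀ᶠ R in 𝓝 L₀.right, ∃ L : Leaf W, L.right = R ∧ L.period = 2 * τ R ∧
        L.left = (orb W R (τ R)).1 ∧ L₀.SameBranch L := by
  set u : ℝ × ℝ := (L₀.right, L₀.period / 2) with hu
  obtain ⟨hτ0, hneg, hend⟩ := hW.half_spec L₀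
  have hcd : ∀ n : ℕ, n ≠ 0 → ContDiff ℝ (n + 1 : ℕ) W →
      ContDiffAt ℝ n (fun x : ℝ × ℝ => (orb W x.1 x.2).2) u := fun n hn0 hn =>
    (hW.contDiff_orb hn0 hn).snd.contDiffAt
  have h2 : ContDiffAt ℝ (2 : ℕ) (fun x : ℝ × ℝ => (orb W x.1 x.2).2) u :=
    hcd 2 two_ne_zero hW.contDiff
  have hne : -deriv W L₀.left ≠ 0 := by linarith [L₀.deriv_left]
  have hinv := isInvertible_partial (F := fun x : ℝ × ℝ => (orb W x.1 x.2).2) (u := u)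
    (c := -deriv W L₀.left) (h2.differentiableAt (by norm_num)) (by
      have := hW.hasDerivAt_snd L₀.right (L₀.period / 2)
      rwa [hend] at this) hne
  set τ := h2.implicitFunction (by norm_num) hinv with hτdef
  have hu0 : (orb W u.1 u.2).2 = 0 := by simp [hu, hend]
  have hτu : τ L₀.right = L₀.period / 2 := h2.implicitFunction_apply_self (by norm_num) hinv
  have hreg : ∀ n : ℕ, n ≠ 0 → ContDiff ℝ (n + 1 : ℕ) W → ContDiffAt ℝ n τ L₀.right :=
    fun n hn0 hn => (hcd n hn0 hn).contDiffAt_implicitFunction (by exact_mod_cast hn0) hinv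
  have hτc : ContinuousAt τ L₀.right := (hreg 2 two_ne_zero hW.contDiff).continuousAt
  refine ⟨τ, hτu, hreg, ?_⟩
  have hzero : ∀ᶠ R in 𝓝 L₀.right, (orb W R (τ R)).2 = 0 := by
    have := h2.eventually_apply_implicitFunction (by norm_num) hinv
    simpa only [hu0] using this
  have hoc := hW.continuous_orb_uncurry
  have hdc := hW.continuous_deriv
  have hgc : Continuous fun x : ℝ × ℝ => -deriv W (orb W x.1 x.2).1 := by fun_prop
  -- At the two ends the momentum has simple zeros, with slope `-W'` at the right and left turning
  -- points; near them the sign persists because the zeros persist, and in between by compactness.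
  have hneg' : ∀ᶠ R in 𝓝 L₀.right, ∀ t ∈ Ioo 0 (τ R), (orb W R t).2 < 0 := by
    apply eventually_neg_on_Ioo hτc
    · intro t _; fun_prop
    · rwa [hτu]
    · obtain ⟨a, ha, h⟩ := sign_near_simple_zero (p₀ := L₀.right) (g := fun R t => (orb W R t).2)
        (g' := fun R t => -deriv W (orb W R t).1) (b := fun _ => 0)
        (Eventually.of_forall fun R => hW.hasDerivAt_snd R) hgc.continuousAt continuousAt_const
        (Eventually.of_forall fun R => by simp [orb_zero])
        (by simp only [orb_zero]; linarith [L₀.deriv_right])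
      refine ⟨a, ha, h.mono fun R hR t ht => ?_⟩
      simpa using (hR t ht).1
    · obtain ⟨a, ha, h⟩ := sign_near_simple_zero (p₀ := L₀.right) (g := fun R t => -(orb W R t).2)
        (g' := fun R t => -(-deriv W (orb W R t).1)) (b := τ)
        (Eventually.of_forall fun R t => (hW.hasDerivAt_snd R t).fun_neg) hgc.neg.continuousAt hτc
        (hzero.mono fun R hR => by simp [hR])
        (by rw [hτu, hend]; linarith [L₀.deriv_left])
      refine ⟨a, ha, h.mono fun R hR t ht => ?_⟩
      simpa using (hR t ht).2
  have hlc : ContinuousAt (fun R => (orb W R (τ R)).1) L₀.right :=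
    ContinuousAt.comp (g := fun x : ℝ × ℝ => (orb W x.1 x.2).1) (f := fun R => (R, τ R))
      (by fun_prop) (continuousAt_id.prodMk hτc)
  have hl0 : (orb W L₀.right (τ L₀.right)).1 = L₀.left := by rw [hτu, hend]
  have hpos : ∀ᶠ R in 𝓝 L₀.right, 0 < τ R := hτc.eventually (lt_mem_nhds (by rwa [hτu]))
  have hleft : ∀ᶠ q in 𝓝 L₀.left, ∀ q' ∈ uIcc L₀.left q, deriv W q' < 0 := by
    obtain ⟨c, hc, h⟩ := Metric.eventually_nhds_iff.1
      (hdc.continuousAt.eventually (gt_mem_nhds L₀.deriv_left))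
    filter_upwards [Metric.ball_mem_nhds L₀.left hc] with q hq q' hq'
    apply h
    have h1 := abs_sub_left_of_mem_uIcc hq'
    rw [Real.dist_eq]
    rw [Metric.mem_ball, Real.dist_eq] at hq
    exact h1.trans_lt hq
  have hright : ∀ᶠ q in 𝓝 L₀.right, ∀ q' ∈ uIcc L₀.right q, 0 < deriv W q' := by
    obtain ⟨c, hc, h⟩ := Metric.eventually_nhds_iff.1
      (hdc.continuousAt.eventually (lt_mem_nhds L₀.deriv_right))
    filter_upwards [Metric.ball_mem_nhds L₀.right hc] with q hq q' hq'
    apply h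
    have h1 := abs_sub_left_of_mem_uIcc hq'
    rw [Real.dist_eq]
    rw [Metric.mem_ball, Real.dist_eq] at hq
    exact h1.trans_lt hq
  have hleft' : ∀ᶠ R in 𝓝 L₀.right, ∀ q' ∈ uIcc L₀.left (orb W R (τ R)).1, deriv W q' < 0 := by
    have := hlc.tendsto
    rw [hl0] at this
    exact this.eventually hleft
  filter_upwards [hzero, hneg', hpos, hleft', hright] with R h0 hneg hpos hl hr
  have hanti : StrictAntiOn (fun t => (orb W R t).1) (Icc 0 (τ R)) := by
    apply strictAntiOn_of_deriv_neg (convex_Icc _ _) (hW.continuous_orb _).fst.continuousOn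
    intro t ht
    rw [interior_Icc] at ht
    rw [(hW.hasDerivAt_fst _ t).deriv]
    exact hneg t ht
  have hen := hW.energy_orb R
  let L : Leaf W :=
    { energy := W R
      left := (orb W R (τ R)).1
      right := R
      left_lt_right := by
        have := hanti ⟨le_rfl, hpos.le⟩ ⟨hpos.le, le_rfl⟩ hpos
        simpa [orb_zero] using this
      left_eq := by have := hen (τ R); rw [h0] at this; linarith
      right_eq := rfl
      below := by
        intro q hq
        obtain ⟨t, ht, rfl⟩ := intermediate_value_Ioo' hpos.le
          (f := fun t => (orb W R t).1) (hW.continuous_orb _).fst.continuousOn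
          (show q ∈ _ by simpa [orb_zero] using hq)
        have h1 := hen t
        have h2 := sq_pos_of_neg (hneg t ht)
        simp only
        linarith
      deriv_left := hl _ right_mem_uIcc
      deriv_right := hr _ right_mem_uIcc }
  refine ⟨L, rfl, hW.period_eq_of_half L hpos hneg (Prod.ext rfl h0), rfl, fun q hq => (hl q hq).ne,
    fun q hq => (hr q hq).ne'⟩

end IsGlobalPotential
end Family

/-! ### Potentials cut off to compact support, with complete motion -/

section Cutoff

/-- A smooth function equal to `1` near `[-M, M]`, with compact support. -/
def bump (M : ℝ) : ContDiffBump (0 : ℝ) :=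
  ⟨|M| + 1, |M| + 2, by positivity, by linarith⟩

/-- The potential `V`, switched off outside a neighbourhood of `[-M, M]`. -/
def cut (M : ℝ) (V : ℝ → ℝ) (q : ℝ) : ℝ := bump M q * V q

theorem bump_eventuallyEq {M q : ℝ} (hq : q ∈ Icc (-M) M) : bump M =ᶠ[𝓝 q] 1 := by
  apply (bump M).eventuallyEq_one_of_mem_ball
  rw [Metric.mem_ball, dist_zero_right, Real.norm_eq_abs]
  show |q| < |M| + 1
  have h1 : |q| ≤ M := abs_le.2 hq
  linarith [le_abs_self M]

theorem cut_eventuallyEq {M q : ℝ} (V : ℝ → ℝ) (hq : q ∈ Icc (-M) M) : cut M V =ᶠ[𝓝 q] V := by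
  filter_upwards [bump_eventuallyEq hq] with x hx
  simp [cut, hx]

theorem contDiff_cut {n : ℕ} {V : ℝ → ℝ} (hV : ContDiff ℝ n V) (M : ℝ) : ContDiff ℝ n (cut M V) :=
  (bump M).contDiff.mul hV

theorem hasCompactSupport_cut (M : ℝ) (V : ℝ → ℝ) : HasCompactSupport (cut M V) :=
  HasCompactSupport.mul_right (f := fun q => bump M q) (bump M).hasCompactSupport

theorem lipschitz_deriv_cut {V : ℝ → ℝ} (hV : ContDiff ℝ 2 V) (M : ℝ) :
    ∃ K, LipschitzWith K (deriv (cut M V)) := by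
  have h1 : ContDiff ℝ (1 : ℕ) (deriv (cut M V)) :=
    contDiff_deriv (n := 1) (contDiff_cut (n := 2) hV M)
  exact ContDiff.lipschitzWith_of_hasCompactSupport (hasCompactSupport_cut M V).deriv h1 (by norm_num)

theorem isGlobalPotential_cut {V : ℝ → ℝ} (hV : ContDiff ℝ 3 V) (M : ℝ) :
    IsGlobalPotential (cut M V) where
  contDiff := contDiff_cut (n := 3) hV M
  field :=
    { contDiff := contDiff_field1 (n := 1) (contDiff_cut (n := 2) (hV.of_le (by norm_num)) M)
      lipschitz := by
        obtain ⟨K, hK⟩ := lipschitz_deriv_cut (hV.of_le (by norm_num)) M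
        exact ⟨_, LipschitzWith.prod_snd.prodMk (hK.comp LipschitzWith.prod_fst).neg⟩ }

end Cutoff

/-! ### Leaves of a modified potential; energy and action along a branch -/

section Leaves

namespace Leaf

variable {V W : ℝ → ℝ}

/-- A leaf of `V` is a leaf of every potential that agrees with `V` near it. -/
@[simps] def congr (L : Leaf V) (h : ∀ q ∈ Icc L.left L.right, V =ᶠ[𝓝 q] W) : Leaf W where
  energy := L.energy
  left := L.left
  right := L.right
  left_lt_right := L.left_lt_right
  left_eq := by
    rw [← (h _ (left_mem_Icc.2 L.left_lt_right.le)).eq_of_nhds]; exact L.left_eq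
  right_eq := by
    rw [← (h _ (right_mem_Icc.2 L.left_lt_right.le)).eq_of_nhds]; exact L.right_eq
  below q hq := by
    rw [← (h _ (Ioo_subset_Icc_self hq)).eq_of_nhds]; exact L.below q hq
  deriv_left := by
    rw [← (h _ (left_mem_Icc.2 L.left_lt_right.le)).deriv_eq]; exact L.deriv_left
  deriv_right := by
    rw [← (h _ (right_mem_Icc.2 L.left_lt_right.le)).deriv_eq]; exact L.deriv_right

theorem congr_action (L : Leaf V) (h : ∀ q ∈ Icc L.left L.right, V =ᶠ[𝓝 q] W) :
    (L.congr h).action = L.action := by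
  unfold action
  congr 1
  apply intervalIntegral.integral_congr
  intro q hq
  rw [uIcc_of_le (L.congr h).left_lt_right.le] at hq
  simp [(h q hq).eq_of_nhds]

theorem congr_period (L : Leaf V) (h : ∀ q ∈ Icc L.left L.right, V =ᶠ[𝓝 q] W) :
    (L.congr h).period = L.period := by
  unfold period
  congr 1
  apply intervalIntegral.integral_congr
  intro q hq
  rw [uIcc_of_le (L.congr h).left_lt_right.le] at hq
  simp [(h q hq).eq_of_nhds]

theorem congr_impactPeriod (L : Leaf V) (h : ∀ q ∈ Icc L.left L.right, V =ᶠ[𝓝 q] W)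
    (h0 : 0 ≤ L.right) : (L.congr h).impactPeriod = L.impactPeriod := by
  unfold impactPeriod
  rw [congr_period]
  congr 1
  unfold travelTime
  simp only [congr_left]
  split_ifs with hl
  · congr 1
    apply intervalIntegral.integral_congr
    intro q hq
    rw [uIcc_of_le hl.le] at hq
    simp [(h q ⟨hq.1, hq.2.trans h0⟩).eq_of_nhds]
  · rfl

theorem mem_Icc_of_eventuallyEq_cut {M : ℝ} (L : Leaf V) (hl : -M ≤ L.left) (hr : L.right ≤ M) :
    ∀ q ∈ Icc L.left L.right, V =ᶠ[𝓝 q] cut M V :=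
  fun _ hq => (cut_eventuallyEq V ⟨hl.trans hq.1, hq.2.trans hr⟩).symm

theorem energy_le (L : Leaf V) {q : ℝ} (hq : q ∈ Icc L.left L.right) : V q ≤ L.energy := by
  rcases hq.1.eq_or_lt with h | h
  · rw [← h, L.left_eq]
  rcases hq.2.eq_or_lt with h' | h'
  · rw [h', L.right_eq]
  exact (L.below q ⟨h, h'⟩).le

theorem ext' {L L' : Leaf V} (he : L.energy = L'.energy) (hl : L.left = L'.left)
    (hr : L.right = L'.right) : L = L' := by
  cases L; cases L'; simp_all

namespace SameBranch

theorem symm {L L' : Leaf V} (h : L.SameBranch L') : L'.SameBranch L :=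
  ⟨by rw [uIcc_comm]; exact h.1, by rw [uIcc_comm]; exact h.2⟩

theorem trans {L L' L'' : Leaf V} (h : L.SameBranch L') (h' : L'.SameBranch L'') :
    L.SameBranch L'' :=
  ⟨fun q hq => (uIcc_subset_uIcc_union_uIcc hq).elim (h.1 q) (h'.1 q),
    fun q hq => (uIcc_subset_uIcc_union_uIcc hq).elim (h.2 q) (h'.2 q)⟩

variable {L L' : Leaf V}

/-- `V'` is continuous and has no zero between the two turning points, so it keeps the positive sign
that it has at `L.right`. -/
theorem strictMonoOn_right (h : L.SameBranch L') (hV : ContDiff ℝ 1 V) :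
    StrictMonoOn V (uIcc L.right L'.right) := by
  have hc : ContinuousOn (deriv V) (uIcc L.right L'.right) :=
    (hV.continuous_deriv_one).continuousOn
  have hpos : ∀ q ∈ uIcc L.right L'.right, 0 < deriv V q := by
    intro q hq
    by_contra! hle
    obtain ⟨s, hs, h0⟩ := isPreconnected_uIcc.intermediate_value hq left_mem_uIcc hc
      (⟨hle, L.deriv_right.le⟩ : (0 : ℝ) ∈ Icc _ _)
    exact h.2 s hs h0
  exact strictMonoOn_of_deriv_pos (convex_uIcc _ _) hV.continuous.continuousOn
    fun q hq => hpos q (interior_subset hq)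

theorem strictAntiOn_left (h : L.SameBranch L') (hV : ContDiff ℝ 1 V) :
    StrictAntiOn V (uIcc L.left L'.left) := by
  have hc : ContinuousOn (deriv V) (uIcc L.left L'.left) :=
    (hV.continuous_deriv_one).continuousOn
  have hneg : ∀ q ∈ uIcc L.left L'.left, deriv V q < 0 := by
    intro q hq
    by_contra! hle
    obtain ⟨s, hs, h0⟩ := isPreconnected_uIcc.intermediate_value left_mem_uIcc hq hc
      (⟨L.deriv_left.le, hle⟩ : (0 : ℝ) ∈ Icc _ _)
    exact h.1 s hs h0
  exact strictAntiOn_of_deriv_neg (convex_uIcc _ _) hV.continuous.continuousOn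
    fun q hq => hneg q (interior_subset hq)

theorem eq_of_energy (h : L.SameBranch L') (hV : ContDiff ℝ 1 V) (he : L.energy = L'.energy) :
    L = L' := by
  refine ext' he ((h.strictAntiOn_left hV).injOn left_mem_uIcc right_mem_uIcc ?_)
    ((h.strictMonoOn_right hV).injOn left_mem_uIcc right_mem_uIcc ?_)
  · rw [L.left_eq, L'.left_eq, he]
  · rw [L.right_eq, L'.right_eq, he]

/-- A larger energy increases the integrand and widens the interval of integration. Hence the action
can serve as a coordinate on a branch. -/
theorem action_lt (h : L.SameBranch L') (hV : ContDiff ℝ 1 V) (he : L.energy < L'.energy) :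
    L.action < L'.action := by
  have hl : L'.left < L.left := by
    rw [← (h.strictAntiOn_left hV).lt_iff_gt left_mem_uIcc right_mem_uIcc, L.left_eq, L'.left_eq]
    exact he
  have hr : L.right < L'.right := by
    rw [← (h.strictMonoOn_right hV).lt_iff_lt left_mem_uIcc right_mem_uIcc, L.right_eq, L'.right_eq]
    exact he
  have hVc := hV.continuous
  have hc : ∀ e : ℝ, Continuous fun q => Real.sqrt (2 * (e - V q)) := fun e => by fun_prop
  have h1 : ∫ q in L.left..L.right, Real.sqrt (2 * (L.energy - V q)) <
      ∫ q in L.left..L.right, Real.sqrt (2 * (L'.energy - V q)) := by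
    apply intervalIntegral.integral_lt_integral_of_continuousOn_of_le_of_exists_lt L.left_lt_right
      (hc _).continuousOn (hc _).continuousOn
    · intro q _
      exact Real.sqrt_le_sqrt (by linarith)
    · refine ⟨L.left, left_mem_Icc.2 L.left_lt_right.le, Real.sqrt_lt_sqrt ?_ (by linarith)⟩
      rw [L.left_eq]; simp
  have h2 : ∫ q in L.left..L.right, Real.sqrt (2 * (L'.energy - V q)) ≤
      ∫ q in L'.left..L'.right, Real.sqrt (2 * (L'.energy - V q)) :=
    intervalIntegral.integral_mono_interval hl.le L.left_lt_right.le hr.le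
      (Eventually.of_forall fun _ => Real.sqrt_nonneg _) ((hc _).intervalIntegrable _ _)
  unfold action
  exact mul_lt_mul_of_pos_left (h1.trans_le h2) (inv_pos.2 Real.pi_pos)

theorem eq_of_action (h : L.SameBranch L') (hV : ContDiff ℝ 1 V) (ha : L.action = L'.action) :
    L = L' := by
  rcases lt_trichotomy L.energy L'.energy with he | he | he
  · exact absurd ha (h.action_lt hV he).ne
  · exact h.eq_of_energy hV he
  · exact absurd ha (h.symm.action_lt hV he).ne'

end SameBranch

/-- The leaf lies in the open interval `(-M, M)`. -/
def InBox (L : Leaf V) (M : ℝ) : Prop := -M < L.left ∧ L.right < M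

theorem InBox.eventuallyEq_cut {M : ℝ} {L : Leaf V} (h : L.InBox M) :
    ∀ q ∈ Icc L.left L.right, V =ᶠ[𝓝 q] cut M V :=
  L.mem_Icc_of_eventuallyEq_cut h.1.le h.2.le

/-- Near a regular leaf, the leaves form a smooth family parametrized by the right turning point. -/
theorem exists_family (hV : ContDiff ℝ 3 V) {M : ℝ} (L₀ : Leaf V) (hM : L₀.InBox M) :
    ∃ τ : ℝ → ℝ, τ L₀.right = L₀.period / 2 ∧
      (∀ n : ℕ, n ≠ 0 → ContDiff ℝ (n + 1 : ℕ) V → ContDiffAt ℝ n τ L₀.right) ∧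
      ∀ᶠ R in 𝓝 L₀.right, ∃ L : Leaf V, L.right = R ∧ L.period = 2 * τ R ∧
        L.left = (orb (cut M V) R (τ R)).1 ∧ L.InBox M ∧ L₀.SameBranch L := by
  have hW := isGlobalPotential_cut hV M
  obtain ⟨τ, h0, hreg, hfam⟩ := hW.exists_half_time_family (L₀.congr hM.eventuallyEq_cut)
  simp only [congr_right, congr_period] at h0 hreg hfam
  refine ⟨τ, h0, fun n hn0 hn => hreg n hn0 (contDiff_cut hn M), ?_⟩
  have hτc : ContinuousAt τ L₀.right :=
    (hreg 2 two_ne_zero hW.contDiff).continuousAt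
  have hlc : ContinuousAt (fun R => (orb (cut M V) R (τ R)).1) L₀.right :=
    ContinuousAt.comp (g := fun x : ℝ × ℝ => (orb (cut M V) x.1 x.2).1) (f := fun R => (R, τ R))
      (hW.continuous_orb_uncurry.fst.continuousAt) (continuousAt_id.prodMk hτc)
  have hl0 : (orb (cut M V) L₀.right (τ L₀.right)).1 = L₀.left := by
    have := (hW.half_spec (L₀.congr hM.eventuallyEq_cut)).2.2
    simp only [congr_right, congr_period, congr_left] at this
    rw [h0, this]
  have hl : ∀ᶠ R in 𝓝 L₀.right, -M < (orb (cut M V) R (τ R)).1 :=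
    hlc.eventually (lt_mem_nhds (by simp only [hl0]; exact hM.1))
  filter_upwards [hfam, hl, gt_mem_nhds hM.2] with R ⟨L, hLR, hLp, hLl, hLs⟩ hl hr
  have hbox : L.InBox M := ⟨by rwa [hLl], by rwa [hLR]⟩
  have hcongr : ∀ q ∈ Icc L.left L.right, cut M V =ᶠ[𝓝 q] V :=
    fun q hq => cut_eventuallyEq V ⟨hbox.1.le.trans hq.1, hq.2.trans hbox.2.le⟩
  refine ⟨L.congr hcongr, hLR, by rw [congr_period, hLp], hLl, hbox, ?_, ?_⟩
  · intro q hq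
    have hq' : q ∈ Icc (-M) M := ⟨by
      have := hq.1; rcases min_choice L₀.left (L.congr hcongr).left with h | h <;> rw [h] at this
      · exact hM.1.le.trans this
      · exact hbox.1.le.trans this, by
      have := hq.2; rcases max_choice L₀.left (L.congr hcongr).left with h | h <;> rw [h] at this
      · exact this.trans (L₀.left_lt_right.le.trans hM.2.le)
      · exact this.trans (L.left_lt_right.le.trans hbox.2.le)⟩
    rw [← (cut_eventuallyEq V hq').deriv_eq]
    exact hLs.1 q hq
  · intro q hq
    have hq' : q ∈ Icc (-M) M := ⟨by
      have := hq.1; rcases min_choice L₀.right (L.congr hcongr).right with h | h <;> rw [h] at this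
      · exact (hM.1.le.trans L₀.left_lt_right.le).trans this
      · exact (hbox.1.le.trans L.left_lt_right.le).trans this, by
      have := hq.2; rcases max_choice L₀.right (L.congr hcongr).right with h | h <;> rw [h] at this
      · exact this.trans hM.2.le
      · exact this.trans hbox.2.le⟩
    rw [← (cut_eventuallyEq V hq').deriv_eq]
    exact hLs.2 q hq

end Leaf
end Leaves

/-! ### The action as a parameter of the leaves -/

section ActionFamily

/-- The predicate `P` collects the orders of smoothness, so that one and the same inverse `ρ` has
all of them; inverses chosen separately for each order would have to be compared. -/
theorem exists_local_inverse {a : ℝ → ℝ} {R₀ c : ℝ} {P : ℕ → Prop} (ha : HasDerivAt a c R₀)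
    (hc : c ≠ 0) (hP : ∀ n, P n → ContDiffAt ℝ n a R₀) (h1 : P 1) :
    ∃ ρ : ℝ → ℝ, ρ (a R₀) = R₀ ∧ (∀ n, n ≠ 0 → P n → ContDiffAt ℝ n ρ (a R₀)) ∧
      ∀ᶠ I in 𝓝 (a R₀), a (ρ I) = I := by
  set F : ℝ × ℝ → ℝ := fun x => a x.2 - x.1 with hF
  set u : ℝ × ℝ := (a R₀, R₀) with hu
  have hFP : ∀ n, P n → ContDiffAt ℝ n F u := fun n hn =>
    ((hP n hn).comp u contDiffAt_snd).sub contDiffAt_fst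
  have hF1 := hFP 1 h1
  have hinv := isInvertible_partial (F := F) (u := u) (hF1.differentiableAt (by norm_num))
    (ha.sub_const (a R₀)) hc
  have h10 : ((1 : ℕ) : WithTop ℕ∞) ≠ 0 := by norm_num
  refine ⟨hF1.implicitFunction h10 hinv, hF1.implicitFunction_apply_self h10 hinv,
    fun n hn0 hn => (hFP n hn).contDiffAt_implicitFunction (by exact_mod_cast hn0) hinv, ?_⟩
  filter_upwards [hF1.eventually_apply_implicitFunction h10 hinv] with I hI
  simp only [hF, hu, sub_self] at hI
  linarith

namespace Leaf

variable {V : ℝ → ℝ}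

theorem exists_right_of_energy {n₀ : ℕ} (h1 : n₀ ≠ 0) (hV : ContDiff ℝ n₀ V) (L₀ : Leaf V) :
    ∃ ρ : ℝ → ℝ, ρ L₀.energy = L₀.right ∧
      (∀ n : ℕ, n ≠ 0 → ContDiff ℝ n V → ContDiffAt ℝ n ρ L₀.energy) ∧
      ∀ᶠ e in 𝓝 L₀.energy, V (ρ e) = e := by
  have hV1 : ContDiff ℝ 1 V := hV.of_le (by exact_mod_cast Nat.one_le_iff_ne_zero.2 h1)
  have := exists_local_inverse (a := V) (P := fun n => ContDiff ℝ n V)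
    ((hV1.differentiable one_ne_zero) L₀.right).hasDerivAt L₀.deriv_right.ne'
    (fun n hn => hn.contDiffAt) (by exact_mod_cast hV1)
  rwa [L₀.right_eq] at this

/-- Near a regular leaf, the leaves form a smooth family parametrized by the action `I`,
and `d(energy)/dI = 2π / period`. -/
theorem exists_action_family (hV : ContDiff ℝ 3 V) {M : ℝ} (L₀ : Leaf V) (hM : L₀.InBox M) :
    ∃ ρ τ : ℝ → ℝ, ρ L₀.action = L₀.right ∧ τ L₀.action = L₀.period / 2 ∧
      (∀ n : ℕ, n ≠ 0 → ContDiff ℝ (n + 1 : ℕ) V →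
        ContDiffAt ℝ n ρ L₀.action ∧ ContDiffAt ℝ n τ L₀.action) ∧
      HasDerivAt (fun I => V (ρ I)) (2 * Real.pi / L₀.period) L₀.action ∧
      ∀ᶠ I in 𝓝 L₀.action, ∃ L : Leaf V, L.action = I ∧ L.right = ρ I ∧ L.period = 2 * τ I ∧
        L.InBox M ∧ L₀.SameBranch L := by
  have hW := isGlobalPotential_cut hV M
  set W := cut M V with hWdef
  obtain ⟨τ, hτ0, hreg, hfam⟩ := L₀.exists_family hV hM
  set a : ℝ → ℝ := fun R => Real.pi⁻¹ * ∫ t in (0 : ℝ)..τ R, (orb W R t).2 ^ 2 with ha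
  have hspec : ∀ (L : Leaf V), L.InBox M → 0 < L.period / 2 ∧ (orb W L.right (L.period / 2)).2 = 0 ∧
      L.action = Real.pi⁻¹ * ∫ t in (0 : ℝ)..(L.period / 2), (orb W L.right t).2 ^ 2 := by
    intro L hL
    have h1 := hW.half_spec (L.congr hL.eventuallyEq_cut)
    have h2 := hW.action_eq (L.congr hL.eventuallyEq_cut)
    simp only [congr_right, congr_period, congr_left, congr_action] at h1 h2
    exact ⟨h1.1, by rw [h1.2.2], h2⟩
  have hfam' : ∀ᶠ R in 𝓝 L₀.right, 0 < τ R ∧ (orb W R (τ R)).2 = 0 := by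
    filter_upwards [hfam] with R ⟨L, hLR, hLp, _, hLM, _⟩
    have h1 := hspec L hLM
    rw [hLp, mul_div_cancel_left₀ _ two_ne_zero, hLR] at h1
    exact ⟨h1.1, h1.2.1⟩
  have hτ2 : ContDiffAt ℝ (2 : ℕ) τ L₀.right := hreg 2 two_ne_zero hV
  have hda : ∀ᶠ R in 𝓝 L₀.right, HasDerivAt a (Real.pi⁻¹ * (τ R * deriv W R)) R := by
    filter_upwards [hfam', hτ2.eventually (by norm_num)] with R hR hτR
    exact (hW.hasDerivAt_action_integral (hτR.differentiableAt (by norm_num)).hasDerivAt hR.1.le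
      hR.2).const_mul _
  -- Smoothness of the action is obtained from the formula for its derivative, whose factors `τ` and
  -- `W'` are `C^n`, and not by differentiating the integral repeatedly.
  have haC : ∀ n : ℕ, n ≠ 0 ∧ ContDiff ℝ (n + 1 : ℕ) V → ContDiffAt ℝ n a L₀.right := by
    rintro n ⟨hn0, hn⟩
    have h1 : ContDiffAt ℝ n (fun R => Real.pi⁻¹ * (τ R * deriv W R)) L₀.right :=
      contDiffAt_const.mul ((hreg n hn0 hn).mul
        (contDiff_deriv (contDiff_cut hn M)).contDiffAt)
    have h2 : ContDiffAt ℝ ((n : WithTop ℕ∞) + 1) a L₀.right := by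
      rw [contDiffAt_succ_iff_hasFDerivAt]
      refine ⟨fun R => ContinuousLinearMap.toSpanSingleton ℝ (Real.pi⁻¹ * (τ R * deriv W R)),
        ⟨_, hda, fun R hR => hR.hasFDerivAt⟩, ?_⟩
      exact (ContinuousLinearMap.toSpanSingletonCLE (𝕜 := ℝ) (E := ℝ)).contDiff.contDiffAt.comp _ h1
    exact h2.of_le (by norm_cast; omega)
  have hI0 : a L₀.right = L₀.action := by
    simp only [ha, hτ0]; exact (hspec L₀ hM).2.2.symm
  have hd0 : deriv W L₀.right = deriv V L₀.right :=
    (cut_eventuallyEq V ⟨(hM.1.trans L₀.left_lt_right).le, hM.2.le⟩).deriv_eq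
  have hpos := (hspec L₀ hM).1
  have hda0 := hda.self_of_nhds
  rw [hτ0, hd0] at hda0
  have hc : Real.pi⁻¹ * (L₀.period / 2 * deriv V L₀.right) ≠ 0 :=
    (mul_pos (inv_pos.2 Real.pi_pos) (mul_pos hpos L₀.deriv_right)).ne'
  obtain ⟨ρ, hρ0, hρreg, hρa⟩ := exists_local_inverse (P := fun n => n ≠ 0 ∧ ContDiff ℝ (n + 1 : ℕ) V)
    hda0 hc haC ⟨one_ne_zero, hV.of_le (by norm_num)⟩
  rw [hI0] at hρ0 hρreg hρa
  have hρc : ContDiffAt ℝ (1 : ℕ) ρ L₀.action :=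
    hρreg 1 one_ne_zero ⟨one_ne_zero, hV.of_le (by norm_num)⟩
  have hρt : Tendsto ρ (𝓝 L₀.action) (𝓝 L₀.right) := by
    have := hρc.continuousAt.tendsto; rwa [hρ0] at this
  refine ⟨ρ, fun I => τ (ρ I), hρ0, by simp only [hρ0, hτ0], fun n hn0 hn =>
    ⟨hρreg n hn0 ⟨hn0, hn⟩, ContDiffAt.comp _ (by rw [hρ0]; exact hreg n hn0 hn)
      (hρreg n hn0 ⟨hn0, hn⟩)⟩, ?_, ?_⟩
  -- `dI/dR = period · V'(R) / 2π`, so in `dV(ρ I)/dI = V'(R) / (dI/dR)` the factor `V'(R)` cancels.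
  · have h1 : HasDerivAt ρ (deriv ρ L₀.action) L₀.action :=
      (hρc.differentiableAt (by norm_num)).hasDerivAt
    have h2 : Real.pi⁻¹ * (L₀.period / 2 * deriv V L₀.right) * deriv ρ L₀.action = 1 := by
      have h3 : HasDerivAt (fun I => a (ρ I)) _ L₀.action :=
        HasDerivAt.comp (h₂ := a) L₀.action (by rw [hρ0]; exact hda0) h1
      exact h3.unique ((hasDerivAt_id L₀.action).congr_of_eventuallyEq hρa)
    have h4 : HasDerivAt (fun I => V (ρ I)) (deriv V L₀.right * deriv ρ L₀.action) L₀.action :=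
      HasDerivAt.comp L₀.action (by
        rw [hρ0]; exact ((hV.differentiable (by norm_num)) L₀.right).hasDerivAt) h1
    refine h4.congr_deriv ?_
    have hp : L₀.period ≠ 0 := by linarith
    have := Real.pi_pos.ne'
    field_simp at h2 ⊢
    linarith
  · filter_upwards [hρt.eventually hfam, hρa] with I ⟨L, hLR, hLp, _, hLM, hLs⟩ hI
    refine ⟨L, ?_, hLR, hLp, hLM, hLs⟩
    rw [(hspec L hLM).2.2, hLp, mul_div_cancel_left₀ _ two_ne_zero, hLR]
    exact hI

end Leaf
end ActionFamily

/-! ### Leaves on wall branches, and families of tori -/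

section Tori

namespace Leaf

variable {V : ℝ → ℝ}

/-- Along the tangent branch the left turning point starts at the wall and moves right, over an
interval on which `V` decreases. -/
theorem lt_of_onWallBranch_of_left_pos {L : Leaf V} (hV : ContDiff ℝ 1 V) (h : L.OnWallBranch)
    (hl : 0 < L.left) : L.energy < V 0 := by
  rcases h.2 with h | ⟨Lt, hte, htl, hts⟩
  · exact absurd hl h.not_gt
  · have := hts.strictAntiOn_left hV left_mem_uIcc right_mem_uIcc (by rwa [htl])
    rwa [htl, L.left_eq] at this

theorem OnWallBranch.left_le_iff {L : Leaf V} (hV : ContDiff ℝ 1 V) (h : L.OnWallBranch) :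
    L.left ≤ 0 ↔ V 0 ≤ L.energy := by
  constructor
  · exact fun hl => L.energy_le ⟨hl, h.1.le⟩
  · intro he
    by_contra! hl
    exact (lt_of_onWallBranch_of_left_pos hV h hl).not_ge he

theorem OnWallBranch.left_neg {L : Leaf V} (hV : ContDiff ℝ 1 V) (h : L.OnWallBranch)
    (he : V 0 < L.energy) : L.left < 0 := by
  refine lt_of_le_of_ne ((h.left_le_iff hV).2 he.le) fun h0 => ?_
  rw [← L.left_eq, h0] at he
  exact he.false

theorem OnWallBranch.left_pos {L : Leaf V} (hV : ContDiff ℝ 1 V) (h : L.OnWallBranch)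
    (he : L.energy < V 0) : 0 < L.left := by
  by_contra! hl
  exact ((h.left_le_iff hV).1 hl).not_gt he

/-- If the two intervals overlapped without coinciding, an endpoint of one would lie inside the
other, where `V` is below the common energy. -/
theorem eq_of_inter {L L' : Leaf V} (he : L.energy = L'.energy) {q : ℝ}
    (hq : q ∈ Ico L.left L.right) (hq' : q ∈ Ico L'.left L'.right) : L = L' := by
  refine ext' he ?_ ?_
  · rcases lt_trichotomy L.left L'.left with h | h | h
    · have := L.below L'.left ⟨h, hq'.1.trans_lt hq.2⟩
      rw [L'.left_eq] at this; linarith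
    · exact h
    · have := L'.below L.left ⟨h, hq.1.trans_lt hq'.2⟩
      rw [L.left_eq] at this; linarith
  · rcases lt_trichotomy L.right L'.right with h | h | h
    · have := L'.below L.right ⟨hq'.1.trans_lt hq.2, h⟩
      rw [L.right_eq] at this; linarith
    · exact h
    · have := L.below L'.right ⟨hq.1.trans_lt hq'.2, h⟩
      rw [L'.right_eq] at this; linarith

/-- Comparison of the energy with `V 0` decides whether a leaf meets the wall. If it does, both
leaves surround `0`; if not, both are on the branch of the unique tangent leaf. -/
theorem OnWallBranch.eq_of_energy {L L' : Leaf V} (hV : ContDiff ℝ 1 V) (h : L.OnWallBranch)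
    (h' : L'.OnWallBranch) (he : L.energy = L'.energy) : L = L' := by
  by_cases hl : L.left ≤ 0
  · have hl' : L'.left ≤ 0 := by
      rw [h'.left_le_iff hV, ← he]; exact (h.left_le_iff hV).1 hl
    exact eq_of_inter he ⟨hl, h.1⟩ ⟨hl', h'.1⟩
  · have hl' : ¬ L'.left ≤ 0 := by
      rw [h'.left_le_iff hV, ← he]; exact fun h2 => hl ((h.left_le_iff hV).2 h2)
    obtain ⟨Lt, hte, htl, hts⟩ := h.2.resolve_left hl
    obtain ⟨Lt', hte', htl', hts'⟩ := h'.2.resolve_left hl'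
    have : Lt = Lt' := eq_of_inter (q := 0) (hte.trans hte'.symm)
      ⟨htl.le, by rw [← htl]; exact Lt.left_lt_right⟩
      ⟨htl'.le, by rw [← htl']; exact Lt'.left_lt_right⟩
    subst this
    exact (hts.symm.trans hts').eq_of_energy hV he

/-- Near a leaf on a wall branch, not of the energy of the wall, the leaves on wall branches form
a family with smoothly varying right turning point and continuous impact period. -/
theorem exists_wall_family (hV : ContDiff ℝ 3 V) {M : ℝ} (L₀ : Leaf V) (hM : L₀.InBox M)
    (hw : L₀.OnWallBranch) (he : L₀.energy ≠ V 0) :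
    ∃ ρ ι : ℝ → ℝ, ρ L₀.energy = L₀.right ∧ ι L₀.energy = L₀.impactPeriod / 2 ∧
      (∀ n : ℕ, n ≠ 0 → ContDiff ℝ n V → ContDiffAt ℝ n ρ L₀.energy) ∧
      ContinuousAt ι L₀.energy ∧
      ∀ᶠ e in 𝓝 L₀.energy, ∃ L : Leaf V, L.energy = e ∧ L.right = ρ e ∧
        L.impactPeriod = 2 * ι e ∧ L.InBox M ∧ L.OnWallBranch := by
  have hW := isGlobalPotential_cut hV M
  have hV1 : ContDiff ℝ 1 V := hV.of_le (by norm_num)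
  obtain ⟨τ, hτ0, hτreg, hfam⟩ := L₀.exists_family hV hM
  obtain ⟨ρ, hρ0, hρreg, hρ⟩ := L₀.exists_right_of_energy (n₀ := 3) three_ne_zero hV
  have hτc : ContinuousAt τ L₀.right := (hτreg 2 two_ne_zero hV).continuousAt
  have hρc : ContinuousAt ρ L₀.energy := (hρreg 3 three_ne_zero hV).continuousAt
  have hρt : Tendsto ρ (𝓝 L₀.energy) (𝓝 L₀.right) := by
    have := hρc.tendsto; rwa [hρ0] at this
  have hρpos : ∀ᶠ e in 𝓝 L₀.energy, 0 < ρ e := hρt.eventually (lt_mem_nhds hw.1)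
  have half := fun (L : Leaf V) (hL : L.InBox M) => hW.half_spec (L.congr hL.eventuallyEq_cut)
  simp only [congr_right, congr_period, congr_left] at half
  have hlc : ContinuousAt (fun R => (orb (cut M V) R (τ R)).1) L₀.right :=
    ContinuousAt.comp (g := fun x : ℝ × ℝ => (orb (cut M V) x.1 x.2).1) (f := fun R => (R, τ R))
      (hW.continuous_orb_uncurry.fst.continuousAt) (continuousAt_id.prodMk hτc)
  have hl0 : (orb (cut M V) L₀.right (τ L₀.right)).1 = L₀.left := by rw [hτ0, (half L₀ hM).2.2]
  rcases lt_or_gt_of_ne he with he | he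
  · -- the wall is not reached
    have hl := hw.left_pos hV1 he
    refine ⟨ρ, fun e => τ (ρ e), hρ0, ?_, hρreg, ?_, ?_⟩
    · simp only [hρ0, hτ0]; rw [IsGlobalPotential.impactPeriod_eq_period _ hl.le]
    · exact ContinuousAt.comp (by rwa [hρ0]) hρc
    · have h1 : ∀ᶠ R in 𝓝 L₀.right, 0 < (orb (cut M V) R (τ R)).1 :=
        hlc.eventually (lt_mem_nhds (by simp only [hl0]; exact hl))
      filter_upwards [hρt.eventually hfam, hρt.eventually h1, hρpos, hρ] with e ⟨L, hLR, hLp, hLl, hLM, hLs⟩ hpos hr he'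
      refine ⟨L, by rw [← L.right_eq, hLR, he'], hLR, ?_, hLM, by rwa [hLR], Or.inr ?_⟩
      · rw [IsGlobalPotential.impactPeriod_eq_period _ (by rw [hLl]; exact hpos.le), hLp]
      · obtain ⟨Lt, hte, htl, hts⟩ := hw.2.resolve_left hl.not_ge
        exact ⟨Lt, hte, htl, hts.trans hLs⟩
  -- The orbit crosses `q = 0` with nonzero momentum, so the implicit function theorem provides the
  -- hitting time. It comes before the turning time `τ R`, which identifies it with half of the
  -- impact period.
  · have hl := hw.left_neg hV1 he
    obtain ⟨hι0, hι1, hι2⟩ := hW.hit_spec (L₀.congr hM.eventuallyEq_cut) hl hw.1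
    rw [congr_impactPeriod _ _ hw.1.le] at hι0 hι1 hι2
    simp only [congr_right, congr_period] at hι1 hι2
    set u : ℝ × ℝ := (L₀.right, L₀.impactPeriod / 2) with hu
    have hF : ContDiffAt ℝ (2 : ℕ) (fun x : ℝ × ℝ => (orb (cut M V) x.1 x.2).1) u :=
      (hW.contDiff_orb (n := 2) two_ne_zero hW.contDiff).fst.contDiffAt
    have hinv := isInvertible_partial (F := fun x : ℝ × ℝ => (orb (cut M V) x.1 x.2).1) (u := u)
      (hF.differentiableAt (by norm_num)) (hW.hasDerivAt_fst L₀.right (L₀.impactPeriod / 2))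
      ((half L₀ hM).2.1 _ ⟨hι0, hι1⟩).ne
    set ι := hF.implicitFunction (by norm_num) hinv with hι
    have hιu : ι L₀.right = L₀.impactPeriod / 2 := hF.implicitFunction_apply_self (by norm_num) hinv
    have hιc : ContinuousAt ι L₀.right :=
      (hF.contDiffAt_implicitFunction (by norm_num) hinv).continuousAt
    have hz : ∀ᶠ R in 𝓝 L₀.right, (orb (cut M V) R (ι R)).1 = 0 := by
      have := hF.eventually_apply_implicitFunction (by norm_num) hinv
      simpa only [hu, hι2] using this
    have h1 : ∀ᶠ R in 𝓝 L₀.right, 0 < ι R := hιc.eventually (lt_mem_nhds (by rwa [hιu]))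
    have h2 : ∀ᶠ R in 𝓝 L₀.right, ι R < τ R :=
      hιc.eventually_lt hτc (by rwa [hιu, hτ0])
    have h3 : ∀ᶠ R in 𝓝 L₀.right, (orb (cut M V) R (τ R)).1 < 0 :=
      hlc.eventually (gt_mem_nhds (by simp only [hl0]; exact hl))
    refine ⟨ρ, fun e => ι (ρ e), hρ0, by simp only [hρ0, hιu], hρreg,
      ContinuousAt.comp (by rwa [hρ0]) hρc, ?_⟩
    filter_upwards [hρt.eventually (hfam.and (hz.and (h1.and (h2.and h3)))), hρpos, hρ] with e
      ⟨⟨L, hLR, hLp, hLl, hLM, _⟩, hz, h1, h2, h3⟩ hr he'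
    have hLneg : L.left < 0 := by rwa [hLl]
    have hLr : 0 < L.right := by rwa [hLR]
    refine ⟨L, by rw [← L.right_eq, hLR, he'], hLR, ?_, hLM, hLr, Or.inl hLneg.le⟩
    rw [← congr_impactPeriod L hLM.eventuallyEq_cut hLr.le]
    refine hW.impactPeriod_eq_of_hit _ hLneg ⟨h1.le, ?_⟩ ?_
    · rw [congr_period, hLp]; linarith
    · rw [congr_right, hLR]; exact hz

end Leaf

namespace ImpactSystem

variable (S : ImpactSystem)

/-- The smoothness of the unperturbed potentials, and their coercivity. -/
structure IsRegular : Prop where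
  contDiff₁ : ContDiff ℝ 3 S.V₁
  contDiff₂ : ContDiff ℝ 3 S.V₂
  bounded₁ : Tendsto S.V₁ (cocompact ℝ) atTop
  bounded₂ : Tendsto S.V₂ (cocompact ℝ) atTop

/-- Both degrees of freedom are confined to `(-M, M)` at total energy `H`. -/
def Confined (H M : ℝ) : Prop :=
  (∀ q, S.V₁ q ≤ H - ⨅ q, S.V₂ q → |q| < M) ∧ ∀ q, S.V₂ q ≤ H - ⨅ q, S.V₁ q → |q| < M

variable {S}

theorem exists_abs_lt_of_le {V : ℝ → ℝ} (hV : Tendsto V (cocompact ℝ) atTop) (E : ℝ) :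
    ∃ M, ∀ q, V q ≤ E → |q| < M := by
  have h1 : ∀ᶠ q in cocompact ℝ, E < V q := hV.eventually (eventually_gt_atTop E)
  rw [Metric.cobounded_eq_cocompact.symm] at h1
  obtain ⟨M, hM⟩ := (Metric.hasBasis_cobounded_compl_closedBall (0 : ℝ)).eventually_iff.1 h1
  refine ⟨M + 1, fun q hq => ?_⟩
  by_contra! hlt
  have : q ∈ (Metric.closedBall (0 : ℝ) M)ᶜ := by
    rw [mem_compl_iff, mem_closedBall_zero_iff, Real.norm_eq_abs]; linarith
  exact absurd (hM.2 this) hq.not_gt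

theorem bddBelow_of_tendsto {V : ℝ → ℝ} (hV : Continuous V) (h : Tendsto V (cocompact ℝ) atTop) :
    BddBelow (range V) := by
  obtain ⟨q, hq⟩ := hV.exists_forall_le h
  exact ⟨V q, by rintro _ ⟨x, rfl⟩; exact hq x⟩

namespace IsRegular

theorem exists_confined (hS : S.IsRegular) (H : ℝ) : ∃ M, S.Confined H M := by
  obtain ⟨M₁, h₁⟩ := exists_abs_lt_of_le hS.bounded₁ (H - ⨅ q, S.V₂ q)
  obtain ⟨M₂, h₂⟩ := exists_abs_lt_of_le hS.bounded₂ (H - ⨅ q, S.V₁ q)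
  exact ⟨max M₁ M₂, fun q hq => (h₁ q hq).trans_le (le_max_left _ _),
    fun q hq => (h₂ q hq).trans_le (le_max_right _ _)⟩

theorem iInf₁_le (hS : S.IsRegular) (q : ℝ) : ⨅ q, S.V₁ q ≤ S.V₁ q :=
  ciInf_le (bddBelow_of_tendsto hS.contDiff₁.continuous hS.bounded₁) q

theorem iInf₂_le (hS : S.IsRegular) (q : ℝ) : ⨅ q, S.V₂ q ≤ S.V₂ q :=
  ciInf_le (bddBelow_of_tendsto hS.contDiff₂.continuous hS.bounded₂) q

variable {B : Leaf S.V₂} {H I : ℝ} {L₁ L₁' : Leaf S.V₁} {L₂ L₂' : Leaf S.V₂}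

theorem energy₁_le (hS : S.IsRegular) (h : S.IsTorus B H I L₁ L₂) :
    L₁.energy ≤ H - ⨅ q, S.V₂ q := by
  have h1 := hS.iInf₂_le L₂.left
  rw [L₂.left_eq] at h1
  linarith [h.2.2.2]

theorem energy₂_le (hS : S.IsRegular) (h : S.IsTorus B H I L₁ L₂) :
    L₂.energy ≤ H - ⨅ q, S.V₁ q := by
  have h1 := hS.iInf₁_le L₁.left
  rw [L₁.left_eq] at h1
  linarith [h.2.2.2]

theorem inBox₁ (hS : S.IsRegular) {M : ℝ} (hM : S.Confined H M) (h : S.IsTorus B H I L₁ L₂) :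
    L₁.InBox M :=
  ⟨(abs_lt.1 (hM.1 _ (by rw [L₁.left_eq]; exact hS.energy₁_le h))).1,
    (abs_lt.1 (hM.1 _ (by rw [L₁.right_eq]; exact hS.energy₁_le h))).2⟩

theorem inBox₂ (hS : S.IsRegular) {M : ℝ} (hM : S.Confined H M) (h : S.IsTorus B H I L₁ L₂) :
    L₂.InBox M :=
  ⟨(abs_lt.1 (hM.2 _ (by rw [L₂.left_eq]; exact hS.energy₂_le h))).1,
    (abs_lt.1 (hM.2 _ (by rw [L₂.right_eq]; exact hS.energy₂_le h))).2⟩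

/-- The action fixes the second leaf on its branch, the total energy then fixes the energy of the
first, and on wall branches the energy fixes the leaf. So quantities defined by choosing a torus do
not depend on the choice. -/
theorem torus_unique (hS : S.IsRegular) (h : S.IsTorus B H I L₁ L₂)
    (h' : S.IsTorus B H I L₁' L₂') : L₁ = L₁' ∧ L₂ = L₂' := by
  have h2 : L₂ = L₂' := (h.2.1.symm.trans h'.2.1).eq_of_action (hS.contDiff₂.of_le (by norm_num))
    (h.2.2.1.trans h'.2.2.1.symm)
  subst h2
  refine ⟨h.1.eq_of_energy (hS.contDiff₁.of_le (by norm_num)) h'.1 ?_, rfl⟩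
  linarith [h.2.2.2, h'.2.2.2]

theorem rotation_eq (hS : S.IsRegular) (h : S.IsTorus B H I L₁ L₂) :
    S.rotation B H I = 2 * Real.pi * (L₁.impactPeriod / L₂.period) := by
  have hex : ∃ L : Leaf S.V₁ × Leaf S.V₂, S.IsTorus B H I L.1 L.2 := ⟨(L₁, L₂), h⟩
  unfold rotation
  rw [dif_pos hex]
  obtain ⟨h1, h2⟩ := hS.torus_unique hex.choose_spec h
  rw [h1, h2]

/-- The smooth family of tori near a torus that is not tangent to the wall. -/
theorem exists_torus_family (hS : S.IsRegular) {M : ℝ} (hM : S.Confined H M)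
    (h : S.IsTorus B H I L₁ L₂) (he : L₁.energy ≠ S.V₁ 0) :
    ∃ ρ₁ ι ρ₂ τ : ℝ → ℝ, ρ₁ I = L₁.right ∧ ι I = L₁.impactPeriod / 2 ∧ ρ₂ I = L₂.right ∧
      τ I = L₂.period / 2 ∧
      (∀ n : ℕ, n ≠ 0 → ContDiff ℝ (n + 1 : ℕ) S.V₁ → ContDiff ℝ (n + 1 : ℕ) S.V₂ →
        ContDiffAt ℝ n ρ₁ I ∧ ContDiffAt ℝ n ρ₂ I ∧ ContDiffAt ℝ n τ I) ∧
      ContinuousAt ι I ∧ HasDerivAt (fun I => S.V₂ (ρ₂ I)) (2 * Real.pi / L₂.period) I ∧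
      ∀ᶠ J in 𝓝 I, ∃ L₁' L₂', S.IsTorus B H J L₁' L₂' ∧ L₁'.right = ρ₁ J ∧
        L₁'.impactPeriod = 2 * ι J ∧ L₂'.right = ρ₂ J ∧ L₂'.period = 2 * τ J ∧
        (L₁'.energy < S.V₁ 0 ↔ L₁.energy < S.V₁ 0) ∧ L₁'.energy ≠ S.V₁ 0 := by
  obtain ⟨hw, hB, rfl, hH⟩ := h
  have ht : S.IsTorus B H L₂.action L₁ L₂ := ⟨hw, hB, rfl, hH⟩
  obtain ⟨ρ₂, τ, hρ₂, hτ, hreg₂, hd, hfam₂⟩ :=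
    L₂.exists_action_family hS.contDiff₂ (hS.inBox₂ hM ht)
  obtain ⟨ρ₁, ι, hρ₁, hι, hreg₁, hιc, hfam₁⟩ :=
    L₁.exists_wall_family hS.contDiff₁ (hS.inBox₁ hM ht) hw he
  set e : ℝ → ℝ := fun J => H - S.V₂ (ρ₂ J) with hedef
  have he0 : e L₂.action = L₁.energy := by
    simp only [hedef, hρ₂, L₂.right_eq]; linarith
  have hρ₂c : ContinuousAt ρ₂ L₂.action := (hreg₂ 2 two_ne_zero hS.contDiff₂).1.continuousAt
  have hec : ContinuousAt e L₂.action :=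
    continuousAt_const.sub (hS.contDiff₂.continuous.continuousAt.comp hρ₂c)
  have het : Tendsto e (𝓝 L₂.action) (𝓝 L₁.energy) := by
    have := hec.tendsto; rwa [he0] at this
  have hsign : ∀ᶠ x in 𝓝 L₁.energy, (x < S.V₁ 0 ↔ L₁.energy < S.V₁ 0) ∧ x ≠ S.V₁ 0 := by
    rcases lt_or_gt_of_ne he with h | h
    · filter_upwards [gt_mem_nhds h] with x hx
      exact ⟨⟨fun _ => h, fun _ => hx⟩, hx.ne⟩
    · filter_upwards [lt_mem_nhds h] with x hx
      exact ⟨⟨fun h' => absurd h' hx.not_gt, fun h' => absurd h' h.not_gt⟩, hx.ne'⟩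
  refine ⟨fun J => ρ₁ (e J), fun J => ι (e J), ρ₂, τ, by simp only [he0, hρ₁],
    by simp only [he0, hι], hρ₂, hτ, fun n hn0 hn₁ hn₂ => ⟨?_, hreg₂ n hn0 hn₂⟩, ?_, hd, ?_⟩
  · refine ContDiffAt.comp _ (by rw [he0]; exact hreg₁ n hn0 (hn₁.of_le (by norm_cast; omega))) ?_
    exact contDiffAt_const.sub ((hn₂.of_le (by norm_cast; omega)).contDiffAt.comp _
      (hreg₂ n hn0 hn₂).1)
  · exact ContinuousAt.comp (by rwa [he0]) hec
  · filter_upwards [hfam₂, het.eventually hfam₁, het.eventually hsign] with J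
      ⟨L₂', h2a, h2r, h2p, h2M, h2s⟩ ⟨L₁', h1e, h1r, h1i, h1M, h1w⟩ hs
    refine ⟨L₁', L₂', ⟨h1w, hB.trans h2s, h2a, ?_⟩, h1r, h1i, h2r, h2p, ?_⟩
    · rw [h1e, ← L₂'.right_eq, h2r]; ring
    · rw [h1e]; exact hs

end IsRegular
end ImpactSystem
end Tori

/-! ### Compactness of the set of regular tori -/

section Compactness

namespace Leaf

variable {V : ℝ → ℝ}

/-- The real square root is `0` on negative numbers, so the integrand is continuous everywhere.
Actions therefore pass to the limit before the limit is known to be a leaf. -/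
theorem continuous_integral_sqrt (hV : Continuous V) :
    Continuous fun x : ℝ × ℝ × ℝ => ∫ q in x.2.1..x.2.2, Real.sqrt (2 * (x.1 - V q)) := by
  have h : Continuous (Function.uncurry fun (x : ℝ × ℝ × ℝ) q => Real.sqrt (2 * (x.1 - V q))) := by
    unfold Function.uncurry; fun_prop
  have h1 := intervalIntegral.continuous_parametric_intervalIntegral_of_continuous (a₀ := 0)
    (μ := MeasureTheory.volume) h continuous_snd.snd
  have h2 := intervalIntegral.continuous_parametric_intervalIntegral_of_continuous (a₀ := 0)
    (μ := MeasureTheory.volume) h continuous_snd.fst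
  refine (h1.sub h2).congr fun x => ?_
  have hc : Continuous fun q => Real.sqrt (2 * (x.1 - V q)) := by fun_prop
  exact intervalIntegral.integral_interval_sub_left (hc.intervalIntegrable _ _)
    (hc.intervalIntegrable _ _)

theorem tendsto_action (hV : Continuous V) {L : ℕ → Leaf V} {l r : ℝ}
    (hl : Tendsto (fun n => (L n).left) atTop (𝓝 l))
    (hr : Tendsto (fun n => (L n).right) atTop (𝓝 r)) :
    Tendsto (fun n => (L n).action) atTop
      (𝓝 (Real.pi⁻¹ * ∫ q in l..r, Real.sqrt (2 * (V l - V q)))) := by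
  have he : Tendsto (fun n => V (L n).left) atTop (𝓝 (V l)) := (hV.tendsto l).comp hl
  have h := (((continuous_integral_sqrt hV).tendsto (V l, l, r)).comp
    (he.prodMk_nhds (hl.prodMk_nhds hr))).const_mul Real.pi⁻¹
  refine h.congr fun n => ?_
  simp only [Function.comp, action, (L n).left_eq]

/-- A nondegenerate local minimum of `V` in `[l, r]` is not a maximum on `[l, r]`. -/
theorem exists_lt_of_min (hV : ContDiff ℝ 2 V) {l r q : ℝ} (hlr : l < r) (hq : q ∈ Icc l r)
    (h1 : deriv V q = 0) (h2 : 0 < deriv (deriv V) q) : ∃ x ∈ Icc l r, V q < V x := by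
  have hd := contDiff_deriv (n := 1) hV
  obtain ⟨a, ha, h⟩ := sign_near_simple_zero (X := Unit) (p₀ := ()) (g := fun _ t => -deriv V t)
    (g' := fun _ t => -deriv (deriv V) t) (b := fun _ => q)
    (Eventually.of_forall fun _ t => HasDerivAt.fun_neg
      (hd.differentiable (by norm_num) t).hasDerivAt)
    ((hd.continuous_deriv_one.comp continuous_snd).neg.continuousAt) continuousAt_const
    (Eventually.of_forall fun _ => by simp [h1]) (by simpa using h2)
  have hs := h.self_of_nhds
  have hc : Continuous V := hV.continuous
  rcases hq.2.lt_or_eq with hqr | hqr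
  · set x := min (q + a) r with hx
    have hqx : q < x := lt_min (by linarith) hqr
    refine ⟨x, ⟨hq.1.trans hqx.le, min_le_right _ _⟩, ?_⟩
    have : StrictMonoOn V (Icc q x) := by
      apply strictMonoOn_of_deriv_pos (convex_Icc _ _) hc.continuousOn
      intro y hy
      rw [interior_Icc] at hy
      have := (hs (y - q) ⟨by linarith [hy.1], by linarith [hy.2, min_le_left (q + a) r]⟩).1
      simpa using this
    exact this (left_mem_Icc.2 hqx.le) (right_mem_Icc.2 hqx.le) hqx
  · set x := max (q - a) l with hx
    have hqx : x < q := max_lt (by linarith) (by rw [hqr]; exact hlr)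
    refine ⟨x, ⟨le_max_right _ _, hqx.le.trans hq.2⟩, ?_⟩
    have : StrictAntiOn V (Icc x q) := by
      apply strictAntiOn_of_deriv_neg (convex_Icc _ _) hc.continuousOn
      intro y hy
      rw [interior_Icc] at hy
      have := (hs (q - y) ⟨by linarith [hy.2], by linarith [hy.1, le_max_left (q - a) l]⟩).2
      simpa using this
    exact this (left_mem_Icc.2 hqx.le) (right_mem_Icc.2 hqx.le) hqx

/-- Leaves with actions bounded from below, and energies away from the saddle energies, accumulate
only at regular leaves. -/
theorem exists_limit (hV : ContDiff ℝ 2 V) (hs : ∀ q, deriv V q = 0 → deriv (deriv V) q ≠ 0)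
    {L : ℕ → Leaf V} {l r δ η : ℝ} (hδ : 0 < δ) (hη : 0 < η)
    (hl : Tendsto (fun n => (L n).left) atTop (𝓝 l))
    (hr : Tendsto (fun n => (L n).right) atTop (𝓝 r)) (ha : ∀ n, η ≤ (L n).action)
    (hsad : ∀ n q, IsSaddle V q → δ ≤ |(L n).energy - V q|) :
    ∃ L' : Leaf V, L'.left = l ∧ L'.right = r ∧
      Tendsto (fun n => (L n).energy) atTop (𝓝 L'.energy) ∧
      Tendsto (fun n => (L n).action) atTop (𝓝 L'.action) := by
  have hc := hV.continuous
  have hd := (contDiff_deriv (n := 1) hV).continuous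
  have hel : Tendsto (fun n => (L n).energy) atTop (𝓝 (V l)) :=
    ((hc.tendsto l).comp hl).congr fun n => (L n).left_eq
  have her : Tendsto (fun n => (L n).energy) atTop (𝓝 (V r)) :=
    ((hc.tendsto r).comp hr).congr fun n => (L n).right_eq
  have hVlr : V r = V l := tendsto_nhds_unique her hel
  have hact := tendsto_action hc hl hr
  -- Intervals shrinking to a point would have actions tending to `0`, against the bound `η`.
  have hlr : l < r := by
    refine lt_of_le_of_ne (le_of_tendsto_of_tendsto' hl hr fun n => (L n).left_lt_right.le) ?_
    rintro rfl
    have := ge_of_tendsto' hact ha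
    simp at this
    linarith
  have hle : ∀ q ∈ Icc l r, V q ≤ V l := by
    have : ∀ q ∈ Ioo l r, V q ≤ V l := by
      intro q hq
      refine ge_of_tendsto hel ?_
      filter_upwards [hl.eventually (gt_mem_nhds hq.1), hr.eventually (lt_mem_nhds hq.2)]
        with n h1 h2 using ((L n).below q ⟨h1, h2⟩).le
    intro q hq
    rcases hq.1.eq_or_lt with h | h
    · rw [h]
    rcases hq.2.eq_or_lt with h' | h'
    · rw [h', hVlr]
    exact this q ⟨h, h'⟩
  -- A critical point at the limit energy is nondegenerate. A saddle is excluded by the distance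
  -- `δ`, and a minimum because `V` does not exceed the limit energy on `[l, r]`.
  have hcrit : ∀ q ∈ Icc l r, V q = V l → deriv V q ≠ 0 := by
    intro q hq he h0
    rcases (hs q h0).lt_or_gt with h | h
    · have h1 := ge_of_tendsto' ((hel.sub_const (V q)).abs) fun n => hsad n q ⟨h0, h⟩
      rw [he, sub_self, abs_zero] at h1
      linarith
    · obtain ⟨x, hx, hlt⟩ := exists_lt_of_min hV hlr hq h0 h
      linarith [hle x hx]
  refine ⟨⟨V l, l, r, hlr, rfl, hVlr, fun q hq => ?_, ?_, ?_⟩, rfl, rfl, hel, hact⟩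
  · refine lt_of_le_of_ne (hle q (Ioo_subset_Icc_self hq)) fun he => ?_
    refine hcrit q (Ioo_subset_Icc_self hq) he (IsLocalMax.deriv_eq_zero ?_)
    filter_upwards [Ioo_mem_nhds hq.1 hq.2] with x hx
    rw [he]; exact hle x (Ioo_subset_Icc_self hx)
  · refine lt_of_le_of_ne (le_of_tendsto' ((hd.tendsto l).comp hl) fun n => (L n).deriv_left.le)
      (hcrit l (left_mem_Icc.2 hlr.le) rfl)
  · refine lt_of_le_of_ne (ge_of_tendsto' ((hd.tendsto r).comp hr) fun n => (L n).deriv_right.le)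
      (hcrit r (right_mem_Icc.2 hlr.le) hVlr).symm

/-- A point of `[a, b]` other than `b` already lies between `a` and some `x n`; only `b` itself
needs a separate hypothesis. -/
theorem ne_zero_of_tendsto {f : ℝ → ℝ} {x : ℕ → ℝ} {a b : ℝ} (hx : Tendsto x atTop (𝓝 b))
    (hb : f b ≠ 0) (h : ∀ n, ∀ q ∈ uIcc a (x n), f q ≠ 0) :
    ∀ q ∈ uIcc a b, f q ≠ 0 := by
  intro q hq
  by_cases hqb : q = b
  · rwa [hqb]
  rcases le_total a b with hab | hab
  · rw [uIcc_of_le hab] at hq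
    obtain ⟨n, hn⟩ := (hx.eventually (lt_mem_nhds (lt_of_le_of_ne hq.2 hqb))).exists
    exact h n q (mem_uIcc_of_le hq.1 hn.le)
  · rw [uIcc_of_ge hab] at hq
    obtain ⟨n, hn⟩ := (hx.eventually (gt_mem_nhds (lt_of_le_of_ne hq.1 (Ne.symm hqb)))).exists
    exact h n q (mem_uIcc_of_ge hn.le hq.2)

theorem SameBranch.of_tendsto {B L' : Leaf V} {L : ℕ → Leaf V} (h : ∀ n, B.SameBranch (L n))
    (hl : Tendsto (fun n => (L n).left) atTop (𝓝 L'.left))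
    (hr : Tendsto (fun n => (L n).right) atTop (𝓝 L'.right)) : B.SameBranch L' :=
  ⟨ne_zero_of_tendsto hl L'.deriv_left.ne fun n => (h n).1,
    ne_zero_of_tendsto hr L'.deriv_right.ne' fun n => (h n).2⟩

/-- Off the wall energy, all late terms are of one kind. If they stay off the wall, their tangent
leaf is the same for all of them, and branches are closed under limits that are regular leaves. -/
theorem OnWallBranch.of_tendsto (hV : ContDiff ℝ 1 V) {L' : Leaf V} {L : ℕ → Leaf V}
    (h : ∀ n, (L n).OnWallBranch) (hl : Tendsto (fun n => (L n).left) atTop (𝓝 L'.left))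
    (hr : Tendsto (fun n => (L n).right) atTop (𝓝 L'.right)) (he : L'.energy ≠ V 0) :
    L'.OnWallBranch := by
  have hel : Tendsto (fun n => (L n).energy) atTop (𝓝 L'.energy) := by
    rw [← L'.left_eq]
    exact ((hV.continuous.tendsto _).comp hl).congr fun n => (L n).left_eq
  refine ⟨lt_of_le_of_ne (ge_of_tendsto' hr fun n => (h n).1.le) fun h0 => ?_, ?_⟩
  · rw [← L'.right_eq, ← h0] at he; exact he rfl
  rcases he.lt_or_gt with he | he
  · right
    obtain ⟨N, hN⟩ := eventually_atTop.1 (hel.eventually (gt_mem_nhds he))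
    have key : ∀ n, N ≤ n → ∃ Lt : Leaf V, Lt.energy = V 0 ∧ Lt.left = 0 ∧ Lt.SameBranch (L n) :=
      fun n hn => (h n).2.resolve_left ((h n).left_pos hV (hN n hn)).not_ge
    obtain ⟨Lt, hte, htl, hts⟩ := key N le_rfl
    refine ⟨Lt, hte, htl, SameBranch.of_tendsto (L := fun n => L (n + N)) (fun n => ?_)
      ((tendsto_add_atTop_iff_nat N).2 hl) ((tendsto_add_atTop_iff_nat N).2 hr)⟩
    obtain ⟨Lt', hte', htl', hts'⟩ := key (n + N) (by omega)
    have : Lt = Lt' := eq_of_inter (q := 0) (hte.trans hte'.symm)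
      ⟨htl.le, by rw [← htl]; exact Lt.left_lt_right⟩
      ⟨htl'.le, by rw [← htl']; exact Lt'.left_lt_right⟩
    rwa [this]
  · left
    refine le_of_tendsto hl ?_
    filter_upwards [hel.eventually (lt_mem_nhds he)] with n hn using ((h n).left_neg hV hn).le

end Leaf

namespace ImpactSystem

variable {S : ImpactSystem}

/-- The actions of the tori which are not tangent to the wall. -/
def transverseActions (S : ImpactSystem) (B : Leaf S.V₂) (H : ℝ) : Set ℝ :=
  {I | ∃ L₁ L₂, S.IsTorus B H I L₁ L₂ ∧ L₁.energy ≠ S.V₁ 0}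

namespace IsRegular

theorem isOpen_transverseActions (hS : S.IsRegular) (B : Leaf S.V₂) (H : ℝ) :
    IsOpen (S.transverseActions B H) := by
  rw [isOpen_iff_mem_nhds]
  rintro I ⟨L₁, L₂, h, he⟩
  obtain ⟨M, hM⟩ := hS.exists_confined H
  obtain ⟨ρ₁, ι, ρ₂, τ, _, _, _, _, _, _, _, hfam⟩ := hS.exists_torus_family hM h he
  filter_upwards [hfam] with J ⟨L₁', L₂', h', _, _, _, _, _, he'⟩
  exact ⟨L₁', L₂', h', he'⟩

/-- The turning points are confined, so a sequence of regular tori has a subsequence whose turning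
points converge. The margins `δ`, `η` make the limit leaves regular and `ρ` keeps them off tangency.
Thus the closure of the regular actions is a compact subset of the open set of transverse actions,
and a compact set fits between. -/
theorem exists_compact_actions (hS : S.IsRegular)
    (hs₁ : ∀ q, deriv S.V₁ q = 0 → deriv (deriv S.V₁) q ≠ 0)
    (hs₂ : ∀ q, deriv S.V₂ q = 0 → deriv (deriv S.V₂) q ≠ 0)
    (B : Leaf S.V₂) (H : ℝ) {δ ρ η : ℝ} (hδ : 0 < δ) (hρ : 0 < ρ) (hη : 0 < η) :
    ∃ K, IsCompact K ∧ S.regularActions B H δ ρ η ⊆ interior K ∧ K ⊆ S.transverseActions B H := by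
  obtain ⟨M, hM⟩ := hS.exists_confined H
  have hc₁ : ContDiff ℝ 2 S.V₁ := hS.contDiff₁.of_le (by norm_num)
  have hc₂ : ContDiff ℝ 2 S.V₂ := hS.contDiff₂.of_le (by norm_num)
  have hbd : ∀ L : Leaf S.V₂, L.InBox M → (L.energy, L.left, L.right) ∈
      (S.V₂ '' Icc (-M) M) ×ˢ Icc (-M) M ×ˢ Icc (-M) M := fun L hL =>
    have hl : L.left ∈ Icc (-M) M := ⟨hL.1.le, (L.left_lt_right.trans hL.2).le⟩
    ⟨⟨L.left, hl, L.left_eq⟩, hl, (hL.1.trans L.left_lt_right).le, hL.2.le⟩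
  have hbdd : Bornology.IsBounded (S.regularActions B H δ ρ η) := by
    have hcomp : IsCompact ((S.V₂ '' Icc (-M) M) ×ˢ Icc (-M) M ×ˢ Icc (-M) M) :=
      (isCompact_Icc.image hc₂.continuous).prod (isCompact_Icc.prod isCompact_Icc)
    refine (hcomp.image (continuous_const (y := Real.pi⁻¹) |>.mul
      (Leaf.continuous_integral_sqrt hc₂.continuous))).isBounded.subset ?_
    rintro I ⟨L₁, L₂, h, -⟩
    exact ⟨_, hbd L₂ (hS.inBox₂ hM h), h.2.2.1⟩
  have hsub : closure (S.regularActions B H δ ρ η) ⊆ S.transverseActions B H := by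
    intro I hI
    obtain ⟨J, hJ, hJI⟩ := mem_closure_iff_seq_limit.1 hI
    choose L₁ L₂ ht hreg htan h2 h1 using hJ
    have hmem : ∀ n, (((L₁ n).left, (L₁ n).right), ((L₂ n).left, (L₂ n).right)) ∈
        (Icc (-M) M ×ˢ Icc (-M) M) ×ˢ (Icc (-M) M ×ˢ Icc (-M) M) := by
      intro n
      have b1 := hS.inBox₁ hM (ht n)
      have b2 := hS.inBox₂ hM (ht n)
      exact ⟨⟨⟨b1.1.le, ((L₁ n).left_lt_right.trans b1.2).le⟩,
        (b1.1.trans (L₁ n).left_lt_right).le, b1.2.le⟩,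
        ⟨b2.1.le, ((L₂ n).left_lt_right.trans b2.2).le⟩,
        (b2.1.trans (L₂ n).left_lt_right).le, b2.2.le⟩
    obtain ⟨⟨⟨l₁, r₁⟩, l₂, r₂⟩, -, φ, hφ, hlim⟩ := ((isCompact_Icc.prod isCompact_Icc).prod
      (isCompact_Icc.prod isCompact_Icc)).tendsto_subseq hmem
    have hl₁ : Tendsto (fun n => (L₁ (φ n)).left) atTop (𝓝 l₁) :=
      ((continuous_fst.comp continuous_fst).tendsto _).comp hlim
    have hr₁ : Tendsto (fun n => (L₁ (φ n)).right) atTop (𝓝 r₁) :=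
      ((continuous_snd.comp continuous_fst).tendsto _).comp hlim
    have hl₂ : Tendsto (fun n => (L₂ (φ n)).left) atTop (𝓝 l₂) :=
      ((continuous_fst.comp continuous_snd).tendsto _).comp hlim
    have hr₂ : Tendsto (fun n => (L₂ (φ n)).right) atTop (𝓝 r₂) :=
      ((continuous_snd.comp continuous_snd).tendsto _).comp hlim
    obtain ⟨K₂, rfl, rfl, he₂, ha₂⟩ := Leaf.exists_limit hc₂ hs₂ hδ hη hl₂ hr₂
      (fun n => by rw [(ht (φ n)).2.2.1]; exact h2 _) (fun n => (hreg (φ n)).2.1)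
    -- The two energies add up to `H`, so the condition on `H` minus the saddle energies of `V₁`
    -- keeps the energy of the first leaf away from those saddles.
    obtain ⟨K₁, rfl, rfl, he₁, ha₁⟩ := Leaf.exists_limit hc₁ hs₁ hδ hη hl₁ hr₁
      (fun n => h1 (φ n)) (fun n q hq => by
        have h := (hreg (φ n)).2.2 q hq
        have hH := (ht (φ n)).2.2.2
        rwa [show (L₂ (φ n)).energy - (H - S.V₁ q) = -((L₁ (φ n)).energy - S.V₁ q) by linarith,
          abs_neg] at h)
    have hH : K₁.energy + K₂.energy = H := tendsto_nhds_unique (he₁.add he₂)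
      (tendsto_const_nhds.congr fun n => (ht (φ n)).2.2.2.symm)
    have hB : B.SameBranch K₂ := Leaf.SameBranch.of_tendsto (fun n => (ht (φ n)).2.1) hl₂ hr₂
    have hJ₂ : Tendsto (fun n => J (φ n)) atTop (𝓝 K₂.action) :=
      ha₂.congr fun n => (ht (φ n)).2.2.1
    -- If the limit were tangent, its second leaf would be the tangent one on this branch, and
    -- actions at distance at least `ρ` from its action could not converge to it.
    have hne : K₁.energy ≠ S.V₁ 0 := by
      intro he
      have h := ge_of_tendsto' ((hJ₂.sub_const K₂.action).abs)
        fun n => htan (φ n) K₂ hB (by linarith)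
      rw [sub_self, abs_zero] at h
      linarith
    exact ⟨K₁, K₂, ⟨Leaf.OnWallBranch.of_tendsto (hc₁.of_le (by norm_num))
      (fun n => (ht (φ n)).1) hl₁ hr₁ hne, hB,
      tendsto_nhds_unique hJ₂ (hJI.comp hφ.tendsto_atTop), hH⟩, hne⟩
  obtain ⟨K, hK, hK1, hK2⟩ := exists_compact_between hbdd.isCompact_closure
    (hS.isOpen_transverseActions B H) hsub
  exact ⟨K, hK, subset_closure.trans hK1, hK2⟩

end IsRegular
end ImpactSystem
end Compactness

/-! ### Action-angle coordinates of the second degree of freedom -/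

section ActionAngle

namespace ImpactSystem

variable (S : ImpactSystem) (B : Leaf S.V₂) (H : ℝ)

open Classical in
/-- A function of the leaves of a torus, as a function of the action. -/
def torusValue (φ : Leaf S.V₁ → Leaf S.V₂ → ℝ) (I : ℝ) : ℝ :=
  if h : ∃ L : Leaf S.V₁ × Leaf S.V₂, S.IsTorus B H I L.1 L.2 then φ h.choose.1 h.choose.2 else 0

/-- The right turning point of the first degree of freedom. -/
def right₁ : ℝ → ℝ := S.torusValue B H fun L _ => L.right

/-- The time from the right turning point to the wall or the left turning point. -/
def halfTime₁ : ℝ → ℝ := S.torusValue B H fun L _ => L.impactPeriod / 2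

/-- The right turning point of the second degree of freedom. -/
def right₂ : ℝ → ℝ := S.torusValue B H fun _ L => L.right

/-- Half of the period of the second degree of freedom. -/
def halfPeriod₂ : ℝ → ℝ := S.torusValue B H fun _ L => L.period / 2

/-- The point of the `(q₂, p₂)` plane with given action and angle. -/
def angleMap (M : ℝ) (x : ℝ × ℝ) : ℝ × ℝ :=
  orb (cut M S.V₂) (S.right₂ B H x.1) (x.2 * S.halfPeriod₂ B H x.1 / Real.pi)

variable {S B H}

namespace IsRegular

variable {I M : ℝ} {L₁ : Leaf S.V₁} {L₂ : Leaf S.V₂}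

theorem torusValue_eq (hS : S.IsRegular) (h : S.IsTorus B H I L₁ L₂)
    (φ : Leaf S.V₁ → Leaf S.V₂ → ℝ) : S.torusValue B H φ I = φ L₁ L₂ := by
  have hex : ∃ L : Leaf S.V₁ × Leaf S.V₂, S.IsTorus B H I L.1 L.2 := ⟨(L₁, L₂), h⟩
  unfold torusValue
  rw [dif_pos hex]
  obtain ⟨h1, h2⟩ := hS.torus_unique hex.choose_spec h
  rw [h1, h2]

theorem right₁_eq (hS : S.IsRegular) (h : S.IsTorus B H I L₁ L₂) : S.right₁ B H I = L₁.right :=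
  hS.torusValue_eq h _

theorem halfTime₁_eq (hS : S.IsRegular) (h : S.IsTorus B H I L₁ L₂) :
    S.halfTime₁ B H I = L₁.impactPeriod / 2 :=
  hS.torusValue_eq h _

theorem right₂_eq (hS : S.IsRegular) (h : S.IsTorus B H I L₁ L₂) : S.right₂ B H I = L₂.right :=
  hS.torusValue_eq h _

theorem halfPeriod₂_eq (hS : S.IsRegular) (h : S.IsTorus B H I L₁ L₂) :
    S.halfPeriod₂ B H I = L₂.period / 2 :=
  hS.torusValue_eq h _

theorem period₂_pos (hS : S.IsRegular) (hM : S.Confined H M) (h : S.IsTorus B H I L₁ L₂) :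
    0 < L₂.period := by
  have := (isGlobalPotential_cut hS.contDiff₂ M).period_pos
    (L₂.congr (hS.inBox₂ hM h).eventuallyEq_cut)
  rwa [Leaf.congr_period] at this

theorem rotation_eq_halfTime (hS : S.IsRegular) (h : S.IsTorus B H I L₁ L₂) :
    S.rotation B H I = 2 * S.halfTime₁ B H I * Real.pi / S.halfPeriod₂ B H I := by
  rw [hS.rotation_eq h, hS.halfTime₁_eq h, hS.halfPeriod₂_eq h]
  by_cases h0 : L₂.period = 0
  · simp [h0]
  · field_simp

/-- Smoothness of the turning points and of the period, continuity of the impact time, and the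
local constancy of the type of the torus. -/
theorem torus_regularity (hS : S.IsRegular) (hM : S.Confined H M)
    (hI : I ∈ S.transverseActions B H) :
    (∀ n : ℕ, n ≠ 0 → ContDiff ℝ (n + 1 : ℕ) S.V₁ → ContDiff ℝ (n + 1 : ℕ) S.V₂ →
      ContDiffAt ℝ n (S.right₁ B H) I ∧ ContDiffAt ℝ n (S.right₂ B H) I ∧
        ContDiffAt ℝ n (S.halfPeriod₂ B H) I) ∧
      ContinuousAt (S.halfTime₁ B H) I ∧
      HasDerivAt (fun I => S.V₂ (S.right₂ B H I)) (Real.pi / S.halfPeriod₂ B H I) I ∧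
      ∀ᶠ J in 𝓝 I, (S.V₁ (S.right₁ B H J) < S.V₁ 0 ↔ S.V₁ (S.right₁ B H I) < S.V₁ 0) := by
  obtain ⟨L₁, L₂, h, he⟩ := hI
  obtain ⟨ρ₁, ι, ρ₂, τ, h1, h2, h3, h4, hreg, hι, hd, hfam⟩ := hS.exists_torus_family hM h he
  have e1 : S.right₁ B H =ᶠ[𝓝 I] ρ₁ := by
    filter_upwards [hfam] with J ⟨L₁', L₂', h', hJ, _⟩
    rw [hS.right₁_eq h', hJ]
  have e2 : S.halfTime₁ B H =ᶠ[𝓝 I] ι := by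
    filter_upwards [hfam] with J ⟨L₁', L₂', h', _, hJ, _⟩
    rw [hS.halfTime₁_eq h', hJ]; ring
  have e3 : S.right₂ B H =ᶠ[𝓝 I] ρ₂ := by
    filter_upwards [hfam] with J ⟨L₁', L₂', h', _, _, hJ, _⟩
    rw [hS.right₂_eq h', hJ]
  have e4 : S.halfPeriod₂ B H =ᶠ[𝓝 I] τ := by
    filter_upwards [hfam] with J ⟨L₁', L₂', h', _, _, _, hJ, _⟩
    rw [hS.halfPeriod₂_eq h', hJ]; ring
  refine ⟨fun n hn0 hn₁ hn₂ => ?_, hι.congr e2.symm, ?_, ?_⟩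
  · obtain ⟨r1, r2, r3⟩ := hreg n hn0 hn₁ hn₂
    exact ⟨r1.congr_of_eventuallyEq e1, r2.congr_of_eventuallyEq e3, r3.congr_of_eventuallyEq e4⟩
  · have : Real.pi / S.halfPeriod₂ B H I = 2 * Real.pi / L₂.period := by
      rw [hS.halfPeriod₂_eq h]
      have := (hS.period₂_pos hM h).ne'
      field_simp
    rw [this]
    exact hd.congr_of_eventuallyEq (e3.fun_comp S.V₂)
  · filter_upwards [hfam] with J ⟨L₁', L₂', h', _, _, _, _, hJ, _⟩
    rw [hS.right₁_eq h', hS.right₁_eq h, L₁'.right_eq, L₁.right_eq, hJ]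

theorem angleMap_eq (hS : S.IsRegular) (h : S.IsTorus B H I L₁ L₂) (θ : ℝ) :
    S.angleMap B H M (I, θ) = orb (cut M S.V₂) L₂.right (θ * L₂.period / (2 * Real.pi)) := by
  rw [angleMap, hS.right₂_eq h, hS.halfPeriod₂_eq h]
  congr 1
  ring

theorem angleMap_add_two_pi (hS : S.IsRegular) (hM : S.Confined H M) (x : ℝ × ℝ) :
    S.angleMap B H M (x.1, x.2 + 2 * Real.pi) = S.angleMap B H M x := by
  have hπ := Real.pi_ne_zero
  by_cases hex : ∃ L : Leaf S.V₁ × Leaf S.V₂, S.IsTorus B H x.1 L.1 L.2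
  · obtain ⟨⟨L₁, L₂⟩, h⟩ := hex
    have hp := (isGlobalPotential_cut hS.contDiff₂ M).orb_periodic
      (L₂.congr (hS.inBox₂ hM h).eventuallyEq_cut) (x.2 * L₂.period / (2 * Real.pi))
    rw [Leaf.congr_period, Leaf.congr_right] at hp
    rw [hS.angleMap_eq h, show x = (x.1, x.2) from rfl, hS.angleMap_eq h, ← hp]
    congr 1
    field_simp
  · have : S.halfPeriod₂ B H x.1 = 0 := dif_neg hex
    simp [angleMap, this]

/-- `HasAngle` allows any solution of the equation with the original potential. Energy conservation
confines such a solution to the region where the cut off potential agrees with it, so it is the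
orbit of the complete flow; the leaf is determined by its action. -/
theorem hasCoords_iff (hS : S.IsRegular) (hM : S.Confined H M) (h : S.IsTorus B H I L₁ L₂)
    (θ : ℝ) (z : ℝ × ℝ) : HasCoords B I θ z.1 z.2 ↔ z = S.angleMap B H M (I, θ) := by
  have hbox := hS.inBox₂ hM h
  have hW := isGlobalPotential_cut hS.contDiff₂ M
  have hV1 : ContDiff ℝ 1 S.V₂ := hS.contDiff₂.of_le (by norm_num)
  rw [hS.angleMap_eq h]
  constructor
  · rintro ⟨L, hBL, hLa, x, y, hx, hy, hx0, hy0, hxθ, hyθ⟩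
    obtain rfl : L = L₂ := (hBL.symm.trans h.2.1).eq_of_action hV1 (hLa.trans h.2.2.1.symm)
    have hen : ∀ t, y t ^ 2 / 2 + S.V₂ (x t) = L.energy := by
      have hd : ∀ t, HasDerivAt (fun t => y t ^ 2 / 2 + S.V₂ (x t)) 0 t := by
        intro t
        have h1 := ((hy t).fun_pow 2).div_const 2
        have h2 := ((hV1.differentiable one_ne_zero) (x t)).hasDerivAt.comp t (hx t)
        refine (h1.add h2).congr_deriv ?_
        simp only [Nat.cast_ofNat]; ring
      intro t
      have := is_const_of_deriv_eq_zero (fun t => (hd t).differentiableAt) (fun t => (hd t).deriv) t 0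
      simpa [hx0, hy0, L.right_eq] using this
    have hin : ∀ t, x t ∈ Icc (-M) M := by
      intro t
      have := hM.2 (x t) (by nlinarith [hen t, sq_nonneg (y t), hS.energy₂_le h])
      exact abs_le.1 this.le
    have hflow := hW.field.eq_flow (γ := fun t => (x t, y t)) fun t => by
      have := (hx t).prodMk (hy t)
      rwa [← (cut_eventuallyEq S.V₂ (hin t)).deriv_eq] at this
    simp only [hx0, hy0] at hflow
    rw [orb, ← hflow]
    exact Prod.ext hxθ.symm hyθ.symm
  · intro hz
    refine ⟨L₂, h.2.1, h.2.2.1, fun t => (orb (cut M S.V₂) L₂.right t).1,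
      fun t => (orb (cut M S.V₂) L₂.right t).2, fun t => hW.hasDerivAt_fst _ t, fun t => ?_,
      by simp [IsGlobalPotential.orb_zero], by simp [IsGlobalPotential.orb_zero],
      by rw [hz], by rw [hz]⟩
    have hin := hW.orb_mem_Icc (L₂.congr hbox.eventuallyEq_cut) t
    simp only [Leaf.congr_left, Leaf.congr_right] at hin
    rw [← (cut_eventuallyEq S.V₂ ⟨hbox.1.le.trans hin.1, hin.2.trans hbox.2.le⟩).deriv_eq]
    exact hW.hasDerivAt_snd _ t

theorem contDiffAt_angleMap (hS : S.IsRegular) (hM : S.Confined H M) {n : ℕ} (hn0 : n ≠ 0)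
    (hn₁ : ContDiff ℝ (n + 1 : ℕ) S.V₁) (hn₂ : ContDiff ℝ (n + 1 : ℕ) S.V₂) {x : ℝ × ℝ}
    (hI : x.1 ∈ S.transverseActions B H) : ContDiffAt ℝ n (S.angleMap B H M) x := by
  obtain ⟨-, h2, h3⟩ := (hS.torus_regularity hM hI).1 n hn0 hn₁ hn₂
  have hW := isGlobalPotential_cut hS.contDiff₂ M
  have h2' : ContDiffAt ℝ n (fun x : ℝ × ℝ => S.right₂ B H x.1) x := h2.comp x contDiffAt_fst
  have h3' : ContDiffAt ℝ n (fun x : ℝ × ℝ => S.halfPeriod₂ B H x.1) x := h3.comp x contDiffAt_fst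
  exact ((hW.contDiff_orb hn0 (contDiff_cut hn₂ M)).contDiffAt).comp x
    (h2'.prodMk ((contDiffAt_snd.mul h3').div_const _))

/-- The coordinates are symplectic. -/
theorem area_fderiv_angleMap (hS : S.IsRegular) (hM : S.Confined H M) {x : ℝ × ℝ}
    (hI : x.1 ∈ S.transverseActions B H) (a b : ℝ × ℝ) :
    area (fderiv ℝ (S.angleMap B H M) x a) (fderiv ℝ (S.angleMap B H M) x b) =
      a.2 * b.1 - a.1 * b.2 := by
  have hW := isGlobalPotential_cut hS.contDiff₂ M
  obtain ⟨hreg, -, hd, -⟩ := hS.torus_regularity hM hI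
  obtain ⟨-, h2, h3⟩ := hreg 2 two_ne_zero hS.contDiff₁ hS.contDiff₂
  obtain ⟨L₁, L₂, h, he⟩ := hI
  have hbox := hS.inBox₂ hM h
  have hτ : S.halfPeriod₂ B H x.1 ≠ 0 := by
    rw [hS.halfPeriod₂_eq h]; exact (half_pos (hS.period₂_pos hM h)).ne'
  have hR : HasFDerivAt (fun x : ℝ × ℝ => S.right₂ B H x.1)
      (deriv (S.right₂ B H) x.1 • ContinuousLinearMap.fst ℝ ℝ ℝ) x :=
    (h2.differentiableAt (by norm_num)).hasDerivAt.comp_hasFDerivAt x hasFDerivAt_fst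
  have hT : HasFDerivAt (fun x : ℝ × ℝ => S.halfPeriod₂ B H x.1)
      (deriv (S.halfPeriod₂ B H) x.1 • ContinuousLinearMap.fst ℝ ℝ ℝ) x :=
    (h3.differentiableAt (by norm_num)).hasDerivAt.comp_hasFDerivAt x hasFDerivAt_fst
  have hz := hR.prodMk (hasFDerivAt_const (0 : ℝ) x)
  have htime := ((hasFDerivAt_snd (𝕜 := ℝ) (p := x)).mul hT).mul_const (Real.pi⁻¹)
  -- The initial points `(R(I), 0)` lie on a line, where the area form vanishes. What remains is `dt
  -- ∧ dE` with `t = θ · halfPeriod / π` and `dE = (π / halfPeriod) dI`, that is `dθ ∧ dI`, opposite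
  -- to the orientation `dI ∧ dθ`.
  obtain ⟨L, hL, hpull⟩ := hW.hamiltonian.pullback_flow hz htime
  have hfd : fderiv ℝ (S.angleMap B H M) x = L := by
    refine HasFDerivAt.fderiv (hL.congr_of_eventuallyEq (Eventually.of_forall fun y => ?_))
    simp only [angleMap, orb, div_eq_mul_inv]
    rfl
  rw [hfd, hpull a b]
  have hen : ∀ v : ℝ, fderiv ℝ (energy1 (cut M S.V₂)) (S.right₂ B H x.1, 0) (v, 0) =
      deriv S.V₂ (S.right₂ B H x.1) * v := by
    intro v
    rw [← hW.hamiltonian.apply_field, area_apply]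
    have hin : S.right₂ B H x.1 ∈ Icc (-M) M := by
      rw [hS.right₂_eq h]; exact ⟨(hbox.1.trans L₂.left_lt_right).le, hbox.2.le⟩
    simp [field1, (cut_eventuallyEq S.V₂ hin).deriv_eq]
  have hchain : deriv S.V₂ (S.right₂ B H x.1) * deriv (S.right₂ B H) x.1 =
      Real.pi / S.halfPeriod₂ B H x.1 := by
    refine HasDerivAt.unique ?_ hd
    exact ((hS.contDiff₂.differentiable (by norm_num)) _).hasDerivAt.comp x.1
      (h2.differentiableAt (by norm_num)).hasDerivAt
  simp only [ContinuousLinearMap.prod_apply, _root_.smul_apply, ContinuousLinearMap.coe_fst',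
    smul_eq_mul, _root_.zero_apply, _root_.add_apply, ContinuousLinearMap.coe_snd',
    hen, ← mul_assoc, hchain, area_apply]
  have hπ := Real.pi_ne_zero
  field_simp
  ring

end IsRegular
end ImpactSystem
end ActionAngle

/-! ### The implicit function theorem along a compact set of solutions -/

section ImplicitSolution

variable {X E Y Z : Type*} [NormedAddCommGroup X] [NormedSpace ℝ X] [CompleteSpace X]
  [NormedAddCommGroup E] [NormedSpace ℝ E] [CompleteSpace E]
  [NormedAddCommGroup Y] [NormedSpace ℝ Y] [CompleteSpace Y]
  [NormedAddCommGroup Z] [NormedSpace ℝ Z] [CompleteSpace Z]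

/-- Solutions of an equation which is nondegenerate along a compact set of unperturbed solutions
are given by one function near this set. -/
theorem exists_solution_map {N : ℕ} (hN : N ≠ 0) {Φ : (X × E) × Y → Z} {y₀ : X → Y} {K : Set X}
    (hK : IsCompact K) (hy : ∀ x ∈ K, ContinuousAt y₀ x)
    (hΦ : ∀ x ∈ K, ContDiffAt ℝ N Φ ((x, 0), y₀ x)) (h0 : ∀ x ∈ K, Φ ((x, 0), y₀ x) = 0)
    (hinv : ∀ x ∈ K, (fderiv ℝ Φ ((x, 0), y₀ x) ∘L .inr ℝ (X × E) Y).IsInvertible) :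
    ∃ u : X × E → Y, (∀ x ∈ K, ContDiffAt ℝ N u (x, 0) ∧ u (x, 0) = y₀ x ∧
        ∀ᶠ p in 𝓝 ((x, 0) : X × E), Φ (p, u p) = 0) ∧
      ∀ x x', y₀ x = y₀ x' → (∀ e y, Φ ((x, e), y) = Φ ((x', e), y)) →
        ∀ e, u (x, e) = u (x', e) := by
  classical
  have hN' : (N : WithTop ℕ∞) ≠ 0 := by exact_mod_cast hN
  have hloc : ∀ x ∈ K, ∃ ψ : X × E → Y, ContDiffAt ℝ N ψ (x, 0) ∧ ψ (x, 0) = y₀ x ∧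
      (∀ᶠ p in 𝓝 ((x, 0) : X × E), Φ (p, ψ p) = 0) ∧
      ∀ᶠ v in 𝓝 (((x, 0), y₀ x) : (X × E) × Y), Φ v = 0 ↔ ψ v.1 = v.2 := by
    intro x hx
    have h1 := (hΦ x hx).eventually_apply_implicitFunction hN' (hinv x hx)
    have h2 := (hΦ x hx).eventually_apply_eq_iff_implicitFunction hN' (hinv x hx)
    rw [h0 x hx] at h1 h2
    exact ⟨_, (hΦ x hx).contDiffAt_implicitFunction hN' (hinv x hx),
      (hΦ x hx).implicitFunction_apply_self hN' (hinv x hx), h1, h2⟩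
  have hy' : ∀ x ∈ K, ContinuousAt (fun p : X × E => y₀ p.1) (x, 0) := fun x hx =>
    ContinuousAt.comp (f := Prod.fst) (hy x hx) continuousAt_fst
  -- Local solutions are glued through uniqueness. Compactness gives one radius `α` such that near
  -- the unperturbed set an equation has at most one solution within `α` of `y₀`.
  have huniq : ∃ α > 0, ∀ x ∈ K, ∀ᶠ p in 𝓝 ((x, 0) : X × E), ∀ y y', dist y (y₀ p.1) < α →
      dist y' (y₀ p.1) < α → Φ (p, y) = 0 → Φ (p, y') = 0 → y = y' := by
    refine hK.induction_on (p := fun s => ∃ α > 0, ∀ x ∈ s, ∀ᶠ p in 𝓝 ((x, 0) : X × E), ∀ y y',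
      dist y (y₀ p.1) < α → dist y' (y₀ p.1) < α → Φ (p, y) = 0 → Φ (p, y') = 0 → y = y')
      ⟨1, one_pos, by simp⟩ ?_ ?_ ?_
    · rintro s t hst ⟨α, hα, h⟩
      exact ⟨α, hα, fun x hx => h x (hst hx)⟩
    · rintro s t ⟨α, hα, h⟩ ⟨β, hβ, h'⟩
      refine ⟨min α β, lt_min hα hβ, fun x hx => ?_⟩
      rcases hx with hx | hx
      · filter_upwards [h x hx] with p hp y y' h1 h2
        exact hp y y' (h1.trans_le (min_le_left _ _)) (h2.trans_le (min_le_left _ _))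
      · filter_upwards [h' x hx] with p hp y y' h1 h2
        exact hp y y' (h1.trans_le (min_le_right _ _)) (h2.trans_le (min_le_right _ _))
    · intro x hx
      obtain ⟨ψ, -, -, -, hψ⟩ := hloc x hx
      rw [nhds_prod_eq] at hψ
      obtain ⟨P, hP, R, hR, hPR⟩ := eventually_prod_iff.1 hψ
      obtain ⟨c, hc, hcR⟩ := Metric.eventually_nhds_iff.1 hR
      have hR' : ∀ᶠ p in 𝓝 ((x, 0) : X × E), ∀ y y', dist y (y₀ p.1) < c / 2 →
          dist y' (y₀ p.1) < c / 2 → Φ (p, y) = 0 → Φ (p, y') = 0 → y = y' := by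
        have hd := hy' x hx (Metric.ball_mem_nhds (y₀ x) (half_pos hc))
        filter_upwards [hP, hd] with p hp hd y y' h1 h2 e1 e2
        have hd : dist (y₀ p.1) (y₀ x) < c / 2 := hd
        have key : ∀ y, dist y (y₀ p.1) < c / 2 → Φ (p, y) = 0 → ψ p = y := fun y h e =>
          (hPR hp (hcR (by linarith [dist_triangle y (y₀ p.1) (y₀ x)]))).1 e
        rw [← key y h1 e1, ← key y' h2 e2]
      have hcont : ContinuousAt (fun x' : X => ((x', 0) : X × E)) x := by fun_prop
      exact ⟨_, mem_nhdsWithin_of_mem_nhds (hcont.eventually hR'.eventually_nhds), c / 2,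
        half_pos hc, fun x' hx' => hx'⟩
  obtain ⟨α, hα, huniq⟩ := huniq
  -- The value is chosen from a set which depends on `x` only through `y₀ x` and the equation at
  -- `x`. Any symmetry of these data, periodicity in particular, passes exactly to `u`.
  set u : X × E → Y := fun p => if h : ∃ y, dist y (y₀ p.1) < α ∧ Φ (p, y) = 0 then h.choose else 0
    with hu
  refine ⟨u, fun x hx => ?_, ?_⟩
  · obtain ⟨ψ, hψN, hψ0, hψ, -⟩ := hloc x hx
    have hball : ∀ᶠ p in 𝓝 ((x, 0) : X × E), dist (ψ p) (y₀ p.1) < α := by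
      have h1 : Tendsto (fun p => dist (ψ p) (y₀ p.1)) (𝓝 (x, 0)) (𝓝 (dist (ψ (x, 0)) (y₀ x))) :=
        hψN.continuousAt.dist (hy' x hx)
      rw [hψ0, dist_self] at h1
      exact h1.eventually (gt_mem_nhds hα)
    have heq : u =ᶠ[𝓝 (x, 0)] ψ := by
      filter_upwards [hψ, hball, huniq x hx] with p h1 h2 h3
      have hex : ∃ y, dist y (y₀ p.1) < α ∧ Φ (p, y) = 0 := ⟨ψ p, h2, h1⟩
      simp only [hu]
      rw [dif_pos hex]
      exact h3 _ _ hex.choose_spec.1 h2 hex.choose_spec.2 h1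
    refine ⟨hψN.congr_of_eventuallyEq heq, heq.eq_of_nhds.trans hψ0, ?_⟩
    filter_upwards [heq, hψ] with p h1 h2
    rwa [h1]
  · intro x x' hxx hΦx e
    simp only [hu, hxx, hΦx]

end ImplicitSolution

/-! ### Dependence of derivatives on a parameter -/

section DerivativeBounds

theorem eventually_norm_sub_lt {X E F : Type*} [TopologicalSpace X] [TopologicalSpace E] [Zero E]
    [SeminormedAddCommGroup F] {T : X × E → F} {K : Set X} (hK : IsCompact K)
    (hT : ∀ x ∈ K, ContinuousAt T (x, 0)) {μ : ℝ} (hμ : 0 < μ) :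
    ∀ᶠ e in 𝓝 (0 : E), ∀ x ∈ K, ‖T (x, e) - T (x, 0)‖ < μ := by
  refine hK.eventually_forall_of_forall_eventually fun x hx => ?_
  have h1 : ContinuousAt (fun p : E × X => T (p.2, p.1)) (0, x) :=
    ContinuousAt.comp (f := fun p : E × X => (p.2, p.1)) (hT x hx) (by fun_prop)
  have h2 : ContinuousAt (fun p : E × X => T (p.2, 0)) (0, x) :=
    ContinuousAt.comp (f := fun p : E × X => (p.2, (0 : E))) (hT x hx) (by fun_prop)
  have h3 : Tendsto (fun p : E × X => ‖T (p.2, p.1) - T (p.2, 0)‖) (𝓝 (0, x))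
      (𝓝 ‖T (x, 0) - T (x, 0)‖) := (h1.sub h2).norm
  rw [sub_self, norm_zero] at h3
  exact h3.eventually (gt_mem_nhds hμ)

variable {X E F : Type*} [NormedAddCommGroup X] [NormedSpace ℝ X] [NormedAddCommGroup E]
  [NormedSpace ℝ E] [NormedAddCommGroup F] [NormedSpace ℝ F]

/-- The derivatives with respect to the first variable depend smoothly on both. -/
theorem contDiffAt_iteratedFDeriv_left {u : X × E → F} {p : X × E} :
    ∀ j k : ℕ, ContDiffAt ℝ (j + k : ℕ) u p →
      ContDiffAt ℝ k (fun p : X × E => iteratedFDeriv ℝ j (fun x => u (x, p.2)) p.1) p := by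
  intro j
  induction j with
  | zero =>
    intro k hu
    rw [zero_add] at hu
    have h := (continuousMultilinearCurryFin0 ℝ X F).symm.contDiff (n := (k : WithTop ℕ∞))
    exact h.contDiffAt.comp p hu
  | succ j ih =>
    intro k hu
    have h1 := ih (k + 1) (by rwa [show j + (k + 1) = j + 1 + k by ring])
    have h2 : ContDiffAt ℝ (k + 1 : ℕ) (Function.uncurry fun (p : X × E) x =>
        iteratedFDeriv ℝ j (fun x => u (x, p.2)) x) (p, p.1) :=
      ContDiffAt.comp (f := fun q : (X × E) × X => (q.2, q.1.2))
        (g := fun p : X × E => iteratedFDeriv ℝ j (fun x => u (x, p.2)) p.1) (p, p.1) h1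
        (contDiffAt_snd.prodMk contDiffAt_fst.snd)
    have h3 := h2.fderiv (g := Prod.fst) (m := k) contDiffAt_fst (by norm_cast)
    have h := LinearIsometryEquiv.contDiff (𝕜 := ℝ) (E := X →L[ℝ] (X [×j]→L[ℝ] F))
      (F := X [×(j + 1)]→L[ℝ] F) (n := (k : WithTop ℕ∞))
      (continuousMultilinearCurryLeftEquiv ℝ (fun _ : Fin (j + 1) => X) F).symm
    exact h.contDiffAt.comp p h3

/-- Mean value inequality in `e`: the partial derivative in `e` is continuous, hence bounded on the
compact product of `K` and a closed ball. -/
theorem exists_lipschitz_bound [ProperSpace E] {T : X × E → F} {K : Set X} (hK : IsCompact K)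
    {ε₀ : ℝ} (hε : 0 ≤ ε₀) (hT : ∀ x ∈ K, ∀ e, ‖e‖ ≤ ε₀ → ContDiffAt ℝ 1 T (x, e)) :
    ∃ C, ∀ x ∈ K, ∀ e, ‖e‖ ≤ ε₀ → ‖T (x, e) - T (x, 0)‖ ≤ C * ‖e‖ := by
  have hcomp : IsCompact (K ×ˢ Metric.closedBall (0 : E) ε₀) := hK.prod (isCompact_closedBall _ _)
  have hc : ContinuousOn (fun p => fderiv ℝ T p ∘L .inr ℝ X E)
      (K ×ˢ Metric.closedBall (0 : E) ε₀) := by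
    rintro ⟨x, e⟩ ⟨hx, he⟩
    have := (hT x hx e (mem_closedBall_zero_iff.1 he)).fderiv_right (m := 0) (by norm_num)
    exact (this.continuousAt.clm_comp continuousAt_const).continuousWithinAt
  obtain ⟨C, hC⟩ := hcomp.exists_bound_of_continuousOn hc
  refine ⟨C, fun x hx e he => ?_⟩
  have h := (convex_closedBall (0 : E) ε₀).norm_image_sub_le_of_norm_hasFDerivWithin_le
    (f := fun e => T (x, e)) (f' := fun e => fderiv ℝ T (x, e) ∘L .inr ℝ X E) (C := C)
    (fun e' he' => ?_) (fun e' he' => hC (x, e') ⟨hx, he'⟩) (Metric.mem_closedBall_self hε)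
    (mem_closedBall_zero_iff.2 he)
  · simpa using h
  · have hd := ((hT x hx e' (mem_closedBall_zero_iff.1 he')).differentiableAt one_ne_zero).hasFDerivAt
    exact (HasFDerivAt.comp (f := fun e : E => (x, e)) e' hd
      (hasFDerivAt_prodMk_right x e')).hasFDerivWithinAt

end DerivativeBounds

/-! ### Bounds for difference quotients of periodic functions -/

section PeriodicBounds

variable {E : Type*} [NormedAddCommGroup E]

/-- The difference quotient in the size of the parameter. -/
def paramQuotient (u : (ℝ × ℝ) × E → ℝ) (e : E) (x : ℝ × ℝ) : ℝ :=
  ‖e‖⁻¹ * (u (x, e) - u (x, 0))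

theorem norm_mul_paramQuotient (u : (ℝ × ℝ) × E → ℝ) (e : E) (x : ℝ × ℝ) :
    ‖e‖ * paramQuotient u e x = u (x, e) - u (x, 0) := by
  unfold paramQuotient
  by_cases h : e = 0
  · simp [h]
  · rw [mul_inv_cancel_left₀ (norm_ne_zero_iff.2 h)]

variable {u : (ℝ × ℝ) × E → ℝ}

/-- Reduces bounds over all angles to a compact period. The same representative `θ` is used for the
parameters `e` and `0`, because their derivatives are to be subtracted. -/
theorem exists_mem_Icc_of_periodic (hper : ∀ x e, u ((x.1, x.2 + 2 * Real.pi), e) = u (x, e))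
    {x : ℝ × ℝ} (j : ℕ) (e : E) : ∃ θ ∈ Icc 0 (2 * Real.pi),
      iteratedFDeriv ℝ j (fun x => u (x, e)) x =
        iteratedFDeriv ℝ j (fun x => u (x, e)) (x.1, θ) ∧
      iteratedFDeriv ℝ j (fun x => u (x, 0)) x =
        iteratedFDeriv ℝ j (fun x => u (x, 0)) (x.1, θ) := by
  have hp : ∀ e, Function.Periodic (fun θ => iteratedFDeriv ℝ j (fun x => u (x, e)) (x.1, θ))
      (2 * Real.pi) := by
    intro e θ
    have h1 : (fun x => u (x, e)) = fun x : ℝ × ℝ => (fun x => u (x, e)) (x + (0, 2 * Real.pi)) := by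
      funext y
      simp only [← hper y e]
      congr 2
      ext <;> simp
    have h2 := iteratedFDeriv_comp_add_right (𝕜 := ℝ) (f := fun x : ℝ × ℝ => u (x, e)) j
      (0, 2 * Real.pi) (x.1, θ)
    rw [Prod.mk_add_mk, add_zero] at h2
    exact h2.symm.trans (congrArg (fun f => iteratedFDeriv ℝ j f (x.1, θ)) h1.symm)
  have hpi := Real.two_pi_pos
  obtain ⟨n, hn, -⟩ := existsUnique_add_zsmul_mem_Ico hpi x.2 0
  refine ⟨x.2 + n • (2 * Real.pi), ⟨hn.1, by linarith [hn.2]⟩, ?_, ?_⟩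
  · exact ((hp e).zsmul n x.2).symm
  · exact ((hp 0).zsmul n x.2).symm

variable [NormedSpace ℝ E] {N : ℕ} {K : Set ℝ} {ε₀ : ℝ}

theorem contDiffAt_left {e : E} {x : ℝ × ℝ} (h : ContDiffAt ℝ N u (x, e)) :
    ContDiffAt ℝ N (fun x => u (x, e)) x :=
  ContDiffAt.comp (f := fun x : ℝ × ℝ => (x, e)) x h (contDiffAt_id.prodMk contDiffAt_const)

theorem iteratedFDeriv_paramQuotient {e : E} {x : ℝ × ℝ} {j : ℕ} (hj : j ≤ N)
    (h : ContDiffAt ℝ N u (x, e)) (h0 : ContDiffAt ℝ N u (x, 0)) :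
    iteratedFDeriv ℝ j (paramQuotient u e) x = ‖e‖⁻¹ •
      (iteratedFDeriv ℝ j (fun x => u (x, e)) x - iteratedFDeriv ℝ j (fun x => u (x, 0)) x) := by
  have hj' : ((j : ℕ) : WithTop ℕ∞) ≤ (N : WithTop ℕ∞) := by exact_mod_cast hj
  have h1 := (contDiffAt_left h).of_le hj'
  have h2 := (contDiffAt_left h0).of_le hj'
  have h3 : paramQuotient u e = ‖e‖⁻¹ • ((fun x => u (x, e)) - fun x => u (x, 0)) := rfl
  have h4 : ContDiffAt ℝ j ((fun x => u (x, e)) - fun x => u (x, 0)) x := h1.sub h2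
  rw [h3, iteratedFDeriv_const_smul_apply h4, iteratedFDeriv_sub_apply h1 h2]

/-- For `j < N` the derivative of order `j` in `x` is `C^1` in all variables, hence Lipschitz in
`e`; the strict inequality `k < N` is the derivative spent on the parameter. -/
theorem exists_cNormLE_paramQuotient [ProperSpace E] (hK : IsCompact K) (hε : 0 ≤ ε₀)
    (hper : ∀ x e, u ((x.1, x.2 + 2 * Real.pi), e) = u (x, e))
    (hu : ∀ x : ℝ × ℝ, x.1 ∈ K → ∀ e, ‖e‖ ≤ ε₀ → ContDiffAt ℝ N u (x, e)) {k : ℕ} (hk : k < N) :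
    ∃ C, ∀ e, ‖e‖ ≤ ε₀ → CNormLE k (paramQuotient u e) (K ×ˢ univ) C := by
  have key : ∀ j ≤ k, ∃ C, ∀ x ∈ K ×ˢ Icc (0 : ℝ) (2 * Real.pi), ∀ e, ‖e‖ ≤ ε₀ →
      ‖iteratedFDeriv ℝ j (fun x => u (x, e)) x - iteratedFDeriv ℝ j (fun x => u (x, 0)) x‖ ≤
        C * ‖e‖ := by
    intro j hj
    refine exists_lipschitz_bound
      (T := fun p : (ℝ × ℝ) × E => iteratedFDeriv ℝ j (fun x => u (x, p.2)) p.1)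
      (hK.prod isCompact_Icc) hε fun x hx e he => ?_
    refine mod_cast contDiffAt_iteratedFDeriv_left j 1 ((hu x hx.1 e he).of_le ?_)
    exact_mod_cast (by omega : j + 1 ≤ N)
  choose! C hC using key
  refine ⟨∑ j ∈ Finset.range (k + 1), |C j|, fun e he j hj x hx => ?_⟩
  obtain ⟨θ, hθ, e1, e2⟩ := exists_mem_Icc_of_periodic hper (x := x) j e
  rw [iteratedFDeriv_paramQuotient (N := N) (by omega) (hu x hx.1 e he)
    (hu x hx.1 0 (by simpa using hε)), e1, e2, norm_smul, norm_inv, norm_norm]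
  have h1 := hC j hj (x.1, θ) ⟨hx.1, hθ⟩ e he
  have h2 : |C j| ≤ ∑ j ∈ Finset.range (k + 1), |C j| :=
    Finset.single_le_sum (fun i _ => abs_nonneg (C i)) (Finset.mem_range.2 (by omega))
  refine le_trans ?_ h2
  -- For `e = 0` the factor `‖e‖⁻¹` is `0`, so the quotient vanishes and the bound is trivial.
  by_cases h0 : ‖e‖ = 0
  · rw [h0, inv_zero, zero_mul]; exact abs_nonneg _
  · have hpos : 0 < ‖e‖ := lt_of_le_of_ne (norm_nonneg _) (Ne.symm h0)
    rw [inv_mul_le_iff₀ hpos, mul_comm]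
    exact h1.trans (mul_le_mul_of_nonneg_right (le_abs_self _) hpos.le)

/-- At the top order `N` the derivatives are only continuous in the parameter; uniform continuity
over a compact period gives smallness without a rate. -/
theorem exists_cNormLE_of_small [ProperSpace E] (hK : IsCompact K) (hε : 0 < ε₀)
    (hper : ∀ x e, u ((x.1, x.2 + 2 * Real.pi), e) = u (x, e))
    (hu : ∀ x : ℝ × ℝ, x.1 ∈ K → ∀ e, ‖e‖ ≤ ε₀ → ContDiffAt ℝ N u (x, e)) {μ : ℝ} (hμ : 0 < μ) :
    ∃ ε₁ > 0, ∀ e, ‖e‖ < ε₁ →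
      CNormLE N (fun x => ‖e‖ * paramQuotient u e x) (K ×ˢ univ) μ := by
  have key : ∀ᶠ e in 𝓝 (0 : E), ∀ j ∈ Finset.range (N + 1), ∀ x ∈ K ×ˢ Icc (0 : ℝ) (2 * Real.pi),
      ‖iteratedFDeriv ℝ j (fun x => u (x, e)) x - iteratedFDeriv ℝ j (fun x => u (x, 0)) x‖ < μ := by
    rw [Filter.eventually_all_finset]
    intro j hj
    refine eventually_norm_sub_lt
      (T := fun p : (ℝ × ℝ) × E => iteratedFDeriv ℝ j (fun x => u (x, p.2)) p.1)
      (hK.prod isCompact_Icc) (fun x hx => ?_) hμ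
    refine (contDiffAt_iteratedFDeriv_left j 0
      ((hu x hx.1 0 (by simpa using hε.le)).of_le ?_)).continuousAt
    have := Finset.mem_range.1 hj
    exact_mod_cast (by omega : j + 0 ≤ N)
  obtain ⟨ε₁, hε₁, h⟩ := Metric.eventually_nhds_iff.1 key
  refine ⟨min ε₁ ε₀, lt_min hε₁ hε, fun e he j hj x hx => ?_⟩
  have he1 : ‖e‖ < ε₁ := he.trans_le (min_le_left _ _)
  have he0 : ‖e‖ ≤ ε₀ := (he.trans_le (min_le_right _ _)).le
  obtain ⟨θ, hθ, e1, e2⟩ := exists_mem_Icc_of_periodic hper (x := x) j e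
  have hj' : ((j : ℕ) : WithTop ℕ∞) ≤ (N : WithTop ℕ∞) := by exact_mod_cast hj
  have h1 := (contDiffAt_left (hu x hx.1 e he0)).of_le hj'
  have h2 := (contDiffAt_left (hu x hx.1 0 (by simpa using hε.le))).of_le hj'
  have h3 : (fun x => ‖e‖ * paramQuotient u e x) = (fun x => u (x, e)) - fun x => u (x, 0) :=
    funext fun x => norm_mul_paramQuotient u e x
  rw [h3, iteratedFDeriv_sub_apply h1 h2, e1, e2]
  exact (h (by simpa using he1) j (Finset.mem_range.2 (by omega)) (x.1, θ) ⟨hx.1, hθ⟩).le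

end PeriodicBounds

/-! ### The perturbed system, with the parameter of the potential as a phase variable -/

section ExtendedSystem

/-- The extended phase space, with coordinates `(q₁, p₁)`, `(q₂, p₂)` and `(s, u)`: the parameter
`s` of the potential and its conjugate variable `u`. -/
abbrev Space : Type := (ℝ × ℝ) × (ℝ × ℝ) × (ℝ × ℝ)

/-- The configuration together with the parameter. -/
def pos : Space →L[ℝ] ℝ × ℝ × ℝ :=
  ((ContinuousLinearMap.fst ℝ ℝ ℝ) ∘L (ContinuousLinearMap.fst ℝ _ _)).prod
    (((ContinuousLinearMap.fst ℝ ℝ ℝ) ∘L (ContinuousLinearMap.fst ℝ _ _) ∘L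
      (ContinuousLinearMap.snd ℝ _ _)).prod
      ((ContinuousLinearMap.fst ℝ ℝ ℝ) ∘L (ContinuousLinearMap.snd ℝ _ _) ∘L
      (ContinuousLinearMap.snd ℝ _ _)))

theorem pos_apply (x : Space) : pos x = (x.1.1, x.2.1.1, x.2.2.1) := rfl

/-- The Hamiltonian vector field of `p₁ ^ 2 / 2 + p₂ ^ 2 / 2 + U (q₁, q₂, s)`. -/
def field3 (U : ℝ × ℝ × ℝ → ℝ) (x : Space) : Space :=
  ((x.1.2, -fderiv ℝ U (pos x) (1, 0, 0)), (x.2.1.2, -fderiv ℝ U (pos x) (0, 1, 0)),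
    (0, -fderiv ℝ U (pos x) (0, 0, 1)))

/-- The energy `p₁ ^ 2 / 2 + p₂ ^ 2 / 2 + U (q₁, q₂, s)`. -/
def energy3 (U : ℝ × ℝ × ℝ → ℝ) (x : Space) : ℝ := x.1.2 ^ 2 / 2 + x.2.1.2 ^ 2 / 2 + U (pos x)

/-- The standard symplectic form. -/
def form3 : Space →L[ℝ] Space →L[ℝ] ℝ :=
  area.bilinearComp (.fst ℝ _ _) (.fst ℝ _ _) +
    (area.bilinearComp ((ContinuousLinearMap.fst ℝ _ _) ∘L (ContinuousLinearMap.snd ℝ _ _))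
      ((ContinuousLinearMap.fst ℝ _ _) ∘L (ContinuousLinearMap.snd ℝ _ _)) +
    area.bilinearComp ((ContinuousLinearMap.snd ℝ _ _) ∘L (ContinuousLinearMap.snd ℝ _ _))
      ((ContinuousLinearMap.snd ℝ _ _) ∘L (ContinuousLinearMap.snd ℝ _ _)))

theorem form3_apply (u v : Space) :
    form3 u v = area u.1 v.1 + (area u.2.1 v.2.1 + area u.2.2 v.2.2) := rfl

theorem contDiff_field3 {n : ℕ} {U : ℝ × ℝ × ℝ → ℝ} (hU : ContDiff ℝ (n + 1 : ℕ) U) :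
    ContDiff ℝ n (field3 U) := by
  have h : ContDiff ℝ n fun x : Space => fderiv ℝ U (pos x) :=
    (hU.fderiv_right (by norm_cast)).comp pos.contDiff
  unfold field3
  fun_prop

theorem lipschitz_field3 {U : ℝ × ℝ × ℝ → ℝ} (hU : ContDiff ℝ 2 U) (hc : HasCompactSupport U) :
    ∃ K, LipschitzWith K (field3 U) := by
  obtain ⟨K, hK⟩ := ContDiff.lipschitzWith_of_hasCompactSupport (hc.fderiv (𝕜 := ℝ))
    (hU.fderiv_right (m := 1) (by norm_num)) (by norm_num)
  have h := fun v : ℝ × ℝ × ℝ => ((ContinuousLinearMap.apply ℝ ℝ v).lipschitz.comp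
    (hK.comp pos.lipschitz)).neg
  exact ⟨_, ((LipschitzWith.prod_snd.comp LipschitzWith.prod_fst).prodMk (h (1, 0, 0))).prodMk
    (((LipschitzWith.prod_snd.comp (LipschitzWith.prod_fst.comp LipschitzWith.prod_snd)).prodMk
      (h (0, 1, 0))).prodMk ((LipschitzWith.const 0).prodMk (h (0, 0, 1))))⟩

theorem hasFDerivAt_energy3 {U : ℝ × ℝ × ℝ → ℝ} (hU : ContDiff ℝ 2 U) (x : Space) :
    HasFDerivAt (energy3 U) (form3 (field3 U x)) x := by
  have h1 : HasFDerivAt (fun x : Space => x.1.2) _ x := (hasFDerivAt_fst (𝕜 := ℝ) (p := x)).snd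
  have h2 : HasFDerivAt (fun x : Space => x.2.1.2) _ x :=
    (hasFDerivAt_snd (𝕜 := ℝ) (p := x)).fst.snd
  have h3 := ((hU.differentiable two_ne_zero) (pos x)).hasFDerivAt.comp x pos.hasFDerivAt
  have h4 := (((h1.pow 2).mul_const (1 / 2 : ℝ)).add ((h2.pow 2).mul_const (1 / 2 : ℝ))).add h3
  refine (h4.congr_of_eventuallyEq (Eventually.of_forall fun y => ?_)).congr_fderiv ?_
  · simp [energy3]; ring
  · ext <;> simp [form3_apply, area_apply, field3, pos_apply] <;> exact map_zero _

/-- Smoothness in the parameter `s` becomes smoothness in the initial point, while the conjugate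
variable `u` keeps the enlarged field Hamiltonian. The energy does not depend on `u`, so `s` stays
constant. -/
theorem isHamiltonianField_field3 {U : ℝ × ℝ × ℝ → ℝ} (hU : ContDiff ℝ 3 U)
    (hc : HasCompactSupport U) : IsHamiltonianField form3 (energy3 U) (field3 U) where
  field := ⟨contDiff_field3 (n := 1) (hU.of_le (by norm_num)),
    lipschitz_field3 (hU.of_le (by norm_num)) hc⟩
  contDiff_field := contDiff_field3 (n := 2) hU
  contDiff_energy := by
    have : ContDiff ℝ 2 fun x : Space => U (pos x) := (hU.of_le (by norm_num)).comp pos.contDiff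
    exact (((contDiff_fst.snd.pow 2).div_const 2).add
      ((contDiff_snd.fst.snd.pow 2).div_const 2)).add this
  alternating u v := by simp only [form3_apply, area_apply]; ring
  apply_field x v := by rw [(hasFDerivAt_energy3 (hU.of_le (by norm_num)) x).fderiv]

namespace ImpactSystem

variable (S : ImpactSystem)

/-- The perturbed potential, with its parameter as a variable, cut off to compact support. -/
def cutPotential (M : ℝ) (q : ℝ × ℝ × ℝ) : ℝ :=
  bump M q.1 * bump M q.2.1 * bump 1 q.2.2 * (S.V₁ q.1 + S.V₂ q.2.1 + q.2.2 * S.Vr q.1 q.2.1)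

/-- The region where the potential is not cut off. -/
def box (M : ℝ) : Set Space := {x | |x.1.1| < M ∧ |x.2.1.1| < M ∧ |x.2.2.1| < 1}

theorem isOpen_box (M : ℝ) : IsOpen (box M) := by
  have h1 : IsOpen {x : Space | |x.1.1| < M} := isOpen_lt (by fun_prop) continuous_const
  have h2 : IsOpen {x : Space | |x.2.1.1| < M} := isOpen_lt (by fun_prop) continuous_const
  have h3 : IsOpen {x : Space | |x.2.2.1| < 1} := isOpen_lt (by fun_prop) continuous_const
  exact h1.inter (h2.inter h3)

variable {S} {M : ℝ}

theorem contDiff_cutPotential {n : ℕ} (h₁ : ContDiff ℝ n S.V₁) (h₂ : ContDiff ℝ n S.V₂)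
    (hr : ContDiff ℝ n fun x : ℝ × ℝ => S.Vr x.1 x.2) : ContDiff ℝ n (S.cutPotential M) := by
  have hM : ContDiff ℝ n (bump M) := (bump M).contDiff
  have h1 : ContDiff ℝ n (bump 1) := (bump 1).contDiff
  have hr' : ContDiff ℝ n fun q : ℝ × ℝ × ℝ => S.Vr q.1 q.2.1 :=
    hr.comp (contDiff_fst.prodMk contDiff_snd.fst)
  unfold cutPotential
  exact (((hM.comp contDiff_fst).mul (hM.comp contDiff_snd.fst)).mul (h1.comp contDiff_snd.snd)).mul
    (((h₁.comp contDiff_fst).add (h₂.comp contDiff_snd.fst)).add (contDiff_snd.snd.mul hr'))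

theorem hasCompactSupport_cutPotential : HasCompactSupport (S.cutPotential M) := by
  refine HasCompactSupport.of_support_subset_isCompact
    ((bump M).hasCompactSupport.isCompact.prod
      ((bump M).hasCompactSupport.isCompact.prod (bump 1).hasCompactSupport.isCompact)) ?_
  intro q hq
  have hq : S.cutPotential M q ≠ 0 := hq
  have h := left_ne_zero_of_mul hq
  exact ⟨subset_tsupport _ (left_ne_zero_of_mul (left_ne_zero_of_mul h)),
    subset_tsupport _ (right_ne_zero_of_mul (left_ne_zero_of_mul h)),
    subset_tsupport _ (right_ne_zero_of_mul h)⟩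

theorem cutPotential_eventuallyEq {q : ℝ × ℝ × ℝ} (h1 : |q.1| ≤ M) (h2 : |q.2.1| ≤ M)
    (h3 : |q.2.2| ≤ 1) : ∀ᶠ x in 𝓝 q,
      S.cutPotential M x = S.V₁ x.1 + S.V₂ x.2.1 + x.2.2 * S.Vr x.1 x.2.1 := by
  have e1 := (continuous_fst.tendsto q).eventually (bump_eventuallyEq (abs_le.1 h1))
  have e2 := (continuous_snd.fst.tendsto q).eventually (bump_eventuallyEq (abs_le.1 h2))
  have e3 := (continuous_snd.snd.tendsto q).eventually (bump_eventuallyEq (abs_le.1 h3))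
  filter_upwards [e1, e2, e3] with x h1 h2 h3
  simp [cutPotential, h1, h2, h3]

/-- The point of the phase space of the impact system. -/
def toPhase (x : Space) : Phase := ⟨x.1.1, x.1.2, x.2.1.1, x.2.1.2⟩

theorem fderiv_cutPotential₁ (hU : ContDiff ℝ 1 (S.cutPotential M)) {q : ℝ × ℝ × ℝ}
    (h1 : |q.1| ≤ M) (h2 : |q.2.1| ≤ M) (h3 : |q.2.2| ≤ 1) :
    fderiv ℝ (S.cutPotential M) q (1, 0, 0) =
      deriv (fun x => S.V₁ x + S.V₂ q.2.1 + q.2.2 * S.Vr x q.2.1) q.1 := by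
  have hc : HasDerivAt (fun x : ℝ => (x, q.2.1, q.2.2)) ((1 : ℝ), (0 : ℝ), (0 : ℝ)) q.1 :=
    (hasDerivAt_id _).prodMk ((hasDerivAt_const _ _).prodMk (hasDerivAt_const _ _))
  have h := ((hU.differentiable one_ne_zero) q).hasFDerivAt.comp_hasDerivAt q.1 hc
  rw [← h.deriv]
  apply EventuallyEq.deriv_eq
  exact (hc.continuousAt.tendsto.eventually (cutPotential_eventuallyEq h1 h2 h3))

theorem fderiv_cutPotential₂ (hU : ContDiff ℝ 1 (S.cutPotential M)) {q : ℝ × ℝ × ℝ}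
    (h1 : |q.1| ≤ M) (h2 : |q.2.1| ≤ M) (h3 : |q.2.2| ≤ 1) :
    fderiv ℝ (S.cutPotential M) q (0, 1, 0) =
      deriv (fun x => S.V₁ q.1 + S.V₂ x + q.2.2 * S.Vr q.1 x) q.2.1 := by
  have hc : HasDerivAt (fun x : ℝ => (q.1, x, q.2.2)) ((0 : ℝ), (1 : ℝ), (0 : ℝ)) q.2.1 :=
    (hasDerivAt_const _ _).prodMk ((hasDerivAt_id _).prodMk (hasDerivAt_const _ _))
  have h := ((hU.differentiable one_ne_zero) q).hasFDerivAt.comp_hasDerivAt q.2.1 hc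
  rw [← h.deriv]
  apply EventuallyEq.deriv_eq
  exact (hc.continuousAt.tendsto.eventually (cutPotential_eventuallyEq h1 h2 h3))

theorem field3_fst (hU : ContDiff ℝ 1 (S.cutPotential M)) {ε : Params} {x : Space}
    (hx : x ∈ box M) (hε : x.2.2.1 = ε 0) :
    (field3 (S.cutPotential M) x).1 = (x.1.2, S.force₁ ε (toPhase x)) := by
  obtain ⟨h1, h2, h3⟩ := hx
  simp only [field3, pos_apply]
  rw [fderiv_cutPotential₁ hU h1.le h2.le h3.le]
  simp only [force₁, potential, toPhase, hε]

theorem field3_snd (hU : ContDiff ℝ 1 (S.cutPotential M)) {ε : Params} {x : Space}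
    (hx : x ∈ box M) (hε : x.2.2.1 = ε 0) :
    (field3 (S.cutPotential M) x).2.1 = (x.2.1.2, S.force₂ ε (toPhase x)) := by
  obtain ⟨h1, h2, h3⟩ := hx
  simp only [field3, pos_apply]
  rw [fderiv_cutPotential₂ hU h1.le h2.le h3.le]
  simp only [force₂, potential, toPhase, hε]

theorem energy3_eq {ε : Params} {x : Space} (hx : x ∈ box M) (hε : x.2.2.1 = ε 0) :
    energy3 (S.cutPotential M) x = S.energy ε (toPhase x) := by
  obtain ⟨h1, h2, h3⟩ := hx
  have := (cutPotential_eventuallyEq (S := S) (q := pos x) h1.le h2.le h3.le).self_of_nhds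
  rw [energy3, this]
  simp only [energy, potential, toPhase, pos_apply, hε]

theorem force₁_of_zero {ε : Params} (hε : ε 0 = 0) (x : Phase) :
    S.force₁ ε x = -deriv S.V₁ x.q₁ := by
  simp [force₁, potential, hε]

theorem force₂_of_zero {ε : Params} (hε : ε 0 = 0) (x : Phase) :
    S.force₂ ε x = -deriv S.V₂ x.q₂ := by
  simp [force₂, potential, hε]

/-- The parameter is constant along the flow. -/
theorem param_flow {U : ℝ × ℝ × ℝ → ℝ} (hF : IsLipschitzField (field3 U)) (x : Space) (t : ℝ) :
    (flow (field3 U) x t).2.2.1 = x.2.2.1 := by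
  have hd : ∀ t, HasDerivAt (fun t => (flow (field3 U) x t).2.2.1) 0 t := fun t => by
    have h := hF.hasDerivAt_flow x t
    have h1 : HasDerivAt (fun t => (flow (field3 U) x t).2) _ t := h.snd
    have h2 : HasDerivAt (fun t => (flow (field3 U) x t).2.2) _ t := h1.snd
    exact h2.fst
  have := is_const_of_deriv_eq_zero (fun t => (hd t).differentiableAt) (fun t => (hd t).deriv) t 0
  simpa [flow_zero] using this

/-- The unperturbed motion is a product. -/
theorem flow_product (hU : ContDiff ℝ 3 (S.cutPotential M)) {x₁ x₂ : ℝ → ℝ × ℝ}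
    (h₁ : ∀ t, HasDerivAt x₁ (field1 S.V₁ (x₁ t)) t) (h₂ : ∀ t, HasDerivAt x₂ (field1 S.V₂ (x₂ t)) t)
    (hb₁ : ∀ t, |(x₁ t).1| < M) (hb₂ : ∀ t, |(x₂ t).1| < M) (u₀ t : ℝ) :
    ∃ u, flow (field3 (S.cutPotential M)) (x₁ 0, x₂ 0, (0, u₀)) t = (x₁ t, x₂ t, (0, u)) := by
  have hF := (isHamiltonianField_field3 hU hasCompactSupport_cutPotential).field
  have hU1 : ContDiff ℝ 1 (S.cutPotential M) := hU.of_le (by norm_num)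
  -- The velocity of the variable conjugate to the parameter. It does not act back on the other
  -- variables and is integrated along the given curves.
  set k : ℝ → ℝ := fun t => -fderiv ℝ (S.cutPotential M) ((x₁ t).1, (x₂ t).1, 0) (0, 0, 1) with hk
  have hx₁ : Continuous x₁ := continuous_iff_continuousAt.2 fun t => (h₁ t).continuousAt
  have hx₂ : Continuous x₂ := continuous_iff_continuousAt.2 fun t => (h₂ t).continuousAt
  have hkc : Continuous k :=
    (((hU1.continuous_fderiv one_ne_zero).comp
      (hx₁.fst.prodMk (hx₂.fst.prodMk continuous_const))).clm_apply continuous_const).neg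
  have hu : ∀ t, HasDerivAt (fun t => u₀ + ∫ s in (0 : ℝ)..t, k s) (k t) t := fun t =>
    (intervalIntegral.integral_hasDerivAt_right (hkc.intervalIntegrable _ _)
      (hkc.stronglyMeasurableAtFilter _ _) hkc.continuousAt).const_add u₀
  have hflow := hF.eq_flow (γ := fun t => (x₁ t, x₂ t, ((0 : ℝ), u₀ + ∫ s in (0 : ℝ)..t, k s)))
    fun t => by
      have hbox : ((x₁ t, x₂ t, ((0 : ℝ), u₀ + ∫ s in (0 : ℝ)..t, k s)) : Space) ∈ box M :=
        ⟨hb₁ t, hb₂ t, by simp⟩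
      have e1 := field3_fst hU1 (ε := 0) hbox rfl
      have e2 := field3_snd hU1 (ε := 0) hbox rfl
      rw [force₁_of_zero rfl] at e1
      rw [force₂_of_zero rfl] at e2
      refine ((h₁ t).prodMk ((h₂ t).prodMk ((hasDerivAt_const t (0 : ℝ)).prodMk (hu t)))).congr_deriv ?_
      exact Prod.ext e1.symm (Prod.ext e2.symm rfl)
  refine ⟨u₀ + ∫ s in (0 : ℝ)..t, k s, ?_⟩
  rw [show ((x₁ 0, x₂ 0, (0, u₀)) : Space) = (fun t => (x₁ t, x₂ t, ((0 : ℝ),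
    u₀ + ∫ s in (0 : ℝ)..t, k s))) 0 by simp, ← hflow]

/-- The slope of the wall. -/
def wallSlope (S : ImpactSystem) (x : ℝ × ℝ) : ℝ :=
  x.2 * fderiv ℝ (fun x : ℝ × ℝ => S.Q x.1 x.2) x (1, 0)

theorem hasDerivAt_wall (hQ : ContDiff ℝ 1 fun x : ℝ × ℝ => S.Q x.1 x.2) (ε : Params) (q : ℝ) :
    HasDerivAt (S.wall ε) (S.wallSlope (q, ε 1)) q := by
  have hc : HasDerivAt (fun x : ℝ => (x, ε 1)) ((1 : ℝ), (0 : ℝ)) q :=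
    (hasDerivAt_id _).prodMk (hasDerivAt_const _ _)
  exact (((hQ.differentiable one_ne_zero) (q, ε 1)).hasFDerivAt.comp_hasDerivAt q hc).const_mul _

theorem contDiff_wallSlope {n : ℕ} (hQ : ContDiff ℝ (n + 1 : ℕ) fun x : ℝ × ℝ => S.Q x.1 x.2) :
    ContDiff ℝ n S.wallSlope :=
  contDiff_snd.mul ((hQ.fderiv_right (by norm_cast)).clm_apply contDiff_const)

/-- Elastic reflection at the wall with parameter `e`, in the extended phase space. -/
def reflectMap (S : ImpactSystem) (e : ℝ) (x : Space) : Space :=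
  ((x.1.1, x.1.2 - 2 * (x.1.2 - S.wallSlope (x.2.1.1, e) * x.2.1.2) /
      (1 + S.wallSlope (x.2.1.1, e) ^ 2)),
    (x.2.1.1, x.2.1.2 + 2 * (x.1.2 - S.wallSlope (x.2.1.1, e) * x.2.1.2) /
      (1 + S.wallSlope (x.2.1.1, e) ^ 2) * S.wallSlope (x.2.1.1, e)), x.2.2)

theorem toPhase_reflectMap (hQ : ContDiff ℝ 1 fun x : ℝ × ℝ => S.Q x.1 x.2) (ε : Params)
    (x : Space) : toPhase (S.reflectMap (ε 1) x) = S.reflect ε (toPhase x) := by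
  simp [toPhase, reflectMap, reflect, normalMomentum, (hasDerivAt_wall hQ ε _).deriv]

theorem contDiff_reflectMap {n : ℕ} (hQ : ContDiff ℝ (n + 1 : ℕ) fun x : ℝ × ℝ => S.Q x.1 x.2) :
    ContDiff ℝ n fun x : Space × ℝ => S.reflectMap x.2 x.1 := by
  have hw : ContDiff ℝ n fun x : Space × ℝ => S.wallSlope (x.1.2.1.1, x.2) :=
    (contDiff_wallSlope hQ).comp (contDiff_fst.snd.fst.fst.prodMk contDiff_snd)
  have hd : ∀ x : Space × ℝ, 1 + S.wallSlope (x.1.2.1.1, x.2) ^ 2 ≠ 0 := fun x => by positivity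
  have hn : ContDiff ℝ n fun x : Space × ℝ =>
      2 * (x.1.1.2 - S.wallSlope (x.1.2.1.1, x.2) * x.1.2.1.2) /
        (1 + S.wallSlope (x.1.2.1.1, x.2) ^ 2) :=
    (contDiff_const.mul (contDiff_fst.fst.snd.sub (hw.mul contDiff_fst.snd.fst.snd))).div
      (contDiff_const.add (hw.pow 2)) hd
  unfold reflectMap
  exact (contDiff_fst.fst.fst.prodMk (contDiff_fst.fst.snd.sub hn)).prodMk
    ((contDiff_fst.snd.fst.fst.prodMk (contDiff_fst.snd.fst.snd.add (hn.mul hw))).prodMk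
      contDiff_fst.snd.snd)

theorem reflectMap_zero (x : Space) :
    S.reflectMap 0 x = ((x.1.1, -x.1.2), x.2) := by
  simp [reflectMap, wallSlope]; ring

end ImpactSystem
end ExtendedSystem

/-! ### The equations of the return and their unperturbed solution -/

section ReturnEquation

namespace ImpactSystem

/-- The standing assumptions: data of class `C^(N+1)`, and motion confined to `(-M, M)`. -/
structure IsSetting (S : ImpactSystem) (H M : ℝ) (N : ℕ) : Prop where
  regular : S.IsRegular
  confined : S.Confined H M
  two_le : 2 ≤ N
  smooth₁ : ContDiff ℝ (N + 1 : ℕ) S.V₁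
  smooth₂ : ContDiff ℝ (N + 1 : ℕ) S.V₂
  perturbation : S.PerturbationSmooth (N + 1)
  impassable : H - S.V₁ 0 - (⨅ q, S.V₂ q) < S.b

/-- The vector field of the cut off system on the extended phase space. -/
abbrev sysField (S : ImpactSystem) (M : ℝ) : Space → Space := field3 (S.cutPotential M)

/-- The coordinates of the section, together with the parameters. -/
abbrev SectionParam : Type := (ℝ × ℝ) × Params

/-- The unknowns `(q₁, t₁, t₂, (I', θ' - θ))`: initial position, duration of the motion before
and after the wall (or left turning point), and the image under the return map. -/
abbrev Unknown : Type := ℝ × ℝ × ℝ × (ℝ × ℝ)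

section Defs

variable (S : ImpactSystem) (B : Leaf S.V₂) (H M : ℝ) (c : Prop) [Decidable c]

/-- The initial point on the section. -/
def startPoint (p : SectionParam) (q : ℝ) : Space := ((q, 0), S.angleMap B H M p.1, (p.2 0, 0))

/-- The motion before the wall (or left turning point). -/
def legOne (p : SectionParam) (y : Unknown) (t : ℝ) : Space :=
  flow (S.sysField M) (S.startPoint B H M p y.1) t

/-- The function which vanishes at the wall (or at the turning points, if `c` holds). -/
def gate (e : ℝ) (x : Space) : ℝ := if c then x.1.2 else x.1.1 - e * S.Q x.2.1.1 e

/-- Reflection at the wall, if `c` fails. -/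
def kick (e : ℝ) (x : Space) : Space := if c then x else S.reflectMap e x

/-- The motion after the wall (or left turning point). -/
def legTwo (p : SectionParam) (y : Unknown) (t : ℝ) : Space :=
  flow (S.sysField M) (S.kick c (p.2 1) (S.legOne B H M p y y.2.1)) t

/-- The equations for the unknowns. -/
def returnEquation (v : SectionParam × Unknown) : Unknown :=
  (energy3 (S.cutPotential M) (S.startPoint B H M v.1 v.2.1) - H,
    S.gate c (v.1.2 1) (S.legOne B H M v.1 v.2 v.2.2.1),
    (S.legTwo B H M c v.1 v.2 v.2.2.2.1).1.2,
    S.angleMap B H M (v.2.2.2.2.1, v.1.1.2 + v.2.2.2.2.2) -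
      (S.legTwo B H M c v.1 v.2 v.2.2.2.1).2.1)

/-- The solution for the unperturbed system. -/
def baseSolution (x : ℝ × ℝ) : Unknown :=
  (S.right₁ B H x.1, S.halfTime₁ B H x.1, S.halfTime₁ B H x.1, (x.1, S.rotation B H x.1))

/-- The torus does not reach the wall. -/
def Avoids (I : ℝ) : Prop := S.V₁ (S.right₁ B H I) < S.V₁ 0

end Defs

variable {S : ImpactSystem} {B : Leaf S.V₂} {H M : ℝ} {N : ℕ}

namespace IsSetting

theorem contDiff_cutPotential (hS : S.IsSetting H M N) :
    ContDiff ℝ (N + 1 : ℕ) (S.cutPotential M) :=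
  ImpactSystem.contDiff_cutPotential hS.smooth₁ hS.smooth₂ (by exact_mod_cast hS.perturbation.1)

theorem contDiff_cutPotential_three (hS : S.IsSetting H M N) :
    ContDiff ℝ 3 (S.cutPotential M) :=
  hS.contDiff_cutPotential.of_le (by exact_mod_cast Nat.succ_le_succ hS.two_le)

theorem contDiff_Q (hS : S.IsSetting H M N) :
    ContDiff ℝ (N + 1 : ℕ) fun x : ℝ × ℝ => S.Q x.1 x.2 := by
  exact_mod_cast hS.perturbation.2

theorem hamiltonian (hS : S.IsSetting H M N) :
    IsHamiltonianField form3 (energy3 (S.cutPotential M)) (S.sysField M) :=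
  isHamiltonianField_field3 hS.contDiff_cutPotential_three hasCompactSupport_cutPotential

variable {I : ℝ}

/-- The orbit of the first degree of freedom on the torus with action `I`. -/
theorem orbit₁ (hS : S.IsSetting H M N) (hI : I ∈ S.transverseActions B H) (t : ℝ) :
    HasDerivAt (orb (cut M S.V₁) (S.right₁ B H I))
      (field1 S.V₁ (orb (cut M S.V₁) (S.right₁ B H I) t)) t ∧
    |(orb (cut M S.V₁) (S.right₁ B H I) t).1| < M := by
  obtain ⟨L₁, L₂, h, he⟩ := hI
  have hbox := hS.regular.inBox₁ hS.confined h
  have hW := isGlobalPotential_cut hS.regular.contDiff₁ M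
  rw [hS.regular.right₁_eq h]
  have hin := hW.orb_mem_Icc (L₁.congr hbox.eventuallyEq_cut) t
  simp only [Leaf.congr_left, Leaf.congr_right] at hin
  refine ⟨?_, abs_lt.2 ⟨hbox.1.trans_le hin.1, hin.2.trans_lt hbox.2⟩⟩
  have h1 := hW.field.hasDerivAt_flow (L₁.right, 0) t
  refine h1.congr_deriv ?_
  show field1 _ (orb _ _ _) = _
  unfold field1
  rw [(cut_eventuallyEq S.V₁ ⟨hbox.1.le.trans hin.1, hin.2.trans hbox.2.le⟩).deriv_eq]

theorem halfPeriod₂_pos (hS : S.IsSetting H M N) (hI : I ∈ S.transverseActions B H) :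
    0 < S.halfPeriod₂ B H I := by
  obtain ⟨L₁, L₂, h, he⟩ := hI
  rw [hS.regular.halfPeriod₂_eq h]
  exact half_pos (hS.regular.period₂_pos hS.confined h)

/-- The orbit of the second degree of freedom on the torus with action `I`. -/
theorem orbit₂ (hS : S.IsSetting H M N) (hI : I ∈ S.transverseActions B H) (θ t : ℝ) :
    HasDerivAt (fun t => S.angleMap B H M (I, θ + t * (Real.pi / S.halfPeriod₂ B H I)))
      (field1 S.V₂ (S.angleMap B H M (I, θ + t * (Real.pi / S.halfPeriod₂ B H I)))) t ∧
    |(S.angleMap B H M (I, θ)).1| < M := by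
  have hpos := hS.halfPeriod₂_pos hI
  obtain ⟨L₁, L₂, h, he⟩ := hI
  have hbox := hS.regular.inBox₂ hS.confined h
  have hW := isGlobalPotential_cut hS.regular.contDiff₂ M
  have hin := hW.orb_mem_Icc (L₂.congr hbox.eventuallyEq_cut)
  simp only [Leaf.congr_left, Leaf.congr_right] at hin
  have hR := hS.regular.right₂_eq h
  have hlin : ∀ t, (θ + t * (Real.pi / S.halfPeriod₂ B H I)) * S.halfPeriod₂ B H I / Real.pi =
      t + θ * S.halfPeriod₂ B H I / Real.pi := by
    intro t
    have := Real.pi_ne_zero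
    field_simp
    ring
  refine ⟨?_, ?_⟩
  · simp only [angleMap, hlin, hR]
    set s := t + θ * S.halfPeriod₂ B H I / Real.pi with hs
    have h1 : HasDerivAt (orb (cut M S.V₂) L₂.right) _ s :=
      hW.field.hasDerivAt_flow (L₂.right, 0) s
    have h2 := h1.comp_add_const t (θ * S.halfPeriod₂ B H I / Real.pi)
    refine h2.congr_deriv ?_
    show field1 _ (orb _ _ _) = _
    unfold field1
    rw [(cut_eventuallyEq S.V₂ ⟨hbox.1.le.trans (hin s).1, (hin s).2.trans hbox.2.le⟩).deriv_eq]
  · simp only [angleMap, hR]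
    exact abs_lt.2 ⟨hbox.1.trans_le (hin _).1, (hin _).2.trans_lt hbox.2⟩

theorem right₁_spec (hS : S.IsSetting H M N) (hI : I ∈ S.transverseActions B H) :
    0 < S.right₁ B H I ∧ 0 < deriv S.V₁ (S.right₁ B H I) ∧
      ∀ θ, S.V₁ (S.right₁ B H I) + ((S.angleMap B H M (I, θ)).2 ^ 2 / 2 +
        S.V₂ (S.angleMap B H M (I, θ)).1) = H := by
  have hb := fun θ => (hS.orbit₂ hI θ 0).2
  obtain ⟨L₁, L₂, h, he⟩ := hI
  have hW := isGlobalPotential_cut hS.regular.contDiff₂ M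
  have hbox := hS.regular.inBox₂ hS.confined h
  rw [hS.regular.right₁_eq h]
  refine ⟨h.1.1, L₁.deriv_right, fun θ => ?_⟩
  have h1 := hW.energy_orb L₂.right (θ * L₂.period / (2 * Real.pi))
  rw [← hS.regular.angleMap_eq h] at h1
  rw [(cut_eventuallyEq S.V₂ (abs_le.1 (hb θ).le)).eq_of_nhds,
    (cut_eventuallyEq S.V₂ ⟨(hbox.1.trans L₂.left_lt_right).le, hbox.2.le⟩).eq_of_nhds,
    L₂.right_eq] at h1
  rw [L₁.right_eq, h1, h.2.2.2]

/-- The end of the first leg is of two kinds: the left turning point, a simple zero of the momentum,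
or the first passage through `q₁ = 0` with negative momentum. All transversality used later comes
from these facts. -/
theorem halfTime₁_spec (hS : S.IsSetting H M N) (hI : I ∈ S.transverseActions B H) :
    0 < S.halfTime₁ B H I ∧
      (∀ t ∈ Ioo 0 (S.halfTime₁ B H I), (orb (cut M S.V₁) (S.right₁ B H I) t).2 < 0) ∧
      (S.Avoids B H I → (orb (cut M S.V₁) (S.right₁ B H I) (S.halfTime₁ B H I)).2 = 0 ∧
        deriv S.V₁ (orb (cut M S.V₁) (S.right₁ B H I) (S.halfTime₁ B H I)).1 < 0 ∧
        ∀ t, 0 < (orb (cut M S.V₁) (S.right₁ B H I) t).1) ∧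
      (¬ S.Avoids B H I → (orb (cut M S.V₁) (S.right₁ B H I) (S.halfTime₁ B H I)).1 = 0 ∧
        (orb (cut M S.V₁) (S.right₁ B H I) (S.halfTime₁ B H I)).2 < 0 ∧
        (orb (cut M S.V₁) (S.right₁ B H I) (S.halfTime₁ B H I)).2 ^ 2 / 2 < S.b ∧
        ∀ t ∈ Ico 0 (S.halfTime₁ B H I), 0 < (orb (cut M S.V₁) (S.right₁ B H I) t).1) := by
  have hM := fun t => (hS.orbit₁ hI t).2
  obtain ⟨L₁, L₂, h, he⟩ := hI
  have hbox := hS.regular.inBox₁ hS.confined h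
  have hV1 : ContDiff ℝ 1 S.V₁ := hS.regular.contDiff₁.of_le (by norm_num)
  have hW := isGlobalPotential_cut hS.regular.contDiff₁ M
  set L := L₁.congr hbox.eventuallyEq_cut with hL
  have hhalf := hW.half_spec L
  have hanti := hW.strictAntiOn_half L
  have hin := hW.orb_mem_Icc L
  have hhit := hW.hit_spec L
  have hip : L.impactPeriod = L₁.impactPeriod := Leaf.congr_impactPeriod _ _ h.1.1.le
  simp only [hL, Leaf.congr_left, Leaf.congr_right, Leaf.congr_period] at hhalf hanti hin hhit
  rw [hip] at hhit
  unfold Avoids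
  rw [hS.regular.right₁_eq h, hS.regular.halfTime₁_eq h, L₁.right_eq]
  rw [hS.regular.right₁_eq h] at hM
  rcases lt_or_gt_of_ne he with hlt | hgt
  · have hl := h.1.left_pos hV1 hlt
    rw [IsGlobalPotential.impactPeriod_eq_period L₁ hl.le]
    refine ⟨hhalf.1, hhalf.2.1, fun _ => ⟨?_, ?_, fun t => hl.trans_le (hin t).1⟩,
      fun hn => absurd hlt hn⟩
    · rw [hhalf.2.2]
    · rw [hhalf.2.2]; exact L₁.deriv_left
  · obtain ⟨h1, h2, h3⟩ := hhit (h.1.left_neg hV1 hgt) h.1.1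
    refine ⟨h1, fun t ht => hhalf.2.1 t ⟨ht.1, ht.2.trans h2⟩, fun hn => absurd hn hgt.not_gt,
      fun _ => ⟨h3, hhalf.2.1 _ ⟨h1, h2⟩, ?_, fun t ht => ?_⟩⟩
    -- The kinetic energy at the wall is the energy of the first leaf minus `V₁ 0`, at most `H - min
    -- V₂ - V₁ 0`, which is below the barrier.
    · have hen := hW.energy_orb L₁.right (L₁.impactPeriod / 2)
      rw [(cut_eventuallyEq S.V₁ (abs_le.1 (hM _).le)).eq_of_nhds, h3,
        (cut_eventuallyEq S.V₁ ⟨(hbox.1.trans L₁.left_lt_right).le, hbox.2.le⟩).eq_of_nhds,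
        L₁.right_eq] at hen
      have := hS.regular.energy₁_le h
      linarith [hS.impassable]
    · rw [← h3]
      exact hanti ⟨ht.1, ht.2.le.trans h2.le⟩ ⟨h1.le, h2.le⟩ ht.2

theorem legOne_base (hS : S.IsSetting H M N) (hI : I ∈ S.transverseActions B H) (θ t : ℝ)
    {y : Unknown} (hy : y.1 = S.right₁ B H I) :
    ∃ u, S.legOne B H M ((I, θ), 0) y t = (orb (cut M S.V₁) (S.right₁ B H I) t,
      S.angleMap B H M (I, θ + t * (Real.pi / S.halfPeriod₂ B H I)), (0, u)) := by
  obtain ⟨u, hu⟩ := flow_product hS.contDiff_cutPotential_three (fun t => (hS.orbit₁ hI t).1)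
    (fun t => (hS.orbit₂ hI θ t).1) (fun t => (hS.orbit₁ hI t).2) (fun t => (hS.orbit₂ hI _ t).2) 0 t
  refine ⟨u, ?_⟩
  rw [← hu]
  simp [legOne, startPoint, hy, IsGlobalPotential.orb_zero]

variable [Decidable (S.Avoids B H I)]

/-- On a torus that avoids the wall the first leg ends with `p₁ = 0`, so leaving the point alone
also reverses `p₁`. This lets both types of return be treated together. -/
theorem kick_base (hS : S.IsSetting H M N) (hI : I ∈ S.transverseActions B H) (θ : ℝ)
    {y : Unknown} (hy : y.1 = S.right₁ B H I) (hy' : y.2.1 = S.halfTime₁ B H I) :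
    ∃ u, S.kick (S.Avoids B H I) ((0 : Params) 1) (S.legOne B H M ((I, θ), 0) y y.2.1) =
      (((orb (cut M S.V₁) (S.right₁ B H I) (S.halfTime₁ B H I)).1,
        -(orb (cut M S.V₁) (S.right₁ B H I) (S.halfTime₁ B H I)).2),
      S.angleMap B H M (I, θ + S.halfTime₁ B H I * (Real.pi / S.halfPeriod₂ B H I)), (0, u)) := by
  obtain ⟨u, hu⟩ := hS.legOne_base hI θ y.2.1 hy
  refine ⟨u, ?_⟩
  rw [hu, hy', kick]
  split_ifs with hc
  · have h1 := ((hS.halfTime₁_spec hI).2.2.1 hc).1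
    refine Prod.ext (Prod.ext rfl ?_) rfl
    show (orb _ _ _).2 = _
    rw [h1, neg_zero]
  · rw [show ((0 : Params) 1) = 0 from rfl, reflectMap_zero]

/-- By reversibility the first degree of freedom retraces its orbit after the momentum is reversed;
the second runs on undisturbed. -/
theorem legTwo_base (hS : S.IsSetting H M N) (hI : I ∈ S.transverseActions B H) (θ t : ℝ)
    {y : Unknown} (hy : y.1 = S.right₁ B H I) (hy' : y.2.1 = S.halfTime₁ B H I) :
    ∃ u, S.legTwo B H M (S.Avoids B H I) ((I, θ), 0) y t =
      (((orb (cut M S.V₁) (S.right₁ B H I) (S.halfTime₁ B H I - t)).1,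
        -(orb (cut M S.V₁) (S.right₁ B H I) (S.halfTime₁ B H I - t)).2),
      S.angleMap B H M (I, θ + (S.halfTime₁ B H I + t) * (Real.pi / S.halfPeriod₂ B H I)),
      (0, u)) := by
  obtain ⟨u₀, hu₀⟩ := hS.kick_base hI θ hy hy'
  set T := S.halfTime₁ B H I
  set x := orb (cut M S.V₁) (S.right₁ B H I) with hx
  have h1 : ∀ t, HasDerivAt (fun t => ((x (T - t)).1, -(x (T - t)).2))
      (field1 S.V₁ ((x (T - t)).1, -(x (T - t)).2)) t := by
    intro t
    have h := (hS.orbit₁ hI (T - t)).1.scomp t ((hasDerivAt_id t).const_sub T)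
    have e1 : HasDerivAt (fun t => (x (T - t)).1) _ t := h.fst
    have e2 : HasDerivAt (fun t => (x (T - t)).2) _ t := h.snd
    have e3 := e1.prodMk (HasDerivAt.fun_neg e2)
    refine e3.congr_deriv ?_
    simp [field1, hx]
  have h2 : ∀ t, HasDerivAt (fun t => S.angleMap B H M (I, θ + (T + t) * (Real.pi / S.halfPeriod₂ B H I)))
      (field1 S.V₂ (S.angleMap B H M (I, θ + (T + t) * (Real.pi / S.halfPeriod₂ B H I)))) t := by
    intro t
    exact (hS.orbit₂ hI θ (T + t)).1.comp_const_add T t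
  obtain ⟨u, hu⟩ := flow_product hS.contDiff_cutPotential_three h1 h2
    (fun t => (hS.orbit₁ hI (T - t)).2) (fun t => (hS.orbit₂ hI _ t).2) u₀ t
  refine ⟨u, ?_⟩
  rw [← hu, legTwo]
  simp only [sub_zero, add_zero]
  rw [← hu₀]

/-- The way back takes as long as the way out, so the angle advances by twice the half time at rate
`π / halfPeriod₂`, which is the rotation. -/
theorem returnEquation_base (hS : S.IsSetting H M N) (hI : I ∈ S.transverseActions B H) (θ : ℝ) :
    S.returnEquation B H M (S.Avoids B H I) (((I, θ), 0), S.baseSolution B H (I, θ)) = 0 := by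
  obtain ⟨hR0, hR1, hR2⟩ := hS.right₁_spec hI
  obtain ⟨u, hu⟩ := hS.legOne_base hI θ (S.halfTime₁ B H I)
    (y := S.baseSolution B H (I, θ)) rfl
  obtain ⟨w, hw⟩ := hS.legTwo_base hI θ (S.halfTime₁ B H I)
    (y := S.baseSolution B H (I, θ)) rfl rfl
  have hrot : S.rotation B H I = 2 * S.halfTime₁ B H I * Real.pi / S.halfPeriod₂ B H I := by
    obtain ⟨L₁, L₂, h, -⟩ := hI
    exact hS.regular.rotation_eq_halfTime h
  have hb1 := (hS.orbit₁ hI 0).2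
  rw [IsGlobalPotential.orb_zero] at hb1
  have hbox : S.startPoint B H M ((I, θ), 0) (S.right₁ B H I) ∈ box M :=
    ⟨hb1, (hS.orbit₂ hI θ 0).2, by simp [startPoint]⟩
  have he := energy3_eq (S := S) (ε := 0) hbox rfl
  refine Prod.ext ?_ (Prod.ext ?_ (Prod.ext ?_ ?_))
  · show energy3 _ (S.startPoint B H M ((I, θ), 0) (S.right₁ B H I)) - H = 0
    rw [he]
    have := hR2 θ
    simp only [energy, potential, toPhase, startPoint]
    simp
    linarith
  · show S.gate _ _ (S.legOne B H M _ _ (S.halfTime₁ B H I)) = 0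
    rw [hu, gate]
    split_ifs with hc
    · exact ((hS.halfTime₁_spec hI).2.2.1 hc).1
    · simp [((hS.halfTime₁_spec hI).2.2.2 hc).1]
  · show (S.legTwo B H M _ _ _ (S.halfTime₁ B H I)).1.2 = 0
    rw [hw]
    simp [IsGlobalPotential.orb_zero]
  · show S.angleMap B H M (I, θ + S.rotation B H I) -
      (S.legTwo B H M _ _ _ (S.halfTime₁ B H I)).2.1 = 0
    rw [hw, hrot, sub_eq_zero]
    congr 3
    ring

end IsSetting
end ImpactSystem
end ReturnEquation

/-! ### Smoothness and nondegeneracy of the return equations -/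

section ReturnEquationRegularity

namespace ImpactSystem

variable {S : ImpactSystem} {B : Leaf S.V₂} {H M : ℝ} {N : ℕ}

namespace IsSetting

variable (c : Prop) [Decidable c]

theorem contDiff_flow (hS : S.IsSetting H M N) :
    ContDiff ℝ N fun q : Space × ℝ => flow (S.sysField M) q.1 q.2 :=
  hS.hamiltonian.field.contDiff_flow (by have := hS.two_le; omega)
    (contDiff_field3 hS.contDiff_cutPotential)

theorem contDiff_energy3 (hS : S.IsSetting H M N) :
    ContDiff ℝ N (energy3 (S.cutPotential M)) := by
  have h : ContDiff ℝ N fun x : Space => S.cutPotential M (pos x) :=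
    (hS.contDiff_cutPotential.of_le (by norm_cast; omega)).comp pos.contDiff
  exact (((contDiff_fst.snd.pow 2).div_const 2).add
    ((contDiff_snd.fst.snd.pow 2).div_const 2)).add h

theorem contDiff_gate (hS : S.IsSetting H M N) :
    ContDiff ℝ N fun x : Space × ℝ => S.gate c x.2 x.1 := by
  unfold gate
  split_ifs
  · exact contDiff_fst.fst.snd
  · have h : ContDiff ℝ N fun x : Space × ℝ => S.Q x.1.2.1.1 x.2 :=
      (hS.contDiff_Q.of_le (by norm_cast; omega)).comp
        (contDiff_fst.snd.fst.fst.prodMk contDiff_snd)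
    exact contDiff_fst.fst.fst.sub (contDiff_snd.mul h)

theorem contDiff_kick (hS : S.IsSetting H M N) :
    ContDiff ℝ N fun x : Space × ℝ => S.kick c x.2 x.1 := by
  unfold kick
  split_ifs
  · exact contDiff_fst
  · exact contDiff_reflectMap hS.contDiff_Q

theorem contDiff_param (n : WithTop ℕ∞) (i : Fin 2) : ContDiff ℝ n fun e : Params => e i :=
  (EuclideanSpace.proj (𝕜 := ℝ) i).contDiff

theorem contDiffAt_angleMap (hS : S.IsSetting H M N) {x : ℝ × ℝ}
    (hx : x.1 ∈ S.transverseActions B H) : ContDiffAt ℝ N (S.angleMap B H M) x :=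
  hS.regular.contDiffAt_angleMap hS.confined (by have := hS.two_le; omega) hS.smooth₁ hS.smooth₂ hx

theorem contDiffAt_startPoint (hS : S.IsSetting H M N) {x : SectionParam × ℝ}
    (hx : x.1.1.1 ∈ S.transverseActions B H) :
    ContDiffAt ℝ N (fun x : SectionParam × ℝ => S.startPoint B H M x.1 x.2) x := by
  have h1 : ContDiffAt ℝ N (fun x : SectionParam × ℝ => S.angleMap B H M x.1.1) x :=
    (hS.contDiffAt_angleMap hx).comp x contDiffAt_fst.fst
  have h2 : ContDiff ℝ N fun x : SectionParam × ℝ => x.1.2 0 :=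
    (contDiff_param N 0).comp contDiff_fst.snd
  exact (contDiffAt_snd.prodMk contDiffAt_const).prodMk (h1.prodMk (h2.contDiffAt.prodMk contDiffAt_const))

theorem contDiffAt_legOne (hS : S.IsSetting H M N) {x : (SectionParam × Unknown) × ℝ}
    (hx : x.1.1.1.1 ∈ S.transverseActions B H) :
    ContDiffAt ℝ N (fun x : (SectionParam × Unknown) × ℝ => S.legOne B H M x.1.1 x.1.2 x.2) x := by
  have h1 : ContDiffAt ℝ N (fun x : (SectionParam × Unknown) × ℝ =>
      S.startPoint B H M x.1.1 x.1.2.1) x :=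
    ContDiffAt.comp (f := fun x : (SectionParam × Unknown) × ℝ => (x.1.1, x.1.2.1)) x
      (hS.contDiffAt_startPoint (x := (x.1.1, x.1.2.1)) hx)
      (contDiffAt_fst.fst.prodMk contDiffAt_fst.snd.fst)
  exact hS.contDiff_flow.contDiffAt.comp x (h1.prodMk contDiffAt_snd)

theorem contDiffAt_kick_legOne (hS : S.IsSetting H M N) {v : SectionParam × Unknown}
    (hx : v.1.1.1 ∈ S.transverseActions B H) :
    ContDiffAt ℝ N (fun v : SectionParam × Unknown =>
      S.kick c (v.1.2 1) (S.legOne B H M v.1 v.2 v.2.2.1)) v := by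
  have h1 : ContDiffAt ℝ N (fun v : SectionParam × Unknown => S.legOne B H M v.1 v.2 v.2.2.1) v :=
    ContDiffAt.comp (f := fun v : SectionParam × Unknown => (v, v.2.2.1)) v
      (hS.contDiffAt_legOne (x := (v, v.2.2.1)) hx) (contDiffAt_id.prodMk contDiffAt_snd.snd.fst)
  have h2 : ContDiff ℝ N fun v : SectionParam × Unknown => v.1.2 1 :=
    (contDiff_param N 1).comp contDiff_fst.snd
  exact (hS.contDiff_kick c).contDiffAt.comp v (h1.prodMk h2.contDiffAt)

theorem contDiffAt_legTwo (hS : S.IsSetting H M N) {x : (SectionParam × Unknown) × ℝ}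
    (hx : x.1.1.1.1 ∈ S.transverseActions B H) :
    ContDiffAt ℝ N (fun x : (SectionParam × Unknown) × ℝ => S.legTwo B H M c x.1.1 x.1.2 x.2) x := by
  have h1 : ContDiffAt ℝ N (fun x : (SectionParam × Unknown) × ℝ =>
      S.kick c (x.1.1.2 1) (S.legOne B H M x.1.1 x.1.2 x.1.2.2.1)) x :=
    (hS.contDiffAt_kick_legOne c hx).comp x contDiffAt_fst
  exact hS.contDiff_flow.contDiffAt.comp x (h1.prodMk contDiffAt_snd)

/-- The angle map, smooth only at transverse actions, is evaluated both at the initial action and at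
the unknown final one; hence the two conditions. -/
theorem contDiffAt_returnEquation (hS : S.IsSetting H M N) {v : SectionParam × Unknown}
    (hx : v.1.1.1 ∈ S.transverseActions B H) (hy : v.2.2.2.2.1 ∈ S.transverseActions B H) :
    ContDiffAt ℝ N (S.returnEquation B H M c) v := by
  have h1 : ContDiffAt ℝ N (fun v : SectionParam × Unknown => S.startPoint B H M v.1 v.2.1) v :=
    ContDiffAt.comp (f := fun v : SectionParam × Unknown => (v.1, v.2.1)) v
      (hS.contDiffAt_startPoint (x := (v.1, v.2.1)) hx) (contDiffAt_fst.prodMk contDiffAt_snd.fst)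
  have h2 : ContDiffAt ℝ N (fun v : SectionParam × Unknown => S.legOne B H M v.1 v.2 v.2.2.1) v :=
    ContDiffAt.comp (f := fun v : SectionParam × Unknown => (v, v.2.2.1)) v
      (hS.contDiffAt_legOne (x := (v, v.2.2.1)) hx) (contDiffAt_id.prodMk contDiffAt_snd.snd.fst)
  have h3 : ContDiffAt ℝ N (fun v : SectionParam × Unknown =>
      S.legTwo B H M c v.1 v.2 v.2.2.2.1) v :=
    ContDiffAt.comp (f := fun v : SectionParam × Unknown => (v, v.2.2.2.1)) v
      (hS.contDiffAt_legTwo c (x := (v, v.2.2.2.1)) hx)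
      (contDiffAt_id.prodMk contDiffAt_snd.snd.snd.fst)
  have h4 : ContDiffAt ℝ N (fun v : SectionParam × Unknown =>
      S.angleMap B H M (v.2.2.2.2.1, v.1.1.2 + v.2.2.2.2.2)) v :=
    ContDiffAt.comp (f := fun v : SectionParam × Unknown =>
      (v.2.2.2.2.1, v.1.1.2 + v.2.2.2.2.2)) v
      (hS.contDiffAt_angleMap (x := (v.2.2.2.2.1, v.1.1.2 + v.2.2.2.2.2)) hy)
      (contDiffAt_snd.snd.snd.snd.fst.prodMk
        (contDiffAt_fst.fst.snd.add contDiffAt_snd.snd.snd.snd.snd))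
  have h5 : ContDiff ℝ N fun v : SectionParam × Unknown => v.1.2 1 :=
    (contDiff_param N 1).comp contDiff_fst.snd
  have h6 := (hS.contDiff_gate c).contDiffAt.comp v (h2.prodMk h5.contDiffAt)
  exact ((hS.contDiff_energy3.contDiffAt.comp v h1).sub contDiffAt_const).prodMk
    (h6.prodMk (h3.fst.snd.prodMk (h4.sub h3.snd.fst)))

variable {I : ℝ}

theorem isInvertible_of_injective {E : Type*} [NormedAddCommGroup E] [NormedSpace ℝ E]
    [FiniteDimensional ℝ E] {A : E →L[ℝ] E} (h : ∀ v, A v = 0 → v = 0) : A.IsInvertible := by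
  have hinj : Function.Injective (A : E →ₗ[ℝ] E) :=
    (injective_iff_map_eq_zero _).2 h
  refine ⟨(LinearEquiv.ofInjectiveEndo (A : E →ₗ[ℝ] E) hinj).toContinuousLinearEquiv, ?_⟩
  ext v
  simp

theorem start_mem_box (hS : S.IsSetting H M N) (hI : I ∈ S.transverseActions B H) (θ : ℝ) :
    S.startPoint B H M ((I, θ), 0) (S.right₁ B H I) ∈ box M := by
  have hb1 := (hS.orbit₁ hI 0).2
  rw [IsGlobalPotential.orb_zero] at hb1
  exact ⟨hb1, (hS.orbit₂ hI θ 0).2, by simp [startPoint]⟩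

theorem field_fst_of_zero (hS : S.IsSetting H M N) {x : Space} (hx : x ∈ box M)
    (h0 : x.2.2.1 = 0) : (S.sysField M x).1 = (x.1.2, -deriv S.V₁ x.1.1) := by
  rw [sysField, field3_fst (hS.contDiff_cutPotential_three.of_le (by norm_num)) (ε := 0) hx h0,
    force₁_of_zero rfl]
  rfl

/-- The derivative is triangular in the order energy, first leg, second leg, coordinates of the end:
each equation determines one more component of `w` once the earlier ones vanish. The function is
differentiated along the line through the base solution with direction `w`, and the vanishing
components are substituted in turn. -/
theorem injective_returnEquation (hS : S.IsSetting H M N) [Decidable (S.Avoids B H I)]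
    (hI : I ∈ S.transverseActions B H) (θ : ℝ) {w : Unknown}
    (hw : fderiv ℝ (S.returnEquation B H M (S.Avoids B H I))
      (((I, θ), 0), S.baseSolution B H (I, θ)) (0, w) = 0) : w = 0 := by
  obtain ⟨w₁, w₂, w₃, w₄⟩ := w
  have hN : (N : WithTop ℕ∞) ≠ 0 := by
    have := hS.two_le; exact_mod_cast (by omega : N ≠ 0)
  obtain ⟨hR0, hR1, -⟩ := hS.right₁_spec hI
  have hT := hS.halfTime₁_spec hI
  set R := S.right₁ B H I with hR
  set T := S.halfTime₁ B H I with hTdef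
  set y := S.baseSolution B H (I, θ) with hy
  have hbd := hS.hamiltonian.field
  have hcurve : HasDerivAt (fun s : ℝ => ((((I, θ), 0), y + s • (w₁, w₂, w₃, w₄)) :
      SectionParam × Unknown)) (0, (w₁, w₂, w₃, w₄)) 0 := by
    have h1 := ((hasDerivAt_id (0 : ℝ)).smul_const ((w₁, w₂, w₃, w₄) : Unknown)).const_add y
    rw [one_smul] at h1
    exact (hasDerivAt_const _ _).prodMk h1
  have hΦ := ((hS.contDiffAt_returnEquation (B := B) (S.Avoids B H I)
    (v := (((I, θ), 0), y)) hI hI).differentiableAt hN).hasFDerivAt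
  have hd : HasDerivAt (fun s : ℝ => S.returnEquation B H M (S.Avoids B H I)
      (((I, θ), 0), y + s • (w₁, w₂, w₃, w₄))) 0 0 := by
    have h0 : ((((I, θ), 0), y) : SectionParam × Unknown) =
      (fun s : ℝ => (((I, θ), 0), y + s • (w₁, w₂, w₃, w₄))) 0 := by simp
    rw [h0] at hΦ hw
    exact (hΦ.comp_hasDerivAt 0 hcurve).congr_deriv hw
  -- the energy equation
  have hd1 : HasDerivAt (fun s : ℝ => energy3 (S.cutPotential M)
      (S.startPoint B H M ((I, θ), 0) (R + s * w₁)) - H) 0 0 := hd.fst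
  have hw1 : w₁ = 0 := by
    have hs : HasDerivAt (fun s : ℝ => S.startPoint B H M ((I, θ), 0) (R + s * w₁))
        ((w₁, 0), 0, 0) 0 := by
      have h1 : HasDerivAt (fun s : ℝ => R + s * w₁) w₁ 0 := by
        simpa using ((hasDerivAt_id (0 : ℝ)).mul_const w₁).const_add R
      exact (h1.prodMk (hasDerivAt_const _ _)).prodMk
        ((hasDerivAt_const _ _).prodMk (hasDerivAt_const _ _))
    have he := hasFDerivAt_energy3 (hS.contDiff_cutPotential_three.of_le (by norm_num) :
      ContDiff ℝ 2 (S.cutPotential M)) (S.startPoint B H M ((I, θ), 0) (R + 0 * w₁))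
    have h2 := (he.comp_hasDerivAt 0 hs).sub_const H
    have h3 := h2.unique hd1
    rw [zero_mul, add_zero, form3_apply, area_apply,
      hS.field_fst_of_zero (hS.start_mem_box hI θ) rfl] at h3
    have h4 : deriv S.V₁ R * w₁ = 0 := by
      simpa [startPoint, area_apply] using h3
    exact (mul_eq_zero.1 h4).resolve_left hR1.ne'
  subst hw1
  have hflow : ∀ (z : Space) (k : ℝ), HasDerivAt (fun s : ℝ => flow (S.sysField M) z (T + s * k))
      (k • S.sysField M (flow (S.sysField M) z T)) 0 := by
    intro z k
    have h1 : HasDerivAt (fun s : ℝ => T + s * k) k 0 := by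
      simpa using ((hasDerivAt_id (0 : ℝ)).mul_const k).const_add T
    have h2 := hbd.hasDerivAt_flow z (T + 0 * k)
    exact (h2.scomp (0 : ℝ) h1).congr_deriv (by simp)
  -- arrival at the wall
  have hone : ∀ s : ℝ, S.legOne B H M ((I, θ), 0) (y + s • (0, w₂, w₃, w₄)) =
      flow (S.sysField M) (S.startPoint B H M ((I, θ), 0) R) := by
    intro s
    funext t
    simp [legOne, hy, baseSolution, hR]
  obtain ⟨u, hu⟩ := hS.legOne_base hI θ T (y := y) rfl
  have hu' : flow (S.sysField M) (S.startPoint B H M ((I, θ), 0) R) T = _ := hu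
  have hbox1 : flow (S.sysField M) (S.startPoint B H M ((I, θ), 0) R) T ∈ box M := by
    rw [hu']; exact ⟨(hS.orbit₁ hI T).2, (hS.orbit₂ hI _ 0).2, by simp⟩
  have hd2 : HasDerivAt (fun s : ℝ => S.gate (S.Avoids B H I) 0
      (flow (S.sysField M) (S.startPoint B H M ((I, θ), 0) R) (T + s * w₂))) 0 0 := by
    have h1 : HasDerivAt (fun s : ℝ => (S.returnEquation B H M (S.Avoids B H I)
      (((I, θ), 0), y + s • (0, w₂, w₃, w₄))).2.1) 0 0 := hd.snd.fst
    refine h1.congr_of_eventuallyEq (Eventually.of_forall fun s => ?_)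
    simp only [returnEquation, hone]
    rfl
  have hw2 : w₂ = 0 := by
    have h1 := hflow (S.startPoint B H M ((I, θ), 0) R) w₂
    have hf := hS.field_fst_of_zero hbox1 (by rw [hu'])
    have h11 : HasDerivAt (fun s : ℝ => (flow (S.sysField M)
      (S.startPoint B H M ((I, θ), 0) R) (T + s * w₂)).1) _ 0 := h1.fst
    rw [_root_.Prod.smul_fst, hf, hu'] at h11
    unfold gate at hd2
    split_ifs at hd2 with hc
    · have h3 : HasDerivAt (fun s : ℝ => (flow (S.sysField M)
        (S.startPoint B H M ((I, θ), 0) R) (T + s * w₂)).1.2) _ 0 := h11.snd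
      have h4 := h3.unique hd2
      simp only [Prod.smul_mk, smul_eq_mul] at h4
      exact (mul_eq_zero.1 h4).resolve_right (neg_ne_zero.2 (hT.2.2.1 hc).2.1.ne)
    · have h3 : HasDerivAt (fun s : ℝ => (flow (S.sysField M)
        (S.startPoint B H M ((I, θ), 0) R) (T + s * w₂)).1.1) _ 0 := h11.fst
      simp only [zero_mul, sub_zero] at hd2
      have h4 := h3.unique hd2
      simp only [Prod.smul_mk, smul_eq_mul] at h4
      exact (mul_eq_zero.1 h4).resolve_right (hT.2.2.2 hc).2.1.ne
  subst hw2
  -- return to the section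
  have htwo : ∀ s : ℝ, S.legTwo B H M (S.Avoids B H I) ((I, θ), 0) (y + s • (0, 0, w₃, w₄)) =
      S.legTwo B H M (S.Avoids B H I) ((I, θ), 0) y := by
    intro s
    have h2 : (y + s • (0, 0, w₃, w₄)).2.1 = y.2.1 := by simp
    have h1 : (y + s • (0, 0, w₃, w₄)).1 = y.1 := by simp
    funext t
    simp only [legTwo, legOne, h1, h2]
  obtain ⟨u', hu2⟩ := hS.legTwo_base hI θ T (y := y) rfl rfl
  rw [← hTdef, sub_self, IsGlobalPotential.orb_zero] at hu2
  have hbox2 : S.legTwo B H M (S.Avoids B H I) ((I, θ), 0) y T ∈ box M := by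
    rw [hu2]; exact ⟨(hS.start_mem_box hI θ).1, (hS.orbit₂ hI _ 0).2, by simp⟩
  have hw3 : w₃ = 0 := by
    have hd3 : HasDerivAt (fun s : ℝ => (S.legTwo B H M (S.Avoids B H I) ((I, θ), 0) y
        (T + s * w₃)).1.2) 0 0 := by
      have h1 : HasDerivAt (fun s : ℝ => (S.returnEquation B H M (S.Avoids B H I)
        (((I, θ), 0), y + s • (0, 0, w₃, w₄))).2.2.1) 0 0 := hd.snd.snd.fst
      refine h1.congr_of_eventuallyEq (Eventually.of_forall fun s => ?_)
      simp only [returnEquation, htwo]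
      rfl
    have h1 := hflow (S.kick (S.Avoids B H I) ((0 : Params) 1)
      (S.legOne B H M ((I, θ), 0) y y.2.1)) w₃
    have hf := hS.field_fst_of_zero hbox2 (by rw [hu2])
    have h11 : HasDerivAt (fun s : ℝ => (S.legTwo B H M (S.Avoids B H I) ((I, θ), 0) y
        (T + s * w₃)).1) (w₃ • (S.sysField M
          (S.legTwo B H M (S.Avoids B H I) ((I, θ), 0) y T)).1) 0 := h1.fst
    rw [hf, hu2] at h11
    have h3 : HasDerivAt (fun s : ℝ => (S.legTwo B H M (S.Avoids B H I) ((I, θ), 0) y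
        (T + s * w₃)).1.2) _ 0 := h11.snd
    have h4 := h3.unique hd3
    simp only [Prod.smul_mk, smul_eq_mul] at h4
    exact (mul_eq_zero.1 h4).resolve_right (neg_ne_zero.2 hR1.ne')
  subst hw3
  -- The angle map pulls the area form back to a nondegenerate form, so its derivative kills no
  -- vector; testing against the two basis vectors gives the components.
  have hw4 : w₄ = 0 := by
    set x : ℝ × ℝ := (I, θ + S.rotation B H I) with hx
    have hd4 : HasDerivAt (fun s : ℝ => S.angleMap B H M (x + s • w₄) -
        (S.legTwo B H M (S.Avoids B H I) ((I, θ), 0) y T).2.1) 0 0 := by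
      have h1 : HasDerivAt (fun s : ℝ => (S.returnEquation B H M (S.Avoids B H I)
        (((I, θ), 0), y + s • (0, 0, 0, w₄))).2.2.2) 0 0 := hd.snd.snd.snd
      refine h1.congr_of_eventuallyEq (Eventually.of_forall fun s => ?_)
      have hxs : x + s • w₄ = (I + s * w₄.1, θ + (S.rotation B H I + s * w₄.2)) := by
        ext <;> simp [hx, add_assoc]
      simp only [returnEquation, htwo]
      rw [hxs]
      simp [hy, baseSolution, hTdef]
    have h1 : HasDerivAt (fun s : ℝ => x + s • w₄) w₄ 0 := by
      simpa using ((hasDerivAt_id (0 : ℝ)).smul_const w₄).const_add x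
    have h2 : HasFDerivAt (S.angleMap B H M) (fderiv ℝ (S.angleMap B H M) x)
        ((fun s : ℝ => x + s • w₄) 0) := by
      simpa using ((hS.contDiffAt_angleMap (x := x) hI).differentiableAt hN).hasFDerivAt
    have h3 := ((h2.comp_hasDerivAt 0 h1).sub_const _).unique hd4
    have h5 := hS.regular.area_fderiv_angleMap hS.confined (x := x) hI w₄
    rw [h3] at h5
    simp only [map_zero, _root_.zero_apply] at h5
    have e1 := h5 (1, 0)
    have e2 := h5 (0, 1)
    simp only [mul_one, mul_zero, sub_zero, zero_sub] at e1 e2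
    exact Prod.ext (by simp; linarith) (by simp; linarith)
  subst hw4
  rfl

end IsSetting
end ImpactSystem
end ReturnEquationRegularity

/-! ### Persistence of signs along a leg of variable duration -/

section LegSigns

/-- Rescaling the leg to the fixed compact interval `[0, 1]` turns the claim into openness uniform
over a compact set. -/
theorem eventually_mem_on_Icc {X Y : Type*} [TopologicalSpace X] [TopologicalSpace Y] {p₀ : X}
    {ℓ : X → ℝ → Y} {τ : X → ℝ} {O : Set Y} (hO : IsOpen O) (hτ : ContinuousAt τ p₀)
    (hτ0 : 0 < τ p₀) (hℓ : ∀ t, ContinuousAt (fun x : X × ℝ => ℓ x.1 x.2) (p₀, t))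
    (h : ∀ t ∈ Icc 0 (τ p₀), ℓ p₀ t ∈ O) : ∀ᶠ p in 𝓝 p₀, ∀ t ∈ Icc 0 (τ p), ℓ p t ∈ O := by
  have h1 : ∀ᶠ p in 𝓝 p₀, ∀ s ∈ Icc (0 : ℝ) 1, ℓ p (s * τ p) ∈ O := by
    refine isCompact_Icc.eventually_forall_of_forall_eventually fun s hs => ?_
    have hc : ContinuousAt (fun x : X × ℝ => ℓ x.1 (x.2 * τ x.1)) (p₀, s) := by
      refine ContinuousAt.comp (g := fun x : X × ℝ => ℓ x.1 x.2)
        (f := fun x : X × ℝ => (x.1, x.2 * τ x.1)) (hℓ _) ?_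
      exact continuousAt_fst.prodMk (continuousAt_snd.mul
        (ContinuousAt.comp (f := Prod.fst) hτ continuousAt_fst))
    exact hc.eventually (hO.mem_nhds (h _ ⟨by nlinarith [hs.1], by nlinarith [hs.2]⟩))
  filter_upwards [h1, hτ.eventually (lt_mem_nhds hτ0)] with p hp hτp t ht
  have := hp (t / τ p) ⟨div_nonneg ht.1 hτp.le, (div_le_one hτp).2 ht.2⟩
  rwa [div_mul_cancel₀ _ hτp.ne'] at this

/-- Strict negativity is not an open condition near an end where `g` vanishes. There it survives if
the zero persists at the end for nearby `p` and is simple for `p₀`. -/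
theorem eventually_neg_on_leg {X : Type*} [TopologicalSpace X] {p₀ : X} {g g' : X → ℝ → ℝ}
    {τ : X → ℝ} (hg : ∀ p t, HasDerivAt (g p) (g' p t) t)
    (hgc : ∀ t, ContinuousAt (fun x : X × ℝ => g x.1 x.2) (p₀, t))
    (hgc' : ∀ t, ContinuousAt (fun x : X × ℝ => g' x.1 x.2) (p₀, t)) (hτ : ContinuousAt τ p₀)
    (hneg : ∀ t ∈ Ioo 0 (τ p₀), g p₀ t < 0)
    (hstart : g p₀ 0 < 0 ∨ (∀ᶠ p in 𝓝 p₀, g p 0 = 0) ∧ g' p₀ 0 < 0)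
    (hend : g p₀ (τ p₀) < 0 ∨ (∀ᶠ p in 𝓝 p₀, g p (τ p) = 0) ∧ 0 < g' p₀ (τ p₀)) :
    ∀ᶠ p in 𝓝 p₀, ∀ t ∈ Ioo 0 (τ p), g p t < 0 := by
  refine eventually_neg_on_Ioo hτ (fun t _ => hgc t) hneg ?_ ?_
  · rcases hstart with h | ⟨h0, h⟩
    · obtain ⟨a, ha, h1⟩ := eventually_neg_near_base (b := fun _ : X => (0 : ℝ)) continuousAt_const
        (hgc 0) h
      exact ⟨a, ha, h1.mono fun p hp t ht => by simpa using (hp t ht).1⟩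
    · obtain ⟨a, ha, h1⟩ := sign_near_simple_zero (b := fun _ : X => (0 : ℝ))
        (Eventually.of_forall fun p => hg p) (hgc' 0) continuousAt_const h0 h
      exact ⟨a, ha, h1.mono fun p hp t ht => by simpa using (hp t ht).1⟩
  · rcases hend with h | ⟨h0, h⟩
    · obtain ⟨a, ha, h1⟩ := eventually_neg_near_base hτ (hgc _) h
      exact ⟨a, ha, h1.mono fun p hp t ht => (hp t ht).2⟩
    · obtain ⟨a, ha, h1⟩ := sign_near_simple_zero (g := fun p t => -g p t)
        (g' := fun p t => -g' p t) (Eventually.of_forall fun p t => HasDerivAt.fun_neg (hg p t))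
        (hgc' _).neg hτ (h0.mono fun p hp => by simp [hp]) (by simpa using h)
      exact ⟨a, ha, h1.mono fun p hp t ht => by simpa using (hp t ht).2⟩

theorem nonpos_on_Icc {g : ℝ → ℝ} (hg : Continuous g) {τ : ℝ} (hτ : 0 < τ)
    (h : ∀ t ∈ Ioo 0 τ, g t < 0) : ∀ t ∈ Icc 0 τ, g t ≤ 0 := by
  intro t ht
  rw [← closure_Ioo hτ.ne] at ht
  exact closure_minimal (fun s hs => (h s hs).le) (isClosed_le hg continuous_const) ht

end LegSigns

/-! ### Solutions near the unperturbed one satisfy the conditions of a first return -/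

section LocalReturn

namespace ImpactSystem

variable {S : ImpactSystem} {B : Leaf S.V₂} {H M : ℝ} {N : ℕ}

/-- What is needed in order that the solution `y` of the equations gives the first return to the
section of the point with coordinates `p.1`. -/
structure IsReturnData (S : ImpactSystem) (B : Leaf S.V₂) (H M : ℝ) (c : Prop) [Decidable c]
    (p : SectionParam) (y : Unknown) : Prop where
  eqn : S.returnEquation B H M c (p, y) = 0
  pos₁ : 0 < y.2.1
  pos₂ : 0 < y.2.2.1
  box₁ : ∀ t ∈ Icc 0 y.2.1, S.legOne B H M p y t ∈ box M
  box₂ : ∀ t ∈ Icc 0 y.2.2.1, S.legTwo B H M c p y t ∈ box M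
  neg₁ : ∀ t ∈ Ioo 0 y.2.1, (S.legOne B H M p y t).1.2 < 0
  pos_leg₂ : ∀ t ∈ Ioo 0 y.2.2.1, 0 < (S.legTwo B H M c p y t).1.2
  inside₁ : ∀ t ∈ Icc 0 y.2.1,
    S.wall p.2 (S.legOne B H M p y t).2.1.1 ≤ (S.legOne B H M p y t).1.1
  inside₂ : ∀ t ∈ Icc 0 y.2.2.1,
    S.wall p.2 (S.legTwo B H M c p y t).2.1.1 ≤ (S.legTwo B H M c p y t).1.1
  turn : c → 0 < (S.sysField M (S.legOne B H M p y y.2.1)).1.2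
  impact : ¬c → S.IsImpact p.2 (toPhase (S.legOne B H M p y y.2.1)) ∧
    0 < (S.legTwo B H M c p y 0).1.2
  start : (S.sysField M (S.startPoint B H M p y.1)).1.2 < 0
  finish : (S.sysField M (S.legTwo B H M c p y y.2.2.1)).1.2 < 0

namespace IsSetting

variable {I θ : ℝ} {u : SectionParam → Unknown} [Decidable (S.Avoids B H I)]

/-- The gap is the position of the wall minus `q₁`, negative inside the billiard. For a flat wall
its velocity is `-p₁`, so a transversal impact is a simple zero. -/
theorem hasDerivAt_gap (hS : S.IsSetting H M N) (e : Params) (z : Space) (t : ℝ) :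
    HasDerivAt (fun t => e 1 * S.Q (flow (S.sysField M) z t).2.1.1 (e 1) -
        (flow (S.sysField M) z t).1.1)
      (S.wallSlope ((flow (S.sysField M) z t).2.1.1, e 1) * (flow (S.sysField M) z t).2.1.2 -
        (flow (S.sysField M) z t).1.2) t := by
  have h := hS.hamiltonian.field.hasDerivAt_flow z t
  have h1 : HasDerivAt (fun t => (flow (S.sysField M) z t).1) _ t := h.fst
  have h2 : HasDerivAt (fun t => (flow (S.sysField M) z t).1.1) _ t := h1.fst
  have h3 : HasDerivAt (fun t => (flow (S.sysField M) z t).2) _ t := h.snd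
  have h4 : HasDerivAt (fun t => (flow (S.sysField M) z t).2.1) _ t := h3.fst
  have h5 : HasDerivAt (fun t => (flow (S.sysField M) z t).2.1.1) _ t := h4.fst
  have h6 := (hasDerivAt_wall (hS.contDiff_Q.of_le (by norm_cast; omega)) e
    (flow (S.sysField M) z t).2.1.1).comp t h5
  exact h6.sub h2

theorem hasDerivAt_momentum (hS : S.IsSetting H M N) (z : Space) (t : ℝ) :
    HasDerivAt (fun t => (flow (S.sysField M) z t).1.2)
      (S.sysField M (flow (S.sysField M) z t)).1.2 t := by
  have h := hS.hamiltonian.field.hasDerivAt_flow z t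
  have h1 : HasDerivAt (fun t => (flow (S.sysField M) z t).1) _ t := h.fst
  exact h1.snd

/-- The conditions hold on the unperturbed torus. Those with strict inequalities on closed legs are
open; for the sign of `p₁` and of the gap, the zeros at the ends are kept by the return equations
and are simple, so `eventually_neg_on_leg` applies. -/
theorem eventually_isReturnData (hS : S.IsSetting H M N) (hI : I ∈ S.transverseActions B H)
    (hu : ContinuousAt u ((I, θ), 0)) (hu0 : u ((I, θ), 0) = S.baseSolution B H (I, θ))
    (heq : ∀ᶠ p in 𝓝 (((I, θ), 0) : SectionParam),
      S.returnEquation B H M (S.Avoids B H I) (p, u p) = 0) :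
    ∀ᶠ p in 𝓝 (((I, θ), 0) : SectionParam), S.IsReturnData B H M (S.Avoids B H I) p (u p) := by
  set p₀ : SectionParam := ((I, θ), 0) with hp₀
  have hT := hS.halfTime₁_spec hI
  obtain ⟨hR0, hR1, -⟩ := hS.right₁_spec hI
  set R := S.right₁ B H I with hR
  set T := S.halfTime₁ B H I with hTdef
  set x := orb (cut M S.V₁) R with hx
  have hx0 : x 0 = (R, 0) := IsGlobalPotential.orb_zero _ _
  set ℓ₁ : SectionParam → ℝ → Space := fun p t => S.legOne B H M p (u p) t with hℓ₁
  set ℓ₂ : SectionParam → ℝ → Space := fun p t => S.legTwo B H M (S.Avoids B H I) p (u p) t with hℓ₂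
  have hpu : ContinuousAt (fun p => (p, u p)) p₀ := continuousAt_id.prodMk hu
  have hput : ∀ t, ContinuousAt (fun x : SectionParam × ℝ => ((x.1, u x.1), x.2)) (p₀, t) :=
    fun t => ContinuousAt.prodMk (ContinuousAt.comp (g := fun p => (p, u p)) (f := Prod.fst)
      (x := (p₀, t)) hpu continuousAt_fst) continuousAt_snd
  have hc₁ : ∀ t, ContinuousAt (fun x : SectionParam × ℝ => ℓ₁ x.1 x.2) (p₀, t) := fun t =>
    ContinuousAt.comp (x := (p₀, t))
      (g := fun x : (SectionParam × Unknown) × ℝ => S.legOne B H M x.1.1 x.1.2 x.2)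
      (f := fun x : SectionParam × ℝ => ((x.1, u x.1), x.2))
      (hS.contDiffAt_legOne (x := ((p₀, u p₀), t)) hI).continuousAt (hput t)
  have hc₂ : ∀ t, ContinuousAt (fun x : SectionParam × ℝ => ℓ₂ x.1 x.2) (p₀, t) := fun t =>
    ContinuousAt.comp (x := (p₀, t))
      (g := fun x : (SectionParam × Unknown) × ℝ => S.legTwo B H M (S.Avoids B H I) x.1.1 x.1.2 x.2)
      (f := fun x : SectionParam × ℝ => ((x.1, u x.1), x.2))
      (hS.contDiffAt_legTwo (S.Avoids B H I) (x := ((p₀, u p₀), t)) hI).continuousAt (hput t)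
  have hfc : Continuous (S.sysField M) := (contDiff_field3 hS.contDiff_cutPotential).continuous
  have ht₁ : ContinuousAt (fun p => (u p).2.1) p₀ := hu.snd.fst
  have ht₂ : ContinuousAt (fun p => (u p).2.2.1) p₀ := hu.snd.snd.fst
  have ht₁0 : (u p₀).2.1 = T := by rw [hu0]; rfl
  have ht₂0 : (u p₀).2.2.1 = T := by rw [hu0]; rfl
  have hq0 : (u p₀).1 = R := by rw [hu0]; rfl
  have hat₁ : ContinuousAt (fun p => ℓ₁ p (u p).2.1) p₀ :=
    ContinuousAt.comp (g := fun x : SectionParam × ℝ => ℓ₁ x.1 x.2)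
      (f := fun p => (p, (u p).2.1)) (hc₁ _) (continuousAt_id.prodMk ht₁)
  have hat₂ : ContinuousAt (fun p => ℓ₂ p (u p).2.2.1) p₀ :=
    ContinuousAt.comp (g := fun x : SectionParam × ℝ => ℓ₂ x.1 x.2)
      (f := fun p => (p, (u p).2.2.1)) (hc₂ _) (continuousAt_id.prodMk ht₂)
  have hat₃ : ContinuousAt (fun p => ℓ₂ p 0) p₀ :=
    ContinuousAt.comp (g := fun x : SectionParam × ℝ => ℓ₂ x.1 x.2)
      (f := fun p => (p, (0 : ℝ))) (hc₂ _) (continuousAt_id.prodMk continuousAt_const)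
  have hat₀ : ContinuousAt (fun p => ℓ₁ p 0) p₀ :=
    ContinuousAt.comp (g := fun x : SectionParam × ℝ => ℓ₁ x.1 x.2)
      (f := fun p => (p, (0 : ℝ))) (hc₁ _) (continuousAt_id.prodMk continuousAt_const)
  have hb₁ : ∀ t, ∃ w, ℓ₁ p₀ t = (x t,
      S.angleMap B H M (I, θ + t * (Real.pi / S.halfPeriod₂ B H I)), (0, w)) :=
    fun t => hS.legOne_base hI θ t hq0
  have hb₂ : ∀ t, ∃ w, ℓ₂ p₀ t = (((x (T - t)).1, -(x (T - t)).2),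
      S.angleMap B H M (I, θ + (T + t) * (Real.pi / S.halfPeriod₂ B H I)), (0, w)) :=
    fun t => hS.legTwo_base hI θ t hq0 ht₁0
  have h₁fst : ∀ t, (ℓ₁ p₀ t).1 = x t := fun t => by obtain ⟨w, hw⟩ := hb₁ t; rw [hw]
  have h₂fst : ∀ t, (ℓ₂ p₀ t).1 = ((x (T - t)).1, -(x (T - t)).2) := fun t => by
    obtain ⟨w, hw⟩ := hb₂ t; rw [hw]
  have hbox₁ : ∀ t, ℓ₁ p₀ t ∈ box M := fun t => by
    obtain ⟨w, hw⟩ := hb₁ t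
    rw [hw]; exact ⟨(hS.orbit₁ hI t).2, (hS.orbit₂ hI _ 0).2, by simp⟩
  have hbox₂ : ∀ t, ℓ₂ p₀ t ∈ box M := fun t => by
    obtain ⟨w, hw⟩ := hb₂ t
    rw [hw]; exact ⟨(hS.orbit₁ hI _).2, (hS.orbit₂ hI _ 0).2, by simp⟩
  have hf₁ : ∀ t, (S.sysField M (ℓ₁ p₀ t)).1.2 = -deriv S.V₁ (x t).1 := fun t => by
    obtain ⟨w, hw⟩ := hb₁ t
    rw [hS.field_fst_of_zero (hbox₁ t) (by rw [hw]), h₁fst]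
  have hf₂ : ∀ t, (S.sysField M (ℓ₂ p₀ t)).1.2 = -deriv S.V₁ (x (T - t)).1 := fun t => by
    obtain ⟨w, hw⟩ := hb₂ t
    rw [hS.field_fst_of_zero (hbox₂ t) (by rw [hw]), h₂fst]
  have hℓ₁0 : ∀ p, ℓ₁ p 0 = S.startPoint B H M p (u p).1 := fun p => flow_zero _ _
  have hℓ₂0 : ∀ p, ℓ₂ p 0 = S.kick (S.Avoids B H I) (p.2 1) (ℓ₁ p (u p).2.1) := fun p => flow_zero _ _
  have hend1 : ∀ᶠ p in 𝓝 p₀, S.gate (S.Avoids B H I) (p.2 1) (ℓ₁ p (u p).2.1) = 0 :=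
    heq.mono fun p hp => congrArg (fun y : Unknown => y.2.1) hp
  have hend2 : ∀ᶠ p in 𝓝 p₀, (ℓ₂ p (u p).2.2.1).1.2 = 0 :=
    heq.mono fun p hp => congrArg (fun y : Unknown => y.2.2.1) hp
  have he1 : ContinuousAt (fun p : SectionParam => p.2 1) p₀ :=
    ((contDiff_param 0 1).continuous.comp continuous_snd).continuousAt
  have he1' : ∀ t, ContinuousAt (fun x : SectionParam × ℝ => x.1.2 1) (p₀, t) := fun t =>
    ContinuousAt.comp (g := fun p : SectionParam => p.2 1) (f := Prod.fst) (x := (p₀, t)) he1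
      continuousAt_fst
  have hQc : Continuous fun x : ℝ × ℝ => S.Q x.1 x.2 := hS.contDiff_Q.continuous
  have hsc : Continuous S.wallSlope := (contDiff_wallSlope hS.contDiff_Q).continuous
  -- the gap between the wall and the orbit
  set G : Space → ℝ → ℝ := fun z e => e * S.Q z.2.1.1 e - z.1.1 with hG
  set G' : Space → ℝ → ℝ := fun z e => S.wallSlope (z.2.1.1, e) * z.2.1.2 - z.1.2 with hG'
  have hGc : Continuous fun x : Space × ℝ => G x.1 x.2 := by
    have h1 : Continuous fun x : Space × ℝ => S.Q x.1.2.1.1 x.2 :=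
      hQc.comp (continuous_fst.snd.fst.fst.prodMk continuous_snd)
    simp only [hG]; fun_prop
  have hGc' : Continuous fun x : Space × ℝ => G' x.1 x.2 := by
    have h1 : Continuous fun x : Space × ℝ => S.wallSlope (x.1.2.1.1, x.2) :=
      hsc.comp (continuous_fst.snd.fst.fst.prodMk continuous_snd)
    simp only [hG']; fun_prop
  have hG0 : ∀ z : Space, G z 0 = -z.1.1 := fun z => by simp [hG]
  have hG0' : ∀ z : Space, G' z 0 = -z.1.2 := fun z => by simp [hG', wallSlope]
  have hGℓ : ∀ {ℓ : SectionParam → ℝ → Space},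
      (∀ t, ContinuousAt (fun x : SectionParam × ℝ => ℓ x.1 x.2) (p₀, t)) →
      (∀ t, ContinuousAt (fun x : SectionParam × ℝ => G (ℓ x.1 x.2) (x.1.2 1)) (p₀, t)) ∧
      ∀ t, ContinuousAt (fun x : SectionParam × ℝ => G' (ℓ x.1 x.2) (x.1.2 1)) (p₀, t) :=
    fun h => ⟨fun t => ContinuousAt.comp (g := fun x : Space × ℝ => G x.1 x.2)
      hGc.continuousAt ((h t).prodMk (he1' t)),
      fun t => ContinuousAt.comp (g := fun x : Space × ℝ => G' x.1 x.2)
      hGc'.continuousAt ((h t).prodMk (he1' t))⟩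
  -- The leg starts at `p₁ = 0` exactly. It ends either at a turning point, where the equation keeps
  -- `p₁ = 0` and the force is positive, or at the wall, where `p₁` is strictly negative.
  have E2 : ∀ᶠ p in 𝓝 p₀, ∀ t ∈ Ioo 0 (u p).2.1, (ℓ₁ p t).1.2 < 0 := by
    refine eventually_neg_on_leg (g := fun p t => (ℓ₁ p t).1.2)
      (g' := fun p t => (S.sysField M (ℓ₁ p t)).1.2) (fun p t => hS.hasDerivAt_momentum _ t)
      (fun t => (hc₁ t).fst.snd) (fun t => (hfc.continuousAt.comp (hc₁ t)).fst.snd) ht₁ ?_ ?_ ?_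
    · intro t ht
      rw [ht₁0] at ht
      simp only [h₁fst]
      exact hT.2.1 t ht
    · refine Or.inr ⟨Eventually.of_forall fun p => by simp only [hℓ₁0]; rfl, ?_⟩
      simp only [hf₁, hx0]
      linarith
    · by_cases h : (S.Avoids B H I)
      · refine Or.inr ⟨hend1.mono fun p hp => by simpa [gate, h] using hp, ?_⟩
        simp only [hf₁, ht₁0]
        linarith [(hT.2.2.1 h).2.1]
      · refine Or.inl ?_
        simp only [h₁fst, ht₁0]
        exact (hT.2.2.2 h).2.1
  have E3 : ∀ᶠ p in 𝓝 p₀, ∀ t ∈ Ioo 0 (u p).2.2.1, -(ℓ₂ p t).1.2 < 0 := by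
    refine eventually_neg_on_leg (g := fun p t => -(ℓ₂ p t).1.2)
      (g' := fun p t => -(S.sysField M (ℓ₂ p t)).1.2)
      (fun p t => HasDerivAt.fun_neg (hS.hasDerivAt_momentum _ t))
      (fun t => (hc₂ t).fst.snd.neg) (fun t => (hfc.continuousAt.comp (hc₂ t)).fst.snd.neg) ht₂
      ?_ ?_ ?_
    · intro t ht
      rw [ht₂0] at ht
      simp only [h₂fst, neg_neg]
      exact hT.2.1 _ ⟨by linarith [ht.2], by linarith [ht.1]⟩
    · by_cases h : (S.Avoids B H I)
      · refine Or.inr ⟨hend1.mono fun p hp => ?_, ?_⟩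
        · simp only [hℓ₂0, kick, if_pos h]
          simpa [gate, h] using hp
        · simp only [hf₂, sub_zero, neg_neg]
          exact (hT.2.2.1 h).2.1
      · refine Or.inl ?_
        simp only [h₂fst, neg_neg, sub_zero]
        exact (hT.2.2.2 h).2.1
    · refine Or.inr ⟨hend2.mono fun p hp => by simp [hp], ?_⟩
      simp only [hf₂, ht₂0, sub_self, hx0]
      linarith
  -- A torus that avoids the wall has a strictly negative gap up to the end. Otherwise the gate
  -- equation keeps the zero at the end, and the unperturbed gap grows there at rate `-p₁ > 0`.
  have E4 : ∀ᶠ p in 𝓝 p₀, ∀ t ∈ Ioo 0 (u p).2.1, G (ℓ₁ p t) (p.2 1) < 0 := by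
    refine eventually_neg_on_leg (g := fun p t => G (ℓ₁ p t) (p.2 1))
      (g' := fun p t => G' (ℓ₁ p t) (p.2 1)) (fun p t => hS.hasDerivAt_gap p.2 _ t)
      (hGℓ hc₁).1 (hGℓ hc₁).2 ht₁ ?_ ?_ ?_
    · intro t ht
      rw [ht₁0] at ht
      show G (ℓ₁ p₀ t) 0 < 0
      rw [hG0, h₁fst, neg_lt_zero]
      by_cases h : (S.Avoids B H I)
      · exact (hT.2.2.1 h).2.2 t
      · exact (hT.2.2.2 h).2.2.2 t ⟨ht.1.le, ht.2⟩
    · refine Or.inl ?_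
      show G (ℓ₁ p₀ 0) 0 < 0
      rw [hG0, h₁fst, neg_lt_zero, hx0]
      exact hR0
    · by_cases h : (S.Avoids B H I)
      · refine Or.inl ?_
        show G (ℓ₁ p₀ (u p₀).2.1) 0 < 0
        rw [hG0, h₁fst, neg_lt_zero]
        exact (hT.2.2.1 h).2.2 _
      · refine Or.inr ⟨hend1.mono fun p hp => ?_, ?_⟩
        · simp only [gate, if_neg h] at hp
          simp only [hG]; linarith
        · show 0 < G' (ℓ₁ p₀ (u p₀).2.1) 0
          rw [hG0', h₁fst, ht₁0]
          linarith [(hT.2.2.2 h).2.1]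
  -- Reflection does not move the position, so the zero of the gap at the impact is also the start
  -- of the second leg, where the unperturbed `p₁` is positive and the gap decreases.
  have E5 : ∀ᶠ p in 𝓝 p₀, ∀ t ∈ Ioo 0 (u p).2.2.1, G (ℓ₂ p t) (p.2 1) < 0 := by
    refine eventually_neg_on_leg (g := fun p t => G (ℓ₂ p t) (p.2 1))
      (g' := fun p t => G' (ℓ₂ p t) (p.2 1)) (fun p t => hS.hasDerivAt_gap p.2 _ t)
      (hGℓ hc₂).1 (hGℓ hc₂).2 ht₂ ?_ ?_ ?_
    · intro t ht
      rw [ht₂0] at ht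
      show G (ℓ₂ p₀ t) 0 < 0
      rw [hG0, h₂fst, neg_lt_zero]
      by_cases h : (S.Avoids B H I)
      · exact (hT.2.2.1 h).2.2 _
      · exact (hT.2.2.2 h).2.2.2 _ ⟨by linarith [ht.2], by linarith [ht.1]⟩
    · by_cases h : (S.Avoids B H I)
      · refine Or.inl ?_
        show G (ℓ₂ p₀ 0) 0 < 0
        rw [hG0, h₂fst, neg_lt_zero]
        exact (hT.2.2.1 h).2.2 _
      · refine Or.inr ⟨hend1.mono fun p hp => ?_, ?_⟩
        · simp only [gate, if_neg h] at hp
          simp only [hG, hℓ₂0, kick, if_neg h, reflectMap]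
          linarith
        · show G' (ℓ₂ p₀ 0) 0 < 0
          rw [hG0', h₂fst, sub_zero]
          simp only [neg_neg]
          exact (hT.2.2.2 h).2.1
    · refine Or.inl ?_
      show G (ℓ₂ p₀ (u p₀).2.2.1) 0 < 0
      rw [hG0, h₂fst, ht₂0, sub_self, neg_lt_zero, hx0]
      exact hR0
  have hO := isOpen_box M
  have E6 := eventually_mem_on_Icc hO ht₁ (by simp only [ht₁0]; exact hT.1) hc₁ fun t _ => hbox₁ t
  have E7 := eventually_mem_on_Icc hO ht₂ (by simp only [ht₂0]; exact hT.1) hc₂ fun t _ => hbox₂ t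
  have E8 : ∀ᶠ p in 𝓝 p₀, 0 < (u p).2.1 := ht₁.eventually (lt_mem_nhds (by simp only [ht₁0]; exact hT.1))
  have E9 : ∀ᶠ p in 𝓝 p₀, 0 < (u p).2.2.1 :=
    ht₂.eventually (lt_mem_nhds (by simp only [ht₂0]; exact hT.1))
  have E10 : ∀ᶠ p in 𝓝 p₀, (S.sysField M (ℓ₁ p 0)).1.2 < 0 :=
    (hfc.continuousAt.comp hat₀).fst.snd.eventually
      (gt_mem_nhds (by simp only [Function.comp, hf₁, hx0]; linarith))
  have E11 : ∀ᶠ p in 𝓝 p₀, (S.sysField M (ℓ₂ p (u p).2.2.1)).1.2 < 0 :=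
    (hfc.continuousAt.comp hat₂).fst.snd.eventually
      (gt_mem_nhds (by simp only [Function.comp, hf₂, ht₂0, sub_self, hx0]; linarith))
  have E12 : ∀ᶠ p in 𝓝 p₀, (S.Avoids B H I) → 0 < (S.sysField M (ℓ₁ p (u p).2.1)).1.2 := by
    by_cases h : (S.Avoids B H I)
    · have := (hfc.continuousAt.comp hat₁).fst.snd.eventually
        (lt_mem_nhds (a := 0) (by
          simp only [Function.comp, hf₁, ht₁0]; linarith [(hT.2.2.1 h).2.1]))
      exact this.mono fun p hp _ => hp
    · exact Eventually.of_forall fun p hp => absurd hp h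
  have E13 : ∀ᶠ p in 𝓝 p₀, ¬(S.Avoids B H I) → S.IsImpact p.2 (toPhase (ℓ₁ p (u p).2.1)) ∧
      0 < (ℓ₂ p 0).1.2 := by
    by_cases h : (S.Avoids B H I)
    · exact Eventually.of_forall fun p hp => absurd h hp
    · have hslope : ContinuousAt (fun p => S.wallSlope ((ℓ₁ p (u p).2.1).2.1.1, p.2 1)) p₀ :=
        ContinuousAt.comp (f := fun p => ((ℓ₁ p (u p).2.1).2.1.1, p.2 1)) hsc.continuousAt
          (hat₁.snd.fst.fst.prodMk he1)
      have hn : ContinuousAt (fun p => (ℓ₁ p (u p).2.1).1.2 -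
          S.wallSlope ((ℓ₁ p (u p).2.1).2.1.1, p.2 1) * (ℓ₁ p (u p).2.1).2.1.2) p₀ :=
        hat₁.fst.snd.sub (hslope.mul hat₁.snd.fst.snd)
      have hk : ContinuousAt (fun p => ((ℓ₁ p (u p).2.1).1.2 -
          S.wallSlope ((ℓ₁ p (u p).2.1).2.1.1, p.2 1) * (ℓ₁ p (u p).2.1).2.1.2) ^ 2 /
          (1 + S.wallSlope ((ℓ₁ p (u p).2.1).2.1.1, p.2 1) ^ 2) / 2) p₀ :=
        ContinuousAt.div_const (ContinuousAt.div (hn.pow 2)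
          ((continuousAt_const (y := (1 : ℝ))).add (hslope.pow 2))
          (add_pos_of_pos_of_nonneg one_pos (sq_nonneg _)).ne') 2
      have hs0 : S.wallSlope ((ℓ₁ p₀ (u p₀).2.1).2.1.1, p₀.2 1) = 0 := by
        show (0 : ℝ) * _ = 0
        rw [zero_mul]
      have hx1 := (hT.2.2.2 h).2.1
      have hn0 := hn.eventually (Iio_mem_nhds (a := 0) (by
        beta_reduce; rw [hs0, h₁fst, ht₁0, zero_mul, sub_zero]; exact hx1))
      have hk0 := hk.eventually (Iio_mem_nhds (a := S.b) (by
        beta_reduce; rw [hs0, h₁fst, ht₁0, zero_mul, sub_zero]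
        simpa using (hT.2.2.2 h).2.2.1))
      have hp2 : ∀ᶠ p in 𝓝 p₀, 0 < (ℓ₂ p 0).1.2 := hat₃.fst.snd.eventually (lt_mem_nhds (by
        simp only [h₂fst, sub_zero]; linarith))
      filter_upwards [hn0, hk0, hp2, hend1] with p h1 h2 h3 h4 _
      refine ⟨⟨?_, ?_, ?_⟩, h3⟩
      · simp only [gate, if_neg h] at h4
        exact sub_eq_zero.1 h4
      · simpa [normalMomentum, toPhase,
          (hasDerivAt_wall (hS.contDiff_Q.of_le (by norm_cast; omega)) _ _).deriv] using h1
      · simpa [normalMomentum, toPhase,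
          (hasDerivAt_wall (hS.contDiff_Q.of_le (by norm_cast; omega)) _ _).deriv] using h2
  have hflowc : ∀ z, Continuous fun t => flow (S.sysField M) z t :=
    fun z => hS.hamiltonian.field.continuous_flow z
  filter_upwards [heq, E2, E3, E4, E5, E6, E7, E8, E9, E10, E11, E12, E13]
    with p e1 e2 e3 e4 e5 e6 e7 e8 e9 e10 e11 e12 e13
  refine ⟨e1, e8, e9, e6, e7, e2, fun t ht => neg_lt_zero.1 (e3 t ht), ?_, ?_, e12, e13, ?_, e11⟩
  · intro t ht
    have hc : Continuous fun t => G (ℓ₁ p t) (p.2 1) :=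
      hGc.comp ((hflowc _).prodMk continuous_const)
    have := nonpos_on_Icc hc e8 e4 t ht
    exact sub_nonpos.1 this
  · intro t ht
    have hc : Continuous fun t => G (ℓ₂ p t) (p.2 1) :=
      hGc.comp ((hflowc _).prodMk continuous_const)
    have := nonpos_on_Icc hc e9 e5 t ht
    exact sub_nonpos.1 this
  · rw [hℓ₁0] at e10
    exact e10

end IsSetting
end ImpactSystem
end LocalReturn

/-! ### From the two legs to a trajectory of the impact system -/

section FirstReturn

namespace ImpactSystem

variable {S : ImpactSystem} {B : Leaf S.V₂} {H M : ℝ} {N : ℕ}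

namespace IsSetting

theorem flow_motion (hS : S.IsSetting H M N) {ε : Params} {z : Space} (hz : z.2.2.1 = ε 0) {t : ℝ}
    (hb : flow (S.sysField M) z t ∈ box M) :
    HasDerivAt (fun s => (toPhase (flow (S.sysField M) z s)).q₁)
        (toPhase (flow (S.sysField M) z t)).p₁ t ∧
      HasDerivAt (fun s => (toPhase (flow (S.sysField M) z s)).p₁)
        (S.force₁ ε (toPhase (flow (S.sysField M) z t))) t ∧
      HasDerivAt (fun s => (toPhase (flow (S.sysField M) z s)).q₂)
        (toPhase (flow (S.sysField M) z t)).p₂ t ∧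
      HasDerivAt (fun s => (toPhase (flow (S.sysField M) z s)).p₂)
        (S.force₂ ε (toPhase (flow (S.sysField M) z t))) t := by
  have h := hS.hamiltonian.field.hasDerivAt_flow z t
  have hU : ContDiff ℝ 1 (S.cutPotential M) := hS.contDiff_cutPotential_three.of_le (by norm_num)
  have hs : (flow (S.sysField M) z t).2.2.1 = ε 0 := by
    rw [param_flow hS.hamiltonian.field, hz]
  have h1 : HasDerivAt (fun t => (flow (S.sysField M) z t).1) _ t := h.fst
  have h2 : HasDerivAt (fun t => (flow (S.sysField M) z t).2) _ t := h.snd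
  have h3 : HasDerivAt (fun t => (flow (S.sysField M) z t).2.1) _ t := h2.fst
  rw [field3_fst hU hb hs] at h1
  rw [field3_snd hU hb hs] at h3
  exact ⟨h1.fst, h1.snd, h3.fst, h3.snd⟩

theorem force_eq (hS : S.IsSetting H M N) {ε : Params} {z : Space} (hz : z.2.2.1 = ε 0)
    (hb : z ∈ box M) : S.force₁ ε (toPhase z) = (S.sysField M z).1.2 := by
  rw [sysField, field3_fst (hS.contDiff_cutPotential_three.of_le (by norm_num)) hb hz]

theorem tendsToPhase_flow (hS : S.IsSetting H M N) (z : Space) (t₀ t : ℝ) {l : Filter ℝ}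
    (hl : l ≤ 𝓝 t) : TendsToPhase (fun s => toPhase (flow (S.sysField M) z (s - t₀))) l
      (toPhase (flow (S.sysField M) z (t - t₀))) := by
  have hc : Continuous fun s => flow (S.sysField M) z (s - t₀) :=
    (hS.hamiltonian.field.continuous_flow z).comp (continuous_sub_right t₀)
  exact ⟨(hc.fst.fst.tendsto t).mono_left hl, (hc.fst.snd.tendsto t).mono_left hl,
    (hc.snd.fst.fst.tendsto t).mono_left hl, (hc.snd.fst.snd.tendsto t).mono_left hl⟩

variable {c : Prop} [Decidable c] {p : SectionParam} {y : Unknown}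

theorem legOne_zero :
    S.legOne B H M p y 0 = S.startPoint B H M p y.1 := flow_zero _ _

theorem legTwo_zero :
    S.legTwo B H M c p y 0 = S.kick c (p.2 1) (S.legOne B H M p y y.2.1) := flow_zero _ _

theorem param_legOne (hS : S.IsSetting H M N) (t : ℝ) :
    (S.legOne B H M p y t).2.2.1 = p.2 0 := param_flow hS.hamiltonian.field _ _

theorem param_legTwo (hS : S.IsSetting H M N) (t : ℝ) :
    (S.legTwo B H M c p y t).2.2.1 = p.2 0 := by
  rw [legTwo, param_flow hS.hamiltonian.field]
  unfold kick
  split_ifs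
  · exact hS.param_legOne _
  · exact hS.param_legOne _

/-- Smooth motion along the flow of a point of the section until the next section point. -/
theorem isFirstReturn_of_smooth (hS : S.IsSetting H M N) (hc : c)
    (h : S.IsReturnData B H M c p y) :
    S.IsFirstReturn p.2 (toPhase (S.startPoint B H M p y.1))
      (toPhase (S.legTwo B H M c p y y.2.2.1)) := by
  have hpos := h.pos₁
  have hpos' := h.pos₂
  have hadd : ∀ t, S.legTwo B H M c p y t = S.legOne B H M p y (y.2.1 + t) := by
    intro t
    simp only [legTwo, kick, if_pos hc, legOne]
    rw [hS.hamiltonian.field.flow_add]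
  have hadd' : ∀ t, S.legOne B H M p y t = S.legTwo B H M c p y (t - y.2.1) := by
    intro t; rw [hadd]; congr 1; ring
  have hbox : ∀ t ∈ Icc 0 (y.2.1 + y.2.2.1), S.legOne B H M p y t ∈ box M := by
    intro t ht
    rcases le_total t y.2.1 with h1 | h1
    · exact h.box₁ t ⟨ht.1, h1⟩
    · rw [hadd' t]; exact h.box₂ _ ⟨by linarith, by linarith [ht.2]⟩
  have hturn : (S.legOne B H M p y y.2.1).1.2 = 0 := by
    have := congrArg (fun z : Unknown => z.2.1) h.eqn
    simpa [returnEquation, gate, hc] using this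
  have hend : (S.legTwo B H M c p y y.2.2.1).1.2 = 0 := by
    have := congrArg (fun z : Unknown => z.2.2.1) h.eqn
    simpa [returnEquation] using this
  refine ⟨y.2.1 + y.2.2.1, by linarith, fun t => toPhase (S.legOne B H M p y t), ∅,
    ⟨by simp, ?_, ?_, by simp⟩, ?_, ?_, ⟨rfl, ?_⟩, ⟨hend, ?_⟩, ?_⟩
  · intro t ht
    rcases le_total t y.2.1 with h1 | h1
    · exact h.inside₁ t ⟨ht.1, h1⟩
    · rw [hadd' t]; exact h.inside₂ _ ⟨by linarith, by linarith [ht.2]⟩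
  · intro t ht _
    have hm := hS.flow_motion (ε := p.2) (z := S.startPoint B H M p y.1) rfl (hbox t ht)
    exact ⟨hm.1.hasDerivWithinAt, hm.2.1.hasDerivWithinAt, hm.2.2.1.hasDerivWithinAt,
      hm.2.2.2.hasDerivWithinAt⟩
  · simp only [legOne_zero]
  · simp only [hadd]
  · have := hbox 0 ⟨le_rfl, by linarith⟩
    rw [legOne_zero] at this
    rw [hS.force_eq rfl this]
    exact h.start
  · rw [hS.force_eq (hS.param_legTwo _) (h.box₂ _ ⟨hpos'.le, le_rfl⟩)]
    exact h.finish
  -- Strictly between the ends, `p₁` vanishes only at the junction of the legs, which is a left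
  -- turning point: the force is positive there, so the section is not met.
  · rintro t ht ⟨h1, h2⟩
    rw [hS.force_eq (hS.param_legOne _) (hbox t ⟨ht.1.le, ht.2.le⟩)] at h2
    rcases lt_trichotomy t y.2.1 with h3 | h3 | h3
    · exact (h.neg₁ t ⟨ht.1, h3⟩).ne h1
    · rw [h3] at h2; exact (h.turn hc).not_gt h2
    · have := h.pos_leg₂ (t - y.2.1) ⟨by linarith, by linarith [ht.2]⟩
      rw [← hadd' t] at this
      exact this.ne' h1

/-- Motion with one reflection at the wall. -/
theorem isFirstReturn_of_impact (hS : S.IsSetting H M N) (hc : ¬c)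
    (h : S.IsReturnData B H M c p y) :
    S.IsFirstReturn p.2 (toPhase (S.startPoint B H M p y.1))
      (toPhase (S.legTwo B H M c p y y.2.2.1)) := by
  have hpos := h.pos₁
  have hpos' := h.pos₂
  obtain ⟨himp, hp0⟩ := h.impact hc
  have hend : (S.legTwo B H M c p y y.2.2.1).1.2 = 0 := by
    have := congrArg (fun z : Unknown => z.2.2.1) h.eqn
    simpa [returnEquation] using this
  set t₁ := y.2.1 with ht₁
  set T := t₁ + y.2.2.1 with hT
  -- At the impact time the curve takes the value after the reflection, as the definition of a
  -- trajectory requires.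
  set γ : ℝ → Phase := fun t => if t < t₁ then toPhase (S.legOne B H M p y t) else
    toPhase (S.legTwo B H M c p y (t - t₁)) with hγ
  have hγ₁ : ∀ t, t < t₁ → γ t = toPhase (S.legOne B H M p y t) := fun t ht => if_pos ht
  have hγ₂ : ∀ t, t₁ ≤ t → γ t = toPhase (S.legTwo B H M c p y (t - t₁)) :=
    fun t ht => if_neg ht.not_gt
  have hlocal : ∀ t, t < t₁ → γ =ᶠ[𝓝 t] fun t => toPhase (S.legOne B H M p y t) :=
    fun t ht => (gt_mem_nhds ht).mono fun s hs => hγ₁ s hs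
  have hlocal' : ∀ t, t₁ < t → γ =ᶠ[𝓝 t] fun t => toPhase (S.legTwo B H M c p y (t - t₁)) :=
    fun t ht => (lt_mem_nhds ht).mono fun s hs => hγ₂ s (le_of_lt hs)
  have hmid : γ t₁ = S.reflect p.2 (toPhase (S.legOne B H M p y t₁)) := by
    rw [hγ₂ _ le_rfl, sub_self, legTwo_zero, kick, if_neg hc,
      toPhase_reflectMap (hS.contDiff_Q.of_le (by norm_cast; omega))]
  refine ⟨T, by linarith, γ, {t₁}, ⟨?_, ?_, ?_, ?_⟩, ?_, ?_, ⟨rfl, ?_⟩, ⟨hend, ?_⟩, ?_⟩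
  · intro s hs
    rw [Finset.mem_singleton.1 hs]
    exact ⟨hpos, by linarith⟩
  · intro t ht
    rcases lt_or_ge t t₁ with h1 | h1
    · rw [hγ₁ t h1]; exact h.inside₁ t ⟨ht.1, h1.le⟩
    · rw [hγ₂ t h1]; exact h.inside₂ _ ⟨by linarith, by linarith [ht.2]⟩
  · intro t ht htτ
    have hne : t ≠ t₁ := fun he => htτ (Finset.mem_singleton.2 he)
    rcases lt_or_gt_of_ne hne with h1 | h1
    · have hm := hS.flow_motion (ε := p.2) (z := S.startPoint B H M p y.1) rfl (h.box₁ t ⟨ht.1, h1.le⟩)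
      have hl := hlocal t h1
      rw [hγ₁ t h1]
      exact ⟨(hm.1.congr_of_eventuallyEq (hl.fun_comp Phase.q₁)).hasDerivWithinAt,
        (hm.2.1.congr_of_eventuallyEq (hl.fun_comp Phase.p₁)).hasDerivWithinAt,
        (hm.2.2.1.congr_of_eventuallyEq (hl.fun_comp Phase.q₂)).hasDerivWithinAt,
        (hm.2.2.2.congr_of_eventuallyEq (hl.fun_comp Phase.p₂)).hasDerivWithinAt⟩
    · have hz := hS.param_legTwo (B := B) (c := c) (p := p) (y := y) 0
      rw [legTwo_zero] at hz
      have hm := hS.flow_motion (ε := p.2) (z := S.kick c (p.2 1) (S.legOne B H M p y y.2.1)) hz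
        (h.box₂ (t - t₁) ⟨by linarith, by linarith [ht.2]⟩)
      have hl := hlocal' t h1
      rw [hγ₂ t h1.le]
      exact ⟨((hm.1.comp_sub_const t t₁).congr_of_eventuallyEq
          (hl.fun_comp Phase.q₁)).hasDerivWithinAt,
        ((hm.2.1.comp_sub_const t t₁).congr_of_eventuallyEq
          (hl.fun_comp Phase.p₁)).hasDerivWithinAt,
        ((hm.2.2.1.comp_sub_const t t₁).congr_of_eventuallyEq
          (hl.fun_comp Phase.q₂)).hasDerivWithinAt,
        ((hm.2.2.2.comp_sub_const t t₁).congr_of_eventuallyEq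
          (hl.fun_comp Phase.p₂)).hasDerivWithinAt⟩
  · intro s hs
    rw [Finset.mem_singleton.1 hs]
    refine ⟨_, ?_, himp, hmid, ?_⟩
    · have h1 := hS.tendsToPhase_flow (S.startPoint B H M p y.1) 0 t₁ (l := 𝓝[<] t₁) inf_le_left
      simp only [sub_zero] at h1
      have hl : γ =ᶠ[𝓝[<] t₁] fun t => toPhase (S.legOne B H M p y t) :=
        eventually_mem_nhdsWithin.mono fun s hs => hγ₁ s hs
      exact ⟨h1.1.congr' (hl.fun_comp Phase.q₁).symm, h1.2.1.congr' (hl.fun_comp Phase.p₁).symm,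
        h1.2.2.1.congr' (hl.fun_comp Phase.q₂).symm, h1.2.2.2.congr' (hl.fun_comp Phase.p₂).symm⟩
    · have h1 := hS.tendsToPhase_flow (S.kick c (p.2 1) (S.legOne B H M p y y.2.1)) t₁ t₁
        (l := 𝓝[>] t₁) inf_le_left
      have hl : γ =ᶠ[𝓝[>] t₁] fun t => toPhase (S.legTwo B H M c p y (t - t₁)) :=
        eventually_mem_nhdsWithin.mono fun s hs => hγ₂ s (le_of_lt hs)
      rw [hγ₂ t₁ le_rfl]
      exact ⟨h1.1.congr' (hl.fun_comp Phase.q₁).symm, h1.2.1.congr' (hl.fun_comp Phase.p₁).symm,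
        h1.2.2.1.congr' (hl.fun_comp Phase.q₂).symm, h1.2.2.2.congr' (hl.fun_comp Phase.p₂).symm⟩
  · rw [hγ₁ 0 hpos, legOne_zero]
  · rw [hγ₂ T (by linarith), hT, add_sub_cancel_left]
  · have := h.box₁ 0 ⟨le_rfl, hpos.le⟩
    rw [legOne_zero] at this
    rw [hS.force_eq rfl this]
    exact h.start
  · rw [hS.force_eq (hS.param_legTwo _) (h.box₂ _ ⟨hpos'.le, le_rfl⟩)]
    exact h.finish
  -- `p₁` is negative before the impact and positive afterwards, at the impact time too because the
  -- value there is the reflected one.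
  · rintro t ht ⟨h1, -⟩
    rcases lt_trichotomy t t₁ with h3 | h3 | h3
    · rw [hγ₁ t h3] at h1
      exact (h.neg₁ t ⟨ht.1, h3⟩).ne h1
    · rw [h3, hγ₂ _ le_rfl, sub_self] at h1
      exact hp0.ne' h1
    · rw [hγ₂ t h3.le] at h1
      exact (h.pos_leg₂ (t - t₁) ⟨by linarith, by linarith [ht.2]⟩).ne' h1

theorem isFirstReturn (hS : S.IsSetting H M N) (h : S.IsReturnData B H M c p y) :
    S.IsFirstReturn p.2 (toPhase (S.startPoint B H M p y.1))
      (toPhase (S.legTwo B H M c p y y.2.2.1)) := by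
  by_cases hc : c
  · exact hS.isFirstReturn_of_smooth hc h
  · exact hS.isFirstReturn_of_impact hc h

end IsSetting
end ImpactSystem
end FirstReturn

/-! ### Points of the perturbed section and their returns -/

section SectionPoints

namespace ImpactSystem

variable {S : ImpactSystem} {B : Leaf S.V₂} {H M κ : ℝ} {N : ℕ}

/-- The coordinates `p.1` determine a section point, which returns to the section at the point
with coordinates `(z.1, p.1.2 + z.2)`. -/
def HasReturn (S : ImpactSystem) (B : Leaf S.V₂) (H κ : ℝ) (p : SectionParam) (z : ℝ × ℝ) : Prop :=
  (∃! x, S.IsSectionPoint B H κ p.2 p.1.1 p.1.2 x) ∧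
    ∀ x, S.IsSectionPoint B H κ p.2 p.1.1 p.1.2 x →
      ∃ y, S.IsFirstReturn p.2 x y ∧ S.IsSectionPoint B H κ p.2 z.1 (p.1.2 + z.2) y

namespace IsSetting

variable {c : Prop} [Decidable c] {p : SectionParam} {y : Unknown}

theorem isSectionPoint_start (hS : S.IsSetting H M N) (h : S.IsReturnData B H M c p y)
    (hI : p.1.1 ∈ S.transverseActions B H) (hκ : |y.1 - S.right₁ B H p.1.1| < κ) :
    S.IsSectionPoint B H κ p.2 p.1.1 p.1.2 (toPhase (S.startPoint B H M p y.1)) := by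
  have hbox : S.startPoint B H M p y.1 ∈ box M := by
    have := h.box₁ 0 ⟨le_rfl, h.pos₁.le⟩
    rwa [legOne_zero] at this
  obtain ⟨L₁, L₂, hL, -⟩ := hI
  refine ⟨⟨rfl, ?_⟩, ?_, ?_, L₁, L₂, hL, ?_⟩
  · rw [hS.force_eq rfl hbox]; exact h.start
  · rw [← energy3_eq (S := S) (ε := p.2) hbox rfl]
    have := congrArg (fun z : Unknown => z.1) h.eqn
    exact sub_eq_zero.1 this
  · exact (hS.regular.hasCoords_iff hS.confined hL p.1.2 _).2 rfl
  · rw [← hS.regular.right₁_eq hL]; exact hκ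

theorem energy3_kick (U : ℝ × ℝ × ℝ → ℝ) (e : ℝ) (x : Space) :
    energy3 U (S.kick c e x) = energy3 U x := by
  unfold kick
  split_ifs
  · rfl
  · simp only [energy3, reflectMap, pos_apply]
    have : 1 + S.wallSlope (x.2.1.1, e) ^ 2 ≠ 0 := by positivity
    field_simp
    ring

theorem energy3_legTwo (hS : S.IsSetting H M N) (h : S.returnEquation B H M c (p, y) = 0) (t : ℝ) :
    energy3 (S.cutPotential M) (S.legTwo B H M c p y t) = H := by
  have := congrArg (fun z : Unknown => z.1) h
  rw [legTwo, hS.hamiltonian.energy_flow, energy3_kick, legOne, hS.hamiltonian.energy_flow]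
  exact sub_eq_zero.1 this

theorem isSectionPoint_finish (hS : S.IsSetting H M N) (h : S.IsReturnData B H M c p y)
    (hI : y.2.2.2.1 ∈ S.transverseActions B H)
    (hκ : |(S.legTwo B H M c p y y.2.2.1).1.1 - S.right₁ B H y.2.2.2.1| < κ) :
    S.IsSectionPoint B H κ p.2 y.2.2.2.1 (p.1.2 + y.2.2.2.2)
      (toPhase (S.legTwo B H M c p y y.2.2.1)) := by
  have hmem : y.2.2.1 ∈ Icc 0 y.2.2.1 := ⟨h.pos₂.le, le_rfl⟩
  have hbox := h.box₂ _ hmem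
  obtain ⟨L₁, L₂, hL, -⟩ := hI
  refine ⟨⟨?_, ?_⟩, ?_, ?_, L₁, L₂, hL, ?_⟩
  · have := congrArg (fun z : Unknown => z.2.2.1) h.eqn
    exact this
  · rw [hS.force_eq (hS.param_legTwo _) hbox]; exact h.finish
  · rw [← energy3_eq (S := S) (ε := p.2) hbox (hS.param_legTwo _)]
    exact hS.energy3_legTwo h.eqn _
  · refine (hS.regular.hasCoords_iff hS.confined hL _ (S.legTwo B H M c p y y.2.2.1).2.1).2 ?_
    have := congrArg (fun z : Unknown => z.2.2.2) h.eqn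
    exact (sub_eq_zero.1 this).symm
  · rw [← hS.regular.right₁_eq hL]; exact hκ

/-- On the section `p₁ = 0`, and the coordinates fix `(q₂, p₂)`. The energy is then a scalar
equation for `q₁`, and injectivity within `κ` of the right turning point leaves one solution. -/
theorem hasReturn (hS : S.IsSetting H M N) (h : S.IsReturnData B H M c p y)
    (hI : p.1.1 ∈ S.transverseActions B H) (hκ : |y.1 - S.right₁ B H p.1.1| < κ)
    (hI' : y.2.2.2.1 ∈ S.transverseActions B H)
    (hκ' : |(S.legTwo B H M c p y y.2.2.1).1.1 - S.right₁ B H y.2.2.2.1| < κ)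
    (hinj : InjOn (fun q => S.V₁ q + p.2 0 * S.Vr q (S.angleMap B H M p.1).1)
      {q | |q - S.right₁ B H p.1.1| < κ}) : S.HasReturn B H κ p y.2.2.2 := by
  have hstart := hS.isSectionPoint_start h hI hκ
  have huniq : ∀ x, S.IsSectionPoint B H κ p.2 p.1.1 p.1.2 x →
      x = toPhase (S.startPoint B H M p y.1) := by
    rintro ⟨q₁, p₁, q₂, p₂⟩ ⟨⟨hp1, -⟩, hen, hco, L₁, L₂, hL, hq⟩
    have hp1 : p₁ = 0 := hp1
    have hco := (hS.regular.hasCoords_iff hS.confined hL p.1.2 (q₂, p₂)).1 hco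
    have hco : (q₂, p₂) = S.angleMap B H M p.1 := hco
    have hq₂ : q₂ = (S.angleMap B H M p.1).1 := congrArg Prod.fst hco
    have hp₂ : p₂ = (S.angleMap B H M p.1).2 := congrArg Prod.snd hco
    rw [← hS.regular.right₁_eq hL] at hq
    have hen' := hstart.2.1
    have hen' := hen'.trans hen.symm
    simp only [energy, potential, toPhase, startPoint, hp1] at hen'
    rw [← hq₂, ← hp₂] at hen'
    have hqq : q₁ = y.1 := by
      refine hinj (show |q₁ - _| < κ from hq) (show |y.1 - _| < κ from hκ) ?_
      show S.V₁ q₁ + _ * S.Vr q₁ _ = S.V₁ y.1 + _ * S.Vr y.1 _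
      rw [← hq₂]
      linarith
    simp [toPhase, startPoint, hp1, hqq, ← hq₂, ← hp₂]
  refine ⟨⟨_, hstart, huniq⟩, fun x hx => ?_⟩
  rw [huniq x hx]
  exact ⟨_, hS.isFirstReturn h, hS.isSectionPoint_finish h hI' hκ'⟩

variable {I θ : ℝ}

/-- For `ε = 0` the derivative in `q₁` is `V₁' > 0`, and it stays positive on a compact interval.
The radius `2κ` leaves room for the centre of the `κ`-interval to move with the action by less than
`κ`. -/
theorem eventually_injOn (hS : S.IsSetting H M N) (hI : I ∈ S.transverseActions B H) (hκ : 0 < κ)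
    (hmono : ∀ q, |q - S.right₁ B H I| ≤ 2 * κ → 0 < deriv S.V₁ q) :
    ∀ᶠ p in 𝓝 (((I, θ), 0) : SectionParam),
      InjOn (fun q => S.V₁ q + p.2 0 * S.Vr q (S.angleMap B H M p.1).1)
        {q | |q - S.right₁ B H p.1.1| < κ} := by
  set p₀ : SectionParam := ((I, θ), 0) with hp₀
  set R := S.right₁ B H I with hR
  have hN : (N : WithTop ℕ∞) ≠ 0 := by
    have := hS.two_le; exact_mod_cast (by omega : N ≠ 0)
  have hV : ContDiff ℝ 1 S.V₁ := hS.regular.contDiff₁.of_le (by norm_num)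
  have hVr : ContDiff ℝ 1 fun x : ℝ × ℝ => S.Vr x.1 x.2 :=
    hS.perturbation.1.of_le (by norm_cast; omega)
  have hA : ContinuousAt (fun p : SectionParam => S.angleMap B H M p.1) p₀ :=
    ContinuousAt.comp (g := S.angleMap B H M) (f := Prod.fst)
      (hS.contDiffAt_angleMap (x := (I, θ)) hI).continuousAt continuousAt_fst
  have hright : ContinuousAt (fun p : SectionParam => S.right₁ B H p.1.1) p₀ := by
    have h1 := ((hS.regular.torus_regularity hS.confined hI).1 2 two_ne_zero hS.regular.contDiff₁
      hS.regular.contDiff₂).1.continuousAt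
    exact ContinuousAt.comp (g := S.right₁ B H) (f := fun p : SectionParam => p.1.1) h1
      continuousAt_fst.fst
  have hd : ∀ z w q, HasDerivAt (fun q => S.V₁ q + w * S.Vr q z)
      (deriv S.V₁ q + w * fderiv ℝ (fun x : ℝ × ℝ => S.Vr x.1 x.2) (q, z) (1, 0)) q := by
    intro z w q
    have hc : HasDerivAt (fun x : ℝ => (x, z)) ((1 : ℝ), (0 : ℝ)) q :=
      (hasDerivAt_id _).prodMk (hasDerivAt_const _ _)
    have h0 := ((hVr.differentiable one_ne_zero) (q, z)).hasFDerivAt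
    have h1 : HasDerivAt ((fun x : ℝ × ℝ => S.Vr x.1 x.2) ∘ fun x => (x, z)) _ q :=
      h0.comp_hasDerivAt q hc
    exact ((hV.differentiable one_ne_zero) q).hasDerivAt.add (h1.const_mul w)
  have hpos : ∀ᶠ p in 𝓝 p₀, ∀ q ∈ Icc (R - 2 * κ) (R + 2 * κ), 0 < deriv S.V₁ q + p.2 0 *
      fderiv ℝ (fun x : ℝ × ℝ => S.Vr x.1 x.2) (q, (S.angleMap B H M p.1).1) (1, 0) := by
    refine isCompact_Icc.eventually_forall_of_forall_eventually fun q hq => ?_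
    have hc : ContinuousAt (fun x : SectionParam × ℝ => deriv S.V₁ x.2 + x.1.2 0 *
        fderiv ℝ (fun x : ℝ × ℝ => S.Vr x.1 x.2) (x.2, (S.angleMap B H M x.1.1).1) (1, 0))
        (p₀, q) := by
      have e1 : ContinuousAt (fun x : SectionParam × ℝ => deriv S.V₁ x.2) (p₀, q) :=
        ((hV.continuous_deriv le_rfl).comp continuous_snd).continuousAt
      have e2 : ContinuousAt (fun x : SectionParam × ℝ => x.1.2 0) (p₀, q) := by
        have := (contDiff_param 1 0).continuous.comp
          (continuous_snd.comp (continuous_fst (X := SectionParam) (Y := ℝ)))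
        exact this.continuousAt
      have e3 : ContinuousAt (fun x : SectionParam × ℝ => (x.2, (S.angleMap B H M x.1.1).1))
          (p₀, q) :=
        continuousAt_snd.prodMk (ContinuousAt.comp (g := fun p : SectionParam => S.angleMap B H M p.1)
          (f := Prod.fst) (x := (p₀, q)) hA continuousAt_fst).fst
      have e4 := ((hVr.continuous_fderiv one_ne_zero).clm_apply
        (continuous_const (y := ((1 : ℝ), (0 : ℝ))))).continuousAt (x := (q, (S.angleMap B H M p₀.1).1))
      exact e1.add (e2.mul (ContinuousAt.comp (f := fun x : SectionParam × ℝ =>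
        (x.2, (S.angleMap B H M x.1.1).1)) (x := (p₀, q)) e4 e3))
    refine hc.eventually (lt_mem_nhds ?_)
    have := hmono q (abs_le.2 ⟨by linarith [hq.1], by linarith [hq.2]⟩)
    simpa [hp₀] using this
  have hnear : ∀ᶠ p in 𝓝 p₀, |S.right₁ B H p.1.1 - R| < κ := by
    have h1 : ContinuousAt (fun p : SectionParam => |S.right₁ B H p.1.1 - R|) p₀ :=
      (hright.sub continuousAt_const).abs
    exact h1.eventually (gt_mem_nhds (by simpa [hp₀, ← hR] using hκ))
  filter_upwards [hpos, hnear] with p h1 h2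
  have hset : {q | |q - S.right₁ B H p.1.1| < κ} ⊆ Icc (R - 2 * κ) (R + 2 * κ) := by
    intro q hq
    have := abs_lt.1 (show |q - S.right₁ B H p.1.1| < κ from hq)
    have := abs_lt.1 h2
    constructor <;> linarith
  have hm : StrictMonoOn (fun q => S.V₁ q + p.2 0 * S.Vr q (S.angleMap B H M p.1).1)
      (Icc (R - 2 * κ) (R + 2 * κ)) := by
    refine strictMonoOn_of_deriv_pos (convex_Icc _ _)
      (fun q _ => (hd _ _ q).continuousAt.continuousWithinAt) fun q hq => ?_
    rw [(hd _ _ q).deriv]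
    exact h1 q (interior_subset hq)
  exact hm.injOn.mono hset

variable {u : SectionParam → Unknown} [Decidable (S.Avoids B H I)]

/-- At the base solution both the initial and the final `q₁` equal the unperturbed right turning
point and the final action equals the initial one. All side conditions of `hasReturn` are therefore
open conditions that hold at the base. -/
theorem eventually_hasReturn (hS : S.IsSetting H M N) (hI : I ∈ S.transverseActions B H)
    (hu : ContinuousAt u ((I, θ), 0)) (hu0 : u ((I, θ), 0) = S.baseSolution B H (I, θ))
    (heq : ∀ᶠ p in 𝓝 (((I, θ), 0) : SectionParam),
      S.returnEquation B H M (S.Avoids B H I) (p, u p) = 0)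
    (hκ : 0 < κ) (hmono : ∀ q, |q - S.right₁ B H I| ≤ 2 * κ → 0 < deriv S.V₁ q) :
    ∀ᶠ p in 𝓝 (((I, θ), 0) : SectionParam), S.HasReturn B H κ p (u p).2.2.2 ∧
      p.1.1 ∈ S.transverseActions B H ∧ (u p).2.2.2.1 ∈ S.transverseActions B H := by
  set p₀ : SectionParam := ((I, θ), 0) with hp₀
  have hopen := hS.regular.isOpen_transverseActions B H
  have hr : ContinuousAt (S.right₁ B H) I :=
    ((hS.regular.torus_regularity hS.confined hI).1 2 two_ne_zero hS.regular.contDiff₁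
      hS.regular.contDiff₂).1.continuousAt
  have e1 : ∀ᶠ p in 𝓝 p₀, p.1.1 ∈ S.transverseActions B H :=
    (continuousAt_fst.fst : ContinuousAt (fun p : SectionParam => p.1.1) p₀).eventually
      (hopen.mem_nhds hI)
  have hJ : ContinuousAt (fun p => (u p).2.2.2.1) p₀ := hu.snd.snd.snd.fst
  have hJ0 : (u p₀).2.2.2.1 = I := by rw [hu0]; rfl
  have e2 : ∀ᶠ p in 𝓝 p₀, (u p).2.2.2.1 ∈ S.transverseActions B H :=
    hJ.eventually (hopen.mem_nhds (by beta_reduce; rw [hJ0]; exact hI))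
  have hr1 : ContinuousAt (fun p : SectionParam => S.right₁ B H p.1.1) p₀ :=
    ContinuousAt.comp (g := S.right₁ B H) (f := fun p : SectionParam => p.1.1) hr
      continuousAt_fst.fst
  have hr2 : ContinuousAt (fun p : SectionParam => S.right₁ B H (u p).2.2.2.1) p₀ :=
    ContinuousAt.comp (g := S.right₁ B H) (f := fun p => (u p).2.2.2.1) (by rwa [hJ0]) hJ
  have h3 : ContinuousAt (fun p => |(u p).1 - S.right₁ B H p.1.1|) p₀ := (hu.fst.sub hr1).abs
  have e3 : ∀ᶠ p in 𝓝 p₀, |(u p).1 - S.right₁ B H p.1.1| < κ :=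
    h3.eventually (gt_mem_nhds (by
      show |(u p₀).1 - S.right₁ B H I| < κ
      rw [hu0]; simpa [baseSolution] using hκ))
  have hleg : ContinuousAt (fun p => S.legTwo B H M (S.Avoids B H I) p (u p) (u p).2.2.1) p₀ :=
    ContinuousAt.comp (x := p₀)
      (g := fun x : (SectionParam × Unknown) × ℝ => S.legTwo B H M (S.Avoids B H I) x.1.1 x.1.2 x.2)
      (f := fun p : SectionParam => ((p, u p), (u p).2.2.1))
      (hS.contDiffAt_legTwo (S.Avoids B H I) (x := ((p₀, u p₀), (u p₀).2.2.1)) hI).continuousAt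
      ((continuousAt_id.prodMk hu).prodMk hu.snd.snd.fst)
  have h4 : ContinuousAt (fun p => |(S.legTwo B H M (S.Avoids B H I) p (u p) (u p).2.2.1).1.1 -
      S.right₁ B H (u p).2.2.2.1|) p₀ := (hleg.fst.fst.sub hr2).abs
  have e4 : ∀ᶠ p in 𝓝 p₀, |(S.legTwo B H M (S.Avoids B H I) p (u p) (u p).2.2.1).1.1 -
      S.right₁ B H (u p).2.2.2.1| < κ := by
    refine h4.eventually (gt_mem_nhds ?_)
    obtain ⟨w, hw⟩ := hS.legTwo_base hI θ (S.halfTime₁ B H I)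
      (y := S.baseSolution B H (I, θ)) rfl rfl
    have : S.legTwo B H M (S.Avoids B H I) p₀ (S.baseSolution B H (I, θ))
      (S.baseSolution B H (I, θ)).2.2.1 = _ := hw
    beta_reduce
    rw [hJ0, hu0, this]
    simpa [IsGlobalPotential.orb_zero] using hκ
  filter_upwards [hS.eventually_isReturnData hI hu hu0 heq, e1, e2, e3, e4,
    hS.eventually_injOn hI hκ hmono] with p h1 h2 h3 h4 h5 h6
  exact ⟨hS.hasReturn h1 h2 h4 h3 h5 h6, h2, h3⟩

end IsSetting
end ImpactSystem
end SectionPoints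

/-! ### The return map is symplectic -/

section Symplectic

namespace ImpactSystem

variable {S : ImpactSystem} {B : Leaf S.V₂} {H M : ℝ} {N : ℕ}

/-- Reflection at the wall preserves the symplectic form on pairs of vectors tangent to the
wall. -/
theorem form3_reflectMap (hQ : ContDiff ℝ 3 fun x : ℝ × ℝ => S.Q x.1 x.2) {D : Type}
    [NormedAddCommGroup D] [NormedSpace ℝ D] {z : D → Space} {z' : D →L[ℝ] Space} {d : D} {e : ℝ}
    (hz : HasFDerivAt z z' d)
    (hwall : ∀ᶠ x in 𝓝 d, (z x).1.1 - e * S.Q (z x).2.1.1 e = 0) :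
    ∃ L : D →L[ℝ] Space, HasFDerivAt (fun x => S.reflectMap e (z x)) L d ∧
      ∀ a b, form3 (L a) (L b) = form3 (z' a) (z' b) := by
  have hq₁ : HasFDerivAt (fun x => (z x).1.1) _ d := hz.fst.fst
  have hp₁ : HasFDerivAt (fun x => (z x).1.2) _ d := hz.fst.snd
  have hz2 : HasFDerivAt (fun x => (z x).2) _ d := hz.snd
  have hq₂ : HasFDerivAt (fun x => (z x).2.1.1) _ d := hz2.fst.fst
  have hp₂ : HasFDerivAt (fun x => (z x).2.1.2) _ d := hz2.fst.snd
  have hs : HasFDerivAt (fun x => (z x).2.2) _ d := hz2.snd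
  have hW : ContDiff ℝ 1 fun q => S.wallSlope (q, e) :=
    (contDiff_wallSlope (n := 1) (hQ.of_le (by norm_num))).comp (contDiff_id.prodMk contDiff_const)
  have hw : HasFDerivAt ((fun q => S.wallSlope (q, e)) ∘ fun x => (z x).2.1.1) _ d :=
    ((hW.differentiable one_ne_zero) (z d).2.1.1).hasDerivAt.comp_hasFDerivAt d hq₂
  change HasFDerivAt (fun x => S.wallSlope ((z x).2.1.1, e)) _ d at hw
  set w' := deriv (fun q => S.wallSlope (q, e)) (z d).2.1.1
  have hk : DifferentiableAt ℝ (fun x => 2 * ((z x).1.2 - S.wallSlope ((z x).2.1.1, e) *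
      (z x).2.1.2) / (1 + S.wallSlope ((z x).2.1.1, e) ^ 2)) d := by
    simp only [div_eq_mul_inv]
    exact ((hp₁.differentiableAt.fun_sub (hw.differentiableAt.fun_mul
      hp₂.differentiableAt)).const_mul 2).fun_mul (((hw.differentiableAt.fun_pow 2).const_add
      1).fun_inv (add_pos_of_pos_of_nonneg one_pos (sq_nonneg _)).ne')
  obtain ⟨k', hk⟩ := hk
  -- With `w` the slope, vectors tangent to the wall satisfy `dq₁ = w dq₂`. The reflection `p₁ - k`,
  -- `p₂ + k w` changes the form by `-dq₁ ∧ dk + dq₂ ∧ (w dk + k dw)`, which is zero since `dw` is a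
  -- multiple of `dq₂`. The first entry of `!₂[0, e]` is arbitrary, as the wall depends only on the
  -- second.
  have htan : ∀ a, (z' a).1.1 = S.wallSlope ((z d).2.1.1, e) * (z' a).2.1.1 := by
    have h1 : HasFDerivAt (S.wall !₂[0, e] ∘ fun x => (z x).2.1.1) _ d :=
      (hasDerivAt_wall (hQ.of_le (by norm_num)) (!₂[0, e]) (z d).2.1.1).comp_hasFDerivAt d hq₂
    change HasFDerivAt (fun x => e * S.Q (z x).2.1.1 e)
      (S.wallSlope ((z d).2.1.1, e) • _) d at h1
    have h2 := (hq₁.sub h1).unique ((hasFDerivAt_const (0 : ℝ) d).congr_of_eventuallyEq hwall)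
    intro a
    have h3 := congrArg (fun l : D →L[ℝ] ℝ => l a) h2
    simpa [sub_eq_zero] using h3
  have hL := (hq₁.prodMk (hp₁.sub hk)).prodMk ((hq₂.prodMk (hp₂.add (hk.mul hw))).prodMk hs)
  refine ⟨_, hL, fun a b => ?_⟩
  simp only [form3_apply, area_apply]
  simp [htan]
  ring

namespace IsSetting

variable {c : Prop} [Decidable c] {u : SectionParam → Unknown}

/-- The derivative of the constant energy along a family of points. -/
theorem fderiv_energy_eq_zero (hS : S.IsSetting H M N) {D : Type}
    [NormedAddCommGroup D] [NormedSpace ℝ D] {z : D → Space} {z' : D →L[ℝ] Space} {d : D}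
    (hz : HasFDerivAt z z' d) (h : ∀ᶠ x in 𝓝 d, energy3 (S.cutPotential M) (z x) = H) (a : D) :
    fderiv ℝ (energy3 (S.cutPotential M)) (z d) (z' a) = 0 := by
  have h1 := ((hS.hamiltonian.contDiff_energy.differentiable two_ne_zero) (z d)).hasFDerivAt.comp d hz
  have h2 := h1.unique ((hasFDerivAt_const H d).congr_of_eventuallyEq h)
  exact congrArg (fun l : D →L[ℝ] ℝ => l a) h2

/-- The solution of the return equations is a symplectic map of the section. -/
theorem symplectic_solution (hS : S.IsSetting H M N) {x : ℝ × ℝ} {ε : Params}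
    (hx : x.1 ∈ S.transverseActions B H)
    (hx' : (u (x, ε)).2.2.2.1 ∈ S.transverseActions B H)
    (hu : DifferentiableAt ℝ (fun x => u (x, ε)) x)
    (heq : ∀ᶠ x in 𝓝 x, S.returnEquation B H M c ((x, ε), u (x, ε)) = 0) :
    ∃ F' : ℝ × ℝ →L[ℝ] ℝ × ℝ,
      HasFDerivAt (fun x : ℝ × ℝ => ((u (x, ε)).2.2.2.1, x.2 + (u (x, ε)).2.2.2.2)) F' x ∧
      ∀ a b, (F' a).1 * (F' b).2 - (F' a).2 * (F' b).1 = a.1 * b.2 - a.2 * b.1 := by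
  have hN : (N : WithTop ℕ∞) ≠ 0 := by
    have := hS.two_le; exact_mod_cast (by omega : N ≠ 0)
  obtain ⟨u', hu⟩ := hu
  have hq : HasFDerivAt (fun x => (u (x, ε)).1) _ x := hu.fst
  have ht₁ : HasFDerivAt (fun x => (u (x, ε)).2.1) _ x := hu.snd.fst
  have ht₂ : HasFDerivAt (fun x => (u (x, ε)).2.2.1) _ x := hu.snd.snd.fst
  have hJ : HasFDerivAt (fun x => (u (x, ε)).2.2.2.1) _ x := hu.snd.snd.snd.fst
  have hs : HasFDerivAt (fun x => (u (x, ε)).2.2.2.2) _ x := hu.snd.snd.snd.snd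
  have hA : HasFDerivAt (S.angleMap B H M) (fderiv ℝ (S.angleMap B H M) x) x :=
    ((hS.contDiffAt_angleMap hx).differentiableAt hN).hasFDerivAt
  set z₀ : ℝ × ℝ → Space := fun x => S.startPoint B H M (x, ε) (u (x, ε)).1 with hz₀
  have h0 : HasFDerivAt z₀ _ x :=
    (hq.prodMk (hasFDerivAt_const (0 : ℝ) x)).prodMk
      (hA.prodMk ((hasFDerivAt_const (ε 0, (0 : ℝ)) x)))
  have hen₀ : ∀ᶠ x in 𝓝 x, energy3 (S.cutPotential M) (z₀ x) = H := heq.mono fun x hx =>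
    sub_eq_zero.1 (congrArg (fun z : Unknown => z.1) hx)
  obtain ⟨L₁, hL₁, hp₁⟩ := hS.hamiltonian.pullback_flow h0 ht₁
  have hkick : ∃ L : ℝ × ℝ →L[ℝ] Space,
      HasFDerivAt (fun x => S.kick c (ε 1) (flow (S.sysField M) (z₀ x) (u (x, ε)).2.1)) L x ∧
      ∀ a b, form3 (L a) (L b) = form3 (L₁ a) (L₁ b) := by
    by_cases hc : c
    · simp only [kick, if_pos hc]
      exact ⟨L₁, hL₁, fun _ _ => rfl⟩
    · simp only [kick, if_neg hc]
      refine form3_reflectMap (hS.contDiff_Q.of_le (by have := hS.two_le; norm_cast; omega)) hL₁ ?_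
      filter_upwards [heq] with x hx
      have := congrArg (fun z : Unknown => z.2.1) hx
      simp only [returnEquation, gate, if_neg hc] at this
      exact this
  obtain ⟨L₂, hL₂, hp₂⟩ := hkick
  have hen₂ : ∀ᶠ x in 𝓝 x, energy3 (S.cutPotential M)
      (S.kick c (ε 1) (flow (S.sysField M) (z₀ x) (u (x, ε)).2.1)) = H := by
    filter_upwards [hen₀] with x hx
    rw [energy3_kick, hS.hamiltonian.energy_flow, hx]
  obtain ⟨L₃, hL₃, hp₃⟩ := hS.hamiltonian.pullback_flow hL₂ ht₂
  -- Both legs start on the energy level `H` for all nearby points of the section, so the terms with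
  -- the differentials of the travel times drop out.
  have hpull : ∀ a b, form3 (L₃ a) (L₃ b) = form3
      ((((ContinuousLinearMap.fst ℝ ℝ (ℝ × ℝ × ℝ × ℝ)) ∘L u').prod 0).prod
        ((fderiv ℝ (S.angleMap B H M) x).prod 0) a)
      ((((ContinuousLinearMap.fst ℝ ℝ (ℝ × ℝ × ℝ × ℝ)) ∘L u').prod 0).prod
        ((fderiv ℝ (S.angleMap B H M) x).prod 0) b) := by
    intro a b
    rw [hp₃, hp₂, hp₁, hS.fderiv_energy_eq_zero hL₂ hen₂, hS.fderiv_energy_eq_zero hL₂ hen₂,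
      hS.fderiv_energy_eq_zero h0 hen₀, hS.fderiv_energy_eq_zero h0 hen₀]
    ring
  have hA' : HasFDerivAt (S.angleMap B H M) _ ((u (x, ε)).2.2.2.1, x.2 + (u (x, ε)).2.2.2.2) :=
    ((hS.contDiffAt_angleMap (x := ((u (x, ε)).2.2.2.1, x.2 + (u (x, ε)).2.2.2.2))
      hx').differentiableAt hN).hasFDerivAt
  have hF := hJ.prodMk ((hasFDerivAt_snd (𝕜 := ℝ) (p := x)).add hs)
  refine ⟨_, hF, fun a b => ?_⟩
  have hend : HasFDerivAt (S.angleMap B H M ∘ fun x : ℝ × ℝ =>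
      ((u (x, ε)).2.2.2.1, x.2 + (u (x, ε)).2.2.2.2)) _ x := hA'.comp x hF
  have hL₃2 : HasFDerivAt (fun x => (S.legTwo B H M c (x, ε) (u (x, ε)) (u (x, ε)).2.2.1).2) _ x :=
    hL₃.snd
  have hL₃' : HasFDerivAt (fun x => (S.legTwo B H M c (x, ε) (u (x, ε)) (u (x, ε)).2.2.1).1) _ x :=
    hL₃.fst
  have hL₃'' : HasFDerivAt (fun x => (S.legTwo B H M c (x, ε) (u (x, ε))
    (u (x, ε)).2.2.1).2.2) _ x := hL₃2.snd
  -- At the end `p₁ = 0` and the parameter is constant for all nearby points, so only the area form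
  -- in the `(q₂, p₂)` plane is left, as at the start.
  have e1 := hL₃2.fst.unique (hend.congr_of_eventuallyEq (heq.mono fun x hx =>
    (sub_eq_zero.1 (congrArg (fun z : Unknown => z.2.2.2) hx)).symm))
  have e2 := hL₃'.snd.unique ((hasFDerivAt_const (0 : ℝ) x).congr_of_eventuallyEq
    (heq.mono fun x hx => congrArg (fun z : Unknown => z.2.2.1) hx))
  have e3 := hL₃''.fst.unique ((hasFDerivAt_const (ε 0) x).congr_of_eventuallyEq
    (Eventually.of_forall fun x => hS.param_legTwo (p := (x, ε)) _))
  have e1' : ∀ a, (L₃ a).2.1 = _ := fun a => congrArg (fun l : ℝ × ℝ →L[ℝ] ℝ × ℝ => l a) e1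
  have e2' : ∀ a, (L₃ a).1.2 = 0 := fun a => congrArg (fun l : ℝ × ℝ →L[ℝ] ℝ => l a) e2
  have e3' : ∀ a, (L₃ a).2.2.1 = 0 := fun a => congrArg (fun l : ℝ × ℝ →L[ℝ] ℝ => l a) e3
  have h1 := hpull a b
  rw [form3_apply, form3_apply, e1', e1', ContinuousLinearMap.comp_apply,
    ContinuousLinearMap.comp_apply, hS.regular.area_fderiv_angleMap hS.confined
      (x := ((u (x, ε)).2.2.2.1, x.2 + (u (x, ε)).2.2.2.2)) hx'] at h1
  have h2 := hS.regular.area_fderiv_angleMap hS.confined hx a b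
  simp only [area_apply, e2', e3', ContinuousLinearMap.prod_apply, _root_.zero_apply] at h1 h2 ⊢
  -- The angle map reverses the orientation at both ends, and the two signs cancel.
  linear_combination -h1 - h2

end IsSetting
end ImpactSystem
end Symplectic

/-! ### One periodic solution over a compact set of tori -/

section BranchSolution

namespace ImpactSystem

variable {S : ImpactSystem} {B : Leaf S.V₂} {H M κ : ℝ} {N : ℕ}

open Classical in
/-- The return equation, with the type of the return chosen according to the unperturbed torus. -/
def sectionEquation (S : ImpactSystem) (B : Leaf S.V₂) (H M : ℝ) (v : SectionParam × Unknown) :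
    Unknown :=
  S.returnEquation B H M (S.Avoids B H v.1.1.1) v

theorem sectionEquation_eq {I : ℝ} [Decidable (S.Avoids B H I)] {v : SectionParam × Unknown}
    (h : S.Avoids B H v.1.1.1 ↔ S.Avoids B H I) :
    S.sectionEquation B H M v = S.returnEquation B H M (S.Avoids B H I) v := by
  have h' := propext h
  unfold sectionEquation
  congr!

theorem IsRegular.angleMap_add_int (hS : S.IsRegular) (hM : S.Confined H M) (I θ : ℝ) (n : ℤ) :
    S.angleMap B H M (I, θ + n * (2 * Real.pi)) = S.angleMap B H M (I, θ) := by
  have h : Function.Periodic (fun θ => S.angleMap B H M (I, θ)) (2 * Real.pi) :=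
    fun θ => hS.angleMap_add_two_pi hM (I, θ)
  exact h.int_mul n θ

/-- The last unknown is the increment of the angle and not the new angle, so a shift of `θ` by whole
turns enters only through the periodic angle map and the same unknowns solve the equations. -/
theorem sectionEquation_add_int (hS : S.IsRegular) (hM : S.Confined H M) (x : ℝ × ℝ) (e : Params)
    (n : ℤ) (y : Unknown) : S.sectionEquation B H M (((x.1, x.2 + n * (2 * Real.pi)), e), y) =
      S.sectionEquation B H M ((x, e), y) := by
  have h1 : ∀ q, S.startPoint B H M ((x.1, x.2 + n * (2 * Real.pi)), e) q =
      S.startPoint B H M (x, e) q := fun q => by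
    simp only [startPoint, hS.angleMap_add_int hM]
  have h2 : ∀ I s, S.angleMap B H M (I, x.2 + n * (2 * Real.pi) + s) =
      S.angleMap B H M (I, x.2 + s) := fun I s => by
    rw [← hS.angleMap_add_int hM I (x.2 + s) n]; congr 2; ring
  simp only [sectionEquation, returnEquation, legTwo, legOne, h1, h2]

theorem isSectionPoint_add_int (hS : S.IsRegular) (hM : S.Confined H M) {ε : Params} {I θ : ℝ}
    (n : ℤ) {x : Phase} : S.IsSectionPoint B H κ ε I (θ + n * (2 * Real.pi)) x ↔
      S.IsSectionPoint B H κ ε I θ x := by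
  have key : (∃ L₁ L₂, S.IsTorus B H I L₁ L₂ ∧ |x.q₁ - L₁.right| < κ) →
      (HasCoords B I (θ + n * (2 * Real.pi)) x.q₂ x.p₂ ↔ HasCoords B I θ x.q₂ x.p₂) := by
    rintro ⟨L₁, L₂, h, -⟩
    rw [hS.hasCoords_iff hM h _ (x.q₂, x.p₂), hS.hasCoords_iff hM h _ (x.q₂, x.p₂),
      hS.angleMap_add_int hM]
  unfold IsSectionPoint
  constructor <;> rintro ⟨h1, h2, h3, h4⟩
  · exact ⟨h1, h2, (key h4).1 h3, h4⟩
  · exact ⟨h1, h2, (key h4).2 h3, h4⟩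

theorem hasReturn_add_int (hS : S.IsRegular) (hM : S.Confined H M) {e : Params} {x z : ℝ × ℝ}
    (n : ℤ) : S.HasReturn B H κ ((x.1, x.2 + n * (2 * Real.pi)), e) z ↔
      S.HasReturn B H κ (x, e) z := by
  have h : ∀ y, S.IsSectionPoint B H κ e z.1 (x.2 + n * (2 * Real.pi) + z.2) y ↔
      S.IsSectionPoint B H κ e z.1 (x.2 + z.2) y := fun y => by
    rw [add_right_comm, isSectionPoint_add_int hS hM]
  simp only [HasReturn, isSectionPoint_add_int hS hM, h]

namespace IsSetting

/-- Continuity is enough here: the smoothness of the impact time and of the rotation comes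
afterwards from the implicit function theorem. -/
theorem continuousAt_baseSolution (hS : S.IsSetting H M N) {x : ℝ × ℝ}
    (hx : x.1 ∈ S.transverseActions B H) : ContinuousAt (S.baseSolution B H) x := by
  obtain ⟨hreg, ht, -, -⟩ := hS.regular.torus_regularity hS.confined hx
  obtain ⟨h1, -, h3⟩ := hreg 2 two_ne_zero hS.regular.contDiff₁ hS.regular.contDiff₂
  have hrot : ContinuousAt (S.rotation B H) x.1 := by
    have h4 : ContinuousAt (fun I => 2 * S.halfTime₁ B H I * Real.pi / S.halfPeriod₂ B H I) x.1 :=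
      ((continuousAt_const.mul ht).mul continuousAt_const).div h3.continuousAt
        (hS.halfPeriod₂_pos hx).ne'
    refine h4.congr ?_
    filter_upwards [(hS.regular.isOpen_transverseActions B H).mem_nhds hx] with I hI
    obtain ⟨L₁, L₂, h, -⟩ := hI
    exact (hS.regular.rotation_eq_halfTime h).symm
  have f1 : ContinuousAt (fun x : ℝ × ℝ => S.right₁ B H x.1) x :=
    ContinuousAt.comp (f := Prod.fst) h1.continuousAt continuousAt_fst
  have f2 : ContinuousAt (fun x : ℝ × ℝ => S.halfTime₁ B H x.1) x :=
    ContinuousAt.comp (f := Prod.fst) ht continuousAt_fst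
  have f3 : ContinuousAt (fun x : ℝ × ℝ => S.rotation B H x.1) x :=
    ContinuousAt.comp (f := Prod.fst) hrot continuousAt_fst
  exact f1.prodMk (f2.prodMk (f2.prodMk (continuousAt_fst.prodMk f3)))

/-- Away from tangency the type of the torus is locally constant. Near each base point the equation
therefore coincides with one of fixed type, which is smooth. -/
theorem eventually_sectionEquation_eq (hS : S.IsSetting H M N) {I : ℝ}
    [Decidable (S.Avoids B H I)] (hI : I ∈ S.transverseActions B H) {θ : ℝ} {e : Params}
    {y : Unknown} : ∀ᶠ v in 𝓝 ((((I, θ), e), y) : SectionParam × Unknown),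
      S.sectionEquation B H M v = S.returnEquation B H M (S.Avoids B H I) v := by
  obtain ⟨-, -, -, h⟩ := hS.regular.torus_regularity hS.confined hI
  have hc : Continuous fun v : SectionParam × Unknown => v.1.1.1 := by fun_prop
  exact ((hc.tendsto (((I, θ), e), y)).eventually h).mono fun v hv => sectionEquation_eq hv

/-- What is needed of the solution `u` of the return equations at `p`. -/
structure IsGood (B : Leaf S.V₂) (H M κ : ℝ) (N : ℕ) (u : SectionParam → Unknown)
    (p : SectionParam) : Prop where
  contDiffAt : ContDiffAt ℝ N u p
  hasReturn : S.HasReturn B H κ p (u p).2.2.2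
  mem : p.1.1 ∈ S.transverseActions B H
  mem' : (u p).2.2.2.1 ∈ S.transverseActions B H
  eqn : ∀ᶠ p' in 𝓝 p, S.sectionEquation B H M (p', u p') = 0

theorem IsGood.symplectic (hS : S.IsSetting H M N) {u : SectionParam → Unknown} {x : ℝ × ℝ}
    {ε : Params} (h : IsGood B H M κ N u (x, ε)) : ∃ F' : ℝ × ℝ →L[ℝ] ℝ × ℝ,
      HasFDerivAt (fun x : ℝ × ℝ => ((u (x, ε)).2.2.2.1, x.2 + (u (x, ε)).2.2.2.2)) F' x ∧
      ∀ a b, (F' a).1 * (F' b).2 - (F' a).2 * (F' b).1 = a.1 * b.2 - a.2 * b.1 := by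
  classical
  have hN : (N : WithTop ℕ∞) ≠ 0 := by
    have := hS.two_le; exact_mod_cast (by omega : N ≠ 0)
  have hc : ContinuousAt (fun x : ℝ × ℝ => (x, ε)) x := by fun_prop
  refine hS.symplectic_solution (c := S.Avoids B H x.1) h.mem h.mem' ?_ ?_
  · exact DifferentiableAt.comp (f := fun x : ℝ × ℝ => (x, ε)) x (h.contDiffAt.differentiableAt hN)
      (differentiableAt_id.prodMk (differentiableAt_const _))
  · have h1 : ContinuousAt (fun p => (p, u p)) (x, ε) :=
      continuousAt_id.prodMk h.contDiffAt.continuousAt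
    have h2 := h1.eventually (hS.eventually_sectionEquation_eq (I := x.1) (θ := x.2) h.mem)
    filter_upwards [hc.eventually h.eqn, hc.eventually h2] with z h3 h4
    rw [← h4, h3]

/-- Carries the properties from one period of angles, where compactness applies, to all angles. -/
theorem IsGood.of_add_int (hS : S.IsSetting H M N) {u : SectionParam → Unknown} {x : ℝ × ℝ}
    {e : Params} {n : ℤ} (hper : ∀ x e, u ((x.1, x.2 + n * (2 * Real.pi)), e) = u (x, e))
    (h : IsGood B H M κ N u ((x.1, x.2 + n * (2 * Real.pi)), e)) : IsGood B H M κ N u (x, e) := by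
  have hshift : ContDiff ℝ N fun p : SectionParam => ((p.1.1, p.1.2 + n * (2 * Real.pi)), p.2) := by
    fun_prop
  refine ⟨?_, ?_, h.mem, ?_, ?_⟩
  · have h1 := ContDiffAt.comp (f := fun p : SectionParam =>
      ((p.1.1, p.1.2 + n * (2 * Real.pi)), p.2)) (x, e) h.contDiffAt hshift.contDiffAt
    exact h1.congr_of_eventuallyEq (Eventually.of_forall fun p => (hper p.1 p.2).symm)
  · have h1 := h.hasReturn
    rwa [hper, hasReturn_add_int hS.regular hS.confined] at h1
  · have h1 := h.mem'
    rwa [hper] at h1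
  · have h1 := (hshift.continuous.tendsto (x, e)).eventually h.eqn
    filter_upwards [h1] with p hp
    rw [hper, sectionEquation_add_int hS.regular hS.confined] at hp
    exact hp

/-- The return map of the section, for all parameters near zero, over a compact set of tori. -/
theorem exists_branch_solution (hS : S.IsSetting H M N) {K : Set ℝ} (hK : IsCompact K)
    (hKt : K ⊆ S.transverseActions B H) (hκ : 0 < κ)
    (hmono : ∀ I ∈ K, ∀ q, |q - S.right₁ B H I| ≤ 2 * κ → 0 < deriv S.V₁ q) :
    ∃ u : SectionParam → Unknown, (∀ x e, u ((x.1, x.2 + 2 * Real.pi), e) = u (x, e)) ∧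
      ∃ ε₀ > 0, ∀ x : ℝ × ℝ, x.1 ∈ K → u (x, 0) = S.baseSolution B H x ∧
        ∀ e, ‖e‖ ≤ ε₀ → IsGood B H M κ N u (x, e) := by
  classical
  have hN : N ≠ 0 := by have := hS.two_le; omega
  have hK' : IsCompact (K ×ˢ Icc (0 : ℝ) (2 * Real.pi)) := hK.prod isCompact_Icc
  have hloc : ∀ x ∈ K ×ˢ Icc (0 : ℝ) (2 * Real.pi), S.sectionEquation B H M =ᶠ[𝓝 ((x, 0),
      S.baseSolution B H x)] S.returnEquation B H M (S.Avoids B H x.1) := fun x hx =>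
    hS.eventually_sectionEquation_eq (hKt hx.1)
  obtain ⟨u, hu, hper⟩ := exists_solution_map (X := ℝ × ℝ) (E := Params) (Y := Unknown)
    (Z := Unknown) hN (Φ := S.sectionEquation B H M) (y₀ := S.baseSolution B H) hK'
    (fun x hx => hS.continuousAt_baseSolution (hKt hx.1))
    (fun x hx => (hS.contDiffAt_returnEquation (B := B) (S.Avoids B H x.1)
      (v := ((x, 0), S.baseSolution B H x)) (hKt hx.1) (hKt hx.1)).congr_of_eventuallyEq (hloc x hx))
    (fun x hx => by
      rw [(hloc x hx).eq_of_nhds]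
      exact hS.returnEquation_base (hKt hx.1) x.2)
    (fun x hx => by
      rw [(hloc x hx).fderiv_eq]
      exact isInvertible_of_injective fun v hv =>
        hS.injective_returnEquation (hKt hx.1) x.2 (by simpa using hv))
  have hper1 : ∀ (n : ℤ) x e, u ((x.1, x.2 + n * (2 * Real.pi)), e) = u (x, e) := fun n x e =>
    hper (x.1, x.2 + n * (2 * Real.pi)) x rfl (fun e y => sectionEquation_add_int hS.regular hS.confined x e n y) e
  have hper2 : ∀ x e, u ((x.1, x.2 + 2 * Real.pi), e) = u (x, e) := fun x e => by
    simpa using hper1 1 x e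
  have hgood : ∀ x ∈ K ×ˢ Icc (0 : ℝ) (2 * Real.pi),
      ∀ᶠ p in 𝓝 ((x, 0) : SectionParam), IsGood B H M κ N u p := by
    intro x hx
    obtain ⟨h1, h2, h3⟩ := hu x hx
    have h4 : ContinuousAt (fun p => (p, u p)) (x, 0) := continuousAt_id.prodMk h1.continuousAt
    have h5 := h4.eventually (hS.eventually_sectionEquation_eq (I := x.1) (θ := x.2) (hKt hx.1))
    have h6 : ∀ᶠ p in 𝓝 ((x, 0) : SectionParam),
        S.returnEquation B H M (S.Avoids B H x.1) (p, u p) = 0 := by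
      filter_upwards [h3, h5] with p h7 h8
      rw [← h8, h7]
    filter_upwards [h1.eventually (by simp), h3.eventually_nhds,
      hS.eventually_hasReturn (I := x.1) (θ := x.2) (hKt hx.1) h1.continuousAt h2 h6 hκ
        (hmono x.1 hx.1)] with p h7 h8 h9
    exact ⟨h7, h9.1, h9.2.1, h9.2.2, h8⟩
  -- A neighbourhood of each point of the compact set at `ε = 0` contains a uniform slab in the
  -- parameter; the radius of this slab becomes `ε₀`.
  have hall : ∀ᶠ e in 𝓝 (0 : Params), ∀ x ∈ K ×ˢ Icc (0 : ℝ) (2 * Real.pi),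
      IsGood B H M κ N u (x, e) := by
    refine hK'.eventually_forall_of_forall_eventually fun x hx => ?_
    exact (continuous_swap.tendsto ((0 : Params), x)).eventually (hgood x hx)
  obtain ⟨ε, hε, hall⟩ := Metric.eventually_nhds_iff.1 hall
  refine ⟨u, hper2, ε / 2, half_pos hε, fun x hx => ?_⟩
  obtain ⟨n, hn⟩ : ∃ n : ℤ, x.2 + n * (2 * Real.pi) ∈ Icc (0 : ℝ) (2 * Real.pi) := by
    obtain ⟨n, hn, -⟩ := existsUnique_add_zsmul_mem_Ico Real.two_pi_pos x.2 0
    rw [zero_add, zsmul_eq_mul] at hn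
    exact ⟨n, hn.1, hn.2.le⟩
  have hmem : ((x.1, x.2 + n * (2 * Real.pi)) : ℝ × ℝ) ∈ K ×ˢ Icc (0 : ℝ) (2 * Real.pi) := ⟨hx, hn⟩
  refine ⟨?_, fun e he => ?_⟩
  · rw [← hper1 n, (hu _ hmem).2.1]
    rfl
  · refine IsGood.of_add_int hS (hper1 n) (hall ?_ _ hmem)
    rw [dist_zero_right]
    linarith

end IsSetting
end ImpactSystem
end BranchSolution

/-! ### Estimates on a branch, and uniformity over all branches -/

section ReturnMap

theorem CNormLE.mono {k k' : ℕ} {f : ℝ × ℝ → ℝ} {s s' : Set (ℝ × ℝ)} {C C' : ℝ}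
    (h : CNormLE k f s C) (hk : k' ≤ k) (hs : s' ⊆ s) (hC : C ≤ C') : CNormLE k' f s' C' :=
  fun j hj x hx => (h j (hj.trans hk) x (hs hx)).trans hC

namespace ImpactSystem

/-- The return map on the branch of `B` exists and is near-integrable. -/
def HasNearIntegrableReturn (S : ImpactSystem) (r : ℕ) (H δ ρ η : ℝ) (B : Leaf S.V₂)
    (κ ε₀ C : ℝ) : Prop :=
  ∃ U : Set ℝ, IsOpen U ∧ S.regularActions B H δ ρ η ⊆ U ∧
    (∀ I ∈ U, ∃ L₁ L₂, S.IsTorus B H I L₁ L₂) ∧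
    ∃ f g : Params → ℝ × ℝ → ℝ,
      (∀ ε : Params, ‖ε‖ < ε₀ →
        S.IsReturnMapOn B H κ ε U (S.nearIntegrableMap B H ε (f ε) (g ε)) ∧
        ContDiffOn ℝ r (S.nearIntegrableMap B H ε (f ε) (g ε)) (U ×ˢ univ) ∧
        IsSymplecticOn (S.nearIntegrableMap B H ε (f ε) (g ε)) (U ×ˢ univ) ∧
        ContDiffOn ℝ r (f ε) (U ×ˢ univ) ∧ ContDiffOn ℝ r (g ε) (U ×ˢ univ) ∧
        (∀ I ∈ U, ∀ θ : ℝ, f ε (I, θ + 2 * Real.pi) = f ε (I, θ) ∧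
          g ε (I, θ + 2 * Real.pi) = g ε (I, θ)) ∧
        CNormLE (r - 1) (f ε) (U ×ˢ univ) C ∧
        CNormLE (r - 1) (g ε) (U ×ˢ univ) C) ∧
      (∀ μ > 0, ∃ ε₁ > 0, ∀ ε : Params, ‖ε‖ < ε₁ →
        CNormLE r (fun x => ‖ε‖ * f ε x) (U ×ˢ univ) μ ∧
        CNormLE r (fun x => ‖ε‖ * g ε x) (U ×ˢ univ) μ) ∧
      (S.IsS3B (r + 1) → S.PerturbationSmooth (r + 2) →
        ∃ C' : ℝ, ∀ ε : Params, ‖ε‖ < ε₀ →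
          CNormLE r (f ε) (U ×ˢ univ) C' ∧ CNormLE r (g ε) (U ×ˢ univ) C')

variable {S : ImpactSystem} {B : Leaf S.V₂} {H M κ δ ρ η : ℝ} {N r : ℕ}

theorem HasNearIntegrableReturn.mono {ε₀ ε₁ C C' : ℝ}
    (h : S.HasNearIntegrableReturn r H δ ρ η B κ ε₀ C) (hε : ε₁ ≤ ε₀) (hC : C ≤ C') :
    S.HasNearIntegrableReturn r H δ ρ η B κ ε₁ C' := by
  obtain ⟨U, hU, hA, hT, f, g, h1, h2, h3⟩ := h
  refine ⟨U, hU, hA, hT, f, g, fun ε he => ?_, h2, fun ha hb => ?_⟩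
  · obtain ⟨a1, a2, a3, a4, a5, a6, a7, a8⟩ := h1 ε (he.trans_le hε)
    exact ⟨a1, a2, a3, a4, a5, a6, a7.mono le_rfl Subset.rfl hC, a8.mono le_rfl Subset.rfl hC⟩
  · obtain ⟨C', h⟩ := h3 ha hb
    exact ⟨C', fun ε he => h ε (he.trans_le hε)⟩

/-- The leaf `B` enters only through the predicate of being on its branch, so any leaf of the branch
may represent it. -/
theorem HasNearIntegrableReturn.congr {B' : Leaf S.V₂} {ε₀ C : ℝ}
    (h : S.HasNearIntegrableReturn r H δ ρ η B κ ε₀ C) (hB : B.SameBranch = B'.SameBranch) :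
    S.HasNearIntegrableReturn r H δ ρ η B' κ ε₀ C := by
  have hT : S.IsTorus B = S.IsTorus B' := by
    funext H I L₁ L₂
    simp only [IsTorus, hB]
  have hR : S.rotation B = S.rotation B' := by
    funext H I
    unfold rotation
    rw [hT]
  have hC : HasCoords B = HasCoords B' := by
    funext I θ q p
    simp only [HasCoords, hB]
  have hA : S.regularActions B = S.regularActions B' := by
    funext H δ ρ η
    simp only [regularActions, hB, hT]
  have hP : S.IsSectionPoint B = S.IsSectionPoint B' := by
    funext H κ ε I θ x
    simp only [IsSectionPoint, hC, hT]
  have hM : S.IsReturnMapOn B = S.IsReturnMapOn B' := by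
    funext H κ ε U F
    simp only [IsReturnMapOn, hP]
  have hN : S.nearIntegrableMap B = S.nearIntegrableMap B' := by
    funext H ε f g x
    simp only [nearIntegrableMap, hR]
  unfold HasNearIntegrableReturn at h ⊢
  rwa [hT, hA, hM, hN] at h

namespace IsSetting

/-- `f` and `g` are the difference quotients in `‖ε‖` of the last two unknowns, whose values at `ε =
0` are `I` and `Θ(I)`. Multiplied by `‖ε‖` they give the exact increments, at `ε = 0` too. Bounds
are proved on the compact `K`, and `U` is its interior. -/
theorem exists_hasNearIntegrableReturn (hS : S.IsSetting H M N) (hr : 0 < r) (hrN : r ≤ N)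
    (hrN' : S.IsS3B (r + 1) → S.PerturbationSmooth (r + 2) → r < N) {K : Set ℝ}
    (hK : IsCompact K) (hKt : K ⊆ S.transverseActions B H)
    (hA : S.regularActions B H δ ρ η ⊆ interior K) (hκ : 0 < κ)
    (hmono : ∀ I ∈ K, ∀ q, |q - S.right₁ B H I| ≤ 2 * κ → 0 < deriv S.V₁ q) :
    ∃ ε₀ > 0, ∃ C, S.HasNearIntegrableReturn r H δ ρ η B κ ε₀ C := by
  obtain ⟨u, hper, ε₀, hε₀, hu⟩ := hS.exists_branch_solution hK hKt hκ hmono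
  set u₁ : (ℝ × ℝ) × Params → ℝ := fun p => (u p).2.2.2.1 with hu₁
  set u₂ : (ℝ × ℝ) × Params → ℝ := fun p => (u p).2.2.2.2 with hu₂
  have hper₁ : ∀ x e, u₁ ((x.1, x.2 + 2 * Real.pi), e) = u₁ (x, e) := fun x e => by
    simp only [hu₁, hper]
  have hper₂ : ∀ x e, u₂ ((x.1, x.2 + 2 * Real.pi), e) = u₂ (x, e) := fun x e => by
    simp only [hu₂, hper]
  have hc₁ : ∀ x : ℝ × ℝ, x.1 ∈ K → ∀ e, ‖e‖ ≤ ε₀ → ContDiffAt ℝ N u₁ (x, e) :=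
    fun x hx e he => ((hu x hx).2 e he).contDiffAt.snd.snd.snd.fst
  have hc₂ : ∀ x : ℝ × ℝ, x.1 ∈ K → ∀ e, ‖e‖ ≤ ε₀ → ContDiffAt ℝ N u₂ (x, e) :=
    fun x hx e he => ((hu x hx).2 e he).contDiffAt.snd.snd.snd.snd
  have hrN1 : ((r : ℕ) : WithTop ℕ∞) ≤ (N : WithTop ℕ∞) := by exact_mod_cast hrN
  obtain ⟨C₁, hC₁⟩ := exists_cNormLE_paramQuotient hK hε₀.le hper₁ hc₁ (k := r - 1) (by omega)
  obtain ⟨C₂, hC₂⟩ := exists_cNormLE_paramQuotient hK hε₀.le hper₂ hc₂ (k := r - 1) (by omega)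
  have hUK : interior K ×ˢ (univ : Set ℝ) ⊆ K ×ˢ univ := prod_mono interior_subset Subset.rfl
  have hopen : IsOpen (interior K ×ˢ (univ : Set ℝ)) := isOpen_interior.prod isOpen_univ
  have hmap : ∀ ε : Params, ∀ x ∈ interior K ×ˢ (univ : Set ℝ),
      S.nearIntegrableMap B H ε (paramQuotient u₁ ε) (paramQuotient u₂ ε) x =
        (u₁ (x, ε), x.2 + u₂ (x, ε)) := by
    intro ε x hx
    have h0 := (hu x (hUK hx).1).1
    have h1 : u₁ (x, 0) = x.1 := by simp only [hu₁, h0, baseSolution]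
    have h2 : u₂ (x, 0) = S.rotation B H x.1 := by simp only [hu₂, h0, baseSolution]
    simp only [nearIntegrableMap, norm_mul_paramQuotient, h1, h2]
    exact Prod.ext (by ring) (by ring)
  have hquot : ∀ v : (ℝ × ℝ) × Params → ℝ,
      (∀ x : ℝ × ℝ, x.1 ∈ K → ∀ e, ‖e‖ ≤ ε₀ → ContDiffAt ℝ N v (x, e)) → ∀ ε : Params, ‖ε‖ < ε₀ →
      ContDiffOn ℝ r (paramQuotient v ε) (interior K ×ˢ univ) := by
    intro v hv ε he x hx
    have h1 := contDiffAt_left (hv x (hUK hx).1 ε he.le)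
    have h0 := contDiffAt_left (hv x (hUK hx).1 0 (by simpa using hε₀.le))
    exact ((contDiffAt_const.mul (h1.sub h0)).of_le hrN1).contDiffWithinAt
  refine ⟨ε₀, hε₀, max C₁ C₂, interior K, isOpen_interior, hA, fun I hI => ?_,
    paramQuotient u₁, paramQuotient u₂, fun ε he => ⟨?_, ?_, ?_, hquot u₁ hc₁ ε he,
      hquot u₂ hc₂ ε he, fun I hI θ => ⟨?_, ?_⟩, (hC₁ ε he.le).mono le_rfl hUK (le_max_left _ _),
      (hC₂ ε he.le).mono le_rfl hUK (le_max_right _ _)⟩, fun μ hμ => ?_, fun ha hb => ?_⟩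
  · obtain ⟨L₁, L₂, h, -⟩ := hKt (interior_subset hI)
    exact ⟨L₁, L₂, h⟩
  · intro I hI θ
    rw [hmap ε (I, θ) ⟨hI, mem_univ _⟩]
    exact ((hu (I, θ) (interior_subset hI)).2 ε he.le).hasReturn
  · refine ContDiffOn.congr (f := fun x => (u₁ (x, ε), x.2 + u₂ (x, ε))) (fun x hx => ?_) (hmap ε)
    have h1 := contDiffAt_left (hc₁ x (hUK hx).1 ε he.le)
    have h2 := contDiffAt_left (hc₂ x (hUK hx).1 ε he.le)
    exact ((h1.prodMk (contDiffAt_snd.add h2)).of_le hrN1).contDiffWithinAt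
  · intro x hx
    obtain ⟨F', hF, hF'⟩ := IsGood.symplectic hS ((hu x (hUK hx).1).2 ε he.le)
    have h1 : HasFDerivAt (S.nearIntegrableMap B H ε (paramQuotient u₁ ε) (paramQuotient u₂ ε))
        F' x := hF.congr_of_eventuallyEq
      (eventually_of_mem (hopen.mem_nhds hx) fun y hy => hmap ε y hy)
    rw [h1.fderiv]
    exact ⟨h1.differentiableAt, hF'⟩
  · simp only [paramQuotient, hper₁ (I, θ)]
  · simp only [paramQuotient, hper₂ (I, θ)]
  · obtain ⟨ε₁, h1, h2⟩ := exists_cNormLE_of_small hK hε₀ hper₁ hc₁ hμ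
    obtain ⟨ε₂, h3, h4⟩ := exists_cNormLE_of_small hK hε₀ hper₂ hc₂ hμ
    exact ⟨min ε₁ ε₂, lt_min h1 h3, fun ε he =>
      ⟨(h2 ε (he.trans_le (min_le_left _ _))).mono hrN hUK le_rfl,
        (h4 ε (he.trans_le (min_le_right _ _))).mono hrN hUK le_rfl⟩⟩
  -- With `r < N` one derivative remains for the parameter even at order `r`.
  · have hlt := hrN' ha hb
    obtain ⟨C₁, hC₁⟩ := exists_cNormLE_paramQuotient hK hε₀.le hper₁ hc₁ hlt
    obtain ⟨C₂, hC₂⟩ := exists_cNormLE_paramQuotient hK hε₀.le hper₂ hc₂ hlt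
    exact ⟨max C₁ C₂, fun ε he => ⟨(hC₁ ε he.le).mono le_rfl hUK (le_max_left _ _),
      (hC₂ ε he.le).mono le_rfl hUK (le_max_right _ _)⟩⟩

/-- The right turning points of a compact set of tori have a common neighbourhood where the
potential increases. -/
theorem exists_increasing_near_right (hS : S.IsSetting H M N) {K : Set ℝ} (hK : IsCompact K)
    (hKt : K ⊆ S.transverseActions B H) : ∃ κ₀ > 0, ∀ κ ≤ κ₀, ∀ I ∈ K, ∀ q,
      |q - S.right₁ B H I| ≤ 2 * κ → 0 < deriv S.V₁ q := by
  have hcont : ContinuousOn (S.right₁ B H) K := fun I hI =>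
    ((hS.regular.torus_regularity hS.confined (hKt hI)).1 2 two_ne_zero hS.regular.contDiff₁
      hS.regular.contDiff₂).1.continuousAt.continuousWithinAt
  have hopen : IsOpen {q | 0 < deriv S.V₁ q} :=
    isOpen_lt continuous_const (hS.regular.contDiff₁.continuous_deriv (by norm_num))
  obtain ⟨d, hd, hsub⟩ := (hK.image_of_continuousOn hcont).exists_cthickening_subset_open hopen
    (by rintro _ ⟨I, hI, rfl⟩; exact (hS.right₁_spec (hKt hI)).2.1)
  refine ⟨d / 2, half_pos hd, fun κ hκ I hI q hq => hsub ?_⟩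
  refine Metric.mem_cthickening_of_dist_le q _ _ _ (mem_image_of_mem _ hI) ?_
  rw [Real.dist_eq]
  linarith

end IsSetting

end ImpactSystem

namespace Leaf

variable {V : ℝ → ℝ}

theorem SameBranch.eq {L L' : Leaf V} (h : L.SameBranch L') :
    L.SameBranch = L'.SameBranch := by
  funext L''
  exact propext ⟨fun h' => h.symm.trans h', fun h' => h.trans h'⟩

/-- A critical point strictly between `a` and `b` would lie below one of them and not below the
other. So the sets of critical points to the left of the turning points encode the branch. -/
theorem deriv_ne_zero_of_inter_Iio_eq {a b : ℝ} (ha : deriv V a ≠ 0) (hb : deriv V b ≠ 0)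
    (h : {q | deriv V q = 0} ∩ Iio a = {q | deriv V q = 0} ∩ Iio b) :
    ∀ q ∈ uIcc a b, deriv V q ≠ 0 := by
  intro q hq h0
  have hqa : q ≠ a := fun he => ha (he ▸ h0)
  have hqb : q ≠ b := fun he => hb (he ▸ h0)
  have hiff : q < a ↔ q < b := by
    have := Set.ext_iff.1 h q
    simpa [h0] using this
  rcases mem_uIcc.1 hq with ⟨h1, h2⟩ | ⟨h1, h2⟩
  · exact absurd (hiff.2 (lt_of_le_of_ne h2 hqb)) h1.not_gt
  · exact absurd (hiff.1 (lt_of_le_of_ne h2 hqa)) h1.not_gt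

/-- There are finitely many branches. -/
theorem finite_range_sameBranch (hf : {q | deriv V q = 0}.Finite) :
    (range fun L : Leaf V => L.SameBranch).Finite := by
  set φ : Leaf V → Set ℝ × Set ℝ := fun L =>
    ({q | deriv V q = 0} ∩ Iio L.left, {q | deriv V q = 0} ∩ Iio L.right) with hφ
  have hfin : (range φ).Finite := by
    refine (hf.finite_subsets.prod hf.finite_subsets).subset ?_
    rintro _ ⟨L, rfl⟩
    exact ⟨inter_subset_left, inter_subset_left⟩
  have heq : ∀ L L', φ L = φ L' → L.SameBranch = L'.SameBranch := fun L L' h =>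
    SameBranch.eq ⟨deriv_ne_zero_of_inter_Iio_eq L.deriv_left.ne L'.deriv_left.ne
      (congrArg Prod.fst h), deriv_ne_zero_of_inter_Iio_eq L.deriv_right.ne' L'.deriv_right.ne'
      (congrArg Prod.snd h)⟩
  have hfac : (fun L : Leaf V => L.SameBranch) = (Function.extend φ (fun L => L.SameBranch)
      fun _ _ => True) ∘ φ := by
    funext L
    have hfact : Function.FactorsThrough (fun L : Leaf V => L.SameBranch) φ := fun L L' h => heq L L' h
    exact (hfact.extend_apply _ L).symm
  rw [hfac, range_comp]
  exact hfin.image _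

end Leaf

/-- A constant that works for each of finitely many classes, and can be decreased, can be chosen
the same for all. -/
theorem exists_forall_of_finite_range {α β : Type*} {φ : α → β} (hφ : (range φ).Finite)
    {P : α → ℝ → Prop} (h : ∀ a, ∃ k > 0, P a k)
    (hmono : ∀ a k k', 0 < k' → k' ≤ k → P a k → P a k')
    (hcongr : ∀ a a' k, φ a = φ a' → P a k → P a' k) : ∃ k > 0, ∀ a, P a k := by
  suffices hs : ∀ s : Set β, s.Finite → ∃ k > 0, ∀ a, φ a ∈ s → P a k by
    obtain ⟨k, hk, h⟩ := hs _ hφ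
    exact ⟨k, hk, fun a => h a ⟨a, rfl⟩⟩
  intro s hs
  induction s, hs using Set.Finite.induction_on with
  | empty => exact ⟨1, one_pos, fun a ha => absurd ha (notMem_empty _)⟩
  | insert _ _ ih =>
    rename_i b s _ _
    obtain ⟨k, hk, ih⟩ := ih
    by_cases hb : ∃ a, φ a = b
    · obtain ⟨a, rfl⟩ := hb
      obtain ⟨k', hk', ha⟩ := h a
      refine ⟨min k k', lt_min hk hk', fun a' ha' => ?_⟩
      rcases ha' with ha' | ha'
      · exact hmono _ _ _ (lt_min hk hk') (min_le_right _ _) (hcongr _ _ _ ha'.symm ha)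
      · exact hmono _ _ _ (lt_min hk hk') (min_le_left _ _) (ih _ ha')
    · refine ⟨k, hk, fun a ha => ?_⟩
      rcases ha with ha | ha
      · exact absurd ⟨a, ha⟩ hb
      · exact ih a ha

namespace ImpactSystem

variable {S : ImpactSystem} {H δ ρ η : ℝ} {r : ℕ}

/-- If the extra derivative is available, the whole construction is run with `N = r + 1` from the
start. The same `f` and `g` then satisfy all the estimates, including the conditional one. -/
theorem exists_isSetting (hr : 3 < r) (hS : S.IsS3B r) (hpert : S.PerturbationSmooth (r + 1))
    (hb : H - S.V₁ 0 - (⨅ q, S.V₂ q) < S.b) : ∃ M N, S.IsSetting H M N ∧ r ≤ N ∧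
      (S.IsS3B (r + 1) → S.PerturbationSmooth (r + 2) → r < N) := by
  have h3 : ((3 : ℕ) : WithTop ℕ∞) ≤ (r : WithTop ℕ∞) + 1 := by norm_cast; omega
  have hreg : S.IsRegular := ⟨hS.1.smooth.of_le h3, hS.2.smooth.of_le h3, hS.1.bounded, hS.2.bounded⟩
  obtain ⟨M, hM⟩ := hreg.exists_confined H
  by_cases h : S.IsS3B (r + 1) ∧ S.PerturbationSmooth (r + 2)
  · exact ⟨M, r + 1, ⟨hreg, hM, by omega, by exact_mod_cast h.1.1.smooth,
      by exact_mod_cast h.1.2.smooth, h.2, hb⟩, by omega, fun _ _ => by omega⟩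
  · exact ⟨M, r, ⟨hreg, hM, by omega, by exact_mod_cast hS.1.smooth,
      by exact_mod_cast hS.2.smooth, hpert, hb⟩, le_rfl, fun h1 h2 => absurd ⟨h1, h2⟩ h⟩

theorem exists_uniform_return (hr : 3 < r) (hS : S.IsS3B r) (hpert : S.PerturbationSmooth (r + 1))
    (hb : H - S.V₁ 0 - (⨅ q, S.V₂ q) < S.b) (hδ : 0 < δ) (hρ : 0 < ρ) (hη : 0 < η) :
    ∃ ε₀ > 0, ∃ κ > 0, ∃ C, ∀ B : Leaf S.V₂, S.HasNearIntegrableReturn r H δ ρ η B κ ε₀ C := by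
  obtain ⟨M, N, hset, hrN, hrN'⟩ := exists_isSetting hr hS hpert hb
  have hfin := Leaf.finite_range_sameBranch hS.2.finite_critical
  -- The size `κ` is fixed before `ε₀` and `C`. The return property is not evidently monotone in
  -- `κ`, so the decreasing property asked of `k` is that every `κ ≤ k` works.
  obtain ⟨κ, hκ, h⟩ := exists_forall_of_finite_range hfin
    (P := fun B k => ∀ κ, 0 < κ → κ ≤ k → ∃ ε₀ > 0, ∃ C,
      S.HasNearIntegrableReturn r H δ ρ η B κ ε₀ C)
    (fun B => by
      obtain ⟨K, hK, hA, hKt⟩ := hset.regular.exists_compact_actions hS.1.simple hS.2.simple B H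
        hδ hρ hη
      obtain ⟨κ₀, hκ₀, h⟩ := hset.exists_increasing_near_right hK hKt
      exact ⟨κ₀, hκ₀, fun κ hκ hle =>
        hset.exists_hasNearIntegrableReturn (by omega) hrN hrN' hK hKt hA hκ (h κ hle)⟩)
    (fun B k k' _ hle h κ hκ hκ' => h κ hκ (hκ'.trans hle))
    (fun B B' k hB h κ hκ hκ' => by
      obtain ⟨ε₀, hε₀, C, h⟩ := h κ hκ hκ'
      exact ⟨ε₀, hε₀, C, h.congr hB⟩)
  -- The two constants are packed into one, `ε₀ = k` and `C = k⁻¹`, so that decreasing `k` weakens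
  -- the claim and the minimum over finitely many branches serves for both.
  obtain ⟨k, hk, h⟩ := exists_forall_of_finite_range hfin
    (P := fun B k => S.HasNearIntegrableReturn r H δ ρ η B κ k k⁻¹)
    (fun B => by
      obtain ⟨ε₀, hε₀, C, h⟩ := h B κ hκ le_rfl
      have hpos : 0 < min ε₀ (max C 1)⁻¹ := lt_min hε₀ (by positivity)
      refine ⟨_, hpos, h.mono (min_le_left _ _) ?_⟩
      calc C ≤ max C 1 := le_max_left _ _
        _ ≤ _ := (le_inv_comm₀ (by positivity) hpos).2 (min_le_right _ _))
    (fun B k k' hk' hle h => h.mono hle (inv_anti₀ hk' hle))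
    (fun B B' k hB h => h.congr hB)
  exact ⟨k, hk, κ, hκ, k⁻¹, h⟩

end ImpactSystem
end ReturnMap

end ImpactHam

end

theorem mainTheorem1 (r : ℕ) (hr : 3 < r) (S : ImpactHam.ImpactSystem)
    (hS : S.IsS3B r) (hpert : S.PerturbationSmooth (r + 1)) (hQ : S.Q 0 0 = 0)
    (hwall : S.RegularWall)
    (H δ ρ η : ℝ) (hδ : 0 < δ) (hρ : 0 < ρ) (hη : 0 < η)
    (hH : S.DeltaRegular δ H)
    -- the wall is impassable on the energy level `H`
    (hb : H - S.V₁ 0 - (⨅ q, S.V₂ q) < S.b) :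
    ∃ ε₀ > 0, ∃ κ > 0, ∃ C : ℝ, ∀ B : ImpactHam.Leaf S.V₂,
      ∃ U : Set ℝ, IsOpen U ∧ S.regularActions B H δ ρ η ⊆ U ∧
      (∀ I ∈ U, ∃ L₁ L₂, S.IsTorus B H I L₁ L₂) ∧
      ∃ f g : ImpactHam.Params → ℝ × ℝ → ℝ,
        (∀ ε : ImpactHam.Params, ‖ε‖ < ε₀ →
          -- the return map has the near-integrable form
          S.IsReturnMapOn B H κ ε U (S.nearIntegrableMap B H ε (f ε) (g ε)) ∧
          -- it is `C^r` and symplectic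
          ContDiffOn ℝ r (S.nearIntegrableMap B H ε (f ε) (g ε)) (U ×ˢ univ) ∧
          ImpactHam.IsSymplecticOn (S.nearIntegrableMap B H ε (f ε) (g ε)) (U ×ˢ univ) ∧
          -- `f` and `g` are `C^r` and periodic in the angle
          ContDiffOn ℝ r (f ε) (U ×ˢ univ) ∧ ContDiffOn ℝ r (g ε) (U ×ˢ univ) ∧
          (∀ I ∈ U, ∀ θ : ℝ, f ε (I, θ + 2 * Real.pi) = f ε (I, θ) ∧
            g ε (I, θ + 2 * Real.pi) = g ε (I, θ)) ∧
          -- the distance to the unperturbed map is `O(‖ε‖)` in `C^(r-1)`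
          ImpactHam.CNormLE (r - 1) (f ε) (U ×ˢ univ) C ∧
          ImpactHam.CNormLE (r - 1) (g ε) (U ×ˢ univ) C) ∧
        -- the distance to the unperturbed map tends to `0` in `C^r`
        (∀ μ > 0, ∃ ε₁ > 0, ∀ ε : ImpactHam.Params, ‖ε‖ < ε₁ →
          ImpactHam.CNormLE r (fun x => ‖ε‖ * f ε x) (U ×ˢ univ) μ ∧
          ImpactHam.CNormLE r (fun x => ‖ε‖ * g ε x) (U ×ˢ univ) μ) ∧
        -- it is `O(‖ε‖)` in `C^r` if the data have one more derivative
        (S.IsS3B (r + 1) → S.PerturbationSmooth (r + 2) →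
          ∃ C' : ℝ, ∀ ε : ImpactHam.Params, ‖ε‖ < ε₀ →
            ImpactHam.CNormLE r (f ε) (U ×ˢ univ) C' ∧
            ImpactHam.CNormLE r (g ε) (U ×ˢ univ) C') := by
  exact ImpactHam.ImpactSystem.exists_uniform_return hr hS hpert hb hδ hρ hη
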